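/- Let $W$ be a finite group acting faithfully and linearly on a finite dimensional complex vector space $\mathfrak h$, let $S\subset W$ be the set of reflections (elements with $\mathrm{rk}(s-1)=1$) and let $c:S\to\mathbb C$ be a conjugation invariant function. For $s\in S$ let $\alpha_s$ generate $\mathrm{Im}(s|_{\mathfrak h^*}-1)$, let $\alpha_s^\vee$ generate $\mathrm{Im}(s|_{\mathfrak h}-1)$ with $(\alpha_s,\alpha_s^\vee)=2$, and let $\lambda_s$ be the nontrivial eigenvalue of $s$ on $\mathfrak h^*$. Let $H_c(W,\mathfrak h)$ be the rational Cherednik algebra, the quotient of $\mathbb C W\ltimes T(\mathfrak h\oplus\mathfrak h^*)$ by $[x,x']=0$, $[y,y']=0$, $[y,x]=(y,x)-\sum_{s\in S}c_s(y,\alpha_s)(x,\alpha_s^\vee)s$ for $x,x'\in\mathfrak h^*$, $y,y'\in\mathfrak h$, and let $\mathcal O_c(W,\mathfrak h)_0$ be the category of $H_c(W,\mathfrak h)$-modules that are finitely generated over $\mathbb C[\mathfrak h]$ and locally nilpotent under $\mathfrak h$. Let $b\in\mathfrak h$, let $W'=W_b$ be its stabilizer and $c'=c|_{S\cap W'}$.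 We use the following objects. * $\widehat{H_c}(W,\mathfrak h)_b$ is the completion of $H_c(W,\mathfrak h)$ at $b$, i.e. the algebra generated by the functions on the formal neighborhood of the orbit $Wb$, the group $W$ and $\mathfrak h$ (acting by the Dunkl–Opdam operators $\partial_a+\sum_{s\in S}\frac{2c_s}{1-\lambda_s}\frac{\alpha_s(a)}{\alpha_s}(s-1)$, $a\in\mathfrak h$). For $M\in\mathcal O_c(W,\mathfrak h)_0$ put $\widehat M_b=\widehat{H_c}(W,\mathfrak h)_b\otimes_{H_c(W,\mathfrak h)}M$. * For an $\widehat{H_c}(W,\mathfrak h)_b$-module $N$, $E^b(N)$ is the space of $\mathfrak h$-nilpotent vectors of $N$. For a module $N$ over $\widehat{H_{c'}}(W',\mathfrak h)_0$, $E(N)$ is the span of the generalized eigenvectors in $N$ of $\mathbf h=\sum_i x_iy_i+\frac{\dim\mathfrak h}{2}-\sum_{s\in S\cap W'}\frac{2c_s}{1-\lambda_s}s\in H_{c'}(W',\mathfrak h)$, where $(y_i)$ is a basis of $\mathfrak h$ and $(x_i)$ the dual basis. * For $A=\widehat{H_{c'}}(W',\mathfrak h)_0$ let $P=\{F:W\to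 A\mid F(hw)=hF(w),\ h\in W'\}$, a right $A$-module, let $Z=\mathrm{End}_A(P)$, and let $I$ be the functor $N\mapsto P\otimes_AN$ from $A$-modules to $Z$-modules; it is an equivalence. * $\theta:\widehat{H_c}(W,\mathfrak h)_b\to Z$ is the isomorphism given by $(\theta(u)F)(w)=F(wu)$ for $u\in W$, by $(\theta(\varphi)F)(w)=(w\varphi)(b+\cdot)\,F(w)$ for functions $\varphi$ on the formal neighborhood of $Wb$ (in particular $(\theta(x_\alpha)F)(w)=(x_{w\alpha}+(w\alpha,b))F(w)$ for $\alpha\in\mathfrak h^*$), and by $$(\theta(y_a)F)(w)=y_{wa}F(w)+\sum_{s\in S,\ s\notin W'}\frac{2c_s}{1-\lambda_s}\,\frac{\alpha_s(wa)}{x_{\alpha_s}+\alpha_s(b)}\,(F(sw)-F(w)),\qquad a\in\mathfrak h;$$ $\theta_*$ is the induced equivalence of module categories. * $\zeta:\mathcal O_{c'}(W',\mathfrak h)_0\to\mathcal O_{c'}(W',\mathfrak h/\mathfrak h^{W'})_0$ is the equivalence $\zeta(M)=\{v\in M: yv=0\text{ for all }y\in\mathfrak h^{W'}\}$. Then $$\mathrm{Res}_b(M)=(\zeta\circ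 E\circ I^{-1}\circ\theta_*)(\widehat M_b),\qquad \mathrm{Ind}_b(N)=(E^b\circ\theta_*^{-1}\circ I)\big(\widehat{\zeta^{-1}(N)}_0\big)$$ are well-defined functors $\mathrm{Res}_b:\mathcal O_c(W,\mathfrak h)_0\to\mathcal O_{c'}(W',\mathfrak h/\mathfrak h^{W'})_0$ and $\mathrm{Ind}_b:\mathcal O_{c'}(W',\mathfrak h/\mathfrak h^{W'})_0\to\mathcal O_c(W,\mathfrak h)_0$, and the following hold. (i) $\mathrm{Res}_b$ and $\mathrm{Ind}_b$ are exact. (ii) $\mathrm{Ind}_b$ is right adjoint to $\mathrm{Res}_b$. (iii) $\mathrm{Ind}_b(\mathrm{Res}_b(M))\cong E^b(\widehat M_b)$, naturally in $M\in\mathcal O_c(W,\mathfrak h)_0$. -/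

import Mathlib

open CategoryTheory
open scoped TensorProduct

universe u

set_option linter.unusedSectionVars false

noncomputable section

namespace Cherednik

section Reflections

variable {G V : Type u} [Group G] [AddCommGroup V] [Module ℂ V] (ρ : Representation ℂ G V)

/-- `s` is a reflection: `rk (s - 1) = 1` (in particular `s` acts nontrivially). -/
def IsReflection (s : G) : Prop :=
  Module.finrank ℂ (LinearMap.range (ρ s - 1)) = 1

/-- The finite set `S` of reflections. -/
def reflections [Finite G] : Finset G :=
  (Set.toFinite {s : G | IsReflection ρ s}).toFinset

/-- `α_s`, a generator of the image of `s - 1` on the dual space. -/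
def root (s : G) : Module.Dual ℂ V :=
  Classical.epsilon fun α => LinearMap.range (ρ.dual s - 1) = Submodule.span ℂ {α}

/-- `α_s^∨`, the generator of the image of `s - 1` on `V` with `(α_s, α_s^∨) = 2`. -/
def coroot (s : G) : V :=
  Classical.epsilon fun v =>
    LinearMap.range (ρ s - 1) = Submodule.span ℂ {v} ∧ root ρ s v = 2

/-- `λ_s`, the nontrivial eigenvalue of `s` on the dual space. -/
def reflEigenvalue (s : G) : ℂ :=
  Classical.epsilon fun μ => ρ.dual s (root ρ s) = μ • root ρ s

/-- A conjugation invariant function on the set of reflections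
(its values on the other elements of the group are never used). -/
structure Param where
  /-- the value `c_s` -/
  val : G → ℂ
  conj_eq : ∀ g s : G, IsReflection ρ s → val (g * s * g⁻¹) = val s

variable {ρ}

theorem mem_reflections [Finite G] {s : G} : s ∈ reflections ρ ↔ IsReflection ρ s := by
  simp [reflections]

theorem exists_rank_one [Finite G] {s : G} (hs : IsReflection ρ s) :
    ∃ (φ : Module.Dual ℂ V) (v : V), (∀ y, ρ s y = y + φ y • v) ∧ φ v ≠ 0 ∧ 1 + φ v ≠ 0 := by
  obtain ⟨⟨v, hvr⟩, hv0, hv⟩ := finrank_eq_one_iff'.1 hs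
  have hv0' : v ≠ 0 := fun h => hv0 (Subtype.ext h)
  have hmem : ∀ y, (ρ s - 1) y ∈ Submodule.span ℂ {v} := by
    intro y
    obtain ⟨a, ha⟩ := hv ⟨(ρ s - 1) y, y, rfl⟩
    exact Submodule.mem_span_singleton.2 ⟨a, congrArg Subtype.val ha⟩
  let φ : Module.Dual ℂ V :=
    (LinearEquiv.toSpanNonzeroSingleton ℂ V v hv0').symm.toLinearMap ∘ₗ
      (ρ s - 1).codRestrict (Submodule.span ℂ {v}) hmem
  have hφ : ∀ y, ρ s y = y + φ y • v := by
    intro y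
    have h1 : (LinearEquiv.toSpanNonzeroSingleton ℂ V v hv0' (φ y) : V) = (ρ s - 1) y := by
      simp [φ]
    rw [LinearEquiv.toSpanNonzeroSingleton_apply] at h1
    simp only [LinearMap.sub_apply, Module.End.one_apply] at h1
    rw [h1]; abel
  have hpow : ∀ n : ℕ, ρ (s ^ n) v = (1 + φ v) ^ n • v := by
    intro n
    induction n with
    | zero => simp
    | succ k ih =>
      rw [pow_succ', map_mul, Module.End.mul_apply, ih, map_smul, hφ v, pow_succ]
      module
  have hn : 0 < orderOf s := orderOf_pos s
  refine ⟨φ, v, hφ, ?_, ?_⟩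
  · intro h0
    have hpow' : ∀ (n : ℕ) (y : V), ρ (s ^ n) y = y + (n * φ y) • v := by
      intro n y
      induction n with
      | zero => simp
      | succ k ih =>
        rw [pow_succ', map_mul, Module.End.mul_apply, ih, map_add, map_smul, hφ v, hφ y, h0]
        push_cast
        module
    obtain ⟨y, hy⟩ := hvr
    have h2 : φ y • v = v := by
      have h3 : ρ s y - y = v := hy
      rw [hφ y, add_sub_cancel_left] at h3
      exact h3
    have h4 := hpow' (orderOf s) y
    rw [pow_orderOf_eq_one, map_one, Module.End.one_apply, mul_smul, h2] at h4
    have h5 : ((orderOf s : ℂ)) • v = 0 := by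
      simpa using h4.symm
    rcases smul_eq_zero.1 h5 with h6 | h6
    · exact hn.ne' (by exact_mod_cast h6)
    · exact hv0' h6
  · intro h0
    have h4 := hpow (orderOf s)
    rw [pow_orderOf_eq_one, map_one, Module.End.one_apply, h0, zero_pow hn.ne', zero_smul] at h4
    exact hv0' h4

theorem dual_apply' (g : G) (x : Module.Dual ℂ V) (y : V) : ρ.dual g x y = x (ρ g⁻¹ y) := by
  simp [Representation.dual_apply, Module.Dual.transpose_apply]

/-- The basic facts on `α_s`, `α_s^∨`, `λ_s`. -/
theorem root_facts [Finite G] {s : G} (hs : IsReflection ρ s) :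
    reflEigenvalue ρ s ≠ 0 ∧ reflEigenvalue ρ s ≠ 1 ∧ root ρ s (coroot ρ s) = 2 ∧
    (∀ y, ρ s y = y -
      ((1 - (reflEigenvalue ρ s)⁻¹) / 2 * root ρ s y) • coroot ρ s) ∧
    (∀ x, ρ.dual s x = x -
      ((1 - reflEigenvalue ρ s) / 2 * x (coroot ρ s)) • root ρ s) := by
  obtain ⟨φ, v, hφ, h0, h1⟩ := exists_rank_one hs
  have hv : v ≠ 0 := fun h => h0 (by simp [h])
  have hφ0 : φ ≠ 0 := fun h => h0 (by simp [h])
  have hsv : ρ s v = (1 + φ v) • v := by rw [hφ]; module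
  have hinv : ∀ y, ρ s⁻¹ y = y - ((1 + φ v)⁻¹ * φ y) • v := by
    intro y
    have : ρ s (y - ((1 + φ v)⁻¹ * φ y) • v) = y := by
      rw [map_sub, map_smul, hsv, hφ y, smul_smul]
      have : (1 + φ v)⁻¹ * φ y * (1 + φ v) = φ y := by field_simp
      rw [this]; abel
    conv_lhs => rw [← this]
    rw [← Module.End.mul_apply, ← map_mul]
    simp
  have hdual : ∀ x : Module.Dual ℂ V, ρ.dual s x = x - ((1 + φ v)⁻¹ * x v) • φ := by
    intro x
    ext y
    rw [dual_apply', hinv]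
    simp only [map_sub, map_smul, smul_eq_mul, LinearMap.sub_apply, LinearMap.smul_apply]
    ring
  have hrange : LinearMap.range (ρ.dual s - 1) = Submodule.span ℂ {φ} := by
    apply le_antisymm
    · rintro _ ⟨x, rfl⟩
      refine Submodule.mem_span_singleton.2 ⟨-((1 + φ v)⁻¹ * x v), ?_⟩
      rw [LinearMap.sub_apply, Module.End.one_apply, hdual]; module
    · rw [Submodule.span_singleton_le_iff_mem]
      refine ⟨(-((1 + φ v)⁻¹ * φ v)⁻¹) • φ, ?_⟩
      rw [LinearMap.sub_apply, Module.End.one_apply, hdual, LinearMap.smul_apply, smul_eq_mul]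
      have : (-((1 + φ v)⁻¹ * (-((1 + φ v)⁻¹ * φ v)⁻¹ * φ v))) = 1 := by field_simp
      calc _ = (-((1 + φ v)⁻¹ * (-((1 + φ v)⁻¹ * φ v)⁻¹ * φ v))) • φ := by module
        _ = φ := by rw [this, one_smul]
  have hα : LinearMap.range (ρ.dual s - 1) = Submodule.span ℂ {root ρ s} :=
    Classical.epsilon_spec (p := fun α => LinearMap.range (ρ.dual s - 1) =
      Submodule.span ℂ {α}) ⟨φ, hrange⟩
  obtain ⟨t, ht⟩ : ∃ t : ℂ, t • φ = root ρ s := Submodule.mem_span_singleton.1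
    (by rw [← hrange, hα]; exact Submodule.mem_span_singleton_self _)
  have ht0 : t ≠ 0 := by
    rintro rfl
    rw [zero_smul] at ht
    rw [hrange, ← ht] at hα
    simp at hα
    exact hφ0 hα
  have hrv : LinearMap.range (ρ s - 1) = Submodule.span ℂ {(2 / (t * φ v)) • v} := by
    apply le_antisymm
    · rintro _ ⟨y, rfl⟩
      refine Submodule.mem_span_singleton.2 ⟨φ y * (t * φ v) / 2, ?_⟩
      rw [LinearMap.sub_apply, Module.End.one_apply, hφ, smul_smul]
      have : φ y * (t * φ v) / 2 * (2 / (t * φ v)) = φ y := by field_simp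
      rw [this]; abel
    · rw [Submodule.span_singleton_le_iff_mem]
      refine ⟨(2 / (t * φ v) / φ v) • v, ?_⟩
      rw [LinearMap.sub_apply, Module.End.one_apply, hφ, map_smul, smul_eq_mul]
      have : 2 / (t * φ v) / φ v * φ v = 2 / (t * φ v) := by field_simp
      rw [this]; abel
  have hco : LinearMap.range (ρ s - 1) = Submodule.span ℂ {coroot ρ s} ∧
      root ρ s (coroot ρ s) = 2 :=
    Classical.epsilon_spec (p := fun v => LinearMap.range (ρ s - 1) = Submodule.span ℂ {v} ∧
      root ρ s v = 2) ⟨_, hrv, by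
        rw [← ht, LinearMap.smul_apply, map_smul, smul_eq_mul, smul_eq_mul]; field_simp⟩
  obtain ⟨r, hr⟩ : ∃ r : ℂ, r • v = coroot ρ s := by
    have : coroot ρ s ∈ LinearMap.range (ρ s - 1) := by
      rw [hco.1]; exact Submodule.mem_span_singleton_self _
    obtain ⟨y, hy⟩ := this
    refine ⟨φ y, ?_⟩
    rw [← hy, LinearMap.sub_apply, Module.End.one_apply, hφ]; abel
  have htr : t * r * φ v = 2 := by
    have := hco.2
    rw [← ht, ← hr, LinearMap.smul_apply, map_smul, smul_eq_mul, smul_eq_mul] at this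
    rw [← this]; ring
  have hr0 : r ≠ 0 := by rintro rfl; simp at htr
  have hlam : ρ.dual s (root ρ s) = reflEigenvalue ρ s • root ρ s :=
    Classical.epsilon_spec (p := fun μ => ρ.dual s (root ρ s) = μ • root ρ s)
      ⟨(1 + φ v)⁻¹, by
        rw [← ht, map_smul, hdual, smul_comm]
        congr 1
        calc _ = (1 - (1 + φ v)⁻¹ * φ v) • φ := by module
          _ = _ := by congr 1; field_simp; ring⟩
  have hlam' : reflEigenvalue ρ s = (1 + φ v)⁻¹ := by
    have h2 := congrArg (fun f => f v) hlam
    simp only [← ht, hdual, LinearMap.smul_apply, LinearMap.sub_apply,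
      smul_eq_mul] at h2
    have h3 : t * φ v ≠ 0 := mul_ne_zero ht0 h0
    apply mul_right_cancel₀ h3
    rw [← h2]; field_simp; ring
  have htr' : φ v = 2 / (t * r) := by
    field_simp; rw [← htr]; ring
  refine ⟨?_, ?_, hco.2, ?_, ?_⟩
  · rw [hlam']; exact inv_ne_zero h1
  · rw [hlam']; intro h
    rw [inv_eq_one] at h
    exact h0 (by simpa using h)
  · intro y
    rw [hφ, hlam', inv_inv, ← hr, ← ht, smul_smul, sub_eq_add_neg, ← neg_smul]
    congr 2
    rw [LinearMap.smul_apply, smul_eq_mul]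
    linear_combination (-(φ y) / 2) * htr
  · intro x
    rw [hdual, hlam', ← hr, ← ht, smul_smul, map_smul, smul_eq_mul]
    congr 2
    have : 1 - (1 + φ v)⁻¹ = φ v * (1 + φ v)⁻¹ := by field_simp; ring
    rw [this]
    linear_combination (-((1 + φ v)⁻¹ * x v) / 2) * htr

theorem root_pairing [Finite G] {s : G} (hs : IsReflection ρ s) (y : V) (x : Module.Dual ℂ V) :
    root ρ s y * x (coroot ρ s) =
      2 / (1 - (reflEigenvalue ρ s)⁻¹) * (x y - x (ρ s y)) := by
  obtain ⟨h0, h1, -, hy, -⟩ := root_facts hs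
  have h2 : 1 - (reflEigenvalue ρ s)⁻¹ ≠ 0 := by
    intro h
    exact h1 (inv_eq_one.1 (sub_eq_zero.1 h).symm)
  rw [hy y, map_sub, map_smul, smul_eq_mul]
  field_simp
  ring

/-- `λ_s` is determined by the quadratic relation of `s - 1`. -/
theorem reflEigenvalue_eq [Finite G] {s : G} (hs : IsReflection ρ s) {κ : ℂ}
    (h : ∀ y, ρ s (ρ s y - y) - (ρ s y - y) = κ • (ρ s y - y)) :
    (reflEigenvalue ρ s)⁻¹ = 1 + κ := by
  obtain ⟨h0, h1, h2, hy, -⟩ := root_facts hs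
  have h3 := h (coroot ρ s)
  have hc : ρ s (coroot ρ s) = (reflEigenvalue ρ s)⁻¹ • coroot ρ s := by
    rw [hy, h2]; module
  have h4 := congrArg (root ρ s) h3
  simp only [hc, map_sub, map_smul, h2, smul_eq_mul] at h4
  have h5 : (reflEigenvalue ρ s)⁻¹ - 1 ≠ 0 := by
    intro h
    exact h1 (inv_eq_one.1 (sub_eq_zero.1 h))
  have h6 : ((reflEigenvalue ρ s)⁻¹ - 1) * ((reflEigenvalue ρ s)⁻¹ - (1 + κ)) = 0 := by
    linear_combination h4 / 2
  rcases mul_eq_zero.1 h6 with h7 | h7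
  · exact absurd h7 h5
  · exact sub_eq_zero.1 h7

theorem refl_quadratic [Finite G] {s : G} (hs : IsReflection ρ s) (y : V) :
    ρ s (ρ s y - y) - (ρ s y - y) = ((reflEigenvalue ρ s)⁻¹ - 1) • (ρ s y - y) := by
  obtain ⟨h0, h1, h2, hy, -⟩ := root_facts hs
  have hc : ρ s (coroot ρ s) = (reflEigenvalue ρ s)⁻¹ • coroot ρ s := by
    rw [hy, h2]; module
  have : ρ s y - y = -((1 - (reflEigenvalue ρ s)⁻¹) / 2 * root ρ s y) • coroot ρ s := by
    rw [hy y]; module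
  rw [this, map_smul, hc]
  module

theorem apply_inv_apply (g : G) (y : V) : ρ g (ρ g⁻¹ y) = y := by
  rw [← Module.End.mul_apply, ← map_mul]; simp

theorem inv_apply_apply (g : G) (y : V) : ρ g⁻¹ (ρ g y) = y := by
  rw [← Module.End.mul_apply, ← map_mul]; simp

theorem IsReflection.conj {s : G} (hs : IsReflection ρ s) (g : G) :
    IsReflection ρ (g * s * g⁻¹) := by
  have : LinearMap.range (ρ (g * s * g⁻¹) - 1) =
      (LinearMap.range (ρ s - 1)).map (ρ g) := by
    ext v
    constructor
    · rintro ⟨y, rfl⟩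
      refine ⟨(ρ s - 1) (ρ g⁻¹ y), ⟨_, rfl⟩, ?_⟩
      simp [map_mul]
    · rintro ⟨_, ⟨y, rfl⟩, rfl⟩
      refine ⟨ρ g y, ?_⟩
      simp [map_mul]
  unfold IsReflection
  rw [this]
  have hinj : Function.Injective (ρ g) :=
    Function.LeftInverse.injective (inv_apply_apply g)
  rw [← hs]
  exact (LinearEquiv.finrank_eq (Submodule.equivMapOfInjective (ρ g) hinj _)).symm

theorem reflEigenvalue_conj [Finite G] {s : G} (hs : IsReflection ρ s) (g : G) :
    reflEigenvalue ρ (g * s * g⁻¹) = reflEigenvalue ρ s := by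
  have := reflEigenvalue_eq (hs.conj g) (κ := (reflEigenvalue ρ s)⁻¹ - 1) (by
    intro y
    have h := congrArg (ρ g) (refl_quadratic hs (ρ g⁻¹ y))
    simpa [map_mul, apply_inv_apply, inv_apply_apply] using h)
  rw [add_sub_cancel] at this
  exact inv_injective this

/-- The restriction of `c` to the reflections of a subgroup. -/
def Param.restrict (c : Param ρ) (K : Subgroup G) : Param (ρ.comp K.subtype) where
  val s := c.val s
  conj_eq g s hs := c.conj_eq g s hs

end Reflections

section Algebra

variable {G V : Type u} [Group G] [Finite G] [AddCommGroup V] [Module ℂ V]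

/-- Generators of `H_c(G, V)`: `V^*`, `V` and `G`. -/
inductive Gen (G V : Type u) [AddCommGroup V] [Module ℂ V] : Type u
  | x : Module.Dual ℂ V → Gen G V
  | y : V → Gen G V
  | g : G → Gen G V

/-- The defining relations of the rational Cherednik algebra: those of `ℂG ⋉ T(V ⊕ V^*)` and
the three commutation relations. -/
inductive Rel (ρ : Representation ℂ G V) (c : Param ρ) :
    FreeAlgebra ℂ (Gen G V) → FreeAlgebra ℂ (Gen G V) → Prop
  | x_add (a a' : Module.Dual ℂ V) : Rel ρ c (.ι ℂ (.x (a + a'))) (.ι ℂ (.x a) + .ι ℂ (.x a'))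
  | x_smul (r : ℂ) (a : Module.Dual ℂ V) : Rel ρ c (.ι ℂ (.x (r • a))) (r • .ι ℂ (.x a))
  | y_add (v v' : V) : Rel ρ c (.ι ℂ (.y (v + v'))) (.ι ℂ (.y v) + .ι ℂ (.y v'))
  | y_smul (r : ℂ) (v : V) : Rel ρ c (.ι ℂ (.y (r • v))) (r • .ι ℂ (.y v))
  | g_one : Rel ρ c (.ι ℂ (.g 1)) 1
  | g_mul (g h : G) : Rel ρ c (.ι ℂ (.g (g * h))) (.ι ℂ (.g g) * .ι ℂ (.g h))
  | g_x (g : G) (a : Module.Dual ℂ V) :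
      Rel ρ c (.ι ℂ (.g g) * .ι ℂ (.x a)) (.ι ℂ (.x (ρ.dual g a)) * .ι ℂ (.g g))
  | g_y (g : G) (v : V) :
      Rel ρ c (.ι ℂ (.g g) * .ι ℂ (.y v)) (.ι ℂ (.y (ρ g v)) * .ι ℂ (.g g))
  | x_x (a a' : Module.Dual ℂ V) :
      Rel ρ c (.ι ℂ (.x a) * .ι ℂ (.x a')) (.ι ℂ (.x a') * .ι ℂ (.x a))
  | y_y (v v' : V) :
      Rel ρ c (.ι ℂ (.y v) * .ι ℂ (.y v')) (.ι ℂ (.y v') * .ι ℂ (.y v))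
  | y_x (v : V) (a : Module.Dual ℂ V) :
      Rel ρ c (.ι ℂ (.y v) * .ι ℂ (.x a))
        (.ι ℂ (.x a) * .ι ℂ (.y v) + (algebraMap ℂ _ (a v) -
          ∑ s ∈ reflections ρ, (c.val s * root ρ s v * a (coroot ρ s)) • .ι ℂ (.g s)))

/-- The rational Cherednik algebra `H_c(G, V)`. -/
def H (ρ : Representation ℂ G V) (c : Param ρ) : Type u := RingQuot (Rel ρ c)

variable (ρ : Representation ℂ G V) (c : Param ρ)

instance : Ring (H ρ c) := inferInstanceAs (Ring (RingQuot (Rel ρ c)))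

instance : Algebra ℂ (H ρ c) := inferInstanceAs (Algebra ℂ (RingQuot (Rel ρ c)))

namespace H

/-- The projection from the free algebra. -/
def mk : FreeAlgebra ℂ (Gen G V) →ₐ[ℂ] H ρ c := RingQuot.mkAlgHom ℂ (Rel ρ c)

variable {ρ c} in
theorem mk_rel {a b : FreeAlgebra ℂ (Gen G V)} (h : Rel ρ c a b) : mk ρ c a = mk ρ c b :=
  RingQuot.mkAlgHom_rel ℂ h

/-- The generator attached to `a ∈ V^*`. -/
def x (a : Module.Dual ℂ V) : H ρ c := mk ρ c (.ι ℂ (.x a))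

/-- The generator attached to `v ∈ V`. -/
def y (v : V) : H ρ c := mk ρ c (.ι ℂ (.y v))

/-- The generator attached to `g ∈ G`. -/
def g (g : G) : H ρ c := mk ρ c (.ι ℂ (.g g))

theorem x_add (a a' : Module.Dual ℂ V) : x ρ c (a + a') = x ρ c a + x ρ c a' := by
  simpa [x] using mk_rel (Rel.x_add (ρ := ρ) (c := c) a a')

theorem x_smul (r : ℂ) (a : Module.Dual ℂ V) : x ρ c (r • a) = r • x ρ c a := by
  simpa [x] using mk_rel (Rel.x_smul (ρ := ρ) (c := c) r a)

theorem y_add (v v' : V) : y ρ c (v + v') = y ρ c v + y ρ c v' := by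
  simpa [y] using mk_rel (Rel.y_add (ρ := ρ) (c := c) v v')

theorem y_smul (r : ℂ) (v : V) : y ρ c (r • v) = r • y ρ c v := by
  simpa [y] using mk_rel (Rel.y_smul (ρ := ρ) (c := c) r v)

theorem g_one : g ρ c 1 = 1 := by
  simpa [g] using mk_rel (Rel.g_one (ρ := ρ) (c := c))

theorem g_mul (a b : G) : g ρ c (a * b) = g ρ c a * g ρ c b := by
  simpa [g] using mk_rel (Rel.g_mul (ρ := ρ) (c := c) a b)

theorem g_x (w : G) (a : Module.Dual ℂ V) :
    g ρ c w * x ρ c a = x ρ c (ρ.dual w a) * g ρ c w := by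
  simpa [x, g] using mk_rel (Rel.g_x (ρ := ρ) (c := c) w a)

theorem g_y (w : G) (v : V) : g ρ c w * y ρ c v = y ρ c (ρ w v) * g ρ c w := by
  simpa [y, g] using mk_rel (Rel.g_y (ρ := ρ) (c := c) w v)

theorem x_x (a a' : Module.Dual ℂ V) : x ρ c a * x ρ c a' = x ρ c a' * x ρ c a := by
  simpa [x] using mk_rel (Rel.x_x (ρ := ρ) (c := c) a a')

theorem y_y (v v' : V) : y ρ c v * y ρ c v' = y ρ c v' * y ρ c v := by
  simpa [y] using mk_rel (Rel.y_y (ρ := ρ) (c := c) v v')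

theorem y_x (v : V) (a : Module.Dual ℂ V) :
    y ρ c v * x ρ c a = x ρ c a * y ρ c v + (algebraMap ℂ _ (a v) -
      ∑ s ∈ reflections ρ, (c.val s * root ρ s v * a (coroot ρ s)) • g ρ c s) := by
  simpa [x, y, g] using mk_rel (Rel.y_x (ρ := ρ) (c := c) v a)

variable {ρ c}

/-- An additive subgroup of a module that is stable under scalars and generators is stable
under `H_c(G, V)`. -/
theorem smul_mem_of_generators {M : Type*} [AddCommGroup M] [Module (H ρ c) M]
    (K : AddSubgroup M)
    (hr : ∀ (r : ℂ), ∀ m ∈ K, algebraMap ℂ (H ρ c) r • m ∈ K)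
    (hx : ∀ a, ∀ m ∈ K, x ρ c a • m ∈ K) (hy : ∀ v, ∀ m ∈ K, y ρ c v • m ∈ K)
    (hg : ∀ w, ∀ m ∈ K, g ρ c w • m ∈ K) (h : H ρ c) {m : M} (hm : m ∈ K) : h • m ∈ K := by
  obtain ⟨h, rfl⟩ := RingQuot.mkAlgHom_surjective ℂ (Rel ρ c) h
  change mk ρ c h • m ∈ K
  induction h using FreeAlgebra.induction generalizing m with
  | grade0 r => rw [AlgHom.commutes]; exact hr r m hm
  | grade1 i =>
    cases i with
    | x a => exact hx a m hm
    | y a => exact hy a m hm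
    | g a => exact hg a m hm
  | mul a b ha hb => rw [map_mul, mul_smul]; exact ha (hb hm)
  | add a b ha hb => rw [map_add, add_smul]; exact K.add_mem (ha hm) (hb hm)

variable (ρ c) in
/-- `x` as a linear map. -/
def xLin : Module.Dual ℂ V →ₗ[ℂ] H ρ c where
  toFun := x ρ c
  map_add' := x_add ρ c
  map_smul' := x_smul ρ c

variable (ρ c) in
/-- `y` as a linear map. -/
def yLin : V →ₗ[ℂ] H ρ c where
  toFun := y ρ c
  map_add' := y_add ρ c
  map_smul' := y_smul ρ c

end H

section CategoryO

variable {ρ c} {M : Type*} [AddCommGroup M] [Module (H ρ c) M]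

variable (ρ c) in
/-- `NilpotentOfOrder ρ c n m`: every product of `n` elements of `V` kills `m`. -/
def NilpotentOfOrder : ℕ → M → Prop
  | 0, m => m = 0
  | n + 1, m => ∀ v : V, NilpotentOfOrder n (H.y ρ c v • m)

variable (ρ c) in
/-- `m` is a `V`-nilpotent vector. -/
def IsNilpotentVec (m : M) : Prop := ∃ n, NilpotentOfOrder ρ c n m

variable (ρ c) in
/-- The subalgebra `ℂ[V] = S(V^*)` of `H_c(G, V)`. -/
def polySubalgebra : Subalgebra ℂ (H ρ c) := Algebra.adjoin ℂ (Set.range (H.x ρ c))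

variable (ρ c) in
/-- The category `𝒪_c(G, V)_0`, as a full subcategory of the category of `H_c(G, V)`-modules:
modules that are finitely generated over `ℂ[V]` and locally nilpotent under `V`. -/
def IsCatO : ObjectProperty (ModuleCat.{u} (H ρ c)) := fun M =>
  Module.Finite (polySubalgebra ρ c) M ∧ ∀ m : M, IsNilpotentVec ρ c m

theorem nilpotentOfOrder_zero (n : ℕ) : NilpotentOfOrder ρ c n (0 : M) := by
  induction n with
  | zero => rfl
  | succ n ih => intro v; rw [smul_zero]; exact ih

theorem NilpotentOfOrder.succ {n : ℕ} {m : M} (h : NilpotentOfOrder ρ c n m) :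
    NilpotentOfOrder ρ c (n + 1) m := by
  induction n generalizing m with
  | zero => intro v; rw [show m = 0 from h, smul_zero]; rfl
  | succ n ih => intro v; exact ih (h v)

theorem NilpotentOfOrder.mono {n k : ℕ} (hk : n ≤ k) {m : M} (h : NilpotentOfOrder ρ c n m) :
    NilpotentOfOrder ρ c k m := by
  induction k, hk using Nat.le_induction with
  | base => exact h
  | succ k _ ih => exact ih.succ

theorem NilpotentOfOrder.add {n : ℕ} {m m' : M} (h : NilpotentOfOrder ρ c n m)
    (h' : NilpotentOfOrder ρ c n m') : NilpotentOfOrder ρ c n (m + m') := by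
  induction n generalizing m m' with
  | zero => rw [show m = 0 from h, show m' = 0 from h', add_zero]; rfl
  | succ n ih => intro v; rw [smul_add]; exact ih (h v) (h' v)

theorem NilpotentOfOrder.algebraMap_smul {n : ℕ} {m : M} (r : ℂ) (h : NilpotentOfOrder ρ c n m) :
    NilpotentOfOrder ρ c n (algebraMap ℂ (H ρ c) r • m) := by
  induction n generalizing m with
  | zero => rw [show m = 0 from h, smul_zero]; rfl
  | succ n ih =>
    intro v
    rw [← mul_smul, ← Algebra.commutes, mul_smul]
    exact ih (h v)

theorem NilpotentOfOrder.sum {n : ℕ} {ι : Type*} (t : Finset ι) (f : ι → M)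
    (h : ∀ i ∈ t, NilpotentOfOrder ρ c n (f i)) : NilpotentOfOrder ρ c n (∑ i ∈ t, f i) := by
  classical
  induction t using Finset.induction_on with
  | empty => exact nilpotentOfOrder_zero n
  | insert i t hi ih =>
    rw [Finset.sum_insert hi]
    exact (h i (Finset.mem_insert_self _ _)).add
      (ih fun j hj => h j (Finset.mem_insert_of_mem hj))

theorem NilpotentOfOrder.y_smul {n : ℕ} {m : M} (v : V) (h : NilpotentOfOrder ρ c n m) :
    NilpotentOfOrder ρ c n (H.y ρ c v • m) := h.succ v

theorem NilpotentOfOrder.g_smul {n : ℕ} {m : M} (w : G) (h : NilpotentOfOrder ρ c n m) :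
    NilpotentOfOrder ρ c n (H.g ρ c w • m) := by
  induction n generalizing m with
  | zero => rw [show m = 0 from h, smul_zero]; rfl
  | succ n ih =>
    intro v
    have h1 := H.g_y ρ c w (ρ w⁻¹ v)
    rw [apply_inv_apply] at h1
    rw [← mul_smul, ← h1, mul_smul]
    exact ih (h _)

theorem NilpotentOfOrder.x_smul {n : ℕ} {m : M} (a : Module.Dual ℂ V)
    (h : NilpotentOfOrder ρ c n m) : NilpotentOfOrder ρ c (n + 1) (H.x ρ c a • m) := by
  induction n generalizing m with
  | zero => rw [show m = 0 from h, smul_zero]; exact nilpotentOfOrder_zero 1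
  | succ n ih =>
    intro v
    rw [← mul_smul, H.y_x, add_smul, mul_smul, sub_smul, sub_eq_add_neg, ← neg_smul,
      ← Finset.sum_neg_distrib, Finset.sum_smul]
    refine (ih (h v)).add ((h.algebraMap_smul _).add (NilpotentOfOrder.sum _ _ ?_))
    intro s _
    rw [← neg_smul, Algebra.smul_def, mul_smul]
    exact (h.g_smul s).algebraMap_smul _

variable (ρ c M) in
/-- The submodule of `V`-nilpotent vectors. -/
def nilpotentVectors : Submodule (H ρ c) M where
  carrier := {m | IsNilpotentVec ρ c m}
  zero_mem' := ⟨0, rfl⟩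
  add_mem' := by
    rintro m m' ⟨n, h⟩ ⟨n', h'⟩
    exact ⟨max n n', (h.mono (le_max_left _ _)).add (h'.mono (le_max_right _ _))⟩
  smul_mem' := by
    intro h m hm
    let K : AddSubgroup M :=
      { carrier := {m | IsNilpotentVec ρ c m}
        zero_mem' := ⟨0, rfl⟩
        add_mem' := by
          rintro m m' ⟨n, h⟩ ⟨n', h'⟩
          exact ⟨max n n', (h.mono (le_max_left _ _)).add (h'.mono (le_max_right _ _))⟩
        neg_mem' := by
          rintro m ⟨n, h⟩
          exact ⟨n, by simpa using h.algebraMap_smul (-1)⟩ }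
    refine H.smul_mem_of_generators K ?_ ?_ ?_ ?_ h hm
    · rintro r m ⟨n, h⟩; exact ⟨n, h.algebraMap_smul r⟩
    · rintro a m ⟨n, h⟩; exact ⟨n + 1, h.x_smul a⟩
    · rintro v m ⟨n, h⟩; exact ⟨n, h.y_smul v⟩
    · rintro w m ⟨n, h⟩; exact ⟨n, h.g_smul w⟩

theorem NilpotentOfOrder.map {M' : Type*} [AddCommGroup M'] [Module (H ρ c) M']
    (f : M →ₗ[H ρ c] M') {n : ℕ} {m : M} (h : NilpotentOfOrder ρ c n m) :
    NilpotentOfOrder ρ c n (f m) := by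
  induction n generalizing m with
  | zero => rw [show m = 0 from h, map_zero]; rfl
  | succ n ih => intro v; rw [← map_smul]; exact ih (h v)

variable (ρ c) in
/-- The functor taking a module to its submodule of `V`-nilpotent vectors. -/
def nilpotentFunctor : ModuleCat.{u} (H ρ c) ⥤ ModuleCat.{u} (H ρ c) where
  obj M := ModuleCat.of _ (nilpotentVectors ρ c M)
  map f := ModuleCat.ofHom (f.hom.restrict fun _ ⟨n, h⟩ => ⟨n, h.map f.hom⟩)

end CategoryO

section Euler

variable [FiniteDimensional ℂ V]

/-- The element `𝐡 = ∑ xᵢ yᵢ + dim V / 2 - ∑ₛ 2 cₛ / (1 - λₛ) s`. -/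
def euler : H ρ c :=
  ∑ i, H.x ρ c ((Module.finBasis ℂ V).coord i) * H.y ρ c (Module.finBasis ℂ V i) +
    algebraMap ℂ _ (Module.finrank ℂ V / 2) -
    ∑ s ∈ reflections ρ, (2 * c.val s / (1 - reflEigenvalue ρ s)) • H.g ρ c s

theorem sum_coord_x (a : Module.Dual ℂ V) :
    ∑ i, a (Module.finBasis ℂ V i) • H.x ρ c ((Module.finBasis ℂ V).coord i) = H.x ρ c a := by
  have : a = ∑ i, a (Module.finBasis ℂ V i) • (Module.finBasis ℂ V).coord i := by
    refine (Module.finBasis ℂ V).ext fun j => ?_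
    simp
  conv_rhs => rw [this]
  change _ = H.xLin ρ c _
  rw [map_sum]
  simp only [map_smul]
  rfl

theorem sum_coord_y (v : V) :
    ∑ i, (Module.finBasis ℂ V).coord i v • H.y ρ c (Module.finBasis ℂ V i) = H.y ρ c v := by
  conv_rhs => rw [← (Module.finBasis ℂ V).sum_repr v]
  change _ = H.yLin ρ c _
  rw [map_sum]
  simp only [map_smul]
  rfl

theorem euler_x (a : Module.Dual ℂ V) :
    euler ρ c * H.x ρ c a = H.x ρ c a * euler ρ c + H.x ρ c a := by
  have h1 : (∑ i, H.x ρ c ((Module.finBasis ℂ V).coord i) * H.y ρ c (Module.finBasis ℂ V i)) *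
      H.x ρ c a = H.x ρ c a *
        (∑ i, H.x ρ c ((Module.finBasis ℂ V).coord i) * H.y ρ c (Module.finBasis ℂ V i)) +
        (H.x ρ c a - ∑ s ∈ reflections ρ,
          (c.val s * a (coroot ρ s)) • (H.x ρ c (root ρ s) * H.g ρ c s)) := by
    rw [Finset.sum_mul]
    have : ∀ i, H.x ρ c ((Module.finBasis ℂ V).coord i) * H.y ρ c (Module.finBasis ℂ V i) *
        H.x ρ c a = H.x ρ c a * (H.x ρ c ((Module.finBasis ℂ V).coord i) *
          H.y ρ c (Module.finBasis ℂ V i)) +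
        (a (Module.finBasis ℂ V i) • H.x ρ c ((Module.finBasis ℂ V).coord i) -
          ∑ s ∈ reflections ρ, (c.val s * a (coroot ρ s)) •
            ((root ρ s (Module.finBasis ℂ V i) • H.x ρ c ((Module.finBasis ℂ V).coord i)) *
              H.g ρ c s)) := by
      intro i
      rw [mul_assoc, H.y_x, mul_add, ← mul_assoc, H.x_x ρ c _ a, mul_assoc, mul_sub,
        ← Algebra.commutes, ← Algebra.smul_def, Finset.mul_sum]
      congr 2
      refine Finset.sum_congr rfl fun s _ => ?_
      rw [mul_smul_comm, smul_mul_assoc, smul_smul]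
      congr 1
      ring
    rw [Finset.sum_congr rfl fun i _ => this i, Finset.sum_add_distrib, Finset.sum_sub_distrib,
      sum_coord_x, Finset.sum_comm, Finset.mul_sum]
    congr 2
    refine Finset.sum_congr rfl fun s _ => ?_
    rw [← Finset.smul_sum, ← Finset.sum_mul, sum_coord_x]
  have h2 : (∑ s ∈ reflections ρ, (2 * c.val s / (1 - reflEigenvalue ρ s)) • H.g ρ c s) *
      H.x ρ c a = H.x ρ c a *
        (∑ s ∈ reflections ρ, (2 * c.val s / (1 - reflEigenvalue ρ s)) • H.g ρ c s) -
      ∑ s ∈ reflections ρ, (c.val s * a (coroot ρ s)) • (H.x ρ c (root ρ s) * H.g ρ c s) := by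
    rw [Finset.sum_mul, Finset.mul_sum, ← Finset.sum_sub_distrib]
    refine Finset.sum_congr rfl fun s hs => ?_
    obtain ⟨-, hl, -, -, hd⟩ := root_facts (mem_reflections.1 hs)
    have hl' : 1 - reflEigenvalue ρ s ≠ 0 := sub_ne_zero.2 hl.symm
    rw [smul_mul_assoc, H.g_x, hd]
    have : H.x ρ c (a - ((1 - reflEigenvalue ρ s) / 2 * a (coroot ρ s)) • root ρ s) =
        H.x ρ c a - ((1 - reflEigenvalue ρ s) / 2 * a (coroot ρ s)) • H.x ρ c (root ρ s) := by
      change H.xLin ρ c _ = _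
      rw [map_sub, map_smul]; rfl
    rw [this, sub_mul, smul_sub, smul_mul_assoc, smul_smul, mul_smul_comm]
    congr 2
    field_simp
  unfold euler
  rw [sub_mul, add_mul, h1, h2, mul_sub, mul_add, Algebra.commutes]
  abel

theorem euler_y (v : V) :
    euler ρ c * H.y ρ c v = H.y ρ c v * euler ρ c - H.y ρ c v := by
  have hco : ∀ s ∈ reflections ρ,
      ρ s (coroot ρ s) = (reflEigenvalue ρ s)⁻¹ • coroot ρ s := by
    intro s hs
    obtain ⟨-, -, h2, hy, -⟩ := root_facts (mem_reflections.1 hs)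
    rw [hy, h2]; module
  have h1 : H.y ρ c v *
      (∑ i, H.x ρ c ((Module.finBasis ℂ V).coord i) * H.y ρ c (Module.finBasis ℂ V i)) =
      (∑ i, H.x ρ c ((Module.finBasis ℂ V).coord i) * H.y ρ c (Module.finBasis ℂ V i)) *
        H.y ρ c v + (H.y ρ c v - ∑ s ∈ reflections ρ,
          (c.val s * root ρ s v * (reflEigenvalue ρ s)⁻¹) •
            (H.y ρ c (coroot ρ s) * H.g ρ c s)) := by
    rw [Finset.mul_sum]
    have : ∀ i, H.y ρ c v * (H.x ρ c ((Module.finBasis ℂ V).coord i) *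
        H.y ρ c (Module.finBasis ℂ V i)) =
        H.x ρ c ((Module.finBasis ℂ V).coord i) * H.y ρ c (Module.finBasis ℂ V i) * H.y ρ c v +
        ((Module.finBasis ℂ V).coord i v • H.y ρ c (Module.finBasis ℂ V i) -
          ∑ s ∈ reflections ρ, (c.val s * root ρ s v) •
            (H.g ρ c s * ((Module.finBasis ℂ V).coord i (coroot ρ s) •
              H.y ρ c (Module.finBasis ℂ V i)))) := by
      intro i
      rw [← mul_assoc, H.y_x, add_mul, mul_assoc, H.y_y ρ c v, ← mul_assoc, sub_mul,
        ← Algebra.smul_def, Finset.sum_mul]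
      congr 2
      refine Finset.sum_congr rfl fun s _ => ?_
      rw [mul_smul_comm, smul_mul_assoc, smul_smul]
    rw [Finset.sum_congr rfl fun i _ => this i, Finset.sum_add_distrib, Finset.sum_sub_distrib,
      sum_coord_y, Finset.sum_comm, ← Finset.sum_mul]
    congr 2
    refine Finset.sum_congr rfl fun s hs => ?_
    rw [← Finset.smul_sum, ← Finset.mul_sum, sum_coord_y, H.g_y, hco s hs, H.y_smul,
      smul_mul_assoc, smul_smul]
  have h2 : (∑ s ∈ reflections ρ, (2 * c.val s / (1 - reflEigenvalue ρ s)) • H.g ρ c s) *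
      H.y ρ c v = H.y ρ c v *
        (∑ s ∈ reflections ρ, (2 * c.val s / (1 - reflEigenvalue ρ s)) • H.g ρ c s) +
      ∑ s ∈ reflections ρ, (c.val s * root ρ s v * (reflEigenvalue ρ s)⁻¹) •
        (H.y ρ c (coroot ρ s) * H.g ρ c s) := by
    rw [Finset.sum_mul, Finset.mul_sum, ← Finset.sum_add_distrib]
    refine Finset.sum_congr rfl fun s hs => ?_
    obtain ⟨hl0, hl, -, hy, -⟩ := root_facts (mem_reflections.1 hs)
    have hl' : 1 - reflEigenvalue ρ s ≠ 0 := sub_ne_zero.2 hl.symm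
    rw [smul_mul_assoc, H.g_y, hy]
    have : H.y ρ c (v - ((1 - (reflEigenvalue ρ s)⁻¹) / 2 * root ρ s v) • coroot ρ s) =
        H.y ρ c v - ((1 - (reflEigenvalue ρ s)⁻¹) / 2 * root ρ s v) • H.y ρ c (coroot ρ s) := by
      change H.yLin ρ c _ = _
      rw [map_sub, map_smul]; rfl
    rw [this, sub_mul, smul_sub, smul_mul_assoc, smul_smul, mul_smul_comm, sub_eq_add_neg,
      ← neg_smul]
    congr 2
    field_simp
    ring
  unfold euler
  rw [sub_mul, add_mul, h2, mul_sub, mul_add, h1, Algebra.commutes]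
  abel

theorem euler_g (w : G) : euler ρ c * H.g ρ c w = H.g ρ c w * euler ρ c := by
  have h1 : H.g ρ c w *
      (∑ i, H.x ρ c ((Module.finBasis ℂ V).coord i) * H.y ρ c (Module.finBasis ℂ V i)) =
      (∑ i, H.x ρ c ((Module.finBasis ℂ V).coord i) * H.y ρ c (Module.finBasis ℂ V i)) *
        H.g ρ c w := by
    rw [Finset.mul_sum, Finset.sum_mul]
    have : ∀ i, H.g ρ c w * (H.x ρ c ((Module.finBasis ℂ V).coord i) *
        H.y ρ c (Module.finBasis ℂ V i)) =
        ∑ j, H.x ρ c ((Module.finBasis ℂ V).coord j) *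
          ((Module.finBasis ℂ V).coord i (ρ w⁻¹ (Module.finBasis ℂ V j)) •
            H.y ρ c (ρ w (Module.finBasis ℂ V i))) * H.g ρ c w := by
      intro i
      rw [← mul_assoc, H.g_x, mul_assoc, H.g_y, ← sum_coord_x ρ c (ρ.dual w _), Finset.sum_mul]
      refine Finset.sum_congr rfl fun j _ => ?_
      rw [dual_apply', smul_mul_assoc, mul_smul_comm, smul_mul_assoc, mul_assoc]
    rw [Finset.sum_congr rfl fun i _ => this i, Finset.sum_comm]
    refine Finset.sum_congr rfl fun j _ => ?_
    rw [← Finset.sum_mul, ← Finset.mul_sum]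
    congr 2
    have h2 : ρ w (ρ w⁻¹ (Module.finBasis ℂ V j)) = Module.finBasis ℂ V j := apply_inv_apply _ _
    conv_rhs => rw [← h2, ← (Module.finBasis ℂ V).sum_repr (ρ w⁻¹ (Module.finBasis ℂ V j))]
    rw [map_sum]
    change _ = H.yLin ρ c _
    rw [map_sum]
    refine Finset.sum_congr rfl fun i _ => ?_
    rw [map_smul, map_smul]
    rfl
  have h2 : H.g ρ c w *
      (∑ s ∈ reflections ρ, (2 * c.val s / (1 - reflEigenvalue ρ s)) • H.g ρ c s) =
      (∑ s ∈ reflections ρ, (2 * c.val s / (1 - reflEigenvalue ρ s)) • H.g ρ c s) *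
        H.g ρ c w := by
    rw [Finset.mul_sum, Finset.sum_mul]
    refine Finset.sum_nbij' (fun s => w * s * w⁻¹) (fun s => w⁻¹ * s * w) ?_ ?_ ?_ ?_ ?_
    · intro s hs
      exact mem_reflections.2 ((mem_reflections.1 hs).conj w)
    · intro s hs
      have := (mem_reflections.1 hs).conj w⁻¹
      rw [inv_inv] at this
      exact mem_reflections.2 this
    · intro s _; group
    · intro s _; group
    · intro s hs
      have hs' := mem_reflections.1 hs
      rw [c.conj_eq w s hs', reflEigenvalue_conj hs', mul_smul_comm, smul_mul_assoc, ← H.g_mul,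
        ← H.g_mul]
      simp
  unfold euler
  rw [sub_mul, add_mul, mul_sub, mul_add, h1, h2, Algebra.commutes]

variable {ρ c} {M : Type*} [AddCommGroup M] [Module (H ρ c) M]

variable (ρ c) in
/-- `m` is a generalized eigenvector of `𝐡`. -/
def IsEulerGenEigenvector (m : M) : Prop :=
  ∃ (μ : ℂ) (n : ℕ), (euler ρ c - algebraMap ℂ _ μ) ^ n • m = 0

theorem pow_shift {A : Type*} [Ring A] {e e' z : A} (h : e' * z = z * e) (n : ℕ) :
    e' ^ n * z = z * e ^ n := by
  induction n with
  | zero => simp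
  | succ n ih => rw [pow_succ, mul_assoc, h, ← mul_assoc, ih, mul_assoc, pow_succ]

theorem IsEulerGenEigenvector.of_shift {m : M} (hm : IsEulerGenEigenvector ρ c m) (z : H ρ c)
    (k : ℂ) (hz : euler ρ c * z = z * euler ρ c + algebraMap ℂ _ k * z) :
    IsEulerGenEigenvector ρ c (z • m) := by
  obtain ⟨μ, n, h⟩ := hm
  refine ⟨μ + k, n, ?_⟩
  have h1 : (euler ρ c - algebraMap ℂ _ (μ + k)) * z = z * (euler ρ c - algebraMap ℂ _ μ) := by
    rw [sub_mul, hz, map_add, add_mul, mul_sub, Algebra.commutes μ z]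
    abel
  rw [← mul_smul, pow_shift h1, mul_smul, h, smul_zero]

variable (ρ c M) in
/-- The submodule spanned by the generalized eigenvectors of `𝐡`
(the set of these vectors is stable under scalars, so that the additive span is the span). -/
def eulerFinite : Submodule (H ρ c) M where
  toAddSubmonoid := (AddSubgroup.closure {m : M | IsEulerGenEigenvector ρ c m}).toAddSubmonoid
  smul_mem' := by
    intro h m hm
    have key : ∀ (z : H ρ c) (k : ℂ), euler ρ c * z = z * euler ρ c + algebraMap ℂ _ k * z →
        ∀ m ∈ AddSubgroup.closure {m : M | IsEulerGenEigenvector ρ c m},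
          z • m ∈ AddSubgroup.closure {m : M | IsEulerGenEigenvector ρ c m} := by
      intro z k hz m hm
      induction hm using AddSubgroup.closure_induction with
      | mem m hm => exact AddSubgroup.subset_closure (hm.of_shift z k hz)
      | zero => rw [smul_zero]; exact AddSubgroup.zero_mem _
      | add a b _ _ ha hb => rw [smul_add]; exact AddSubgroup.add_mem _ ha hb
      | neg a _ ha => rw [smul_neg]; exact AddSubgroup.neg_mem _ ha
    refine H.smul_mem_of_generators _ ?_ ?_ ?_ ?_ h hm
    · intro r
      refine key _ 0 ?_
      rw [map_zero, zero_mul, add_zero, Algebra.commutes]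
    · intro a
      refine key _ 1 ?_
      rw [map_one, one_mul, euler_x]
    · intro v
      refine key _ (-1) ?_
      rw [map_neg, map_one, neg_one_mul, euler_y, sub_eq_add_neg]
    · intro w
      refine key _ 0 ?_
      rw [map_zero, zero_mul, add_zero, euler_g]

theorem map_mem_eulerFinite {M' : Type*} [AddCommGroup M'] [Module (H ρ c) M']
    (f : M →ₗ[H ρ c] M') (m : M) (hm : m ∈ eulerFinite ρ c M) : f m ∈ eulerFinite ρ c M' := by
  change m ∈ AddSubgroup.closure _ at hm
  change f m ∈ AddSubgroup.closure _
  induction hm using AddSubgroup.closure_induction with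
  | mem m hm =>
    obtain ⟨μ, n, h⟩ := hm
    exact AddSubgroup.subset_closure ⟨μ, n, by rw [← map_smul, h, map_zero]⟩
  | zero => rw [map_zero]; exact AddSubgroup.zero_mem _
  | add a b _ _ ha hb => rw [map_add]; exact AddSubgroup.add_mem _ ha hb
  | neg a _ ha => rw [map_neg]; exact AddSubgroup.neg_mem _ ha

variable (ρ c) in
/-- The functor taking a module to the span of the generalized eigenvectors of `𝐡`. -/
def eulerFiniteFunctor : ModuleCat.{u} (H ρ c) ⥤ ModuleCat.{u} (H ρ c) where
  obj M := ModuleCat.of _ (eulerFinite ρ c M)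
  map f := ModuleCat.ofHom (f.hom.restrict fun m hm => map_mem_eulerFinite f.hom m hm)

end Euler

end Algebra

section Reduction

variable {G V : Type u} [Group G] [Finite G] [AddCommGroup V] [Module ℂ V]
variable (ρ : Representation ℂ G V) (c : Param ρ)

/-- The representation of `G` on `V / V^G`. -/
def redRep : Representation ℂ G (V ⧸ ρ.invariants) :=
  ρ.quotient ρ.invariants fun g v hv => by
    have : ρ g v = v := hv g
    rw [Submodule.mem_comap, this]
    exact hv

/-- The projection of `V` to `V^G`. -/
def average : V →ₗ[ℂ] V :=
  letI := Fintype.ofFinite G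
  (Nat.card G : ℂ)⁻¹ • ∑ g : G, ρ g

variable {ρ}

theorem average_apply_rep (g : G) (v : V) : average ρ (ρ g v) = average ρ v := by
  let _ := Fintype.ofFinite G
  simp only [average, LinearMap.smul_apply, LinearMap.sum_apply]
  congr 1
  refine Fintype.sum_equiv (Equiv.mulRight g) _ _ fun h => ?_
  rw [Equiv.coe_mulRight, map_mul, Module.End.mul_apply]

theorem rep_apply_average (g : G) (v : V) : ρ g (average ρ v) = average ρ v := by
  let _ := Fintype.ofFinite G
  simp only [average, LinearMap.smul_apply, LinearMap.sum_apply, map_smul, map_sum]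
  congr 1
  refine Fintype.sum_equiv (Equiv.mulLeft g) _ _ fun h => ?_
  rw [Equiv.coe_mulLeft, map_mul, Module.End.mul_apply]

theorem average_of_invariant {v : V} (hv : v ∈ ρ.invariants) : average ρ v = v := by
  let _ := Fintype.ofFinite G
  have h : ∀ g, ρ g v = v := hv
  simp only [average, LinearMap.smul_apply, LinearMap.sum_apply, h, Finset.sum_const,
    Finset.card_univ, Nat.card_eq_fintype_card]
  rw [← Nat.cast_smul_eq_nsmul ℂ, smul_smul, inv_mul_cancel₀, one_smul]
  exact_mod_cast Fintype.card_ne_zero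

variable (ρ) in
/-- The `G`-equivariant section of `V → V / V^G`. -/
def redSection : (V ⧸ ρ.invariants) →ₗ[ℂ] V :=
  ρ.invariants.liftQ (LinearMap.id - average ρ) fun v hv => by
    simp [average_of_invariant hv]

theorem redSection_mk (v : V) : redSection ρ (Submodule.Quotient.mk v) = v - average ρ v := rfl

theorem mk_redSection (q : V ⧸ ρ.invariants) :
    (Submodule.Quotient.mk (redSection ρ q) : V ⧸ ρ.invariants) = q := by
  obtain ⟨v, rfl⟩ := Submodule.Quotient.mk_surjective _ q
  rw [redSection_mk, Submodule.Quotient.eq]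
  have : v - average ρ v - v = -average ρ v := by abel
  rw [this]
  exact Submodule.neg_mem _ fun g => rep_apply_average g v

theorem redRep_mk (g : G) (v : V) :
    redRep ρ g (Submodule.Quotient.mk v) = Submodule.Quotient.mk (ρ g v) := rfl

theorem redSection_rep (g : G) (q : V ⧸ ρ.invariants) :
    redSection ρ (redRep ρ g q) = ρ g (redSection ρ q) := by
  obtain ⟨v, rfl⟩ := Submodule.Quotient.mk_surjective _ q
  rw [redRep_mk, redSection_mk, redSection_mk, map_sub, average_apply_rep, rep_apply_average]

theorem isReflection_redRep {s : G} : IsReflection (redRep ρ) s ↔ IsReflection ρ s := by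
  have h1 : LinearMap.range (ρ s - 1) =
      (LinearMap.range (redRep ρ s - 1)).map (redSection ρ) := by
    ext w
    constructor
    · rintro ⟨v, rfl⟩
      refine ⟨_, ⟨Submodule.Quotient.mk v, rfl⟩, ?_⟩
      simp only [LinearMap.sub_apply, Module.End.one_apply, map_sub, redSection_rep,
        redSection_mk, rep_apply_average]
      abel
    · rintro ⟨_, ⟨q, rfl⟩, rfl⟩
      refine ⟨redSection ρ q, ?_⟩
      simp only [LinearMap.sub_apply, Module.End.one_apply, map_sub, redSection_rep]
  have hinj : Function.Injective (redSection ρ) :=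
    Function.LeftInverse.injective (g := Submodule.Quotient.mk) mk_redSection
  unfold IsReflection
  rw [h1]
  exact Eq.congr_left (LinearEquiv.finrank_eq (Submodule.equivMapOfInjective _ hinj _))

theorem reflections_redRep : reflections (redRep ρ) = reflections ρ := by
  ext s
  rw [mem_reflections, mem_reflections, isReflection_redRep]

theorem reflEigenvalue_redRep {s : G} (hs : IsReflection ρ s) :
    reflEigenvalue (redRep ρ) s = reflEigenvalue ρ s := by
  have := reflEigenvalue_eq (isReflection_redRep.2 hs) (κ := (reflEigenvalue ρ s)⁻¹ - 1) (by
    intro q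
    obtain ⟨v, rfl⟩ := Submodule.Quotient.mk_surjective _ q
    exact congrArg (Submodule.Quotient.mk (p := ρ.invariants)) (refl_quadratic hs v))
  rw [add_sub_cancel] at this
  exact inv_injective this

/-- The parameter `c` for the representation `V / V^G`, which has the same reflections. -/
def Param.reduce (c : Param ρ) : Param (redRep ρ) where
  val := c.val
  conj_eq g s hs := c.conj_eq g s (isReflection_redRep.1 hs)

theorem root_pairing_redRep {s : G} (hs : IsReflection ρ s) (q : V ⧸ ρ.invariants)
    (a : Module.Dual ℂ (V ⧸ ρ.invariants)) :
    root (redRep ρ) s q * a (coroot (redRep ρ) s) =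
      root ρ s (redSection ρ q) * (a ∘ₗ ρ.invariants.mkQ) (coroot ρ s) := by
  rw [root_pairing hs, root_pairing (isReflection_redRep.2 hs), reflEigenvalue_redRep hs]
  simp only [LinearMap.comp_apply, Submodule.mkQ_apply, mk_redSection, ← redSection_rep]

variable (ρ) in
/-- Images of the generators under the embedding of `H_c(G, V / V^G)` in `H_c(G, V)`. -/
def redGen : Gen G (V ⧸ ρ.invariants) → H ρ c
  | .x a => H.x ρ c (a ∘ₗ ρ.invariants.mkQ)
  | .y q => H.y ρ c (redSection ρ q)
  | .g w => H.g ρ c w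

variable (ρ) in
/-- The natural homomorphism `H_c(G, V / V^G) → H_c(G, V)`, where `(V / V^G)^*` is a subspace of
`V^*` and `V / V^G` is identified with the `G`-invariant complement of `V^G` in `V`. -/
def redHom : H (redRep ρ) c.reduce →ₐ[ℂ] H ρ c :=
  RingQuot.liftAlgHom ℂ ⟨FreeAlgebra.lift ℂ (redGen ρ c), by
    intro a b h
    have hd : ∀ (w : G) (a : Module.Dual ℂ (V ⧸ ρ.invariants)),
        ρ.dual w (a ∘ₗ ρ.invariants.mkQ) = ((redRep ρ).dual w a) ∘ₗ ρ.invariants.mkQ := by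
      intro w a
      ext v
      rw [dual_apply', LinearMap.comp_apply, LinearMap.comp_apply, dual_apply']
      rfl
    cases h with
    | x_add a a' =>
      simp only [map_add, FreeAlgebra.lift_ι_apply, redGen, LinearMap.add_comp, H.x_add]
    | x_smul r a =>
      simp only [map_smul, FreeAlgebra.lift_ι_apply, redGen, LinearMap.smul_comp, H.x_smul]
    | y_add v v' => simp only [map_add, FreeAlgebra.lift_ι_apply, redGen, H.y_add]
    | y_smul r v => simp only [map_smul, FreeAlgebra.lift_ι_apply, redGen, H.y_smul]
    | g_one => simp only [map_one, FreeAlgebra.lift_ι_apply, redGen, H.g_one]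
    | g_mul g h => simp only [map_mul, FreeAlgebra.lift_ι_apply, redGen, H.g_mul]
    | g_x g a => simp only [map_mul, FreeAlgebra.lift_ι_apply, redGen, H.g_x, hd]
    | g_y g v => simp only [map_mul, FreeAlgebra.lift_ι_apply, redGen, H.g_y, redSection_rep]
    | x_x a a' =>
      simp only [map_mul, FreeAlgebra.lift_ι_apply, redGen]
      exact H.x_x ρ c _ _
    | y_y v v' =>
      simp only [map_mul, FreeAlgebra.lift_ι_apply, redGen]
      exact H.y_y ρ c _ _
    | y_x q a =>
      simp only [map_mul, map_add, map_sub, map_sum, map_smul, FreeAlgebra.lift_ι_apply, redGen,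
        AlgHom.commutes, H.y_x, reflections_redRep]
      congr 2
      · simp only [LinearMap.comp_apply, Submodule.mkQ_apply, mk_redSection]
      · refine Finset.sum_congr rfl fun s hs => ?_
        have := root_pairing_redRep (mem_reflections.1 hs) q a
        congr 1
        rw [mul_assoc, mul_assoc, this]
        rfl⟩

theorem redHom_mk (a : FreeAlgebra ℂ (Gen G (V ⧸ ρ.invariants))) :
    redHom ρ c (H.mk _ _ a) = FreeAlgebra.lift ℂ (redGen ρ c) a := by
  unfold redHom H.mk
  exact RingQuot.liftAlgHom_mkAlgHom_apply _ _ _ _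

theorem redHom_x (a : Module.Dual ℂ (V ⧸ ρ.invariants)) :
    redHom ρ c (H.x _ _ a) = H.x ρ c (a ∘ₗ ρ.invariants.mkQ) := by
  rw [H.x, redHom_mk, FreeAlgebra.lift_ι_apply, redGen]

theorem redHom_y (q : V ⧸ ρ.invariants) :
    redHom ρ c (H.y _ _ q) = H.y ρ c (redSection ρ q) := by
  rw [H.y, redHom_mk, FreeAlgebra.lift_ι_apply, redGen]

theorem redHom_g (w : G) : redHom ρ c (H.g _ _ w) = H.g ρ c w := by
  rw [H.g, redHom_mk, FreeAlgebra.lift_ι_apply, redGen]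

theorem root_invariant {s : G} (hs : IsReflection ρ s) {v : V} (hv : v ∈ ρ.invariants) :
    root ρ s v = 0 := by
  have h : ρ s v = v := hv s
  obtain ⟨h0, h1, h2, hy, -⟩ := root_facts hs
  have h3 := congrArg (root ρ s) (hy v)
  rw [h, map_sub, map_smul, h2, smul_eq_mul] at h3
  have h4 : (1 - (reflEigenvalue ρ s)⁻¹) * root ρ s v = 0 := by linear_combination h3
  rcases mul_eq_zero.1 h4 with h5 | h5
  · exact absurd (inv_eq_one.1 (sub_eq_zero.1 h5).symm) h1
  · exact h5

/-- `ζ(M) = {m ∈ M : y m = 0 for y ∈ V^G}` as a module over `H_c(G, V / V^G)`. -/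
def zetaSubmodule (M : ModuleCat.{u} (H ρ c)) :
    Submodule (H (redRep ρ) c.reduce)
      ((ModuleCat.restrictScalars (redHom ρ c).toRingHom).obj M) where
  carrier := {m : M | ∀ v ∈ ρ.invariants, H.y ρ c v • m = 0}
  zero_mem' v _ := smul_zero (A := M) _
  add_mem' {m m'} hm hm' v hv := by
    have h1 : H.y ρ c v • (show M from m) = 0 := hm v hv
    have h2 : H.y ρ c v • (show M from m') = 0 := hm' v hv
    change H.y ρ c v • ((show M from m) + (show M from m')) = 0
    rw [smul_add, h1, h2, add_zero]
  smul_mem' h m hm := by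
    let K : AddSubgroup ((ModuleCat.restrictScalars (redHom ρ c).toRingHom).obj M) :=
      { carrier := {m : M | ∀ v ∈ ρ.invariants, H.y ρ c v • m = 0}
        zero_mem' := fun v _ => smul_zero (A := M) _
        add_mem' := fun {m m'} hm hm' v hv => by
          have h1 : H.y ρ c v • (show M from m) = 0 := hm v hv
          have h2 : H.y ρ c v • (show M from m') = 0 := hm' v hv
          change H.y ρ c v • ((show M from m) + (show M from m')) = 0
          rw [smul_add, h1, h2, add_zero]
        neg_mem' := fun {m} hm v hv => by
          have h1 : H.y ρ c v • (show M from m) = 0 := hm v hv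
          change H.y ρ c v • (-(show M from m)) = 0
          rw [smul_neg, h1, neg_zero] }
    have key : ∀ z : H (redRep ρ) c.reduce,
        (∀ v ∈ ρ.invariants, ∃ z' v', v' ∈ ρ.invariants ∧
          H.y ρ c v * redHom ρ c z = z' * H.y ρ c v') → ∀ m ∈ K, z • m ∈ K := by
      intro z hz m hm v hv
      obtain ⟨z', v', hv', h1⟩ := hz v hv
      have h2 : H.y ρ c v' • (show M from m) = 0 := hm v' hv'
      change H.y ρ c v • (redHom ρ c z • (show M from m)) = 0
      rw [← mul_smul, h1, mul_smul, h2, smul_zero]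
    refine H.smul_mem_of_generators K ?_ ?_ ?_ ?_ h hm
    · intro r
      refine key _ fun v hv => ⟨algebraMap ℂ _ r, v, hv, ?_⟩
      rw [AlgHom.commutes, Algebra.commutes]
    · intro a
      refine key _ fun v hv => ⟨H.x ρ c (a ∘ₗ ρ.invariants.mkQ), v, hv, ?_⟩
      rw [redHom_x, H.y_x, LinearMap.comp_apply,
        Submodule.mkQ_apply, (Submodule.Quotient.mk_eq_zero _).2 hv, map_zero, map_zero,
        Finset.sum_eq_zero, sub_zero, add_zero]
      intro s hs
      rw [root_invariant (mem_reflections.1 hs) hv, mul_zero, zero_mul, zero_smul]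
    · intro q
      refine key _ fun v hv => ⟨H.y ρ c (redSection ρ q), v, hv, ?_⟩
      rw [redHom_y]
      exact H.y_y ρ c _ _
    · intro w
      refine key _ fun v hv => ⟨H.g ρ c w, v, hv, ?_⟩
      rw [redHom_g]
      have h1 := H.g_y ρ c w v
      rw [show ρ w v = v from hv w] at h1
      exact h1.symm

variable (ρ) in
/-- The functor `ζ`, from `H_c(G, V)`-modules to `H_c(G, V / V^G)`-modules. -/
def zeta : ModuleCat.{u} (H ρ c) ⥤ ModuleCat.{u} (H (redRep ρ) c.reduce) where
  obj M := ModuleCat.of _ (zetaSubmodule c M)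
  map {M N} f := ModuleCat.ofHom
    (((ModuleCat.restrictScalars (redHom ρ c).toRingHom).map f).hom.restrict
      (p := zetaSubmodule c M) (q := zetaSubmodule c N) fun m hm v hv => by
        have h1 : H.y ρ c v • (show M from m) = 0 := hm v hv
        change H.y ρ c v • (f.hom (show M from m)) = 0
        rw [← map_smul, h1, map_zero])

end Reduction

section Completion

variable {G V : Type u} [Group G] [AddCommGroup V] [Module ℂ V] [FiniteDimensional ℂ V]
variable (ρ : Representation ℂ G V)

/-- The orbit of `b`. -/
def orbit (b : V) : Set V := Set.range fun g : G => ρ g b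

theorem rep_mem_orbit {b p : V} (g : G) (hp : p ∈ orbit ρ b) : ρ g p ∈ orbit ρ b := by
  obtain ⟨h, rfl⟩ := hp
  exact ⟨g * h, by simp [map_mul]⟩

theorem self_mem_orbit (b : V) : b ∈ orbit ρ b := ⟨1, by simp⟩

variable (V) in
/-- Formal power series on `V`, in the linear coordinates of a basis of `V`. -/
abbrev FormalSeries : Type := MvPowerSeries (Fin (Module.finrank ℂ V)) ℂ

/-- The ring of regular functions on the formal neighborhood of the orbit of `b`: a family of
formal power series, one at each point of the orbit; the series at `p` is the expansion of the
function `f` at `p`, that is, the series `f(p + z)` in `z ∈ V`. -/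
abbrev FormalFun (b : V) : Type u := orbit ρ b → FormalSeries V

/-- The expansion at `p` of the linear function `a ∈ V^*`: the series `a(p) + a(z)`. -/
def linSeries (a : Module.Dual ℂ V) (p : V) : FormalSeries V :=
  MvPowerSeries.C (a p) + ∑ i, a (Module.finBasis ℂ V i) • MvPowerSeries.X i

variable {ρ} in
/-- The linear function `a ∈ V^*` as a function on the formal neighborhood of the orbit. -/
def linFun (b : V) (a : Module.Dual ℂ V) : FormalFun ρ b := fun p => linSeries a p

/-- The coordinate functions of `g⁻¹ z`. -/
def substSeries (g : G) (i : Fin (Module.finrank ℂ V)) : FormalSeries V :=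
  ∑ j, (Module.finBasis ℂ V).repr (ρ g⁻¹ (Module.finBasis ℂ V j)) i • MvPowerSeries.X j

theorem hasSubst_substSeries (g : G) : MvPowerSeries.HasSubst (substSeries ρ g) :=
  MvPowerSeries.hasSubst_of_constantCoeff_zero fun i => by
    simp [substSeries]

/-- The substitution `f(z) ↦ f(g⁻¹ z)`. -/
def substAct (g : G) : FormalSeries V →ₐ[ℂ] FormalSeries V :=
  MvPowerSeries.substAlgHom (hasSubst_substSeries ρ g)

variable {ρ} in
/-- The action of `g ∈ G` on functions: `(g f)(p) = f(g⁻¹ p)`. -/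
def actFun {b : V} (g : G) (f : FormalFun ρ b) : FormalFun ρ b := fun p =>
  substAct ρ g (f ⟨ρ g⁻¹ p, rep_mem_orbit ρ g⁻¹ p.2⟩)

variable {ρ} in
/-- The derivative `∂_v f`. -/
def derivFun {b : V} (v : V) (f : FormalFun ρ b) : FormalFun ρ b := fun p =>
  ∑ i, (Module.finBasis ℂ V).repr v i • MvPowerSeries.pderiv ℂ i (f p)

variable {ρ}

theorem linFun_add (b : V) (a a' : Module.Dual ℂ V) :
    (linFun b (a + a') : FormalFun ρ b) = linFun b a + linFun b a' := by
  funext p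
  simp only [linFun, linSeries, Pi.add_apply, LinearMap.add_apply, map_add, add_smul,
    Finset.sum_add_distrib]
  abel

theorem linFun_smul (b : V) (r : ℂ) (a : Module.Dual ℂ V) :
    (linFun b (r • a) : FormalFun ρ b) = algebraMap ℂ _ r * linFun b a := by
  rw [← Algebra.smul_def]
  funext p
  simp only [linFun, linSeries, Pi.smul_apply, LinearMap.smul_apply, smul_add, Finset.smul_sum,
    smul_eq_mul, mul_smul]
  congr 1
  rw [MvPowerSeries.smul_eq_C_mul, map_mul]

theorem substAct_linSeries (g : G) (a : Module.Dual ℂ V) (p : V) :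
    substAct ρ g (linSeries a (ρ g⁻¹ p)) = linSeries (ρ.dual g a) p := by
  unfold linSeries
  rw [map_add, map_sum]
  congr 1
  · rw [dual_apply']
    exact (substAct ρ g).commutes _
  · simp only [map_smul, dual_apply']
    have : ∀ i, substAct ρ g (MvPowerSeries.X i) = substSeries ρ g i := fun i =>
      MvPowerSeries.substAlgHom_X _ i
    simp only [this, substSeries, Finset.smul_sum, smul_smul]
    rw [Finset.sum_comm]
    refine Finset.sum_congr rfl fun j _ => ?_
    rw [← Finset.sum_smul]
    congr 1
    conv_rhs => rw [← (Module.finBasis ℂ V).sum_repr (ρ g⁻¹ (Module.finBasis ℂ V j))]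
    rw [map_sum]
    refine Finset.sum_congr rfl fun i _ => ?_
    rw [map_smul, smul_eq_mul, mul_comm]

theorem actFun_linFun (b : V) (g : G) (a : Module.Dual ℂ V) :
    actFun g (linFun b a : FormalFun ρ b) = linFun b (ρ.dual g a) := by
  funext p
  exact substAct_linSeries g a p

theorem derivFun_linFun (b : V) (v : V) (a : Module.Dual ℂ V) :
    derivFun v (linFun b a : FormalFun ρ b) = algebraMap ℂ _ (a v) := by
  classical
  funext p
  simp only [derivFun, linFun, linSeries, map_add, map_sum, Derivation.map_smul]
  have h1 : ∀ i : Fin (Module.finrank ℂ V),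
      MvPowerSeries.pderiv ℂ i (MvPowerSeries.C (a p) : FormalSeries V) = 0 := fun i =>
    (MvPowerSeries.pderiv ℂ i).map_algebraMap (a p)
  have h2 : ∀ i j : Fin (Module.finrank ℂ V),
      MvPowerSeries.pderiv ℂ i (MvPowerSeries.X j : FormalSeries V) = if j = i then 1 else 0 := by
    intro i j
    rw [MvPowerSeries.pderiv_X, Pi.single_apply]
  simp only [h1, h2, zero_add, smul_ite, smul_zero, Finset.sum_ite_eq', Finset.mem_univ, if_true,
    smul_smul]
  rw [← Finset.sum_smul]
  conv_rhs => rw [← (Module.finBasis ℂ V).sum_repr v]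
  simp only [map_sum, map_smul, smul_eq_mul, Pi.algebraMap_apply,
    Algebra.algebraMap_eq_smul_one, Finset.sum_smul]

end Completion

section CompletedAlgebra

variable {G V : Type u} [Group G] [Finite G] [AddCommGroup V] [Module ℂ V]
  [FiniteDimensional ℂ V]

/-- Generators of the completed algebra: functions on the formal neighborhood of the orbit of
`b`, the Dunkl-Opdam operators indexed by `V`, and `G`. -/
inductive HatGen (ρ : Representation ℂ G V) (b : V) : Type u
  | f : FormalFun ρ b → HatGen ρ b
  | y : V → HatGen ρ b
  | g : G → HatGen ρ b

/-- The relations of the completed algebra. The last one is the commutator of the Dunkl-Opdam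
operator `∂_v + ∑ₛ (2 cₛ / (1 - λₛ)) (αₛ(v) / αₛ) (s - 1)` with a function `f`; here `q s` is the
(unique) quotient `(s f - f) / αₛ`. -/
inductive HatRel (ρ : Representation ℂ G V) (c : Param ρ) (b : V) :
    FreeAlgebra ℂ (HatGen ρ b) → FreeAlgebra ℂ (HatGen ρ b) → Prop
  | f_add (f f' : FormalFun ρ b) :
      HatRel ρ c b (.ι ℂ (.f (f + f'))) (.ι ℂ (.f f) + .ι ℂ (.f f'))
  | f_mul (f f' : FormalFun ρ b) :
      HatRel ρ c b (.ι ℂ (.f (f * f'))) (.ι ℂ (.f f) * .ι ℂ (.f f'))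
  | f_const (r : ℂ) : HatRel ρ c b (.ι ℂ (.f (algebraMap ℂ _ r))) (algebraMap ℂ _ r)
  | y_add (v v' : V) : HatRel ρ c b (.ι ℂ (.y (v + v'))) (.ι ℂ (.y v) + .ι ℂ (.y v'))
  | y_smul (r : ℂ) (v : V) : HatRel ρ c b (.ι ℂ (.y (r • v))) (r • .ι ℂ (.y v))
  | g_one : HatRel ρ c b (.ι ℂ (.g 1)) 1
  | g_mul (g h : G) : HatRel ρ c b (.ι ℂ (.g (g * h))) (.ι ℂ (.g g) * .ι ℂ (.g h))
  | g_f (g : G) (f : FormalFun ρ b) :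
      HatRel ρ c b (.ι ℂ (.g g) * .ι ℂ (.f f)) (.ι ℂ (.f (actFun g f)) * .ι ℂ (.g g))
  | g_y (g : G) (v : V) :
      HatRel ρ c b (.ι ℂ (.g g) * .ι ℂ (.y v)) (.ι ℂ (.y (ρ g v)) * .ι ℂ (.g g))
  | y_y (v v' : V) :
      HatRel ρ c b (.ι ℂ (.y v) * .ι ℂ (.y v')) (.ι ℂ (.y v') * .ι ℂ (.y v))
  | y_f (v : V) (f : FormalFun ρ b) (q : G → FormalFun ρ b)
      (hq : ∀ s ∈ reflections ρ, linFun b (root ρ s) * q s = actFun s f - f) :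
      HatRel ρ c b (.ι ℂ (.y v) * .ι ℂ (.f f))
        (.ι ℂ (.f f) * .ι ℂ (.y v) + (.ι ℂ (.f (derivFun v f)) +
          ∑ s ∈ reflections ρ, (2 * c.val s / (1 - reflEigenvalue ρ s) * root ρ s v) •
            (.ι ℂ (.f (q s)) * .ι ℂ (.g s))))

/-- The completion of `H_c(G, V)` at the orbit of `b`: sections of the sheafified Cherednik
algebra on the formal neighborhood of the image of `b` in `V / G`. It is the extension of
`H_c(G, V)` from functions on `V` to functions on the formal neighborhood of the orbit. -/
def HHat (ρ : Representation ℂ G V) (c : Param ρ) (b : V) : Type u := RingQuot (HatRel ρ c b)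

variable (ρ : Representation ℂ G V) (c : Param ρ) (b : V)

instance : Ring (HHat ρ c b) := inferInstanceAs (Ring (RingQuot (HatRel ρ c b)))

instance : Algebra ℂ (HHat ρ c b) := inferInstanceAs (Algebra ℂ (RingQuot (HatRel ρ c b)))

namespace HHat

/-- The projection from the free algebra. -/
def mk : FreeAlgebra ℂ (HatGen ρ b) →ₐ[ℂ] HHat ρ c b := RingQuot.mkAlgHom ℂ (HatRel ρ c b)

variable {ρ c b} in
theorem mk_rel {z z' : FreeAlgebra ℂ (HatGen ρ b)} (h : HatRel ρ c b z z') :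
    mk ρ c b z = mk ρ c b z' :=
  RingQuot.mkAlgHom_rel ℂ h

/-- A function on the formal neighborhood, as an element of the completed algebra. -/
def f (f : FormalFun ρ b) : HHat ρ c b := mk ρ c b (.ι ℂ (.f f))

/-- The element of the completed algebra attached to `v ∈ V`. -/
def y (v : V) : HHat ρ c b := mk ρ c b (.ι ℂ (.y v))

/-- A group element, as an element of the completed algebra. -/
def g (g : G) : HHat ρ c b := mk ρ c b (.ι ℂ (.g g))

/-- Images of the generators of `H_c(G, V)`. -/
def ofGen : Gen G V → HHat ρ c b
  | .x a => f ρ c b (linFun b a)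
  | .y v => y ρ c b v
  | .g w => g ρ c b w

/-- The natural homomorphism from `H_c(G, V)` to its completion. -/
def ofH : H ρ c →ₐ[ℂ] HHat ρ c b :=
  RingQuot.liftAlgHom ℂ ⟨FreeAlgebra.lift ℂ (ofGen ρ c b), by
    intro z z' h
    cases h with
    | x_add a a' =>
      simp only [map_add, FreeAlgebra.lift_ι_apply, ofGen, linFun_add]
      simpa [f] using mk_rel (HatRel.f_add (ρ := ρ) (c := c) (linFun b a) (linFun b a'))
    | x_smul r a =>
      simp only [map_smul, FreeAlgebra.lift_ι_apply, ofGen, linFun_smul]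
      have h1 := mk_rel (HatRel.f_mul (ρ := ρ) (c := c) (algebraMap ℂ _ r) (linFun b a))
      have h2 := mk_rel (HatRel.f_const (ρ := ρ) (c := c) (b := b) r)
      rw [map_mul, h2, AlgHom.commutes] at h1
      rw [Algebra.smul_def r]
      exact h1
    | y_add v v' =>
      simp only [map_add, FreeAlgebra.lift_ι_apply, ofGen]
      simpa [y] using mk_rel (HatRel.y_add (ρ := ρ) (c := c) (b := b) v v')
    | y_smul r v =>
      simp only [map_smul, FreeAlgebra.lift_ι_apply, ofGen]
      simpa [y] using mk_rel (HatRel.y_smul (ρ := ρ) (c := c) (b := b) r v)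
    | g_one =>
      simp only [map_one, FreeAlgebra.lift_ι_apply, ofGen]
      simpa [g] using mk_rel (HatRel.g_one (ρ := ρ) (c := c) (b := b))
    | g_mul u w =>
      simp only [map_mul, FreeAlgebra.lift_ι_apply, ofGen]
      simpa [g] using mk_rel (HatRel.g_mul (ρ := ρ) (c := c) (b := b) u w)
    | g_x w a =>
      simp only [map_mul, FreeAlgebra.lift_ι_apply, ofGen, ← actFun_linFun]
      simpa [f, g] using mk_rel (HatRel.g_f (ρ := ρ) (c := c) (b := b) w (linFun b a))
    | g_y w v =>
      simp only [map_mul, FreeAlgebra.lift_ι_apply, ofGen]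
      simpa [y, g] using mk_rel (HatRel.g_y (ρ := ρ) (c := c) (b := b) w v)
    | x_x a a' =>
      simp only [map_mul, FreeAlgebra.lift_ι_apply, ofGen]
      have h1 := mk_rel (HatRel.f_mul (ρ := ρ) (c := c) (linFun b a) (linFun b a'))
      have h2 := mk_rel (HatRel.f_mul (ρ := ρ) (c := c) (linFun b a') (linFun b a))
      rw [mul_comm (linFun b a), h2, map_mul, map_mul] at h1
      exact h1.symm
    | y_y v v' =>
      simp only [map_mul, FreeAlgebra.lift_ι_apply, ofGen]
      simpa [y] using mk_rel (HatRel.y_y (ρ := ρ) (c := c) (b := b) v v')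
    | y_x v a =>
      simp only [map_mul, map_add, map_sub, map_sum, map_smul, FreeAlgebra.lift_ι_apply, ofGen,
        AlgHom.commutes]
      have h1 := mk_rel (HatRel.y_f (ρ := ρ) (c := c) (b := b) v (linFun b a)
        (fun s => algebraMap ℂ _ (-((1 - reflEigenvalue ρ s) / 2 * a (coroot ρ s)))) (by
          intro s hs
          obtain ⟨-, -, -, -, hd⟩ := root_facts (mem_reflections.1 hs)
          rw [actFun_linFun, hd, sub_eq_add_neg a, ← neg_smul, linFun_add, linFun_smul,
            add_sub_cancel_left, mul_comm]))
      have h2 : ∀ r : ℂ, mk ρ c b (.ι ℂ (.f (algebraMap ℂ _ r))) = algebraMap ℂ _ r := by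
        intro r
        rw [mk_rel (HatRel.f_const (ρ := ρ) (c := c) (b := b) r), AlgHom.commutes]
      simp only [map_mul, map_add, map_sum, map_smul, derivFun_linFun, h2] at h1
      refine h1.trans ?_
      rw [sub_eq_add_neg, ← Finset.sum_neg_distrib]
      congr 2
      refine Finset.sum_congr rfl fun s hs => ?_
      obtain ⟨-, hl, -, -, -⟩ := root_facts (mem_reflections.1 hs)
      have hl' : 1 - reflEigenvalue ρ s ≠ 0 := sub_ne_zero.2 hl.symm
      rw [← Algebra.smul_def, smul_smul, ← neg_smul]
      change _ • g ρ c b s = _ • g ρ c b s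
      congr 1
      field_simp⟩

end HHat

end CompletedAlgebra

section Tensor

variable {R S : Type u} [Ring R] [Ring S] (P : Type u) [AddCommGroup P] [Module S P]

/-- For an `(S, R)`-bimodule `P` (with right action `act`) and a left `R`-module `M`, the
subgroup of `P ⊗_ℤ M` generated over `S` by the elements `p r ⊗ m - p ⊗ r m`. -/
def balancedRelations (act : R → P →ₗ[S] P) (M : Type u) [AddCommGroup M] [Module R M] :
    Submodule S (P ⊗[ℤ] M) :=
  Submodule.span S {t | ∃ (p : P) (r : R) (m : M), t = act r p ⊗ₜ[ℤ] m - p ⊗ₜ[ℤ] (r • m)}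

/-- The functor `P ⊗_R -` from left `R`-modules to left `S`-modules, for an
`(S, R)`-bimodule `P` with right action `act`. -/
def tensorFunctor (act : R → P →ₗ[S] P) : ModuleCat.{u} R ⥤ ModuleCat.{u} S where
  obj M := ModuleCat.of S ((P ⊗[ℤ] M) ⧸ balancedRelations P act M)
  map {M N} f := ModuleCat.ofHom (Submodule.mapQ _ _
    (TensorProduct.AlgebraTensorModule.map (LinearMap.id (R := S) (M := P))
      f.hom.toAddMonoidHom.toIntLinearMap) (by
        unfold balancedRelations
        rw [Submodule.span_le]
        rintro _ ⟨p, r, m, rfl⟩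
        refine Submodule.subset_span ⟨p, r, f.hom m, ?_⟩
        simp))
  map_id M := by
    ext p m
    rfl
  map_comp f g := by
    ext p m
    rfl

/-- Extension of scalars `M ↦ S ⊗_R M`. -/
def extendScalars (φ : R →+* S) : ModuleCat.{u} R ⥤ ModuleCat.{u} S :=
  tensorFunctor S fun r => LinearMap.toSpanSingleton S S (φ r)

end Tensor

section Centralizer

variable {G A : Type u} [Group G] [Ring A] (K : Subgroup G) (j : K → A)

/-- The right `A`-module `P = Fun_K(G, A)` of functions `f : G → A` with `f(h g) = h f(g)` for
`h ∈ K`, where `j` is the map from `K` to `A`. -/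
def FunK : Submodule Aᵐᵒᵖ (G → A) where
  carrier := {f | ∀ (h : K) (g : G), f (h * g) = j h * f g}
  zero_mem' h g := by simp
  add_mem' {f f'} hf hf' h g := by simp [hf h g, hf' h g, mul_add]
  smul_mem' a f hf h g := by simp [hf h g, mul_assoc]

/-- The centralizer algebra `Z(G, K, A) = End_A(P)`. -/
abbrev Centralizer : Type u := Module.End Aᵐᵒᵖ (FunK K j)

/-- The functor `I : N ↦ P ⊗_A N` from `A`-modules to `Z(G, K, A)`-modules. -/
def inductionFunctor : ModuleCat.{u} A ⥤ ModuleCat.{u} (Centralizer K j) :=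
  tensorFunctor (FunK K j) fun a =>
    { toFun := fun p => MulOpposite.op a • p
      map_add' := fun p p' => smul_add _ p p'
      map_smul' := fun z p => (map_smul z (MulOpposite.op a) p).symm }

end Centralizer

section Functors

variable {G V : Type u} [Group G] [Finite G] [AddCommGroup V] [Module ℂ V]
  [FiniteDimensional ℂ V] (ρ : Representation ℂ G V) (c : Param ρ) (b : V)

/-- The category `𝒪_c(G, V)_0`. -/
abbrev CatO {V : Type u} [AddCommGroup V] [Module ℂ V] (ρ : Representation ℂ G V) (c : Param ρ) :=
  (IsCatO ρ c).FullSubcategory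

/-- The stabilizer `G_b` of `b`. -/
def stab : Subgroup G where
  carrier := {g | ρ g b = b}
  one_mem' := by simp
  mul_mem' {g h} hg hh := by
    simp only [Set.mem_ofPred_eq] at hg hh ⊢
    rw [map_mul, Module.End.mul_apply, hh, hg]
  inv_mem' {g} hg := by
    simp only [Set.mem_ofPred_eq] at hg ⊢
    conv_lhs => rw [← hg]
    exact inv_apply_apply g b

/-- `V` as a representation of `G_b`. -/
abbrev stabRep : Representation ℂ (stab ρ b) V := ρ.comp (stab ρ b).subtype

/-- The parameter `c'`. -/
abbrev stabParam : Param (stabRep ρ b) := c.restrict (stab ρ b)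

/-- The completion functor `M ↦ M̂_b` at `b`, from `H_c(G, V)`-modules to modules over the
completed algebra. -/
def completion : ModuleCat.{u} (H ρ c) ⥤ ModuleCat.{u} (HHat ρ c b) :=
  extendScalars (HHat.ofH ρ c b).toRingHom

/-- The functor `E`, from modules over the completion at `0` to `H_c(G, V)`-modules: the span of
the generalized eigenvectors of `𝐡`. -/
def functorE : ModuleCat.{u} (HHat ρ c 0) ⥤ ModuleCat.{u} (H ρ c) :=
  ModuleCat.restrictScalars (HHat.ofH ρ c 0).toRingHom ⋙ eulerFiniteFunctor ρ c

/-- The functor `E^b`, from modules over the completion at `b` to `H_c(G, V)`-modules: the space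
of `V`-nilpotent vectors. -/
def functorEb : ModuleCat.{u} (HHat ρ c b) ⥤ ModuleCat.{u} (H ρ c) :=
  ModuleCat.restrictScalars (HHat.ofH ρ c b).toRingHom ⋙ nilpotentFunctor ρ c

/-- The completion at zero of `H_{c'}(G_b, V)`. -/
abbrev StabHat : Type u := HHat (stabRep ρ b) (stabParam ρ c b) 0

/-- The algebra `Z(G, G_b, Ĥ_{c'}(G_b, V)_0)`. -/
abbrev ZHat : Type u := Centralizer (stab ρ b) (HHat.g (stabRep ρ b) (stabParam ρ c b) 0)

/-- The functor `I` for the algebra `Z(G, G_b, Ĥ_{c'}(G_b, V)_0)`. -/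
abbrev functorI : ModuleCat.{u} (StabHat ρ c b) ⥤ ModuleCat.{u} (ZHat ρ c b) :=
  inductionFunctor (stab ρ b) (HHat.g (stabRep ρ b) (stabParam ρ c b) 0)

/-- A formal series, as an element of the completion at zero of `H_{c'}(G_b, V)`. -/
def stabSeries (f : FormalSeries V) : StabHat ρ c b :=
  HHat.f (stabRep ρ b) (stabParam ρ c b) 0 fun _ => f

open Classical in
/-- The formulas that define the isomorphism `θ : Ĥ_c(G, V)_b ≃ Z(G, G_b, Ĥ_{c'}(G_b, V)_0)`, on
`F ∈ Fun_{G_b}(G, Ĥ_{c'}(G_b, V)_0)`; they determine `θ`, since they give its values on generators: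
* `(θ(u) F)(w) = F(w u)` for `u ∈ G`;
* a function `φ` on the formal neighborhood of the orbit acts by `(θ(φ) F)(w) = (w φ)(b + z) F(w)`;
  for `φ = α ∈ V^*` this is `(x_{w α} + (w α, b)) F(w)`;
* `(θ(y_a) F)(w) = y_{w a} F(w) + ∑ₛ (2 cₛ / (1 - λₛ)) (αₛ(w a) / (x_{αₛ} + αₛ(b))) (F(s w) - F(w))`
  for `a ∈ V`, where the sum is over the reflections `s ∉ G_b`. -/
structure IsTheta (θ : HHat ρ c b ≃+* ZHat ρ c b) : Prop where
  apply_g : ∀ (u : G) (F : FunK _ _) (w : G),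
    (θ (HHat.g ρ c b u) F).1 w = F.1 (w * u)
  apply_f : ∀ (φ : FormalFun ρ b) (F : FunK _ _) (w : G),
    (θ (HHat.f ρ c b φ) F).1 w =
      stabSeries ρ c b (actFun w φ ⟨b, self_mem_orbit ρ b⟩) * F.1 w
  apply_y : ∀ (a : V) (F : FunK _ _) (w : G),
    (θ (HHat.y ρ c b a) F).1 w =
      HHat.y (stabRep ρ b) (stabParam ρ c b) 0 (ρ w a) * F.1 w +
      ∑ s ∈ (reflections ρ).filter (fun s => s ∉ stab ρ b),
        (2 * c.val s / (1 - reflEigenvalue ρ s)) •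
          (stabSeries ρ c b (root ρ s (ρ w a) • (linSeries (root ρ s) b)⁻¹) *
            (F.1 (s * w) - F.1 w))

/-- The functor `ζ`, between the categories `𝒪`. -/
def zetaO {V : Type u} [AddCommGroup V] [Module ℂ V] {ρ : Representation ℂ G V} {c : Param ρ}
    (h : ∀ M : CatO ρ c, IsCatO (redRep ρ) c.reduce ((zeta ρ c).obj M.obj)) :
    CatO ρ c ⥤ CatO (redRep ρ) c.reduce :=
  (IsCatO (redRep ρ) c.reduce).lift ((IsCatO ρ c).ι ⋙ zeta ρ c) h

variable {ρ c b}

/-- `E ∘ I⁻¹ ∘ θ_*` applied to the completion at `b`. -/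
def resAux (θ : HHat ρ c b ≃+* ZHat ρ c b) [(functorI ρ c b).IsEquivalence] :
    ModuleCat.{u} (H ρ c) ⥤ ModuleCat.{u} (H (stabRep ρ b) (stabParam ρ c b)) :=
  completion ρ c b ⋙ ModuleCat.restrictScalars θ.symm.toRingHom ⋙ (functorI ρ c b).inv ⋙
    functorE (stabRep ρ b) (stabParam ρ c b)

/-- `E^b ∘ θ_*⁻¹ ∘ I` applied to the completion at `0`. -/
def indAux (θ : HHat ρ c b ≃+* ZHat ρ c b) :
    ModuleCat.{u} (H (stabRep ρ b) (stabParam ρ c b)) ⥤ ModuleCat.{u} (H ρ c) :=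
  completion (stabRep ρ b) (stabParam ρ c b) 0 ⋙ functorI ρ c b ⋙
    ModuleCat.restrictScalars θ.toRingHom ⋙ functorEb ρ c b

/-- `Res_b(M) = (ζ ∘ E ∘ I⁻¹ ∘ θ_*)(M̂_b)`. -/
def Res (θ : HHat ρ c b ≃+* ZHat ρ c b) [(functorI ρ c b).IsEquivalence]
    (hζ : ∀ M : CatO (stabRep ρ b) (stabParam ρ c b),
      IsCatO (redRep (stabRep ρ b)) (stabParam ρ c b).reduce ((zeta _ _).obj M.obj))
    (hR : ∀ M : CatO ρ c, IsCatO (stabRep ρ b) (stabParam ρ c b) ((resAux θ).obj M.obj)) :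
    CatO ρ c ⥤ CatO (redRep (stabRep ρ b)) (stabParam ρ c b).reduce :=
  (IsCatO (stabRep ρ b) (stabParam ρ c b)).lift ((IsCatO ρ c).ι ⋙ resAux θ) hR ⋙ zetaO hζ

/-- `Ind_b(N) = (E^b ∘ θ_*⁻¹ ∘ I)(completion of ζ⁻¹(N) at 0)`. -/
def Ind (θ : HHat ρ c b ≃+* ZHat ρ c b)
    (hζ : ∀ M : CatO (stabRep ρ b) (stabParam ρ c b),
      IsCatO (redRep (stabRep ρ b)) (stabParam ρ c b).reduce ((zeta _ _).obj M.obj))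
    [(zetaO hζ).IsEquivalence]
    (hI : ∀ N : CatO (stabRep ρ b) (stabParam ρ c b), IsCatO ρ c ((indAux θ).obj N.obj)) :
    CatO (redRep (stabRep ρ b)) (stabParam ρ c b).reduce ⥤ CatO ρ c :=
  (zetaO hζ).inv ⋙
    (IsCatO ρ c).lift ((IsCatO (stabRep ρ b) (stabParam ρ c b)).ι ⋙ indAux θ) hI

end Functors

section Exact

variable {R S : Type u} [Ring R] [Ring S] {P : ObjectProperty (ModuleCat.{u} R)}
  {Q : ObjectProperty (ModuleCat.{u} S)}

/-- A functor between full subcategories of module categories is exact: it is additive and takes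
short exact sequences to short exact sequences. -/
def IsExactFunctor (F : P.FullSubcategory ⥤ Q.FullSubcategory) : Prop :=
  F.Additive ∧
  ∀ (A B C : P.FullSubcategory) (f : A ⟶ B) (g : B ⟶ C),
    Function.Injective f.hom → Function.Exact f.hom g.hom → Function.Surjective g.hom →
    Function.Injective (F.map f).hom ∧ Function.Exact (F.map f).hom (F.map g).hom ∧
      Function.Surjective (F.map g).hom

end Exact

end Cherednik

end

open CategoryTheory
open scoped TensorProduct


set_option linter.unusedSectionVars false

noncomputable section

namespace Cherednik

section Series

variable {σ : Type*} [Finite σ]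

/-- The ideal of formal series without constant term. -/
abbrev varIdeal (σ : Type*) : Ideal (MvPowerSeries σ ℂ) :=
  Ideal.span (Set.range MvPowerSeries.X)

theorem mem_varIdeal_pow {k : ℕ} {f : MvPowerSeries σ ℂ} :
    f ∈ varIdeal σ ^ k ↔ (k : ℕ∞) ≤ f.order := by
  constructor
  · intro hf
    induction k generalizing f with
    | zero => simp
    | succ k ih =>
      rw [pow_succ] at hf
      induction hf using Submodule.mul_induction_on' with
      | mem_mul_mem a ha c hc =>
        refine le_trans ?_ MvPowerSeries.le_order_mul
        rw [Nat.cast_succ]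
        refine add_le_add (ih ha) ?_
        rw [MvPowerSeries.one_le_order_iff_constCoeff_eq_zero]
        have : varIdeal σ ≤ RingHom.ker (MvPowerSeries.constantCoeff (σ := σ) (R := ℂ)) := by
          rw [Ideal.span_le]
          rintro _ ⟨i, rfl⟩
          simp
        exact this hc
      | add a _ c _ ha hc =>
        exact le_trans (le_min ha hc) MvPowerSeries.min_order_le_add
  · intro hf
    have h1 : MvPowerSeries.truncTotal k f = 0 := by
      ext d
      by_cases hd : d.degree < k
      · rw [MvPowerSeries.coeff_truncTotal _ hd, MvPolynomial.coeff_zero]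
        exact MvPowerSeries.coeff_of_lt_order (lt_of_lt_of_le (by exact_mod_cast hd) hf)
      · rw [MvPowerSeries.coeff_truncTotal_eq_zero _ (not_lt.1 hd), MvPolynomial.coeff_zero]
    have h2 : MvPowerSeries.toAdicCompletion σ ℂ f ∈
        ((MvPolynomial.idealOfVars σ ℂ) ^ k • ⊤ :
          Submodule (MvPolynomial σ ℂ) (AdicCompletion (MvPolynomial.idealOfVars σ ℂ)
            (MvPolynomial σ ℂ))) := by
      rw [AdicCompletion.pow_smul_top_eq_ker_eval (MvPolynomial.idealOfVars_fg σ ℂ)]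
      rw [LinearMap.mem_ker]
      change (MvPowerSeries.toAdicCompletion σ ℂ f).val k = 0
      rw [MvPowerSeries.toAdicCompletion_apply_eq_mk_truncTotal, h1]
      rfl
    have h3 : f ∈ ((MvPolynomial.idealOfVars σ ℂ) ^ k • ⊤ :
          Submodule (MvPolynomial σ ℂ) (MvPowerSeries σ ℂ)) := by
      let e := (MvPowerSeries.toAdicCompletionAlgEquiv σ ℂ).toLinearEquiv
      have h4 : e f ∈ ((MvPolynomial.idealOfVars σ ℂ) ^ k • ⊤ :
          Submodule (MvPolynomial σ ℂ) (AdicCompletion (MvPolynomial.idealOfVars σ ℂ)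
            (MvPolynomial σ ℂ))) := h2
      have h5 := Submodule.mem_map_of_mem (f := e.symm.toLinearMap) h4
      rw [Submodule.map_smul''] at h5
      simpa using Submodule.smul_mono le_rfl le_top h5
    have hmap : (MvPolynomial.idealOfVars σ ℂ).map
        (algebraMap (MvPolynomial σ ℂ) (MvPowerSeries σ ℂ)) ≤ varIdeal σ := by
      rw [Ideal.map_le_iff_le_comap, MvPolynomial.idealOfVars, Ideal.span_le]
      rintro _ ⟨i, rfl⟩
      refine Ideal.subset_span ⟨i, ?_⟩
      exact (MvPolynomial.coe_X i).symm
    refine Submodule.smul_induction_on h3 ?_ fun a c ha hc => add_mem ha hc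
    intro P hP g _
    rw [Algebra.smul_def]
    refine Ideal.mul_mem_right _ _ ?_
    have := Ideal.mem_map_of_mem (algebraMap (MvPolynomial σ ℂ) (MvPowerSeries σ ℂ)) hP
    rw [Ideal.map_pow] at this
    exact Ideal.pow_right_mono hmap k this

theorem sub_truncTotal_mem (k : ℕ) (f : MvPowerSeries σ ℂ) :
    f - (MvPowerSeries.truncTotal k f : MvPolynomial σ ℂ) ∈ varIdeal σ ^ k := by
  rw [mem_varIdeal_pow]
  refine MvPowerSeries.nat_le_order fun d hd => ?_
  rw [map_sub, MvPolynomial.coeff_coe, MvPowerSeries.coeff_truncTotal _ hd, sub_self]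

theorem coe_mem_varIdeal_pow {k : ℕ} {P : MvPolynomial σ ℂ} :
    (P : MvPowerSeries σ ℂ) ∈ varIdeal σ ^ k ↔ P ∈ MvPolynomial.idealOfVars σ ℂ ^ k := by
  rw [mem_varIdeal_pow, MvPolynomial.mem_pow_idealOfVars_iff']
  constructor
  · intro h d hd
    rw [← MvPolynomial.coeff_coe]
    exact MvPowerSeries.coeff_of_lt_order (lt_of_lt_of_le (by exact_mod_cast hd) h)
  · intro h
    refine MvPowerSeries.nat_le_order fun d hd => ?_
    rw [MvPolynomial.coeff_coe]
    exact h d hd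

theorem mem_of_mul_mem_varIdeal_pow {k : ℕ} {a f : MvPowerSeries σ ℂ}
    (ha1 : a.order ≤ 1) (h : a * f ∈ varIdeal σ ^ (k + 1)) : f ∈ varIdeal σ ^ k := by
  rw [mem_varIdeal_pow] at h ⊢
  rw [MvPowerSeries.order_mul, Nat.cast_succ] at h
  have : (k : ℕ∞) + 1 ≤ f.order + 1 := by
    rw [add_comm f.order]
    exact h.trans (add_le_add_left ha1 _)
  exact (ENat.add_le_add_iff_right ENat.one_ne_top).1 this

theorem varIdeal_le_jacobson : varIdeal σ ≤ Ideal.jacobson ⊥ :=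
  IsAdicComplete.le_jacobson_bot _

/-- Ideals of the ring of formal series are closed. -/
theorem mem_ideal_of_forall_mem_sup (J : Ideal (MvPowerSeries σ ℂ)) {f : MvPowerSeries σ ℂ}
    (h : ∀ k, f ∈ J ⊔ varIdeal σ ^ k) : f ∈ J := by
  rw [← Ideal.Quotient.eq_zero_iff_mem]
  have h1 := Ideal.iInf_pow_smul_eq_bot_of_le_jacobson (M := MvPowerSeries σ ℂ ⧸ J)
    (varIdeal σ) varIdeal_le_jacobson
  rw [← Submodule.mem_bot (MvPowerSeries σ ℂ), ← h1, Submodule.mem_iInf]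
  intro k
  obtain ⟨a, ha, c, hc, rfl⟩ := Submodule.mem_sup.1 (h k)
  rw [map_add, Ideal.Quotient.eq_zero_iff_mem.2 ha, zero_add]
  have : (Ideal.Quotient.mk J) c = c • (1 : MvPowerSeries σ ℂ ⧸ J) := by
    conv_lhs => rw [← mul_one c]
    rfl
  rw [this]
  exact Submodule.smul_mem_smul hc trivial

theorem pderiv_mem_varIdeal_pow (i : σ) {k : ℕ} {f : MvPowerSeries σ ℂ}
    (h : f ∈ varIdeal σ ^ (k + 1)) : MvPowerSeries.pderiv ℂ i f ∈ varIdeal σ ^ k := by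
  classical
  rw [mem_varIdeal_pow] at h ⊢
  refine MvPowerSeries.nat_le_order fun d hd => ?_
  rw [MvPowerSeries.coeff_pderiv]
  rw [MvPowerSeries.coeff_of_lt_order, zero_mul]
  refine lt_of_lt_of_le ?_ h
  rw [map_add, Finsupp.degree_single]
  exact_mod_cast Nat.add_lt_add_right hd 1

end Series

section Functions

variable {G V : Type u} [Group G] [AddCommGroup V] [Module ℂ V] [FiniteDimensional ℂ V]
variable {ρ : Representation ℂ G V} {b : V}

instance [Finite G] : Finite (orbit ρ b) := Set.finite_range _

variable (ρ b) in
/-- The ideal of functions that vanish on the orbit of `b`. -/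
def orbIdeal : Ideal (FormalFun ρ b) :=
  (varIdeal (Fin (Module.finrank ℂ V))).map (Pi.constRingHom (orbit ρ b) (FormalSeries V))

theorem mem_orbIdeal_pow [Finite G] {k : ℕ} {f : FormalFun ρ b} :
    f ∈ orbIdeal ρ b ^ k ↔ ∀ p, f p ∈ varIdeal (Fin (Module.finrank ℂ V)) ^ k := by
  classical
  rw [orbIdeal, ← Ideal.map_pow]
  constructor
  · intro hf p
    have : (varIdeal (Fin (Module.finrank ℂ V)) ^ k).map
        (Pi.constRingHom (orbit ρ b) (FormalSeries V)) ≤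
        (varIdeal (Fin (Module.finrank ℂ V)) ^ k).comap
          (Pi.evalRingHom (fun _ : orbit ρ b => FormalSeries V) p) := by
      rw [Ideal.map_le_iff_le_comap]
      intro g hg
      exact hg
    exact this hf
  · intro hf
    let _ := Fintype.ofFinite (orbit ρ b)
    have : f = ∑ p, Pi.single p (1 : FormalSeries V) *
        Pi.constRingHom (orbit ρ b) (FormalSeries V) (f p) := by
      funext q
      rw [Finset.sum_apply, Finset.sum_eq_single q]
      · simp
      · intro p _ hp
        simp [hp.symm]
      · simp
    rw [this]
    exact Ideal.sum_mem _ fun p _ => Ideal.mul_mem_left _ _ (Ideal.mem_map_of_mem _ (hf p))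

instance [Finite G] : IsNoetherianRing (FormalFun ρ b) := inferInstance

instance [Finite G] : IsAdicComplete (orbIdeal ρ b) (FormalFun ρ b) where
  haus' f hf := by
    funext p
    have h := (inferInstance : IsHausdorff (varIdeal (Fin (Module.finrank ℂ V)))
      (FormalSeries V)).haus' (f p)
    refine h fun k => ?_
    have := hf k
    rw [SModEq.zero, smul_eq_mul, Ideal.mul_top] at this ⊢
    exact mem_orbIdeal_pow.1 this p
  prec' F hF := by
    have h : ∀ p, ∃ L : FormalSeries V, ∀ n, F n p ≡ L
        [SMOD (varIdeal (Fin (Module.finrank ℂ V)) ^ n • ⊤ : Submodule (FormalSeries V)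
          (FormalSeries V))] := by
      intro p
      refine (inferInstance : IsPrecomplete (varIdeal (Fin (Module.finrank ℂ V)))
        (FormalSeries V)).prec' (fun n => F n p) fun {m n} hmn => ?_
      have := hF hmn
      rw [SModEq.sub_mem, smul_eq_mul, Ideal.mul_top] at this ⊢
      exact mem_orbIdeal_pow.1 this p
    choose L hL using h
    refine ⟨L, fun n => ?_⟩
    rw [SModEq.sub_mem, smul_eq_mul, Ideal.mul_top, mem_orbIdeal_pow]
    intro p
    have := hL p n
    rwa [SModEq.sub_mem, smul_eq_mul, Ideal.mul_top] at this

theorem orbIdeal_le_jacobson [Finite G] : orbIdeal ρ b ≤ Ideal.jacobson ⊥ :=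
  IsAdicComplete.le_jacobson_bot _

theorem eq_zero_of_forall_mem_orbIdeal_pow [Finite G] {f : FormalFun ρ b}
    (h : ∀ k, f ∈ orbIdeal ρ b ^ k) : f = 0 := by
  refine (inferInstance : IsHausdorff (orbIdeal ρ b) (FormalFun ρ b)).haus' f fun k => ?_
  rw [SModEq.zero, smul_eq_mul, Ideal.mul_top]
  exact h k

theorem eq_zero_of_forall_mem_varIdeal_pow {σ : Type*} [Finite σ] {f : MvPowerSeries σ ℂ}
    (h : ∀ k, f ∈ varIdeal σ ^ k) : f = 0 := by
  refine (inferInstance : IsHausdorff (varIdeal σ) (MvPowerSeries σ ℂ)).haus' f fun k => ?_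
  rw [SModEq.zero, smul_eq_mul, Ideal.mul_top]
  exact h k

section Subst

theorem substAct_X (g : G) (i : Fin (Module.finrank ℂ V)) :
    substAct ρ g (MvPowerSeries.X i) = substSeries ρ g i :=
  MvPowerSeries.substAlgHom_X _ i

theorem X_mem_varIdeal {σ : Type*} (i : σ) : (MvPowerSeries.X i : MvPowerSeries σ ℂ) ∈ varIdeal σ :=
  Ideal.subset_span ⟨i, rfl⟩

theorem smul_mem_ideal {R : Type*} [CommRing R] [Algebra ℂ R] (I : Ideal R) (r : ℂ) {x : R}
    (hx : x ∈ I) : r • x ∈ I := by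
  rw [Algebra.smul_def]; exact I.mul_mem_left _ hx

theorem substAct_mem (g : G) {k : ℕ} {f : FormalSeries V}
    (hf : f ∈ varIdeal (Fin (Module.finrank ℂ V)) ^ k) :
    substAct ρ g f ∈ varIdeal (Fin (Module.finrank ℂ V)) ^ k := by
  have h : (varIdeal (Fin (Module.finrank ℂ V))).map (substAct ρ g) ≤ varIdeal _ := by
    rw [Ideal.map_le_iff_le_comap, Ideal.span_le]
    rintro _ ⟨i, rfl⟩
    change substAct ρ g (MvPowerSeries.X i) ∈ varIdeal (Fin (Module.finrank ℂ V))
    rw [substAct_X, substSeries]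
    exact Ideal.sum_mem _ fun j _ => smul_mem_ideal _ _ (X_mem_varIdeal j)
  have h2 := Ideal.mem_map_of_mem (substAct ρ g) hf
  rw [Ideal.map_pow] at h2
  exact Ideal.pow_right_mono h k h2

/-- Twisted derivations of the ring of formal series that agree on the variables are equal. -/
theorem twistedDeriv_ext {σ : Type*} [Finite σ] (φ : MvPowerSeries σ ℂ →ₐ[ℂ] MvPowerSeries σ ℂ)
    (D D' : MvPowerSeries σ ℂ →ₗ[ℂ] MvPowerSeries σ ℂ)
    (hD : ∀ f g, D (f * g) = D f * φ g + φ f * D g)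
    (hD' : ∀ f g, D' (f * g) = D' f * φ g + φ f * D' g)
    (hk : ∀ k, ∀ f ∈ varIdeal σ ^ (k + 1), D f ∈ varIdeal σ ^ k)
    (hk' : ∀ k, ∀ f ∈ varIdeal σ ^ (k + 1), D' f ∈ varIdeal σ ^ k)
    (h : ∀ i, D (MvPowerSeries.X i) = D' (MvPowerSeries.X i)) : D = D' := by
  have h1 : ∀ D : MvPowerSeries σ ℂ →ₗ[ℂ] MvPowerSeries σ ℂ,
      (∀ f g, D (f * g) = D f * φ g + φ f * D g) → D 1 = 0 := by
    intro D hD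
    have := hD 1 1
    rw [map_one φ, mul_one, mul_one, one_mul] at this
    exact left_eq_add.1 this
  have hpoly : ∀ P : MvPolynomial σ ℂ, D (P : MvPowerSeries σ ℂ) = D' P := by
    intro P
    induction P using MvPolynomial.induction_on with
    | C r =>
      have : ((MvPolynomial.C r : MvPolynomial σ ℂ) : MvPowerSeries σ ℂ) = r • 1 := by
        rw [MvPolynomial.coe_C, MvPowerSeries.smul_eq_C_mul, mul_one]
      rw [this, map_smul, map_smul, h1 D hD, h1 D' hD']
    | add P Q hP hQ => rw [MvPolynomial.coe_add, map_add, map_add, hP, hQ]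
    | mul_X P i hP => rw [MvPolynomial.coe_mul, MvPolynomial.coe_X, hD, hD', hP, h]
  refine LinearMap.ext fun f => sub_eq_zero.1 (eq_zero_of_forall_mem_varIdeal_pow fun k => ?_)
  have h2 : D f - D' f = D (f - (MvPowerSeries.truncTotal (k + 1) f : MvPolynomial σ ℂ)) -
      D' (f - (MvPowerSeries.truncTotal (k + 1) f : MvPolynomial σ ℂ)) := by
    rw [map_sub, map_sub, hpoly]; abel
  rw [h2]
  exact sub_mem (hk k _ (sub_truncTotal_mem _ f)) (hk' k _ (sub_truncTotal_mem _ f))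

theorem seriesAlgHom_ext {σ : Type*} [Finite σ]
    (φ ψ : MvPowerSeries σ ℂ →ₐ[ℂ] MvPowerSeries σ ℂ)
    (hk : ∀ k, ∀ f ∈ varIdeal σ ^ k, φ f ∈ varIdeal σ ^ k)
    (hk' : ∀ k, ∀ f ∈ varIdeal σ ^ k, ψ f ∈ varIdeal σ ^ k)
    (h : ∀ i, φ (MvPowerSeries.X i) = ψ (MvPowerSeries.X i)) : φ = ψ := by
  have hpoly : ∀ P : MvPolynomial σ ℂ, φ (P : MvPowerSeries σ ℂ) = ψ P := by
    intro P
    induction P using MvPolynomial.induction_on with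
    | C r =>
      have : ((MvPolynomial.C r : MvPolynomial σ ℂ) : MvPowerSeries σ ℂ) = r • 1 := by
        rw [MvPolynomial.coe_C, MvPowerSeries.smul_eq_C_mul, mul_one]
      rw [this, map_smul, map_smul, map_one, map_one]
    | add P Q hP hQ => rw [MvPolynomial.coe_add, map_add, map_add, hP, hQ]
    | mul_X P i hP => rw [MvPolynomial.coe_mul, MvPolynomial.coe_X, map_mul, map_mul, hP, h]
  refine AlgHom.ext fun f => sub_eq_zero.1 (eq_zero_of_forall_mem_varIdeal_pow fun k => ?_)
  have h2 : φ f - ψ f = φ (f - (MvPowerSeries.truncTotal k f : MvPolynomial σ ℂ)) -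
      ψ (f - (MvPowerSeries.truncTotal k f : MvPolynomial σ ℂ)) := by
    rw [map_sub, map_sub, hpoly]; abel
  rw [h2]
  exact sub_mem (hk k _ (sub_truncTotal_mem _ f)) (hk' k _ (sub_truncTotal_mem _ f))

theorem linSeries_zero_eq (a : Module.Dual ℂ V) :
    linSeries a 0 = ∑ i, a (Module.finBasis ℂ V i) • MvPowerSeries.X i := by
  rw [linSeries, map_zero, map_zero, zero_add]

theorem linSeries_coord_zero (i : Fin (Module.finrank ℂ V)) :
    linSeries ((Module.finBasis ℂ V).coord i) 0 = MvPowerSeries.X i := by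
  classical
  rw [linSeries_zero_eq, Finset.sum_eq_single i]
  · simp
  · intro j _ hj
    simp [hj]
  · simp

theorem substAct_mul (g h : G) (f : FormalSeries V) :
    substAct ρ (g * h) f = substAct ρ g (substAct ρ h f) := by
  have : substAct ρ (g * h) = (substAct ρ g).comp (substAct ρ h) := by
    refine seriesAlgHom_ext _ _ (fun k f hf => substAct_mem _ hf)
      (fun k f hf => substAct_mem _ (substAct_mem _ hf)) fun i => ?_
    have key : ∀ (g : G) (a : Module.Dual ℂ V),
        substAct ρ g (linSeries a 0) = linSeries (ρ.dual g a) 0 := by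
      intro g a
      have := substAct_linSeries (ρ := ρ) g a 0
      rwa [map_zero] at this
    rw [AlgHom.comp_apply, ← linSeries_coord_zero, key, key, key, map_mul, Module.End.mul_apply]
  rw [this]; rfl

theorem substAct_one (f : FormalSeries V) : substAct ρ 1 f = f := by
  have : substAct ρ (1 : G) = AlgHom.id ℂ _ := by
    refine seriesAlgHom_ext _ _ (fun k f hf => substAct_mem _ hf) (fun k f hf => hf) fun i => ?_
    have := substAct_linSeries (ρ := ρ) 1 ((Module.finBasis ℂ V).coord i) 0
    rw [map_zero, map_one, linSeries_coord_zero] at this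
    exact this.trans (linSeries_coord_zero i)
  rw [this]; rfl

end Subst

variable (ρ b) in
/-- The action of `g` on functions, as an algebra homomorphism. -/
def actHom (g : G) : FormalFun ρ b →ₐ[ℂ] FormalFun ρ b where
  toFun := actFun g
  map_one' := by funext p; exact map_one (substAct ρ g)
  map_mul' f f' := by funext p; exact map_mul (substAct ρ g) _ _
  map_zero' := by funext p; exact map_zero (substAct ρ g)
  map_add' f f' := by funext p; exact map_add (substAct ρ g) _ _
  commutes' r := by funext p; exact (substAct ρ g).commutes r

theorem actHom_apply (g : G) (f : FormalFun ρ b) : actHom ρ b g f = actFun g f := rfl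

theorem actFun_mul (g : G) (f f' : FormalFun ρ b) :
    actFun g (f * f') = actFun g f * actFun g f' := map_mul (actHom ρ b g) _ _

theorem actFun_add (g : G) (f f' : FormalFun ρ b) :
    actFun g (f + f') = actFun g f + actFun g f' := map_add (actHom ρ b g) _ _

theorem actFun_sub (g : G) (f f' : FormalFun ρ b) :
    actFun g (f - f') = actFun g f - actFun g f' := map_sub (actHom ρ b g) _ _

theorem actFun_smul (g : G) (r : ℂ) (f : FormalFun ρ b) :
    actFun g (r • f) = r • actFun g f := map_smul (actHom ρ b g) _ _

theorem actFun_actFun (g h : G) (f : FormalFun ρ b) :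
    actFun g (actFun h f) = actFun (g * h) f := by
  funext p
  simp only [actFun]
  rw [substAct_mul]
  congr 3
  apply Subtype.ext
  simp [map_mul]

theorem actFun_one (f : FormalFun ρ b) : actFun (1 : G) f = f := by
  funext p
  simp only [actFun]
  rw [substAct_one]
  congr 1
  apply Subtype.ext
  simp

theorem actFun_mem [Finite G] (g : G) {k : ℕ} {f : FormalFun ρ b} (hf : f ∈ orbIdeal ρ b ^ k) :
    actFun g f ∈ orbIdeal ρ b ^ k := by
  rw [mem_orbIdeal_pow] at hf ⊢
  exact fun p => substAct_mem g (hf _)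

section Deriv

/-- The derivative of a series along `v`. -/
def derivSeries (v : V) : Derivation ℂ (FormalSeries V) (FormalSeries V) :=
  ∑ i, (Module.finBasis ℂ V).repr v i • MvPowerSeries.pderiv ℂ i

theorem derivSeries_apply (v : V) (f : FormalSeries V) : derivSeries v f =
    ∑ i, (Module.finBasis ℂ V).repr v i • MvPowerSeries.pderiv ℂ i f := by
  have := congrFun (map_sum (Derivation.coeFnAddMonoidHom (R := ℂ) (A := FormalSeries V)
    (M := FormalSeries V)) (fun i => (Module.finBasis ℂ V).repr v i • MvPowerSeries.pderiv ℂ i)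
    Finset.univ) f
  rw [Finset.sum_apply] at this
  exact this

theorem derivFun_apply (v : V) (f : FormalFun ρ b) (p : orbit ρ b) :
    derivFun v f p = derivSeries v (f p) := (derivSeries_apply v (f p)).symm

theorem derivFun_mul (v : V) (f f' : FormalFun ρ b) :
    derivFun v (f * f') = derivFun v f * f' + f * derivFun v f' := by
  funext p
  simp only [derivFun_apply, Pi.mul_apply, Pi.add_apply, Derivation.leibniz, smul_eq_mul]
  ring

theorem derivFun_add (v : V) (f f' : FormalFun ρ b) :
    derivFun v (f + f') = derivFun v f + derivFun v f' := by
  funext p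
  simp only [derivFun_apply, Pi.add_apply, map_add]

theorem derivFun_smul (v : V) (r : ℂ) (f : FormalFun ρ b) :
    derivFun v (r • f) = r • derivFun v f := by
  funext p
  simp only [derivFun_apply, Pi.smul_apply, Derivation.map_smul]

theorem derivFun_add_left (v v' : V) (f : FormalFun ρ b) :
    derivFun (v + v') f = derivFun v f + derivFun v' f := by
  funext p
  simp only [derivFun, Pi.add_apply, map_add, Finsupp.add_apply, add_smul, Finset.sum_add_distrib]

theorem derivFun_smul_left (r : ℂ) (v : V) (f : FormalFun ρ b) :
    derivFun (r • v) f = r • derivFun v f := by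
  funext p
  simp only [derivFun, Pi.smul_apply, map_smul, Finsupp.smul_apply, Finset.smul_sum, smul_smul,
    smul_eq_mul]

theorem derivSeries_mem (v : V) {k : ℕ} {f : FormalSeries V}
    (hf : f ∈ varIdeal (Fin (Module.finrank ℂ V)) ^ (k + 1)) :
    derivSeries v f ∈ varIdeal (Fin (Module.finrank ℂ V)) ^ k := by
  rw [derivSeries_apply]
  exact Ideal.sum_mem _ fun i _ => smul_mem_ideal _ _ (pderiv_mem_varIdeal_pow i hf)

theorem derivFun_mem [Finite G] (v : V) {k : ℕ} {f : FormalFun ρ b}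
    (hf : f ∈ orbIdeal ρ b ^ (k + 1)) : derivFun v f ∈ orbIdeal ρ b ^ k := by
  rw [mem_orbIdeal_pow] at hf ⊢
  intro p
  rw [derivFun_apply]
  exact derivSeries_mem v (hf p)

theorem derivSeries_linSeries (v : V) (a : Module.Dual ℂ V) (p : V) :
    derivSeries v (linSeries a p) = MvPowerSeries.C (a v) := by
  have := congrFun (derivFun_linFun (ρ := (1 : Representation ℂ PUnit.{u+1} V)) p v a)
    ⟨p, self_mem_orbit _ p⟩
  rw [derivFun_apply] at this
  exact this

theorem derivSeries_substAct (g : G) (v : V) (f : FormalSeries V) :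
    derivSeries (ρ g v) (substAct ρ g f) = substAct ρ g (derivSeries v f) := by
  have := twistedDeriv_ext (substAct ρ g)
    ((derivSeries (ρ g v)).toLinearMap ∘ₗ (substAct ρ g).toLinearMap)
    ((substAct ρ g).toLinearMap ∘ₗ (derivSeries v).toLinearMap)
    (fun f f' => by
      change derivSeries (ρ g v) (substAct ρ g (f * f')) =
        derivSeries (ρ g v) (substAct ρ g f) * _ + _ * derivSeries (ρ g v) (substAct ρ g f')
      rw [map_mul, Derivation.leibniz, smul_eq_mul, smul_eq_mul]
      ring)
    (fun f f' => by
      change substAct ρ g (derivSeries v (f * f')) =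
        substAct ρ g (derivSeries v f) * _ + _ * substAct ρ g (derivSeries v f')
      rw [Derivation.leibniz, smul_eq_mul, smul_eq_mul, map_add, map_mul, map_mul]
      ring)
    (fun k f hf => derivSeries_mem _ (substAct_mem _ hf))
    (fun k f hf => substAct_mem _ (derivSeries_mem _ hf))
    (fun i => by
      change derivSeries (ρ g v) (substAct ρ g (MvPowerSeries.X i)) =
        substAct ρ g (derivSeries v (MvPowerSeries.X i))
      rw [← linSeries_coord_zero]
      have h1 := substAct_linSeries (ρ := ρ) g ((Module.finBasis ℂ V).coord i) 0
      rw [map_zero] at h1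
      rw [h1, derivSeries_linSeries, derivSeries_linSeries, dual_apply', inv_apply_apply]
      exact ((substAct ρ g).commutes _).symm)
  exact LinearMap.congr_fun this f

theorem derivFun_actFun (g : G) (v : V) (f : FormalFun ρ b) :
    derivFun (ρ g v) (actFun g f) = actFun g (derivFun v f) := by
  funext p
  rw [derivFun_apply]
  simp only [actFun]
  rw [derivFun_apply, derivSeries_substAct]

end Deriv

end Functions

section Division

variable {G V : Type u} [Group G] [Finite G] [AddCommGroup V] [Module ℂ V] [FiniteDimensional ℂ V]
variable {ρ : Representation ℂ G V} {b : V}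

omit [FiniteDimensional ℂ V] in
theorem root_ne_zero {s : G} (hs : IsReflection ρ s) : root ρ s ≠ 0 := by
  intro h
  have := (root_facts hs).2.2.1
  rw [h] at this
  simp at this

theorem constantCoeff_linSeries (a : Module.Dual ℂ V) (p : V) :
    MvPowerSeries.constantCoeff (linSeries a p) = a p := by
  simp [linSeries]

theorem coeff_linSeries (a : Module.Dual ℂ V) (p : V) (i : Fin (Module.finrank ℂ V)) :
    MvPowerSeries.coeff (Finsupp.single i 1) (linSeries a p) = a (Module.finBasis ℂ V i) := by
  classical
  have h1 : ∀ j, MvPowerSeries.coeff (R := ℂ) (Finsupp.single i 1) (MvPowerSeries.X j) =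
      if i = j then 1 else 0 := by
    intro j
    rw [MvPowerSeries.coeff_X]
    simp [Finsupp.single_left_inj]
  rw [linSeries, map_add, MvPowerSeries.coeff_C, map_sum, if_neg (by simp), zero_add]
  simp only [map_smul, h1, smul_eq_mul, mul_ite, mul_one, mul_zero, Finset.sum_ite_eq,
    Finset.mem_univ, if_true]

theorem exists_basis_ne_zero {a : Module.Dual ℂ V} (ha : a ≠ 0) :
    ∃ i, a (Module.finBasis ℂ V i) ≠ 0 := by
  by_contra! h
  exact ha ((Module.finBasis ℂ V).ext fun i => by simpa using h i)

theorem linSeries_ne_zero {a : Module.Dual ℂ V} (ha : a ≠ 0) (p : V) : linSeries a p ≠ 0 := by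
  obtain ⟨i, hi⟩ := exists_basis_ne_zero ha
  intro h
  rw [← coeff_linSeries a p, h, map_zero] at hi
  exact hi rfl

theorem order_linSeries_le {a : Module.Dual ℂ V} (ha : a ≠ 0) (p : V) :
    (linSeries a p).order ≤ 1 := by
  obtain ⟨i, hi⟩ := exists_basis_ne_zero ha
  rw [← coeff_linSeries a p] at hi
  simpa using MvPowerSeries.order_le hi

theorem linSeries_add (a a' : Module.Dual ℂ V) (p : V) :
    linSeries (a + a') p = linSeries a p + linSeries a' p :=
  congrFun (linFun_add (ρ := (1 : Representation ℂ PUnit.{u+1} V)) p a a')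
    ⟨p, self_mem_orbit _ p⟩

theorem linSeries_smul (r : ℂ) (a : Module.Dual ℂ V) (p : V) :
    linSeries (r • a) p = r • linSeries a p := by
  have := congrFun (linFun_smul (ρ := (1 : Representation ℂ PUnit.{u+1} V)) p r a)
    ⟨p, self_mem_orbit _ p⟩
  rw [← Algebra.smul_def] at this
  exact this

omit [FiniteDimensional ℂ V] in
theorem rep_eq_self_iff {s : G} (hs : IsReflection ρ s) (p : V) : ρ s p = p ↔ root ρ s p = 0 := by
  obtain ⟨h0, h1, h2, hy, -⟩ := root_facts hs
  rw [hy p, sub_eq_self]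
  have h3 : (1 - (reflEigenvalue ρ s)⁻¹) / 2 ≠ 0 := by
    refine div_ne_zero (sub_ne_zero.2 fun h => h1 ?_) two_ne_zero
    exact inv_eq_one.1 h.symm
  have h4 : coroot ρ s ≠ 0 := fun h => by rw [h] at h2; simp at h2
  simp [h3, h4]

omit [FiniteDimensional ℂ V] in
theorem rep_inv_eq_self {s : G} {p : V} (h : ρ s p = p) : ρ s⁻¹ p = p := by
  conv_lhs => rw [← h]
  exact inv_apply_apply s p

theorem substAct_sub_mem {s : G} (hs : IsReflection ρ s) (f : FormalSeries V) :
    substAct ρ s f - f ∈ Ideal.span {linSeries (root ρ s) 0} := by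
  have hX : ∀ i, substAct ρ s (MvPowerSeries.X i) - MvPowerSeries.X i ∈
      Ideal.span {linSeries (root ρ s) 0} := by
    intro i
    obtain ⟨-, -, -, -, hd⟩ := root_facts hs
    have h1 := substAct_linSeries (ρ := ρ) s ((Module.finBasis ℂ V).coord i) 0
    rw [map_zero, hd, sub_eq_add_neg, ← neg_smul, linSeries_add, linSeries_smul,
      linSeries_coord_zero] at h1
    rw [h1, add_sub_cancel_left]
    exact smul_mem_ideal _ _ (Ideal.mem_span_singleton_self _)
  have hpoly : ∀ P : MvPolynomial (Fin (Module.finrank ℂ V)) ℂ,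
      substAct ρ s (P : FormalSeries V) - P ∈ Ideal.span {linSeries (root ρ s) 0} := by
    intro P
    induction P using MvPolynomial.induction_on with
    | C r =>
      rw [MvPolynomial.coe_C]
      have : substAct ρ s (MvPowerSeries.C r) = MvPowerSeries.C r := (substAct ρ s).commutes r
      rw [this, sub_self]
      exact zero_mem _
    | add P Q hP hQ =>
      rw [MvPolynomial.coe_add, map_add, add_sub_add_comm]
      exact add_mem hP hQ
    | mul_X P i hP =>
      rw [MvPolynomial.coe_mul, MvPolynomial.coe_X, map_mul]
      have : ∀ a c d e : FormalSeries V, a * c - d * e = (a - d) * c + d * (c - e) := by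
        intros; ring
      rw [this]
      exact add_mem (Ideal.mul_mem_right _ _ hP) (Ideal.mul_mem_left _ _ (hX i))
  refine mem_ideal_of_forall_mem_sup _ fun k => ?_
  have h2 : substAct ρ s f - f =
      (substAct ρ s (MvPowerSeries.truncTotal k f : MvPolynomial _ ℂ) -
        (MvPowerSeries.truncTotal k f : MvPolynomial _ ℂ)) +
      (substAct ρ s (f - (MvPowerSeries.truncTotal k f : MvPolynomial _ ℂ)) -
        (f - (MvPowerSeries.truncTotal k f : MvPolynomial _ ℂ))) := by
    rw [map_sub]; abel
  rw [h2]
  exact add_mem (Ideal.mem_sup_left (hpoly _)) (Ideal.mem_sup_right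
    (sub_mem (substAct_mem s (sub_truncTotal_mem k f)) (sub_truncTotal_mem k f)))

theorem exists_div_root {s : G} (hs : IsReflection ρ s) (f : FormalFun ρ b) :
    ∃ q : FormalFun ρ b, linFun b (root ρ s) * q = actFun s f - f := by
  suffices h : ∀ p : orbit ρ b, ∃ q : FormalSeries V,
      linSeries (root ρ s) p * q = (actFun s f - f) p by
    choose q hq using h
    exact ⟨q, funext hq⟩
  intro p
  by_cases hp : root ρ s p = 0
  · have h1 : ρ s⁻¹ p = p := rep_inv_eq_self ((rep_eq_self_iff hs _).2 hp)
    have h2 : actFun s f p = substAct ρ s (f p) := by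
      simp only [actFun]
      congr 2
      exact Subtype.ext h1
    obtain ⟨q, hq⟩ := Ideal.mem_span_singleton'.1 (substAct_sub_mem hs (f p))
    refine ⟨q, ?_⟩
    rw [Pi.sub_apply, h2, ← hq, mul_comm]
    congr 1
    simp only [linSeries, hp, map_zero]
  · refine ⟨(linSeries (root ρ s) p)⁻¹ * (actFun s f - f) p, ?_⟩
    rw [← mul_assoc, MvPowerSeries.mul_inv_cancel, one_mul]
    rwa [constantCoeff_linSeries]

/-- The quotient `(s f - f) / αₛ`. -/
def divRoot (s : G) (f : FormalFun ρ b) : FormalFun ρ b :=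
  Classical.epsilon fun q => linFun b (root ρ s) * q = actFun s f - f

theorem linFun_mul_divRoot {s : G} (hs : IsReflection ρ s) (f : FormalFun ρ b) :
    linFun b (root ρ s) * divRoot s f = actFun s f - f :=
  Classical.epsilon_spec (exists_div_root hs f)

theorem linFun_mul_cancel {a : Module.Dual ℂ V} (ha : a ≠ 0) {f f' : FormalFun ρ b}
    (h : linFun b a * f = linFun b a * f') : f = f' := by
  funext p
  exact mul_left_cancel₀ (linSeries_ne_zero ha p) (congrFun h p)

theorem eq_divRoot {s : G} (hs : IsReflection ρ s) {f q : FormalFun ρ b}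
    (h : linFun b (root ρ s) * q = actFun s f - f) : q = divRoot s f :=
  linFun_mul_cancel (root_ne_zero hs) (h.trans (linFun_mul_divRoot hs f).symm)

theorem divRoot_add {s : G} (hs : IsReflection ρ s) (f f' : FormalFun ρ b) :
    divRoot s (f + f') = divRoot s f + divRoot s f' := by
  refine (eq_divRoot hs ?_).symm
  rw [mul_add, linFun_mul_divRoot hs, linFun_mul_divRoot hs, actFun_add]
  abel

theorem divRoot_smul {s : G} (hs : IsReflection ρ s) (r : ℂ) (f : FormalFun ρ b) :
    divRoot s (r • f) = r • divRoot s f := by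
  refine (eq_divRoot hs ?_).symm
  rw [mul_smul_comm, linFun_mul_divRoot hs, actFun_smul, smul_sub]

theorem divRoot_mul {s : G} (hs : IsReflection ρ s) (f f' : FormalFun ρ b) :
    divRoot s (f * f') = divRoot s f * actFun s f' + f * divRoot s f' := by
  refine (eq_divRoot hs ?_).symm
  rw [mul_add, ← mul_assoc, linFun_mul_divRoot hs, mul_left_comm, linFun_mul_divRoot hs, actFun_mul]
  ring

theorem divRoot_linFun {s : G} (hs : IsReflection ρ s) (a : Module.Dual ℂ V) :
    divRoot s (linFun b a : FormalFun ρ b) =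
      algebraMap ℂ _ (-((1 - reflEigenvalue ρ s) / 2 * a (coroot ρ s))) := by
  refine (eq_divRoot hs ?_).symm
  obtain ⟨-, -, -, -, hd⟩ := root_facts hs
  rw [actFun_linFun, hd, sub_eq_add_neg a, ← neg_smul, linFun_add, linFun_smul,
    add_sub_cancel_left, mul_comm]

theorem divRoot_one {s : G} (hs : IsReflection ρ s) : divRoot s (1 : FormalFun ρ b) = 0 := by
  refine (eq_divRoot hs ?_).symm
  rw [mul_zero, ← actHom_apply, map_one, sub_self]

theorem mem_of_linFun_mul_mem {a : Module.Dual ℂ V} (ha : a ≠ 0) {k : ℕ} {f : FormalFun ρ b}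
    (h : linFun b a * f ∈ orbIdeal ρ b ^ (k + 1)) : f ∈ orbIdeal ρ b ^ k := by
  rw [mem_orbIdeal_pow] at h ⊢
  exact fun p => mem_of_mul_mem_varIdeal_pow (order_linSeries_le ha p) (h p)

theorem divRoot_mem {s : G} (hs : IsReflection ρ s) {k : ℕ} {f : FormalFun ρ b}
    (hf : f ∈ orbIdeal ρ b ^ (k + 1)) : divRoot s f ∈ orbIdeal ρ b ^ k := by
  refine mem_of_linFun_mul_mem (root_ne_zero hs) ?_
  rw [linFun_mul_divRoot hs]
  exact sub_mem (actFun_mem s hf) hf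

omit [FiniteDimensional ℂ V] in
theorem exists_root_conj {s : G} (hs : IsReflection ρ s) (g : G) :
    ∃ μ : ℂ, μ ≠ 0 ∧ root ρ (g * s * g⁻¹) = μ • ρ.dual g (root ρ s) := by
  obtain ⟨-, hl, h2, -, hd⟩ := root_facts (hs.conj g)
  obtain ⟨-, -, -, -, hd'⟩ := root_facts hs
  set t := g * s * g⁻¹ with ht
  have h3 := hd (root ρ t)
  have h4 : ρ.dual t (root ρ t) = ρ.dual g (ρ.dual s (ρ.dual g⁻¹ (root ρ t))) := by
    rw [← Module.End.mul_apply, ← Module.End.mul_apply, ← map_mul, ← map_mul, ht]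
  rw [h4, hd', map_sub, apply_inv_apply, map_smul, h2, sub_right_inj] at h3
  have hl' : 1 - reflEigenvalue ρ t ≠ 0 := sub_ne_zero.2 hl.symm
  set κ := (1 - reflEigenvalue ρ s) / 2 * (ρ.dual g⁻¹ (root ρ t)) (coroot ρ s)
  have h5 : root ρ t = ((1 - reflEigenvalue ρ t)⁻¹ * κ) • ρ.dual g (root ρ s) := by
    rw [mul_smul, h3, smul_smul]
    have : (1 - reflEigenvalue ρ t)⁻¹ * ((1 - reflEigenvalue ρ t) / 2 * 2) = 1 := by
      field_simp
    rw [this, one_smul]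
  refine ⟨_, fun h => root_ne_zero (hs.conj g) ?_, h5⟩
  rw [← ht, h5, h, zero_smul]

/-- Equivariance of `f ↦ αₛ(a) (s f - f) / αₛ`. -/
theorem actFun_divRoot {s : G} (hs : IsReflection ρ s) (g : G) (a : V) (f : FormalFun ρ b) :
    actFun g (root ρ s a • divRoot s f) =
      root ρ (g * s * g⁻¹) (ρ g a) • divRoot (g * s * g⁻¹) (actFun g f) := by
  obtain ⟨μ, hμ, h⟩ := exists_root_conj hs g
  refine linFun_mul_cancel (root_ne_zero (hs.conj g)) ?_
  rw [mul_smul_comm, linFun_mul_divRoot (hs.conj g), actFun_smul, mul_smul_comm, h, linFun_smul,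
    ← actFun_linFun, ← Algebra.smul_def, smul_mul_assoc, ← actFun_mul, linFun_mul_divRoot hs,
    smul_smul, LinearMap.smul_apply, dual_apply', inv_apply_apply, smul_eq_mul, mul_comm μ,
    actFun_sub, actFun_actFun, actFun_actFun]
  congr 3
  group

section LocConst

variable (ρ b) in
/-- A function that is constant near each point of the orbit. -/
def locConst : (orbit ρ b → ℂ) →ₐ[ℂ] FormalFun ρ b where
  toFun u p := MvPowerSeries.C (u p)
  map_one' := by funext p; simp
  map_mul' u v := by funext p; simp
  map_zero' := by funext p; simp
  map_add' u v := by funext p; simp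
  commutes' r := rfl

theorem locConst_apply (u : orbit ρ b → ℂ) (p : orbit ρ b) :
    locConst ρ b u p = MvPowerSeries.C (u p) := rfl

theorem actFun_locConst (g : G) (u : orbit ρ b → ℂ) : actFun g (locConst ρ b u) =
    locConst ρ b fun p => u ⟨ρ g⁻¹ p, rep_mem_orbit ρ g⁻¹ p.2⟩ := by
  funext p
  exact (substAct ρ g).commutes _

theorem derivFun_locConst (v : V) (u : orbit ρ b → ℂ) : derivFun v (locConst ρ b u) = 0 := by
  funext p
  rw [derivFun_apply]
  exact (derivSeries v).map_algebraMap (u p)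

open Classical in
variable (ρ b) in
/-- The indicator function of the points of the orbit that are fixed by `s`. -/
def fixFun (s : G) : FormalFun ρ b := locConst ρ b fun p => if root ρ s p = 0 then 1 else 0

variable (ρ b) in
/-- The function `1 / αₛ`, at the points of the orbit where it is regular, and zero at the other
points. -/
def rootInv (s : G) : FormalFun ρ b := fun p => (linSeries (root ρ s) p)⁻¹

theorem rootInv_mul_linFun (s : G) :
    rootInv ρ b s * linFun b (root ρ s) = 1 - fixFun ρ b s := by
  classical
  funext p
  simp only [Pi.mul_apply, Pi.sub_apply, Pi.one_apply, rootInv, linFun, fixFun, locConst_apply]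
  split_ifs with h
  · rw [MvPowerSeries.inv_eq_zero.2 (by rw [constantCoeff_linSeries, h])]; simp
  · rw [MvPowerSeries.inv_mul_cancel _ (by rwa [constantCoeff_linSeries])]; simp

theorem fixFun_mul_actFun {s : G} (hs : IsReflection ρ s) (u : orbit ρ b → ℂ) :
    fixFun ρ b s * actFun s (locConst ρ b u) = fixFun ρ b s * locConst ρ b u := by
  classical
  rw [actFun_locConst, fixFun, ← map_mul, ← map_mul]
  congr 1
  funext p
  simp only [Pi.mul_apply]
  split_ifs with h
  · congr 2
    exact Subtype.ext (rep_inv_eq_self ((rep_eq_self_iff hs _).2 h))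
  · simp

theorem actFun_fixFun {s : G} (hs : IsReflection ρ s) (g : G) :
    actFun g (fixFun ρ b s) = fixFun ρ b (g * s * g⁻¹) := by
  classical
  obtain ⟨μ, hμ, h⟩ := exists_root_conj hs g
  rw [fixFun, actFun_locConst, fixFun]
  congr 1
  funext p
  rw [h, LinearMap.smul_apply, dual_apply', smul_eq_mul]
  simp [hμ]

theorem fixFun_mul_divRoot {s : G} (hs : IsReflection ρ s) (u : orbit ρ b → ℂ)
    (f : FormalFun ρ b) : fixFun ρ b s * divRoot s (locConst ρ b u * f) =
      locConst ρ b u * (fixFun ρ b s * divRoot s f) := by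
  refine linFun_mul_cancel (root_ne_zero hs) ?_
  rw [mul_left_comm, linFun_mul_divRoot hs, mul_left_comm (linFun b (root ρ s)),
    mul_left_comm (linFun b (root ρ s)), linFun_mul_divRoot hs, actFun_mul, mul_sub, ← mul_assoc,
    fixFun_mul_actFun hs]
  ring

theorem actFun_rootInv {s : G} (hs : IsReflection ρ s) (g : G) (a : V) :
    actFun g (root ρ s a • rootInv ρ b s) =
      root ρ (g * s * g⁻¹) (ρ g a) • rootInv ρ b (g * s * g⁻¹) := by
  obtain ⟨μ, hμ, h⟩ := exists_root_conj hs g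
  funext p
  have h1 : substAct ρ g ((linSeries (root ρ s) (ρ g⁻¹ p))⁻¹) =
      (linSeries (ρ.dual g (root ρ s)) p)⁻¹ := by
    by_cases hp : root ρ s (ρ g⁻¹ p) = 0
    · rw [MvPowerSeries.inv_eq_zero.2 (by rw [constantCoeff_linSeries, hp]), map_zero,
        MvPowerSeries.inv_eq_zero.2 (by rw [constantCoeff_linSeries, dual_apply', hp])]
    · rw [MvPowerSeries.eq_inv_iff_mul_eq_one (by rwa [constantCoeff_linSeries, dual_apply']),
        ← substAct_linSeries, ← map_mul, MvPowerSeries.inv_mul_cancel _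
          (by rwa [constantCoeff_linSeries]), map_one]
  rw [actFun_smul]
  simp only [Pi.smul_apply, actFun, rootInv]
  rw [h1, h, LinearMap.smul_apply, dual_apply', inv_apply_apply, linSeries_smul,
    MvPowerSeries.smul_inv, smul_smul, smul_eq_mul]
  congr 1
  field_simp

end LocConst

end Division

section Density

variable {G V : Type u} [Group G] [Finite G] [AddCommGroup V] [Module ℂ V] [FiniteDimensional ℂ V]
variable {ρ : Representation ℂ G V} {b : V}

variable (V) in
/-- Polynomial functions on `V`. -/
abbrev Poly : Type := MvPolynomial (Fin (Module.finrank ℂ V)) ℂ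

variable (ρ b) in
/-- Polynomials as functions on the formal neighborhood of the orbit. -/
def polyFun : Poly V →ₐ[ℂ] FormalFun ρ b :=
  MvPolynomial.aeval fun i => linFun b ((Module.finBasis ℂ V).coord i)

/-- Translation of polynomials. -/
def translate (p : V) : Poly V →ₐ[ℂ] Poly V :=
  MvPolynomial.aeval fun i =>
    MvPolynomial.X i + MvPolynomial.C ((Module.finBasis ℂ V).coord i p)

theorem translate_neg (p : V) (P : Poly V) : translate p (translate (-p) P) = P := by
  have : (translate p).comp (translate (-p)) = AlgHom.id ℂ (Poly V) := by
    ext1 i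
    simp only [translate, AlgHom.comp_apply, MvPolynomial.aeval_X, map_add, map_neg,
      AlgHom.id_apply]
    rw [← MvPolynomial.algebraMap_eq, AlgHom.commutes]
    simp
  exact DFunLike.congr_fun this P

theorem polyFun_apply (P : Poly V) (p : orbit ρ b) :
    polyFun ρ b P p = (translate (p : V) P : Poly V) := by
  have : (Pi.evalAlgHom ℂ (fun _ : orbit ρ b => FormalSeries V) p).comp (polyFun ρ b) =
      (MvPolynomial.coeToMvPowerSeries.algHom ℂ).comp (translate (p : V)) := by
    ext1 i
    simp only [polyFun, translate, AlgHom.comp_apply, MvPolynomial.aeval_X, Pi.evalAlgHom_apply,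
      linFun]
    rw [MvPolynomial.coeToMvPowerSeries.algHom_apply]
    simp only [Algebra.algebraMap_self, MvPowerSeries.map_id, RingHom.id_apply,
      MvPolynomial.coe_add, MvPolynomial.coe_X, MvPolynomial.coe_C]
    have h := linSeries_coord_zero (V := V) i
    rw [linSeries_zero_eq] at h
    rw [linSeries, h, add_comm]
  have := DFunLike.congr_fun this P
  simpa [MvPolynomial.coeToMvPowerSeries.algHom_apply] using this

/-- The ideal of polynomials vanishing at `p`. -/
def pointIdeal (p : V) : Ideal (Poly V) :=
  (MvPolynomial.idealOfVars (Fin (Module.finrank ℂ V)) ℂ).comap (translate p)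

/-- Translation as an automorphism. -/
def translateEquiv (p : V) : Poly V ≃ₐ[ℂ] Poly V :=
  AlgEquiv.ofAlgHom (translate p) (translate (-p)) (AlgHom.ext (translate_neg p))
    (AlgHom.ext fun P => by simpa using translate_neg (-p) P)

theorem pointIdeal_pow (p : V) (k : ℕ) : pointIdeal p ^ k =
    (MvPolynomial.idealOfVars (Fin (Module.finrank ℂ V)) ℂ ^ k).comap (translate p) := by
  have h : ∀ I : Ideal (Poly V), I.comap (translate p) = I.map (translateEquiv p).symm.toRingEquiv :=
    fun I => (Ideal.map_symm (translateEquiv p).toRingEquiv).symm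
  rw [pointIdeal, h, h, Ideal.map_pow]

theorem isCoprime_pointIdeal {p q : V} (hpq : p ≠ q) : IsCoprime (pointIdeal p) (pointIdeal q) := by
  obtain ⟨i, hi⟩ : ∃ i, (Module.finBasis ℂ V).coord i p ≠ (Module.finBasis ℂ V).coord i q := by
    by_contra! h
    exact hpq ((Module.finBasis ℂ V).ext_elem h)
  have hmem : ∀ p : V, (MvPolynomial.X i - MvPolynomial.C ((Module.finBasis ℂ V).coord i p)) ∈
      pointIdeal p := by
    intro p
    rw [pointIdeal, Ideal.mem_comap, map_sub, ← MvPolynomial.algebraMap_eq, AlgHom.commutes]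
    simp only [translate, MvPolynomial.aeval_X, MvPolynomial.algebraMap_eq, add_sub_cancel_right]
    exact Ideal.subset_span ⟨i, rfl⟩
  rw [Ideal.isCoprime_iff_exists]
  set d := (Module.finBasis ℂ V).coord i q - (Module.finBasis ℂ V).coord i p with hd
  have hd0 : d ≠ 0 := sub_ne_zero.2 hi.symm
  refine ⟨MvPolynomial.C d⁻¹ * _, Ideal.mul_mem_left _ _ (hmem p),
    -(MvPolynomial.C d⁻¹ * _), neg_mem (Ideal.mul_mem_left _ _ (hmem q)), ?_⟩
  have : (MvPolynomial.C d⁻¹ : Poly V) * MvPolynomial.C d = 1 := by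
    rw [← MvPolynomial.C_mul, inv_mul_cancel₀ hd0, MvPolynomial.C_1]
  rw [← this, hd, MvPolynomial.C_sub]
  ring

variable (ρ b) in
/-- The ideal of polynomials that vanish on the orbit. -/
def orbPolyIdeal : Ideal (Poly V) := (orbIdeal ρ b).comap (polyFun ρ b)

theorem polyFun_mem_iff {k : ℕ} {P : Poly V} : polyFun ρ b P ∈ orbIdeal ρ b ^ k ↔
    ∀ p : orbit ρ b, P ∈ pointIdeal (p : V) ^ k := by
  rw [mem_orbIdeal_pow]
  refine forall_congr' fun p => ?_
  rw [polyFun_apply, coe_mem_varIdeal_pow, pointIdeal_pow]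
  rfl

theorem mem_orbPolyIdeal_pow {k : ℕ} {P : Poly V} :
    P ∈ orbPolyIdeal ρ b ^ k ↔ polyFun ρ b P ∈ orbIdeal ρ b ^ k := by
  let _ := Fintype.ofFinite (orbit ρ b)
  have h1 : orbPolyIdeal ρ b = ∏ p : orbit ρ b, pointIdeal (p : V) := by
    rw [Ideal.prod_eq_iInf_of_pairwise_isCoprime]
    · ext P
      rw [orbPolyIdeal, Ideal.mem_comap]
      have := polyFun_mem_iff (ρ := ρ) (b := b) (k := 1) (P := P)
      simp only [pow_one] at this
      simpa using this
    · intro p _ q _ hpq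
      exact isCoprime_pointIdeal fun h => hpq (Subtype.ext h)
  have h2 : orbPolyIdeal ρ b ^ k = ∏ p : orbit ρ b, pointIdeal (p : V) ^ k := by
    rw [h1, Finset.prod_pow]
  rw [h2, polyFun_mem_iff, Ideal.prod_eq_iInf_of_pairwise_isCoprime]
  · simp
  · intro p _ q _ hpq
    exact (isCoprime_pointIdeal fun h => hpq (Subtype.ext h)).pow

theorem exists_poly_sub_mem (f : FormalFun ρ b) (k : ℕ) :
    ∃ P : Poly V, f - polyFun ρ b P ∈ orbIdeal ρ b ^ k := by
  let Q : orbit ρ b → Poly V := fun p => translate (-(p : V)) (MvPowerSeries.truncTotal k (f p))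
  have hco : Pairwise (Function.onFun IsCoprime fun p : orbit ρ b => pointIdeal (p : V) ^ k) := by
    intro p q hpq
    exact (isCoprime_pointIdeal fun h => hpq (Subtype.ext h)).pow
  obtain ⟨P, hP⟩ := Ideal.quotientInfToPiQuotient_surj hco
    (fun p => Ideal.Quotient.mk _ (Q p))
  obtain ⟨P, rfl⟩ := Ideal.Quotient.mk_surjective P
  refine ⟨P, mem_orbIdeal_pow.2 fun p => ?_⟩
  have h1 : P - Q p ∈ pointIdeal (p : V) ^ k := by
    have := congrFun hP p
    rw [Ideal.quotientInfToPiQuotient_mk'] at this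
    exact (Ideal.Quotient.eq).1 this
  rw [pointIdeal_pow, Ideal.mem_comap, map_sub, translate_neg, ← coe_mem_varIdeal_pow] at h1
  have h2 := sub_truncTotal_mem k (f p)
  rw [Pi.sub_apply, polyFun_apply]
  have h3 : f p - (translate (p : V) P : Poly V) = (f p -
      (MvPowerSeries.truncTotal k (f p) : Poly V)) -
      ((translate (p : V) P - MvPowerSeries.truncTotal k (f p) : Poly V) : FormalSeries V) := by
    rw [sub_eq_add_neg (translate (p : V) P), MvPolynomial.coe_add]
    have : ((-MvPowerSeries.truncTotal k (f p) : Poly V) : FormalSeries V) =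
      -((MvPowerSeries.truncTotal k (f p) : Poly V) : FormalSeries V) := by
      exact map_neg (MvPolynomial.coeToMvPowerSeries.ringHom) _
    rw [this]; ring
  rw [h3]
  exact sub_mem h2 h1

end Density

section Dunkl

variable {G V : Type u} [Group G] [Finite G] [AddCommGroup V] [Module ℂ V] [FiniteDimensional ℂ V]
variable {ρ : Representation ℂ G V} (c : Param ρ) {b : V}

omit [Finite G] [FiniteDimensional ℂ V] in
/-- The coefficient `2 cₛ / (1 - λₛ)`. -/
def reflCoef (s : G) : ℂ := 2 * c.val s / (1 - reflEigenvalue ρ s)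

omit [FiniteDimensional ℂ V] in
theorem reflCoef_conj {s : G} (hs : IsReflection ρ s) (g : G) :
    reflCoef c (g * s * g⁻¹) = reflCoef c s := by
  rw [reflCoef, reflCoef, c.conj_eq g s hs, reflEigenvalue_conj hs]

omit [FiniteDimensional ℂ V] in
theorem sum_reflections_conj {M : Type*} [AddCommMonoid M] (F : G → M) (g : G) :
    ∑ s ∈ reflections ρ, F (g * s * g⁻¹) = ∑ s ∈ reflections ρ, F s := by
  refine Finset.sum_nbij' (fun s => g * s * g⁻¹) (fun s => g⁻¹ * s * g) ?_ ?_ ?_ ?_ ?_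
  · intro s hs
    exact mem_reflections.2 ((mem_reflections.1 hs).conj g)
  · intro s hs
    have := (mem_reflections.1 hs).conj g⁻¹
    rw [inv_inv] at this
    exact mem_reflections.2 this
  · intro s _; group
  · intro s _; group
  · intro s _; rfl

omit [FiniteDimensional ℂ V] in
theorem rep_sub_self {s : G} (hs : IsReflection ρ s) (a : V) :
    a - ρ s a = ((1 - (reflEigenvalue ρ s)⁻¹) / 2 * root ρ s a) • coroot ρ s := by
  obtain ⟨-, -, -, hy, -⟩ := root_facts hs
  rw [hy a, sub_sub_cancel]

/-- The relations of the completed algebra, except for the commutation of the Dunkl operators, where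
the difference quotients are cut off by functions `χ s`. -/
structure DunklData (b : V) (χ : G → FormalFun ρ b) (R : Type*) [Ring R] [Algebra ℂ R] where
  /-- the functions -/
  ι : FormalFun ρ b →ₐ[ℂ] R
  /-- the group -/
  γ : G →* R
  /-- the Dunkl operators -/
  Y : V →ₗ[ℂ] R
  g_f : ∀ g f, γ g * ι f = ι (actFun g f) * γ g
  g_y : ∀ g v, γ g * Y v = Y (ρ g v) * γ g
  y_f : ∀ v f, Y v * ι f = ι f * Y v + (ι (derivFun v f) +
    ∑ s ∈ reflections ρ, (reflCoef c s * root ρ s v) • (ι (χ s * divRoot s f) * γ s))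

namespace DunklData

variable {c} {χ : G → FormalFun ρ b} {R R' : Type*} [Ring R] [Algebra ℂ R] [Ring R'] [Algebra ℂ R']
variable (D : DunklData c b χ R) (D' : DunklData c b χ R')

/-- The product of two families. -/
def prod : DunklData c b χ (R × R') where
  ι := D.ι.prod D'.ι
  γ := D.γ.prod D'.γ
  Y := D.Y.prod D'.Y
  g_f g f := Prod.ext (D.g_f g f) (D'.g_f g f)
  g_y g v := Prod.ext (D.g_y g v) (D'.g_y g v)
  y_f v f := by
    refine Prod.ext ?_ ?_
    · simpa [Prod.fst_sum] using D.y_f v f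
    · simpa [Prod.snd_sum] using D'.y_f v f

/-- The elements `∑ f_g g`. -/
def coefSum : (G → FormalFun ρ b) →ₗ[ℂ] R :=
  letI := Fintype.ofFinite G
  ∑ g, LinearMap.mulRight ℂ (D.γ g) ∘ₗ D.ι.toLinearMap ∘ₗ LinearMap.proj g

theorem coefSum_apply [Fintype G] (φ : G → FormalFun ρ b) :
    D.coefSum φ = ∑ g, D.ι (φ g) * D.γ g := by
  rw [coefSum, LinearMap.sum_apply]
  refine Finset.sum_congr (by ext; simp) fun g _ => rfl

theorem mul_mem_range (f : FormalFun ρ b) (g : G) : D.ι f * D.γ g ∈ LinearMap.range D.coefSum := by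
  classical
  let _ := Fintype.ofFinite G
  refine ⟨Pi.single g f, ?_⟩
  rw [coefSum_apply, Finset.sum_eq_single g]
  · simp
  · intro h _ hh
    simp [hh]
  · simp

theorem ι_mem_range (f : FormalFun ρ b) : D.ι f ∈ LinearMap.range D.coefSum := by
  simpa using D.mul_mem_range f 1

theorem range_mul_mem {x y : R} (hx : x ∈ LinearMap.range D.coefSum)
    (hy : y ∈ LinearMap.range D.coefSum) : x * y ∈ LinearMap.range D.coefSum := by
  let _ := Fintype.ofFinite G
  obtain ⟨φ, rfl⟩ := hx
  obtain ⟨ψ, rfl⟩ := hy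
  rw [coefSum_apply, coefSum_apply, Finset.sum_mul]
  refine Submodule.sum_mem _ fun g _ => ?_
  rw [Finset.mul_sum]
  refine Submodule.sum_mem _ fun h _ => ?_
  have : D.ι (φ g) * D.γ g * (D.ι (ψ h) * D.γ h) = D.ι (φ g * actFun g (ψ h)) * D.γ (g * h) := by
    rw [mul_assoc, ← mul_assoc (D.γ g), D.g_f, map_mul, map_mul]
    simp only [mul_assoc]
  rw [this]
  exact D.mul_mem_range _ _

/-- The operators `∑ₛ (2 cₛ / (1 - λₛ)) (αₛ(v) / αₛ) (s - 1)`, where `1 / αₛ` is replaced by zero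
at its poles. -/
def pert (v : V) : R :=
  ∑ s ∈ reflections ρ, reflCoef c s • (D.ι (root ρ s v • rootInv ρ b s) * (D.γ s - 1))

theorem pert_mem (v : V) : D.pert v ∈ LinearMap.range D.coefSum := by
  refine Submodule.sum_mem _ fun s _ => Submodule.smul_mem _ _ ?_
  rw [mul_sub, mul_one]
  exact sub_mem (D.mul_mem_range _ _) (D.ι_mem_range _)

theorem pert_add (v v' : V) : D.pert (v + v') = D.pert v + D.pert v' := by
  simp only [pert, map_add, add_smul, add_mul, smul_add, Finset.sum_add_distrib]

theorem pert_smul (r : ℂ) (v : V) : D.pert (r • v) = r • D.pert v := by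
  simp only [pert, map_smul, smul_eq_mul, mul_smul, smul_mul_assoc, Finset.smul_sum]
  refine Finset.sum_congr rfl fun s _ => ?_
  rw [smul_comm]

theorem g_pert (g : G) (v : V) : D.γ g * D.pert v = D.pert (ρ g v) * D.γ g := by
  rw [pert, pert, Finset.mul_sum, Finset.sum_mul, ← sum_reflections_conj (fun s => reflCoef c s •
    (D.ι (root ρ s (ρ g v) • rootInv ρ b s) * (D.γ s - 1)) * D.γ g) g]
  refine Finset.sum_congr rfl fun s hs => ?_
  have hs' := mem_reflections.1 hs
  rw [reflCoef_conj c hs', mul_smul_comm, smul_mul_assoc, ← actFun_rootInv hs', ← mul_assoc, D.g_f,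
    mul_assoc, mul_assoc, mul_sub, sub_mul, ← map_mul, ← map_mul]
  simp

theorem commutator_mem (v : V) (f : FormalFun ρ b) :
    D.Y v * D.ι f - D.ι f * D.Y v ∈ LinearMap.range D.coefSum := by
  rw [D.y_f, add_sub_cancel_left]
  exact add_mem (D.ι_mem_range _)
    (Submodule.sum_mem _ fun s _ => Submodule.smul_mem _ _ (D.mul_mem_range _ _))

theorem commutator_pert (a a' : V) :
    D.Y a * D.pert a' - D.pert a' * D.Y a - ∑ s ∈ reflections ρ,
      (reflCoef c s * ((1 - (reflEigenvalue ρ s)⁻¹) / 2) * (root ρ s a * root ρ s a')) •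
        (D.ι (rootInv ρ b s) * D.Y (coroot ρ s) * D.γ s) ∈ LinearMap.range D.coefSum := by
  rw [pert, Finset.mul_sum, Finset.sum_mul, ← Finset.sum_sub_distrib, ← Finset.sum_sub_distrib]
  refine Submodule.sum_mem _ fun s hs => ?_
  have hs' := mem_reflections.1 hs
  set f : FormalFun ρ b := root ρ s a' • rootInv ρ b s with hf
  set x := D.Y a * D.ι f - D.ι f * D.Y a with hx
  have hmem : x ∈ LinearMap.range D.coefSum := D.commutator_mem a f
  have h1 : D.Y a * (D.ι f * (D.γ s - 1)) - D.ι f * (D.γ s - 1) * D.Y a =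
      x * (D.γ s - 1) + D.ι f * D.Y (a - ρ s a) * D.γ s := by
    have h2 : D.ι f * (D.γ s - 1) * D.Y a = D.ι f * D.Y (ρ s a) * D.γ s - D.ι f * D.Y a := by
      rw [mul_assoc, sub_mul, D.g_y, one_mul, mul_sub, mul_assoc]
    rw [h2, hx, map_sub]
    noncomm_ring
  have h3 : (reflCoef c s * ((1 - (reflEigenvalue ρ s)⁻¹) / 2) * (root ρ s a * root ρ s a')) •
        (D.ι (rootInv ρ b s) * D.Y (coroot ρ s) * D.γ s) =
        reflCoef c s • (D.ι f * D.Y (a - ρ s a) * D.γ s) := by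
    rw [rep_sub_self hs', hf, map_smul, map_smul]
    simp only [smul_mul_assoc, mul_smul_comm, smul_smul]
    congr 1
    ring
  rw [mul_smul_comm, smul_mul_assoc, h3, ← smul_sub, ← smul_sub, h1, add_sub_cancel_right]
  refine Submodule.smul_mem _ _ (D.range_mul_mem hmem (sub_mem ?_ ?_))
  · simpa using D.mul_mem_range 1 s
  · simpa using D.mul_mem_range 1 1

theorem pert_commutator_mem (a a' : V) :
    (D.Y a + D.pert a) * (D.Y a' + D.pert a') - (D.Y a' + D.pert a') * (D.Y a + D.pert a) -
      (D.Y a * D.Y a' - D.Y a' * D.Y a) ∈ LinearMap.range D.coefSum := by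
  have h1 := sub_mem (D.commutator_pert a a') (D.commutator_pert a' a)
  have h2 := sub_mem (D.range_mul_mem (D.pert_mem a) (D.pert_mem a'))
    (D.range_mul_mem (D.pert_mem a') (D.pert_mem a))
  have h3 := add_mem h1 h2
  convert h3 using 1
  simp only [mul_comm (root ρ _ a') (root ρ _ a)]
  noncomm_ring

end DunklData

section Operators

variable (χ : G → FormalFun ρ b)

/-- The Dunkl operators on functions, cut off by functions `χ s`. -/
def dunkl (v : V) (f : FormalFun ρ b) : FormalFun ρ b :=
  derivFun v f + ∑ s ∈ reflections ρ, (reflCoef c s * root ρ s v) • (χ s * divRoot s f)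

theorem dunkl_add (v : V) (f f' : FormalFun ρ b) :
    dunkl c χ v (f + f') = dunkl c χ v f + dunkl c χ v f' := by
  have : ∀ s ∈ reflections ρ, (reflCoef c s * root ρ s v) • (χ s * divRoot s (f + f')) =
      (reflCoef c s * root ρ s v) • (χ s * divRoot s f) +
      (reflCoef c s * root ρ s v) • (χ s * divRoot s f') := by
    intro s hs
    rw [divRoot_add (mem_reflections.1 hs), mul_add, smul_add]
  rw [dunkl, Finset.sum_congr rfl this, Finset.sum_add_distrib, derivFun_add, dunkl, dunkl]
  abel

theorem dunkl_smul (v : V) (r : ℂ) (f : FormalFun ρ b) :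
    dunkl c χ v (r • f) = r • dunkl c χ v f := by
  have : ∀ s ∈ reflections ρ, (reflCoef c s * root ρ s v) • (χ s * divRoot s (r • f)) =
      r • ((reflCoef c s * root ρ s v) • (χ s * divRoot s f)) := by
    intro s hs
    rw [divRoot_smul (mem_reflections.1 hs), mul_smul_comm, smul_comm]
  rw [dunkl, Finset.sum_congr rfl this, ← Finset.smul_sum, derivFun_smul, dunkl, smul_add]

theorem dunkl_mul (v : V) (f f' : FormalFun ρ b) :
    dunkl c χ v (f * f') = f * dunkl c χ v f' + (derivFun v f * f' +
      ∑ s ∈ reflections ρ, (reflCoef c s * root ρ s v) • (χ s * divRoot s f * actFun s f')) := by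
  have : ∀ s ∈ reflections ρ, (reflCoef c s * root ρ s v) • (χ s * divRoot s (f * f')) =
      (reflCoef c s * root ρ s v) • (χ s * divRoot s f * actFun s f') +
      f * (reflCoef c s * root ρ s v) • (χ s * divRoot s f') := by
    intro s hs
    rw [divRoot_mul (mem_reflections.1 hs), mul_add, smul_add, mul_smul_comm _ f]
    congr 2 <;> ring
  rw [dunkl, Finset.sum_congr rfl this, Finset.sum_add_distrib, derivFun_mul, dunkl, mul_add,
    ← Finset.mul_sum]
  ring

theorem dunkl_add_left (v v' : V) (f : FormalFun ρ b) :
    dunkl c χ (v + v') f = dunkl c χ v f + dunkl c χ v' f := by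
  simp only [dunkl, derivFun_add_left, map_add, mul_add, add_smul, Finset.sum_add_distrib]
  abel

theorem dunkl_smul_left (r : ℂ) (v : V) (f : FormalFun ρ b) :
    dunkl c χ (r • v) f = r • dunkl c χ v f := by
  simp only [dunkl, derivFun_smul_left, map_smul, smul_add, Finset.smul_sum, smul_eq_mul, smul_smul]
  congr 1
  refine Finset.sum_congr rfl fun s _ => ?_
  congr 1
  ring

theorem dunkl_mem {v : V} {k : ℕ} {f : FormalFun ρ b} (hf : f ∈ orbIdeal ρ b ^ (k + 1)) :
    dunkl c χ v f ∈ orbIdeal ρ b ^ k :=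
  add_mem (derivFun_mem v hf) (Ideal.sum_mem _ fun _ hs => smul_mem_ideal _ _
    (Ideal.mul_mem_left _ _ (divRoot_mem (mem_reflections.1 hs) hf)))

theorem dunkl_one (v : V) : dunkl c χ v (1 : FormalFun ρ b) = 0 := by
  rw [dunkl, Finset.sum_eq_zero, add_zero]
  · rw [← map_one (locConst ρ b), derivFun_locConst]
  · intro s hs
    rw [divRoot_one (mem_reflections.1 hs), mul_zero, smul_zero]

variable {χ}

theorem actFun_dunkl (hχ : ∀ s, IsReflection ρ s → ∀ g, actFun g (χ s) = χ (g * s * g⁻¹))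
    (g : G) (v : V) (f : FormalFun ρ b) :
    actFun g (dunkl c χ v f) = dunkl c χ (ρ g v) (actFun g f) := by
  rw [dunkl, dunkl, actFun_add, derivFun_actFun, ← actHom_apply g (Finset.sum _ _), map_sum,
    ← sum_reflections_conj (fun s => (reflCoef c s * root ρ s (ρ g v)) •
      (χ s * divRoot s (actFun g f))) g]
  congr 1
  refine Finset.sum_congr rfl fun s hs => ?_
  have hs' := mem_reflections.1 hs
  rw [reflCoef_conj c hs', mul_smul, mul_smul, ← mul_smul_comm, ← mul_smul_comm (root ρ _ _),
    map_smul, map_mul, actHom_apply, actHom_apply, hχ s hs', actFun_divRoot hs']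

theorem dunkl_commute (hχ : ∀ s, IsReflection ρ s → ∀ g, actFun g (χ s) = χ (g * s * g⁻¹))
    (hχ' : ∀ s, IsReflection ρ s → ∀ v f, dunkl c χ v (χ s * f) = χ s * dunkl c χ v f)
    (a a' : V) (f : FormalFun ρ b) :
    dunkl c χ a (dunkl c χ a' f) = dunkl c χ a' (dunkl c χ a f) := by
  let L : V → FormalFun ρ b →ₗ[ℂ] FormalFun ρ b := fun v =>
    { toFun := dunkl c χ v, map_add' := dunkl_add c χ v, map_smul' := dunkl_smul c χ v }
  have hlin : ∀ (v : V) (x : Module.Dual ℂ V) (f : FormalFun ρ b),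
      L v (linFun b x * f) = linFun b x * L v f + (x v • f - ∑ s ∈ reflections ρ,
        (reflCoef c s * root ρ s v * ((1 - reflEigenvalue ρ s) / 2 * x (coroot ρ s))) •
          (χ s * actFun s f)) := by
    intro v x f
    change dunkl c χ v _ = _ * dunkl c χ v f + _
    rw [dunkl_mul, derivFun_linFun, ← Algebra.smul_def, sub_eq_add_neg, ← Finset.sum_neg_distrib]
    congr 2
    refine Finset.sum_congr rfl fun s hs => ?_
    rw [divRoot_linFun (mem_reflections.1 hs), mul_comm (χ s), ← Algebra.smul_def, smul_mul_assoc,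
      smul_smul, ← neg_smul]
    congr 1
    ring
  have key : ∀ (x : Module.Dual ℂ V) (f : FormalFun ρ b),
      L a (L a' (linFun b x * f)) - L a' (L a (linFun b x * f)) =
        linFun b x * (L a (L a' f) - L a' (L a f)) := by
    intro x f
    have h1 : ∀ (v : V), ∀ s ∈ reflections ρ, L v (χ s * actFun s f) =
        χ s * actFun s (L v f) + ((1 - (reflEigenvalue ρ s)⁻¹) / 2 * root ρ s v) •
          (χ s * actFun s (L (ρ s⁻¹ (coroot ρ s)) f)) := by
      intro v s hs
      have hs' := mem_reflections.1 hs
      change dunkl c χ v _ = χ s * actFun s (dunkl c χ v f) +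
        _ • (χ s * actFun s (dunkl c χ (ρ s⁻¹ (coroot ρ s)) f))
      rw [hχ' s hs', actFun_dunkl c hχ, actFun_dunkl c hχ, apply_inv_apply, ← mul_smul_comm,
        ← mul_add, ← dunkl_smul_left, ← rep_sub_self hs', ← dunkl_add_left, add_sub_cancel]
    have h2 : ∀ v v', L v (L v' (linFun b x * f)) = linFun b x * L v (L v' f) +
        (x v • L v' f + x v' • L v f - ∑ s ∈ reflections ρ,
          (reflCoef c s * ((1 - reflEigenvalue ρ s) / 2 * x (coroot ρ s))) •
            (root ρ s v • (χ s * actFun s (L v' f)) + root ρ s v' • (χ s * actFun s (L v f)) +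
            (root ρ s v * root ρ s v' * ((1 - (reflEigenvalue ρ s)⁻¹) / 2)) •
              (χ s * actFun s (L (ρ s⁻¹ (coroot ρ s)) f)))) := by
      intro v v'
      have h3 : ∑ s ∈ reflections ρ, L v ((reflCoef c s * root ρ s v' *
          ((1 - reflEigenvalue ρ s) / 2 * x (coroot ρ s))) • (χ s * actFun s f)) +
          ∑ s ∈ reflections ρ, (reflCoef c s * root ρ s v *
            ((1 - reflEigenvalue ρ s) / 2 * x (coroot ρ s))) • (χ s * actFun s (L v' f)) =
          ∑ s ∈ reflections ρ, (reflCoef c s * ((1 - reflEigenvalue ρ s) / 2 * x (coroot ρ s))) •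
            (root ρ s v • (χ s * actFun s (L v' f)) + root ρ s v' • (χ s * actFun s (L v f)) +
            (root ρ s v * root ρ s v' * ((1 - (reflEigenvalue ρ s)⁻¹) / 2)) •
              (χ s * actFun s (L (ρ s⁻¹ (coroot ρ s)) f))) := by
        rw [← Finset.sum_add_distrib]
        refine Finset.sum_congr rfl fun s hs => ?_
        rw [map_smul, h1 v s hs]
        module
      rw [hlin v', map_add, hlin v, map_sub, map_smul, map_sum, ← h3]
      abel
    rw [h2 a a', h2 a' a, mul_sub]
    have h4 : ∀ s, root ρ s a' • (χ s * actFun s (L a f)) + root ρ s a • (χ s * actFun s (L a' f)) +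
        (root ρ s a' * root ρ s a * ((1 - (reflEigenvalue ρ s)⁻¹) / 2)) •
          (χ s * actFun s (L (ρ s⁻¹ (coroot ρ s)) f)) =
        root ρ s a • (χ s * actFun s (L a' f)) + root ρ s a' • (χ s * actFun s (L a f)) +
        (root ρ s a * root ρ s a' * ((1 - (reflEigenvalue ρ s)⁻¹) / 2)) •
          (χ s * actFun s (L (ρ s⁻¹ (coroot ρ s)) f)) := by
      intro s
      rw [mul_comm (root ρ s a')]
      abel
    simp only [h4]
    rw [add_comm (x a' • L a f)]
    abel
  let K : FormalFun ρ b →ₗ[ℂ] FormalFun ρ b := L a ∘ₗ L a' - L a' ∘ₗ L a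
  have hK : ∀ x f, K (linFun b x * f) = linFun b x * K f := key
  have hP : ∀ P : Poly V, K (polyFun ρ b P) = 0 := by
    intro P
    induction P using MvPolynomial.induction_on with
    | C r =>
      rw [← MvPolynomial.algebraMap_eq, AlgHom.commutes, Algebra.algebraMap_eq_smul_one, map_smul]
      change r • (dunkl c χ a (dunkl c χ a' 1) - dunkl c χ a' (dunkl c χ a 1)) = 0
      have h0 : ∀ v, dunkl c χ v (0 : FormalFun ρ b) = 0 := fun v => map_zero (L v)
      rw [dunkl_one, dunkl_one, h0, h0, sub_zero, smul_zero]
    | add P Q hP hQ => rw [map_add, map_add, hP, hQ, add_zero]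
    | mul_X P i hP =>
      rw [map_mul, mul_comm]
      have : polyFun ρ b (MvPolynomial.X i) = linFun b ((Module.finBasis ℂ V).coord i) :=
        MvPolynomial.aeval_X _ _
      rw [this, hK, hP, mul_zero]
  have hK0 : K f = 0 := by
    refine eq_zero_of_forall_mem_orbIdeal_pow fun k => ?_
    obtain ⟨P, hPf⟩ := exists_poly_sub_mem f (k + 1 + 1)
    have : K f = K (f - polyFun ρ b P) := by rw [map_sub, hP, sub_zero]
    rw [this]
    exact sub_mem (dunkl_mem c χ (dunkl_mem c χ hPf)) (dunkl_mem c χ (dunkl_mem c χ hPf))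
  exact sub_eq_zero.1 hK0

theorem dunkl_one_commute (a a' : V) (f : FormalFun ρ b) :
    dunkl c 1 a (dunkl c 1 a' f) = dunkl c 1 a' (dunkl c 1 a f) :=
  dunkl_commute c (fun _ _ g => map_one (actHom ρ b g)) (fun s _ v f => by simp) a a' f

theorem dunkl_fixFun_locConst (u : orbit ρ b → ℂ) (v : V) (f : FormalFun ρ b) :
    dunkl c (fixFun ρ b) v (locConst ρ b u * f) = locConst ρ b u * dunkl c (fixFun ρ b) v f := by
  rw [dunkl, dunkl, derivFun_mul, derivFun_locConst, zero_mul, zero_add, mul_add, Finset.mul_sum]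
  congr 1
  refine Finset.sum_congr rfl fun s hs => ?_
  rw [fixFun_mul_divRoot (mem_reflections.1 hs), mul_smul_comm]

theorem dunkl_fixFun_commute (a a' : V) (f : FormalFun ρ b) :
    dunkl c (fixFun ρ b) a (dunkl c (fixFun ρ b) a' f) =
      dunkl c (fixFun ρ b) a' (dunkl c (fixFun ρ b) a f) :=
  dunkl_commute c (fun _ hs g => actFun_fixFun hs g)
    (fun _ _ v f => dunkl_fixFun_locConst c _ v f) a a' f

variable (b) in
/-- The operators on functions. -/
def funData : DunklData c b (fixFun ρ b) (Module.End ℂ (FormalFun ρ b)) where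
  ι := Algebra.lmul ℂ _
  γ :=
    { toFun := fun g => (actHom ρ b g).toLinearMap
      map_one' := LinearMap.ext fun f => actFun_one f
      map_mul' := fun g h => LinearMap.ext fun f => (actFun_actFun g h f).symm }
  Y :=
    { toFun := fun v =>
        { toFun := dunkl c (fixFun ρ b) v
          map_add' := dunkl_add c _ v
          map_smul' := dunkl_smul c _ v }
      map_add' := fun v v' => LinearMap.ext fun f => dunkl_add_left c _ v v' f
      map_smul' := fun r v => LinearMap.ext fun f => dunkl_smul_left c _ r v f }
  g_f g f := LinearMap.ext fun f' => actFun_mul g f f'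
  g_y g v := LinearMap.ext fun f => actFun_dunkl c (fun _ hs g => actFun_fixFun hs g) g v f
  y_f v f := LinearMap.ext fun f' => by
    simp only [LinearMap.add_apply, LinearMap.sum_apply, LinearMap.smul_apply,
      Module.End.mul_apply]
    exact dunkl_mul c _ v f f'

theorem funData_pert (v : V) (f : FormalFun ρ b) :
    ((funData c b).Y v + (funData c b).pert v) f = dunkl c 1 v f := by
  rw [LinearMap.add_apply, DunklData.pert, LinearMap.sum_apply]
  change dunkl c (fixFun ρ b) v f + _ = _
  rw [dunkl, dunkl, add_assoc, ← Finset.sum_add_distrib]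
  congr 1
  refine Finset.sum_congr rfl fun s hs => ?_
  have h1 : ((reflCoef c s • ((funData c b).ι (root ρ s v • rootInv ρ b s) *
      ((funData c b).γ s - 1))) : Module.End ℂ (FormalFun ρ b)) f =
      reflCoef c s • ((root ρ s v • rootInv ρ b s) * (actFun s f - f)) := rfl
  rw [h1, ← linFun_mul_divRoot (mem_reflections.1 hs), smul_mul_assoc, smul_smul, ← smul_add,
    ← mul_assoc, rootInv_mul_linFun, Pi.one_apply, one_mul, sub_mul, one_mul, add_sub_cancel]

/-- The group elements are linearly independent over functions. -/
theorem coefSum_funData_injective (hρ : Function.Injective ρ) :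
    Function.Injective (funData c b).coefSum := by
  classical
  let _ := Fintype.ofFinite G
  rw [← LinearMap.ker_eq_bot, LinearMap.ker_eq_bot']
  intro φ hφ
  funext g p
  let m : G → FormalFun ρ b →* FormalSeries V := fun g =>
    ((Pi.evalRingHom (fun _ : orbit ρ b => FormalSeries V) p).comp
      (actHom ρ b g).toRingHom).toMonoidHom
  have hm : Function.Injective m := by
    intro g h hgh
    have h1 : ∀ a : Module.Dual ℂ V, ρ.dual g a = ρ.dual h a := by
      intro a
      have h2 : actFun g (linFun b a : FormalFun ρ b) p = actFun h (linFun b a) p :=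
        DFunLike.congr_fun hgh (linFun b a)
      rw [actFun_linFun, actFun_linFun] at h2
      refine (Module.finBasis ℂ V).ext fun i => ?_
      rw [← coeff_linSeries _ (p : V), ← coeff_linSeries _ (p : V)]
      exact congrArg _ h2
    have h3 : ρ g⁻¹ = ρ h⁻¹ := by
      refine LinearMap.ext fun v => ?_
      refine (Module.finBasis ℂ V).ext_elem fun i => ?_
      have := LinearMap.congr_fun (h1 ((Module.finBasis ℂ V).coord i)) v
      rwa [dual_apply', dual_apply'] at this
    exact inv_injective (hρ h3)
  have : IsDomain (FormalSeries V) := NoZeroDivisors.to_isDomain _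
  have hli := (linearIndependent_monoidHom (FormalFun ρ b) (FormalSeries V)).comp m hm
  rw [Fintype.linearIndependent_iff] at hli
  refine hli (fun g => φ g p) ?_ g
  funext f
  have h4 := congrFun (LinearMap.congr_fun hφ f) p
  rw [DunklData.coefSum_apply, LinearMap.sum_apply, Finset.sum_apply] at h4
  rw [Finset.sum_apply]
  exact h4

/-- Adding the terms with poles does not change the commutators of the Dunkl operators. -/
theorem DunklData.pert_commutator (hρ : Function.Injective ρ) {R : Type*} [Ring R] [Algebra ℂ R]
    (D : DunklData c b (fixFun ρ b) R) (a a' : V) :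
    (D.Y a + D.pert a) * (D.Y a' + D.pert a') - (D.Y a' + D.pert a') * (D.Y a + D.pert a) =
      D.Y a * D.Y a' - D.Y a' * D.Y a := by
  let _ := Fintype.ofFinite G
  obtain ⟨φ, hφ⟩ := (D.prod (funData c b)).pert_commutator_mem a a'
  have hfst : ∀ v, ((D.prod (funData c b)).pert v).1 = D.pert v := by
    intro v; simp only [DunklData.pert, Prod.fst_sum]; rfl
  have hsnd : ∀ v, ((D.prod (funData c b)).pert v).2 = (funData c b).pert v := by
    intro v; simp only [DunklData.pert, Prod.snd_sum]; rfl
  have h1 : (funData c b).coefSum φ = 0 := by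
    have h2 := congrArg Prod.snd hφ
    have h3 : ((D.prod (funData c b)).coefSum φ).2 = (funData c b).coefSum φ := by
      rw [DunklData.coefSum_apply, DunklData.coefSum_apply, Prod.snd_sum]; rfl
    rw [h3] at h2
    rw [h2]
    simp only [Prod.snd_sub, Prod.snd_mul, Prod.snd_add, hsnd]
    refine LinearMap.ext fun f => ?_
    change ((funData c b).Y a + (funData c b).pert a)
      (((funData c b).Y a' + (funData c b).pert a') f) -
      ((funData c b).Y a' + (funData c b).pert a')
      (((funData c b).Y a + (funData c b).pert a) f) -
      (dunkl c (fixFun ρ b) a (dunkl c (fixFun ρ b) a' f) -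
      dunkl c (fixFun ρ b) a' (dunkl c (fixFun ρ b) a f)) = 0
    rw [funData_pert, funData_pert, funData_pert, funData_pert, dunkl_one_commute,
      dunkl_fixFun_commute, sub_self, sub_self, sub_self]
  have h4 : φ = 0 := coefSum_funData_injective c hρ (h1.trans (map_zero _).symm)
  rw [h4, map_zero] at hφ
  have h5 := congrArg Prod.fst hφ
  simp only [Prod.fst_sub, Prod.fst_mul, Prod.fst_add, hfst] at h5
  exact sub_eq_zero.1 h5.symm

end Operators

end Dunkl

section HatAlgebra

variable {G V : Type u} [Group G] [Finite G] [AddCommGroup V] [Module ℂ V] [FiniteDimensional ℂ V]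
variable (ρ : Representation ℂ G V) (c : Param ρ) (b : V)

namespace HHat

/-- The functions, as a subalgebra of the completed algebra. -/
def fHom : FormalFun ρ b →ₐ[ℂ] HHat ρ c b where
  toFun := f ρ c b
  map_one' := by
    have h := mk_rel (HatRel.f_const (ρ := ρ) (c := c) (b := b) 1)
    rwa [map_one, map_one, map_one] at h
  map_mul' φ ψ := by simpa [f] using mk_rel (HatRel.f_mul (ρ := ρ) (c := c) φ ψ)
  map_zero' := by
    have h := mk_rel (HatRel.f_const (ρ := ρ) (c := c) (b := b) 0)
    rwa [map_zero, map_zero, map_zero] at h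
  map_add' φ ψ := by simpa [f] using mk_rel (HatRel.f_add (ρ := ρ) (c := c) φ ψ)
  commutes' r := by
    have h := mk_rel (HatRel.f_const (ρ := ρ) (c := c) (b := b) r)
    rwa [AlgHom.commutes] at h

theorem f_zero : f ρ c b 0 = 0 := map_zero (fHom ρ c b)

theorem f_one : f ρ c b 1 = 1 := map_one (fHom ρ c b)

theorem f_mul (φ ψ : FormalFun ρ b) : f ρ c b (φ * ψ) = f ρ c b φ * f ρ c b ψ :=
  map_mul (fHom ρ c b) φ ψ

theorem f_add (φ ψ : FormalFun ρ b) : f ρ c b (φ + ψ) = f ρ c b φ + f ρ c b ψ :=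
  map_add (fHom ρ c b) φ ψ

theorem f_smul (r : ℂ) (φ : FormalFun ρ b) : f ρ c b (r • φ) = r • f ρ c b φ :=
  map_smul (fHom ρ c b) r φ

/-- The group, as a subgroup of the completed algebra. -/
def gHom : G →* HHat ρ c b where
  toFun := g ρ c b
  map_one' := by simpa [g] using mk_rel (HatRel.g_one (ρ := ρ) (c := c) (b := b))
  map_mul' u w := by simpa [g] using mk_rel (HatRel.g_mul (ρ := ρ) (c := c) (b := b) u w)

theorem g_one : g ρ c b 1 = 1 := map_one (gHom ρ c b)

theorem g_mul (u w : G) : g ρ c b (u * w) = g ρ c b u * g ρ c b w := map_mul (gHom ρ c b) u w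

/-- The map `y`, as a linear map. -/
def yLin : V →ₗ[ℂ] HHat ρ c b where
  toFun := y ρ c b
  map_add' v v' := by simpa [y] using mk_rel (HatRel.y_add (ρ := ρ) (c := c) (b := b) v v')
  map_smul' r v := by simpa [y] using mk_rel (HatRel.y_smul (ρ := ρ) (c := c) (b := b) r v)

theorem y_y (v v' : V) : y ρ c b v * y ρ c b v' = y ρ c b v' * y ρ c b v := by
  simpa [y] using mk_rel (HatRel.y_y (ρ := ρ) (c := c) (b := b) v v')

/-- The relations of the completed algebra. -/
def data : DunklData c b 1 (HHat ρ c b) where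
  ι := fHom ρ c b
  γ := gHom ρ c b
  Y := yLin ρ c b
  g_f w φ := by
    have h := mk_rel (HatRel.g_f (ρ := ρ) (c := c) (b := b) w φ)
    rwa [map_mul, map_mul] at h
  g_y w v := by
    have h := mk_rel (HatRel.g_y (ρ := ρ) (c := c) (b := b) w v)
    rwa [map_mul, map_mul] at h
  y_f v φ := by
    have h := mk_rel (HatRel.y_f (ρ := ρ) (c := c) (b := b) v φ (fun s => divRoot s φ)
      fun s hs => linFun_mul_divRoot (mem_reflections.1 hs) φ)
    simp only [map_mul, map_add, map_sum, map_smul] at h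
    simp only [Pi.one_apply, one_mul]
    exact h

theorem g_f (w : G) (φ : FormalFun ρ b) :
    g ρ c b w * f ρ c b φ = f ρ c b (actFun w φ) * g ρ c b w := (data ρ c b).g_f w φ

theorem g_y (w : G) (v : V) : g ρ c b w * y ρ c b v = y ρ c b (ρ w v) * g ρ c b w :=
  (data ρ c b).g_y w v

theorem y_f (v : V) (φ : FormalFun ρ b) : y ρ c b v * f ρ c b φ = f ρ c b φ * y ρ c b v +
    (f ρ c b (derivFun v φ) + ∑ s ∈ reflections ρ, (reflCoef c s * root ρ s v) •
      (f ρ c b (divRoot s φ) * g ρ c b s)) := by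
  have := (data ρ c b).y_f v φ
  simp only [Pi.one_apply, one_mul] at this
  exact this

variable {ρ c b} {R : Type*} [Ring R] [Algebra ℂ R]

/-- The universal property of the completed algebra. -/
def lift (D : DunklData c b 1 R) (hD : ∀ v v', D.Y v * D.Y v' = D.Y v' * D.Y v) :
    HHat ρ c b →ₐ[ℂ] R :=
  RingQuot.liftAlgHom ℂ ⟨FreeAlgebra.lift ℂ fun
    | .f φ => D.ι φ
    | .y v => D.Y v
    | .g w => D.γ w, by
    intro z z' h
    cases h with
    | f_add φ ψ => simp
    | f_mul φ ψ => simp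
    | f_const r =>
      rw [FreeAlgebra.lift_ι_apply, AlgHom.commutes]
      exact D.ι.commutes r
    | y_add v v' => simp
    | y_smul r v => simp
    | g_one => simp
    | g_mul u w => simp
    | g_f w φ => simpa using D.g_f w φ
    | g_y w v => simpa using D.g_y w v
    | y_y v v' => simpa using hD v v'
    | y_f v φ q hq =>
      have h1 := D.y_f v φ
      have h2 : ∀ s ∈ reflections ρ, (reflCoef c s * root ρ s v) •
          (D.ι ((1 : G → FormalFun ρ b) s * divRoot s φ) * D.γ s) =
          (2 * c.val s / (1 - reflEigenvalue ρ s) * root ρ s v) • (D.ι (q s) * D.γ s) := by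
        intro s hs
        rw [Pi.one_apply, one_mul, ← eq_divRoot (mem_reflections.1 hs) (hq s hs)]
        rfl
      rw [Finset.sum_congr rfl h2] at h1
      simpa using h1⟩

section Lift

variable (D : DunklData c b 1 R) (hD : ∀ v v', D.Y v * D.Y v' = D.Y v' * D.Y v)

theorem lift_mk (z : FreeAlgebra ℂ (HatGen ρ b)) :
    lift D hD (mk ρ c b z) = FreeAlgebra.lift ℂ (fun
    | .f φ => D.ι φ
    | .y v => D.Y v
    | .g w => D.γ w) z := by
  unfold lift mk
  exact RingQuot.liftAlgHom_mkAlgHom_apply _ _ _ _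

theorem lift_f (φ : FormalFun ρ b) : lift D hD (f ρ c b φ) = D.ι φ := by
  rw [f, lift_mk, FreeAlgebra.lift_ι_apply]

theorem lift_y (v : V) : lift D hD (y ρ c b v) = D.Y v := by
  rw [y, lift_mk, FreeAlgebra.lift_ι_apply]

theorem lift_g (w : G) : lift D hD (g ρ c b w) = D.γ w := by
  rw [g, lift_mk, FreeAlgebra.lift_ι_apply]

end Lift

/-- Induction over the generators of the completed algebra. -/
theorem induction {P : HHat ρ c b → Prop} (hf : ∀ φ, P (f ρ c b φ)) (hy : ∀ v, P (y ρ c b v))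
    (hg : ∀ w, P (g ρ c b w)) (hadd : ∀ z z', P z → P z' → P (z + z'))
    (hmul : ∀ z z', P z → P z' → P (z * z')) (z : HHat ρ c b) : P z := by
  obtain ⟨z, rfl⟩ := RingQuot.mkAlgHom_surjective ℂ (HatRel ρ c b) z
  change P (mk ρ c b z)
  induction z using FreeAlgebra.induction with
  | grade0 r =>
    rw [AlgHom.commutes, ← AlgHom.commutes (fHom ρ c b)]
    exact hf _
  | grade1 i =>
    cases i with
    | f φ => exact hf φ
    | y v => exact hy v
    | g w => exact hg w
  | mul z z' h h' => rw [map_mul]; exact hmul _ _ h h'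
  | add z z' h h' => rw [map_add]; exact hadd _ _ h h'

theorem ofH_mk (z : FreeAlgebra ℂ (Gen G V)) :
    ofH ρ c b (H.mk ρ c z) = FreeAlgebra.lift ℂ (ofGen ρ c b) z := by
  unfold ofH H.mk
  exact RingQuot.liftAlgHom_mkAlgHom_apply _ _ _ _

theorem ofH_x (a : Module.Dual ℂ V) : ofH ρ c b (H.x ρ c a) = f ρ c b (linFun b a) := by
  rw [H.x, ofH_mk, FreeAlgebra.lift_ι_apply, ofGen]

theorem ofH_y (v : V) : ofH ρ c b (H.y ρ c v) = y ρ c b v := by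
  rw [H.y, ofH_mk, FreeAlgebra.lift_ι_apply, ofGen]

theorem ofH_g (w : G) : ofH ρ c b (H.g ρ c w) = g ρ c b w := by
  rw [H.g, ofH_mk, FreeAlgebra.lift_ι_apply, ofGen]

end HHat

namespace DunklData

variable {ρ c b} {χ : G → FormalFun ρ b} {R : Type*} [Ring R] [Algebra ℂ R]
variable (D : DunklData c b χ R)

theorem pert_f (v : V) (f : FormalFun ρ b) : D.pert v * D.ι f = D.ι f * D.pert v +
    ∑ s ∈ reflections ρ, (reflCoef c s * root ρ s v) •
      (D.ι ((1 - fixFun ρ b s) * divRoot s f) * D.γ s) := by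
  rw [pert, Finset.sum_mul, Finset.mul_sum, ← Finset.sum_add_distrib]
  refine Finset.sum_congr rfl fun s hs => ?_
  rw [← rootInv_mul_linFun, mul_assoc (rootInv ρ b s), linFun_mul_divRoot (mem_reflections.1 hs),
    mul_smul_comm, smul_mul_assoc, mul_smul, ← smul_add]
  congr 1
  have h1 : D.ι (root ρ s v • rootInv ρ b s) * (D.γ s - 1) * D.ι f =
      root ρ s v • (D.ι (rootInv ρ b s) * (D.ι (actFun s f) * D.γ s - D.ι f)) := by
    rw [mul_assoc, sub_mul, D.g_f, one_mul, map_smul, smul_mul_assoc]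
  have h2 : D.ι f * (D.ι (root ρ s v • rootInv ρ b s) * (D.γ s - 1)) =
      root ρ s v • (D.ι (rootInv ρ b s) * (D.ι f * (D.γ s - 1))) := by
    rw [map_smul, smul_mul_assoc, mul_smul_comm, ← mul_assoc, ← mul_assoc, ← map_mul, ← map_mul,
      mul_comm f]
  rw [h1, h2, ← smul_add, map_mul, map_sub]
  congr 1
  noncomm_ring

/-- Adding the terms with poles. -/
def addPert (D : DunklData c b (fixFun ρ b) R) : DunklData c b 1 R where
  ι := D.ι
  γ := D.γ
  Y := D.Y + { toFun := D.pert, map_add' := D.pert_add, map_smul' := D.pert_smul }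
  g_f := D.g_f
  g_y g v := by
    change D.γ g * (D.Y v + D.pert v) = (D.Y (ρ g v) + D.pert (ρ g v)) * D.γ g
    rw [mul_add, add_mul, D.g_y, D.g_pert]
  y_f v f := by
    change (D.Y v + D.pert v) * D.ι f = D.ι f * (D.Y v + D.pert v) + _
    rw [add_mul, D.y_f, D.pert_f, mul_add]
    have : ∀ s, (reflCoef c s * root ρ s v) •
        (D.ι ((1 : G → FormalFun ρ b) s * divRoot s f) * D.γ s) =
        (reflCoef c s * root ρ s v) • (D.ι (fixFun ρ b s * divRoot s f) * D.γ s) +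
        (reflCoef c s * root ρ s v) • (D.ι ((1 - fixFun ρ b s) * divRoot s f) * D.γ s) := by
      intro s
      rw [← smul_add, ← add_mul, ← map_add, ← add_mul, add_sub_cancel, Pi.one_apply]
    simp only [this, Finset.sum_add_distrib]
    abel

theorem addPert_Y (D : DunklData c b (fixFun ρ b) R) (v : V) :
    D.addPert.Y v = D.Y v + D.pert v := rfl

/-- Removing the terms with poles. -/
def subPert (D : DunklData c b 1 R) : DunklData c b (fixFun ρ b) R where
  ι := D.ι
  γ := D.γ
  Y := D.Y - { toFun := D.pert, map_add' := D.pert_add, map_smul' := D.pert_smul }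
  g_f := D.g_f
  g_y g v := by
    change D.γ g * (D.Y v - D.pert v) = (D.Y (ρ g v) - D.pert (ρ g v)) * D.γ g
    rw [mul_sub, sub_mul, D.g_y, D.g_pert]
  y_f v f := by
    change (D.Y v - D.pert v) * D.ι f = D.ι f * (D.Y v - D.pert v) + _
    rw [sub_mul, D.y_f, D.pert_f, mul_sub]
    have : ∀ s, (reflCoef c s * root ρ s v) •
        (D.ι ((1 : G → FormalFun ρ b) s * divRoot s f) * D.γ s) =
        (reflCoef c s * root ρ s v) • (D.ι (fixFun ρ b s * divRoot s f) * D.γ s) +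
        (reflCoef c s * root ρ s v) • (D.ι ((1 - fixFun ρ b s) * divRoot s f) * D.γ s) := by
      intro s
      rw [← smul_add, ← add_mul, ← map_add, ← add_mul, add_sub_cancel, Pi.one_apply]
    simp only [this, Finset.sum_add_distrib]
    abel

theorem addPert_commute (hρ : Function.Injective ρ) (D : DunklData c b (fixFun ρ b) R)
    (hD : ∀ v v', D.Y v * D.Y v' = D.Y v' * D.Y v) (v v' : V) :
    D.addPert.Y v * D.addPert.Y v' = D.addPert.Y v' * D.addPert.Y v := by
  rw [addPert_Y, addPert_Y, ← sub_eq_zero, D.pert_commutator c hρ, hD, sub_self]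

theorem subPert_commute (hρ : Function.Injective ρ) (D : DunklData c b 1 R)
    (hD : ∀ v v', D.Y v * D.Y v' = D.Y v' * D.Y v) (v v' : V) :
    D.subPert.Y v * D.subPert.Y v' = D.subPert.Y v' * D.subPert.Y v := by
  have h := D.subPert.pert_commutator c hρ v v'
  have hY : ∀ v, D.subPert.Y v + D.subPert.pert v = D.Y v := fun v => sub_add_cancel _ _
  rw [hY, hY, hD, sub_self] at h
  exact sub_eq_zero.1 h.symm

end DunklData

end HatAlgebra

section TensorLift

variable {R S : Type u} [Ring R] [Ring S] {P : Type u} [AddCommGroup P] [Module S P]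
  (act : R → P →ₗ[S] P) (M : ModuleCat.{u} R)

/-- The class of `p ⊗ m`. -/
def tensorMk (p : P) (m : M) : (tensorFunctor P act).obj M := Submodule.Quotient.mk (p ⊗ₜ[ℤ] m)

theorem tensorMk_act (p : P) (r : R) (m : M) :
    tensorMk act M (act r p) m = tensorMk act M p (r • m) :=
  (Submodule.Quotient.eq _).2 (Submodule.subset_span ⟨p, r, m, rfl⟩)

theorem tensorMk_add (p : P) (m m' : M) :
    tensorMk act M p (m + m') = tensorMk act M p m + tensorMk act M p m' :=
  congrArg Submodule.Quotient.mk (TensorProduct.tmul_add p m m')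

theorem tensorMk_zero (p : P) : tensorMk act M p 0 = 0 :=
  congrArg Submodule.Quotient.mk (TensorProduct.tmul_zero _ p)

variable {act M} in
theorem tensor_induction {Q : (tensorFunctor P act).obj M → Prop}
    (add : ∀ t t', Q t → Q t' → Q (t + t')) (mk : ∀ p m, Q (tensorMk act M p m))
    (t : (tensorFunctor P act).obj M) : Q t := by
  obtain ⟨t, rfl⟩ := Submodule.Quotient.mk_surjective _ t
  induction t using TensorProduct.induction_on with
  | zero =>
    have := mk 0 0
    rwa [tensorMk_zero] at this
  | tmul p m => exact mk p m
  | add t t' ht ht' => exact add _ _ ht ht'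

section Lift

variable {N : Type*} [AddCommGroup N] (φ : P →+ M →+ N)
  (hb : ∀ p r m, φ (act r p) m = φ p (r • m))

/-- Additive maps out of `P ⊗_R M`. -/
def tensorLiftAdd : (tensorFunctor P act).obj M →+ N :=
  QuotientAddGroup.lift (balancedRelations P act M).toAddSubgroup
    (TensorProduct.liftAddHom φ fun n p m => by simp) (by
      intro t ht
      have key : ∀ s : S, TensorProduct.liftAddHom φ (fun n p m => by simp) (s • t) = 0 := by
        induction ht using Submodule.span_induction with
        | mem t ht =>
          obtain ⟨p, r, m, rfl⟩ := ht
          intro s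
          rw [smul_sub, TensorProduct.smul_tmul', TensorProduct.smul_tmul', ← map_smul, map_sub,
            TensorProduct.liftAddHom_tmul, TensorProduct.liftAddHom_tmul, hb, sub_self]
        | zero => intro s; rw [smul_zero, map_zero]
        | add t t' _ _ ht ht' => intro s; rw [smul_add, map_add, ht, ht', add_zero]
        | smul s' t _ ht => intro s; rw [← mul_smul]; exact ht _
      have := key 1
      rwa [one_smul] at this)

end Lift

section Lift

variable {N : Type*} [AddCommGroup N] [Module S N] (φ : P →+ M →+ N)
  (hs : ∀ (s : S) p m, φ (s • p) m = s • φ p m) (hb : ∀ p r m, φ (act r p) m = φ p (r • m))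

/-- Linear maps out of `P ⊗_R M`. -/
def tensorLift : (tensorFunctor P act).obj M →ₗ[S] N where
  toFun := tensorLiftAdd act M φ hb
  map_add' := map_add _
  map_smul' s t := by
    induction t using tensor_induction with
    | add t t' ht ht' => rw [smul_add, map_add, map_add, smul_add, ht, ht']
    | mk p m => exact hs s p m

end Lift

end TensorLift

section CentralizerEquivalence

variable {G A : Type u} [Group G] [Ring A] {K : Subgroup G} {j : K → A}

namespace FunK

theorem coe_mem (F : FunK K j) {h : G} (hh : h ∈ K) : F.1 h = j ⟨h, hh⟩ * F.1 1 := by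
  have := F.2 ⟨h, hh⟩ 1
  simpa using this

variable (K j) in
/-- Right translation. -/
def translation (u : G) : Centralizer K j where
  toFun F := ⟨fun w => F.1 (w * u), fun h w => by
    change F.1 (h * w * u) = j h * F.1 (w * u)
    rw [mul_assoc]; exact F.2 h _⟩
  map_add' F F' := rfl
  map_smul' a F := rfl

theorem translation_apply (u : G) (F : FunK K j) (w : G) :
    (translation K j u F).1 w = F.1 (w * u) := rfl

/-- Left multiplication by a function with values in `A`. -/
def diagonal (a : G → A) (ha : ∀ (h : K) (w : G), a (h * w) * j h = j h * a w) :
    Centralizer K j where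
  toFun F := ⟨fun w => a w * F.1 w, fun h w => by
    change a (h * w) * F.1 (h * w) = j h * (a w * F.1 w)
    rw [F.2 h w, ← mul_assoc, ha, mul_assoc]⟩
  map_add' F F' := Subtype.ext (funext fun w => mul_add (a w) (F.1 w) (F'.1 w))
  map_smul' r F := Subtype.ext (funext fun w => (mul_assoc (a w) (F.1 w) r.unop).symm)

theorem diagonal_apply (a : G → A) (ha : ∀ (h : K) (w : G), a (h * w) * j h = j h * a w)
    (F : FunK K j) (w : G) : (diagonal a ha F).1 w = a w * F.1 w := rfl

/-- The operator `F' ↦ F F'(1)`. -/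
def rankOne (F : FunK K j) : Centralizer K j where
  toFun F' := MulOpposite.op (F'.1 1) • F
  map_add' F' F'' := by
    rw [← add_smul]; rfl
  map_smul' a F' := by
    rw [RingHom.id_apply, ← mul_smul]; rfl

theorem rankOne_apply (F F' : FunK K j) (w : G) : (rankOne F F').1 w = F.1 w * F'.1 1 := rfl

theorem mul_rankOne (z : Centralizer K j) (F : FunK K j) : z * rankOne F = rankOne (z F) := by
  refine LinearMap.ext fun F' => ?_
  exact map_smul z (MulOpposite.op (F'.1 1)) F

variable (hj1 : j 1 = 1) (hjm : ∀ h h', j (h * h') = j h * j h')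

open Classical in
/-- The function supported on `K` whose value at one is one. -/
def basePoint (hjm : ∀ h h', j (h * h') = j h * j h') : FunK K j :=
  ⟨fun w => if h : w ∈ K then j ⟨w, h⟩ else 0, fun h w => by
    beta_reduce
    by_cases hw : w ∈ K
    · have : (h : G) * w ∈ K := K.mul_mem h.2 hw
      rw [dif_pos this, dif_pos hw, ← hjm]
      rfl
    · have : (h : G) * w ∉ K := fun h' => hw ((K.mul_mem_cancel_left h.2).1 h')
      rw [dif_neg this, dif_neg hw, mul_zero]⟩

theorem basePoint_apply_mem {w : G} (hw : w ∈ K) : (basePoint hjm).1 w = j ⟨w, hw⟩ := dif_pos hw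

theorem basePoint_apply_notMem {w : G} (hw : w ∉ K) : (basePoint hjm).1 w = 0 := dif_neg hw

include hj1 in
theorem basePoint_one : (basePoint hjm).1 1 = 1 := by
  rw [basePoint_apply_mem hjm K.one_mem]; exact hj1

/-- The element of the centralizer algebra attached to an element of `A`. -/
def corner (a : A) : Centralizer K j := rankOne (MulOpposite.op a • basePoint hjm)

theorem corner_apply (a : A) (F : FunK K j) (w : G) :
    (corner hjm a F).1 w = (basePoint hjm).1 w * (a * F.1 1) := mul_assoc _ _ _

theorem corner_add (a a' : A) : corner hjm (a + a') = corner hjm a + corner hjm a' := by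
  refine LinearMap.ext fun F => Subtype.ext (funext fun w => ?_)
  rw [corner_apply, add_mul, mul_add]
  exact congrArg₂ (· + ·) (corner_apply hjm a F w).symm (corner_apply hjm a' F w).symm

theorem corner_zero : corner hjm (0 : A) = 0 := by
  refine LinearMap.ext fun F => Subtype.ext (funext fun w => ?_)
  rw [corner_apply, zero_mul, mul_zero]
  rfl

include hj1 in
theorem corner_apply_one (a : A) (F : FunK K j) : (corner hjm a F).1 1 = a * F.1 1 := by
  rw [corner_apply, basePoint_one hj1, one_mul]

include hj1 in
theorem corner_mul (a a' : A) : corner hjm (a * a') = corner hjm a * corner hjm a' := by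
  refine LinearMap.ext fun F => Subtype.ext (funext fun w => ?_)
  change _ = (corner hjm a (corner hjm a' F)).1 w
  rw [corner_apply, corner_apply, corner_apply_one hj1, mul_assoc]

include hj1 in
theorem corner_injective : Function.Injective (corner hjm : A → Centralizer K j) := by
  intro a a' h
  have := congrArg (fun z : Centralizer K j => (z (basePoint hjm)).1 1) h
  simpa only [corner_apply_one hj1, basePoint_one hj1, mul_one] using this

include hj1 in
theorem corner_sandwich (z : Centralizer K j) :
    corner hjm 1 * z * corner hjm 1 = corner hjm ((z (basePoint hjm)).1 1) := by
  have h1 : z * corner hjm 1 = rankOne (z (basePoint hjm)) := by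
    rw [corner, mul_rankOne]
    congr 2
    exact one_smul _ _
  rw [mul_assoc, h1]
  refine LinearMap.ext fun F => Subtype.ext (funext fun w => ?_)
  change (corner hjm 1 (rankOne (z (basePoint hjm)) F)).1 w = _
  rw [corner_apply, corner_apply, one_mul, rankOne_apply]

theorem corner_one_eq : rankOne (basePoint hjm) = corner hjm 1 := by
  rw [corner]; congr 1; exact (one_smul _ _).symm

theorem rankOne_smul (F : FunK K j) (a : A) (hj1 : j 1 = 1) :
    rankOne (MulOpposite.op a • F) = rankOne F * corner hjm a := by
  refine LinearMap.ext fun F' => Subtype.ext (funext fun w => ?_)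
  change F.1 w * a * F'.1 1 = (rankOne F (corner hjm a F')).1 w
  rw [rankOne_apply, corner_apply_one hj1, mul_assoc]

include hj1 in
theorem sum_translation [Fintype G] (F : FunK K j) :
    ∑ r, (translation K j r⁻¹ * corner hjm 1 * translation K j r) F = Nat.card K • F := by
  classical
  refine Subtype.ext (funext fun w => ?_)
  have h1 : ∀ r : G, ((translation K j r⁻¹ * corner hjm 1 * translation K j r) F).1 w =
      if w * r⁻¹ ∈ K then F.1 w else 0 := by
    intro r
    change (corner hjm 1 (translation K j r F)).1 (w * r⁻¹) = _
    rw [corner_apply, translation_apply, one_mul, one_mul]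
    split_ifs with h
    · rw [basePoint_apply_mem hjm h, ← F.2 ⟨_, h⟩ r]
      simp
    · rw [basePoint_apply_notMem hjm h, zero_mul]
  have h2 : (∑ r, (translation K j r⁻¹ * corner hjm 1 * translation K j r) F).1 w =
      ∑ r, ((translation K j r⁻¹ * corner hjm 1 * translation K j r) F).1 w := by
    refine (congrFun (map_sum (FunK K j).subtype _ _) w).trans ?_
    rw [Finset.sum_apply]
    rfl
  rw [h2]
  simp only [h1]
  rw [Finset.sum_ite, Finset.sum_const_zero, add_zero, Finset.sum_const]
  have h3 : (Finset.univ.filter fun r : G => w * r⁻¹ ∈ K).card = Nat.card K := by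
    rw [Nat.card_eq_fintype_card, ← Finset.card_univ]
    refine Finset.card_bij' (fun r hr => ⟨w * r⁻¹, (Finset.mem_filter.1 hr).2⟩)
      (fun h _ => (h : G)⁻¹ * w) ?_ ?_ ?_ ?_
    · simp
    · intro h _; simp
    · intro r _; simp
    · intro h _; simp
  rw [h3]
  rfl

end FunK

end CentralizerEquivalence

section CentralizerEquivalence

variable {G A : Type u} [Group G] [Finite G] [Ring A] [Algebra ℂ A] {K : Subgroup G} {j : K → A}
variable (hj1 : j 1 = 1) (hjm : ∀ h h', j (h * h') = j h * j h')

open FunK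

include hj1 in
theorem FunK.mem_of_corner_one {N : Type*} [AddCommGroup N] [Module (Centralizer K j) N]
    (L : AddSubgroup N) (hL : ∀ z : Centralizer K j, ∀ n ∈ L, z • n ∈ L) (n : N)
    (h : ∀ r, corner hjm 1 • translation K j r • n ∈ L) : n ∈ L := by
  let _ := Fintype.ofFinite G
  have h1 : algebraMap ℂ (Centralizer K j) (Nat.card K : ℂ)⁻¹ *
      ∑ r, translation K j r⁻¹ * corner hjm 1 * translation K j r = 1 := by
    refine LinearMap.ext fun F => ?_
    rw [Module.End.mul_apply, LinearMap.sum_apply, sum_translation hj1 hjm,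
      Module.algebraMap_end_apply, ← Nat.cast_smul_eq_nsmul ℂ, smul_smul, inv_mul_cancel₀,
      one_smul, Module.End.one_apply]
    exact_mod_cast Nat.card_pos.ne'
  have h2 : n = (algebraMap ℂ (Centralizer K j) (Nat.card K : ℂ)⁻¹) •
      ∑ r, translation K j r⁻¹ • corner hjm 1 • translation K j r • n := by
    conv_lhs => rw [← one_smul (Centralizer K j) n, ← h1, mul_smul, Finset.sum_smul]
    simp only [mul_smul]
  rw [h2]
  exact hL _ _ (AddSubgroup.sum_mem _ fun r _ => hL _ _ (h r))

section Equivalence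

/-- The class of `F ⊗ m`. -/
def inductionMk (M : ModuleCat.{u} A) (F : FunK K j) (m : M) : (inductionFunctor K j).obj M :=
  tensorMk (S := Centralizer K j) _ M F m

variable (M : ModuleCat.{u} A)

theorem inductionMk_smul (F : FunK K j) (a : A) (m : M) :
    inductionMk M (MulOpposite.op a • F) m = inductionMk M F (a • m) :=
  tensorMk_act (S := Centralizer K j) _ M F a m

theorem inductionMk_add (F : FunK K j) (m m' : M) :
    inductionMk M F (m + m') = inductionMk M F m + inductionMk M F m' :=
  tensorMk_add (S := Centralizer K j) _ M F m m'

variable {M} in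
theorem inductionFunctor_induction {Q : (inductionFunctor K j).obj M → Prop}
    (add : ∀ t t', Q t → Q t' → Q (t + t')) (mk : ∀ F m, Q (inductionMk M F m))
    (t : (inductionFunctor K j).obj M) : Q t :=
  tensor_induction (S := Centralizer K j) add mk t

/-- Evaluation at one. -/
def inductionEval : (inductionFunctor K j).obj M →+ M :=
  tensorLiftAdd (S := Centralizer K j) _ M
    ({ toFun := fun F => { toFun := fun m => F.1 1 • m, map_zero' := smul_zero _,
                           map_add' := smul_add _ }
       map_zero' := by ext m; exact zero_smul A m
       map_add' := fun F F' => by ext m; exact add_smul (F.1 1) (F'.1 1) m } :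
      FunK K j →+ M →+ M)
    fun F a m => mul_smul (F.1 1) a m

theorem inductionEval_mk (F : FunK K j) (m : M) : inductionEval M (inductionMk M F m) = F.1 1 • m :=
  rfl

theorem corner_smul_eq (a : A) (t : (inductionFunctor K j).obj M) :
    corner hjm a • t = inductionMk M (basePoint hjm) (a • inductionEval M t) := by
  induction t using inductionFunctor_induction with
  | add t t' ht ht' => rw [smul_add, ht, ht', map_add, smul_add, inductionMk_add]
  | mk F m =>
    change inductionMk M (corner hjm a F) m = inductionMk M (basePoint hjm) (a • (F.1 1 • m))
    rw [← mul_smul, ← inductionMk_smul]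
    congr 1
    refine Subtype.ext (funext fun w => ?_)
    rw [corner_apply]
    rfl

include hj1 in
theorem inductionEval_corner (a : A) (t : (inductionFunctor K j).obj M) :
    inductionEval M (corner hjm a • t) = a • inductionEval M t := by
  rw [corner_smul_eq, inductionEval_mk, basePoint_one hj1, one_smul]

theorem inductionFunctor_map_mk {M N : ModuleCat.{u} A} (f : M ⟶ N) (F : FunK K j) (m : M) :
    ((inductionFunctor K j).map f).hom (inductionMk M F m) = inductionMk N F (f.hom m) := rfl

include hj1 in
theorem inductionFunctor_hom_ext {M : ModuleCat.{u} A} {N : ModuleCat.{u} (Centralizer K j)}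
    {φ ψ : (inductionFunctor K j).obj M ⟶ N}
    (h : ∀ m, φ.hom (inductionMk M (basePoint hjm) m) = ψ.hom (inductionMk M (basePoint hjm) m)) :
    φ = ψ := by
  refine ModuleCat.hom_ext (LinearMap.ext fun t => ?_)
  refine mem_of_corner_one hj1 hjm (LinearMap.eqLocus φ.hom ψ.hom).toAddSubgroup
    (fun z n hn => Submodule.smul_mem _ z hn) t fun r => ?_
  rw [corner_smul_eq]
  exact h _

/-- The module `e N` over `A`, for the idempotent `e` attached to the unit coset. -/
@[reducible] def CornerModule (hjm : ∀ h h', j (h * h') = j h * j h')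
    (N : Type u) [AddCommGroup N] [Module (Centralizer K j) N] : Type u :=
  (DistribSMul.toAddMonoidHom N (corner hjm (1 : A))).range

variable (N : Type u) [AddCommGroup N] [Module (Centralizer K j) N]

include hj1 in
theorem corner_smul_mem (a : A) (n : N) :
    corner hjm a • n ∈ (DistribSMul.toAddMonoidHom N (corner hjm (1 : A))).range := by
  refine ⟨corner hjm a • n, ?_⟩
  change corner hjm 1 • corner hjm a • n = corner hjm a • n
  rw [← mul_smul, ← corner_mul hj1, one_mul]

/-- The action of `A` on `e N`. -/
@[reducible] def cornerModule (hj1 : j 1 = 1) : Module A (CornerModule hjm N) where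
  smul a n := ⟨corner hjm a • n.1, corner_smul_mem hj1 hjm N a n.1⟩
  one_smul n := by
    obtain ⟨n, n', rfl⟩ := n
    refine Subtype.ext ?_
    change corner hjm 1 • corner hjm 1 • n' = corner hjm 1 • n'
    rw [← mul_smul, ← corner_mul hj1, one_mul]
  mul_smul a a' n := Subtype.ext (by
    change corner hjm (a * a') • n.1 = corner hjm a • corner hjm a' • n.1
    rw [corner_mul hj1, mul_smul])
  smul_zero a := Subtype.ext (smul_zero (corner hjm a))
  smul_add a n n' := Subtype.ext (smul_add (corner hjm a) n.1 n'.1)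
  add_smul a a' n := Subtype.ext (by
    change corner hjm (a + a') • n.1 = corner hjm a • n.1 + corner hjm a' • n.1
    rw [corner_add, add_smul])
  zero_smul n := Subtype.ext (by
    change corner hjm 0 • n.1 = 0
    rw [corner_zero, zero_smul])

include hj1 hjm in
/-- Morita equivalence of `A` and the centralizer algebra. -/
theorem inductionFunctor_isEquivalence : (inductionFunctor K j).IsEquivalence where
  faithful := ⟨fun {M N} f g h => by
    refine ModuleCat.hom_ext (LinearMap.ext fun m => ?_)
    have h1 := congrArg (fun φ => inductionEval N (φ.hom (inductionMk M (basePoint hjm) m))) h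
    simpa only [inductionFunctor_map_mk, inductionEval_mk, basePoint_one hj1, one_smul] using h1⟩
  full := ⟨fun {M N} φ => by
    let f : M →ₗ[A] N :=
      { toFun := fun m => inductionEval N (φ.hom (inductionMk M (basePoint hjm) m))
        map_add' := fun m m' => by
          rw [← map_add, ← map_add]
          congr 2
          exact inductionMk_add M _ _ _
        map_smul' := fun a m => by
          have h1 : inductionMk M (basePoint hjm) (a • m) =
              corner hjm a • inductionMk M (basePoint hjm) m := by
            rw [corner_smul_eq, inductionEval_mk, basePoint_one hj1, one_smul]
          rw [h1, map_smul, inductionEval_corner hj1]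
          rfl }
    refine ⟨ModuleCat.ofHom f, inductionFunctor_hom_ext hj1 hjm fun m => ?_⟩
    have h1 : inductionMk M (basePoint hjm) m =
        corner hjm 1 • inductionMk M (basePoint hjm) m := by
      rw [corner_smul_eq, inductionEval_mk, basePoint_one hj1, one_smul, one_smul]
    conv_rhs => rw [h1, map_smul, corner_smul_eq, one_smul]
    rfl⟩
  essSurj := ⟨fun N => by
    let _ := cornerModule hjm N hj1
    let M : ModuleCat.{u} A := ModuleCat.of A (CornerModule hjm N)
    let φ : (inductionFunctor K j).obj M →ₗ[Centralizer K j] N := tensorLift (S := Centralizer K j) _ M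
      ({ toFun := fun F => { toFun := fun n => rankOne F • n.1, map_zero' := smul_zero _,
                             map_add' := fun n n' => smul_add _ _ _ }
         map_zero' := by
          ext n
          change rankOne (0 : FunK K j) • n.1 = 0
          have : rankOne (0 : FunK K j) = 0 :=
            LinearMap.ext fun F => Subtype.ext (funext fun w => zero_mul _)
          rw [this, zero_smul]
         map_add' := fun F F' => by
          ext n
          change rankOne (F + F') • n.1 = rankOne F • n.1 + rankOne F' • n.1
          rw [← add_smul]
          congr 1
          exact LinearMap.ext fun F'' => Subtype.ext (funext fun w => add_mul _ _ _) } :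
        FunK K j →+ M →+ N)
      (fun z F n => by
        change rankOne (z F) • n.1 = z • rankOne F • n.1
        rw [← mul_rankOne, mul_smul])
      (fun F a n => by
        change rankOne (MulOpposite.op a • F) • n.1 = rankOne F • corner hjm a • n.1
        rw [rankOne_smul hjm F a hj1, mul_smul])
    have hφ : ∀ n : M, φ (inductionMk M (basePoint hjm) n) = n.1 := by
      intro n
      change rankOne (basePoint hjm) • n.1 = n.1
      obtain ⟨n, n', rfl⟩ := n
      change rankOne (basePoint hjm) • corner hjm 1 • n' = corner hjm 1 • n'
      rw [corner_one_eq, ← mul_smul, ← corner_mul hj1, one_mul]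
    have hinj : Function.Injective φ := by
      refine (injective_iff_map_eq_zero φ).2 fun t ht => ?_
      refine mem_of_corner_one hj1 hjm (⊥ : AddSubgroup _)
        (fun z n hn => by rw [AddSubgroup.mem_bot.1 hn, smul_zero]; exact AddSubgroup.zero_mem _)
        t fun r => ?_
      have h1 : φ (corner hjm 1 • translation K j r • t) = 0 := by
        rw [map_smul, map_smul, ht, smul_zero, smul_zero]
      rw [corner_smul_eq, hφ] at h1
      have h2 : (1 : A) • inductionEval M (translation K j r • t) = 0 := Subtype.ext h1
      rw [corner_smul_eq, h2, AddSubgroup.mem_bot]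
      exact tensorMk_zero (S := Centralizer K j) _ M _
    have hsurj : Function.Surjective φ := by
      intro n
      refine mem_of_corner_one hj1 hjm (LinearMap.range φ).toAddSubgroup
        (fun z n hn => Submodule.smul_mem _ z hn) n fun r => ?_
      exact ⟨inductionMk M (basePoint hjm) ⟨_, _, rfl⟩, hφ _⟩
    exact ⟨M, ⟨(LinearEquiv.ofBijective φ ⟨hinj, hsurj⟩).toModuleIso⟩⟩⟩

end Equivalence

end CentralizerEquivalence

section Theta

variable {G V : Type u} [Group G] [Finite G] [AddCommGroup V] [Module ℂ V] [FiniteDimensional ℂ V]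
variable {ρ : Representation ℂ G V} (c : Param ρ) (b : V)

omit [Finite G] [FiniteDimensional ℂ V] in
theorem isReflection_stabRep {s : stab ρ b} :
    IsReflection (stabRep ρ b) s ↔ IsReflection ρ (s : G) := Iff.rfl

omit [FiniteDimensional ℂ V] in
open Classical in
theorem sum_reflections_stab {M : Type*} [AddCommMonoid M] (F : G → M) :
    ∑ s ∈ reflections (stabRep ρ b), F s =
      ∑ s ∈ (reflections ρ).filter (fun s => s ∈ stab ρ b), F s := by
  refine Finset.sum_bij (fun s _ => (s : G)) ?_ ?_ ?_ ?_
  · intro s hs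
    exact Finset.mem_filter.2 ⟨mem_reflections.2 ((isReflection_stabRep b).1 (mem_reflections.1 hs)), s.2⟩
  · intro s _ t _ h
    exact Subtype.ext h
  · intro s hs
    obtain ⟨h1, h2⟩ := Finset.mem_filter.1 hs
    exact ⟨⟨s, h2⟩, mem_reflections.2 ((isReflection_stabRep b).2 (mem_reflections.1 h1)), rfl⟩
  · intro s _; rfl

/-- The point `b` of its orbit. -/
abbrev basePt (ρ : Representation ℂ G V) (b : V) : orbit ρ b := ⟨b, self_mem_orbit ρ b⟩

instance : Unique (orbit ρ 0) where
  default := basePt ρ 0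
  uniq p := by
    obtain ⟨p, g, rfl⟩ := p
    exact Subtype.ext (map_zero (ρ g))

theorem formalFun_zero_eq (f : FormalFun ρ 0) : (fun _ => f (basePt ρ 0)) = f := by
  funext p
  rw [Subsingleton.elim p (basePt ρ 0)]

variable (ρ) in
/-- The function attached to a series at `b` that vanishes near the other points of the orbit. -/
def extendZero : FormalSeries V →ₗ[ℂ] FormalFun ρ b :=
  letI := Classical.decEq V
  LinearMap.single ℂ (fun _ => FormalSeries V) (basePt ρ b)

theorem extendZero_same (f : FormalSeries V) : extendZero ρ b f (basePt ρ b) = f := by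
  let _ := Classical.decEq V
  exact Pi.single_eq_same (M := fun _ => FormalSeries V) (basePt ρ b) f

theorem extendZero_ne (f : FormalSeries V) {p : orbit ρ b} (hp : p ≠ basePt ρ b) :
    extendZero ρ b f p = 0 := by
  let _ := Classical.decEq V
  exact Pi.single_eq_of_ne (M := fun _ => FormalSeries V) hp f

theorem extendZero_mul (f f' : FormalSeries V) :
    extendZero ρ b (f * f') = extendZero ρ b f * extendZero ρ b f' := by
  funext p
  rw [Pi.mul_apply]
  by_cases hp : p = basePt ρ b
  · subst hp; simp only [extendZero_same]
  · simp only [extendZero_ne b _ hp, mul_zero]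

theorem mul_extendZero_one (f : FormalFun ρ b) :
    f * extendZero ρ b 1 = extendZero ρ b (f (basePt ρ b)) := by
  funext p
  rw [Pi.mul_apply]
  by_cases hp : p = basePt ρ b
  · subst hp; rw [extendZero_same, extendZero_same, mul_one]
  · rw [extendZero_ne b _ hp, extendZero_ne b _ hp, mul_zero]

theorem extendZero_one_eq : ∃ u, extendZero ρ b (1 : FormalSeries V) = locConst ρ b u := by
  classical
  refine ⟨Pi.single (basePt ρ b) 1, ?_⟩
  funext p
  rw [locConst_apply]
  by_cases hp : p = basePt ρ b
  · subst hp; rw [extendZero_same, Pi.single_eq_same, map_one]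
  · rw [extendZero_ne b _ hp, Pi.single_eq_of_ne hp, map_zero]

theorem actFun_basePt {h : G} (hh : h ∈ stab ρ b) (f : FormalFun ρ b) :
    actFun h f (basePt ρ b) = substAct ρ h (f (basePt ρ b)) := by
  unfold actFun
  congr 2
  exact Subtype.ext (rep_inv_eq_self hh)

theorem rep_inv_ne {h : G} (hh : h ∉ stab ρ b) : ρ h⁻¹ b ≠ b := fun h' =>
  hh ((stab ρ b).inv_mem_iff.1 h')

theorem actFun_extendZero {h : G} (hh : h ∈ stab ρ b) (f : FormalSeries V) :
    actFun h (extendZero ρ b f) = extendZero ρ b (substAct ρ h f) := by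
  funext p
  by_cases hp : p = basePt ρ b
  · subst hp
    rw [actFun_basePt b hh, extendZero_same, extendZero_same]
  · rw [extendZero_ne b _ hp]
    unfold actFun
    rw [extendZero_ne, map_zero]
    intro h'
    refine hp (Subtype.ext ?_)
    have h1 : ρ h⁻¹ p = b := congrArg Subtype.val h'
    rw [← apply_inv_apply (ρ := ρ) h p, h1]
    exact hh

theorem actFun_extendZero_basePt {h : G} (hh : h ∉ stab ρ b) (f : FormalSeries V) :
    actFun h (extendZero ρ b f) (basePt ρ b) = 0 := by
  unfold actFun
  rw [extendZero_ne, map_zero]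
  exact fun h' => rep_inv_ne b hh (congrArg Subtype.val h')

theorem derivFun_extendZero (v : V) (f : FormalSeries V) :
    derivFun v (extendZero ρ b f) = extendZero ρ b (derivSeries v f) := by
  funext p
  rw [derivFun_apply]
  by_cases hp : p = basePt ρ b
  · subst hp; rw [extendZero_same, extendZero_same]
  · rw [extendZero_ne b _ hp, extendZero_ne b _ hp, map_zero]

theorem linSeries_of_root {s : G} (h : root ρ s b = 0) :
    linSeries (root ρ s) b = linSeries (root ρ s) 0 := by
  rw [linSeries, linSeries, h, map_zero (root ρ s)]

theorem mem_stab_iff_root {s : G} (hs : IsReflection ρ s) : s ∈ stab ρ b ↔ root ρ s b = 0 :=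
  rep_eq_self_iff hs b

theorem divRoot_basePt {s : stab ρ b} (hs : IsReflection ρ (s : G)) (f : FormalFun ρ b) :
    (fun _ => divRoot (s : G) f (basePt ρ b) : FormalFun (stabRep ρ b) 0) =
      divRoot s (fun _ => f (basePt ρ b)) := by
  refine eq_divRoot (isReflection_stabRep b |>.2 hs) ?_
  funext p
  have h1 := congrFun (linFun_mul_divRoot hs f) (basePt ρ b)
  obtain rfl : p = basePt (stabRep ρ b) 0 := Subsingleton.elim _ _
  rw [Pi.mul_apply, Pi.sub_apply, actFun_basePt b s.2] at h1
  change linSeries (root ρ (s : G)) b * _ = _ at h1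
  rw [linSeries_of_root b ((mem_stab_iff_root b hs).1 s.2)] at h1
  exact h1

theorem fixFun_basePt_mem {s : G} (hs : IsReflection ρ s) (h : s ∈ stab ρ b) :
    fixFun ρ b s (basePt ρ b) = 1 := by
  rw [fixFun, locConst_apply, if_pos ((mem_stab_iff_root b hs).1 h), map_one]

theorem fixFun_basePt_notMem {s : G} (hs : IsReflection ρ s) (h : s ∉ stab ρ b) :
    fixFun ρ b s (basePt ρ b) = 0 := by
  rw [fixFun, locConst_apply, if_neg (fun h' => h ((mem_stab_iff_root b hs).2 h')), map_zero]

theorem stabSeries_zero : stabSeries ρ c b 0 = 0 := HHat.f_zero _ _ _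

theorem stabSeries_mul (f f' : FormalSeries V) :
    stabSeries ρ c b (f * f') = stabSeries ρ c b f * stabSeries ρ c b f' := HHat.f_mul _ _ _ _ _

theorem stabSeries_smul (r : ℂ) (f : FormalSeries V) :
    stabSeries ρ c b (r • f) = r • stabSeries ρ c b f := HHat.f_smul _ _ _ _ _

theorem g_stabSeries (h : stab ρ b) (f : FormalSeries V) :
    HHat.g (stabRep ρ b) (stabParam ρ c b) 0 h * stabSeries ρ c b f =
      stabSeries ρ c b (substAct ρ (h : G) f) * HHat.g (stabRep ρ b) (stabParam ρ c b) 0 h :=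
  HHat.g_f _ _ _ _ _

theorem stab_g_one : HHat.g (stabRep ρ b) (stabParam ρ c b) 0 1 = 1 := HHat.g_one _ _ _

theorem stab_g_mul (h h' : stab ρ b) : HHat.g (stabRep ρ b) (stabParam ρ c b) 0 (h * h') =
    HHat.g (stabRep ρ b) (stabParam ρ c b) 0 h * HHat.g (stabRep ρ b) (stabParam ρ c b) 0 h' :=
  HHat.g_mul _ _ _ _ _

open FunK

/-- A function, as an element of the centralizer algebra. -/
def thetaFun : FormalFun ρ b →ₐ[ℂ] ZHat ρ c b where
  toFun φ := diagonal (fun w => stabSeries ρ c b (actFun w φ (basePt ρ b))) fun h w => by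
    rw [g_stabSeries, ← actFun_basePt b h.2, actFun_actFun]
  map_one' := by
    refine LinearMap.ext fun F => Subtype.ext (funext fun w => ?_)
    rw [diagonal_apply]
    have h1 : actFun w (1 : FormalFun ρ b) = 1 := map_one (actHom ρ b w)
    rw [h1]
    exact (congrArg (· * F.1 w) (HHat.f_one _ _ _)).trans (one_mul _)
  map_mul' φ ψ := by
    refine LinearMap.ext fun F => Subtype.ext (funext fun w => ?_)
    rw [diagonal_apply, actFun_mul, Pi.mul_apply, stabSeries_mul, mul_assoc]
    rfl
  map_zero' := by
    refine LinearMap.ext fun F => Subtype.ext (funext fun w => ?_)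
    rw [diagonal_apply]
    have h1 : actFun w (0 : FormalFun ρ b) = 0 := map_zero (actHom ρ b w)
    rw [h1]
    exact (congrArg (· * F.1 w) (HHat.f_zero _ _ _)).trans (zero_mul _)
  map_add' φ ψ := by
    refine LinearMap.ext fun F => Subtype.ext (funext fun w => ?_)
    rw [diagonal_apply, actFun_add]
    exact (congrArg (· * F.1 w) (HHat.f_add _ _ _ _ _)).trans (add_mul _ _ _)
  commutes' r := by
    refine LinearMap.ext fun F => Subtype.ext (funext fun w => ?_)
    have h1 : actFun w (algebraMap ℂ (FormalFun ρ b) r) = algebraMap ℂ _ r :=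
      (actHom ρ b w).commutes r
    rw [diagonal_apply, h1, Module.algebraMap_end_apply]
    refine (congrArg (· * F.1 w) ?_).trans (Algebra.smul_def r (F.1 w)).symm
    exact (HHat.fHom (stabRep ρ b) (stabParam ρ c b) 0).commutes r

theorem thetaFun_apply (φ : FormalFun ρ b) (F : FunK _ _) (w : G) :
    (thetaFun c b φ F).1 w = stabSeries ρ c b (actFun w φ (basePt ρ b)) * F.1 w := rfl

/-- The elements of `V` in the centralizer algebra, without the terms with poles. -/
def thetaDeriv : V →ₗ[ℂ] ZHat ρ c b where
  toFun v := diagonal (fun w => HHat.y (stabRep ρ b) (stabParam ρ c b) 0 (ρ w v)) fun h w => by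
    rw [HHat.g_y, map_mul]
    rfl
  map_add' v v' := by
    refine LinearMap.ext fun F => Subtype.ext (funext fun w => ?_)
    rw [diagonal_apply, map_add]
    exact (congrArg (· * F.1 w) (map_add (HHat.yLin _ _ _) _ _)).trans (add_mul _ _ _)
  map_smul' r v := by
    refine LinearMap.ext fun F => Subtype.ext (funext fun w => ?_)
    rw [diagonal_apply, map_smul]
    exact (congrArg (· * F.1 w) (map_smul (HHat.yLin _ _ _) _ _)).trans (smul_mul_assoc _ _ _)

theorem thetaDeriv_apply (v : V) (F : FunK _ _) (w : G) : (thetaDeriv c b v F).1 w =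
    HHat.y (stabRep ρ b) (stabParam ρ c b) 0 (ρ w v) * F.1 w := rfl

theorem FunK.coe_add_apply {A : Type u} [Ring A] {K : Subgroup G} {j : K → A}
    (F F' : FunK K j) (w : G) : (F + F').1 w = F.1 w + F'.1 w := rfl

theorem FunK.coe_sum_apply {A : Type u} [Ring A] {K : Subgroup G} {j : K → A} {ι : Type*}
    (t : Finset ι) (F : ι → FunK K j) (w : G) : (∑ i ∈ t, F i).1 w = ∑ i ∈ t, (F i).1 w := by
  refine (congrFun (map_sum (FunK K j).subtype _ _) w).trans ?_
  rw [Finset.sum_apply]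
  rfl

/-- The relations of the completed algebra in the centralizer algebra. -/
def thetaData : DunklData c b (fixFun ρ b) (ZHat ρ c b) where
  ι := thetaFun c b
  γ :=
    { toFun := translation _ _
      map_one' := LinearMap.ext fun F => Subtype.ext (funext fun w => by
        rw [translation_apply, mul_one]; rfl)
      map_mul' := fun u u' => LinearMap.ext fun F => Subtype.ext (funext fun w => by
        rw [translation_apply, ← mul_assoc]; rfl) }
  Y := thetaDeriv c b
  g_f u φ := LinearMap.ext fun F => Subtype.ext (funext fun w => by
    change (thetaFun c b φ F).1 (w * u) = (thetaFun c b (actFun u φ) _).1 w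
    rw [thetaFun_apply, thetaFun_apply, actFun_actFun]
    rfl)
  g_y u v := LinearMap.ext fun F => Subtype.ext (funext fun w => by
    change (thetaDeriv c b v F).1 (w * u) = (thetaDeriv c b (ρ u v) _).1 w
    rw [thetaDeriv_apply, thetaDeriv_apply, map_mul]
    rfl)
  y_f v φ := LinearMap.ext fun F => Subtype.ext (funext fun w => by
    classical
    simp only [LinearMap.add_apply, LinearMap.sum_apply, LinearMap.smul_apply, FunK.coe_add_apply,
      FunK.coe_sum_apply]
    change HHat.y (stabRep ρ b) (stabParam ρ c b) 0 (ρ w v) *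
      (stabSeries ρ c b (actFun w φ (basePt ρ b)) * F.1 w) =
      stabSeries ρ c b (actFun w φ (basePt ρ b)) *
        (HHat.y (stabRep ρ b) (stabParam ρ c b) 0 (ρ w v) * F.1 w) +
      (stabSeries ρ c b (actFun w (derivFun v φ) (basePt ρ b)) * F.1 w +
        ∑ s ∈ reflections ρ, (reflCoef c s * root ρ s v) •
          (stabSeries ρ c b (actFun w (fixFun ρ b s * divRoot s φ) (basePt ρ b)) * F.1 (w * s)))
    rw [← mul_assoc, stabSeries, HHat.y_f, add_mul, add_mul, mul_assoc, Finset.sum_mul]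
    congr 2
    · rw [← derivFun_actFun]
      rfl
    · have h1 : ∀ s ∈ reflections ρ, (reflCoef c s * root ρ s v) •
          (stabSeries ρ c b (actFun w (fixFun ρ b s * divRoot s φ) (basePt ρ b)) * F.1 (w * s)) =
          (fun t => (reflCoef c t * root ρ t (ρ w v)) • (stabSeries ρ c b
            ((fixFun ρ b t * divRoot t (actFun w φ)) (basePt ρ b)) * F.1 (t * w)))
            (w * s * w⁻¹) := by
        intro s hs
        have hs' := mem_reflections.1 hs
        beta_reduce
        have h2 := actFun_divRoot hs' w v φ
        have h4 : root ρ s v • actFun w (fixFun ρ b s * divRoot s φ) (basePt ρ b) =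
            root ρ (w * s * w⁻¹) (ρ w v) • (fixFun ρ b (w * s * w⁻¹) *
              divRoot (w * s * w⁻¹) (actFun w φ)) (basePt ρ b) := by
          change (root ρ s v • actFun w (fixFun ρ b s * divRoot s φ)) (basePt ρ b) =
            (root ρ (w * s * w⁻¹) (ρ w v) • (fixFun ρ b (w * s * w⁻¹) *
              divRoot (w * s * w⁻¹) (actFun w φ))) (basePt ρ b)
          rw [← mul_smul_comm, ← h2, ← actFun_fixFun hs', ← actFun_mul, mul_smul_comm, actFun_smul]
        have h5 := congrArg (stabSeries ρ c b) h4
        rw [stabSeries_smul, stabSeries_smul] at h5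
        rw [reflCoef_conj c hs', mul_smul, mul_smul, inv_mul_cancel_right, ← smul_mul_assoc, h5,
          smul_mul_assoc]
      rw [Finset.sum_congr rfl h1, sum_reflections_conj (fun t =>
        (reflCoef c t * root ρ t (ρ w v)) • (stabSeries ρ c b
            ((fixFun ρ b t * divRoot t (actFun w φ)) (basePt ρ b)) * F.1 (t * w))) w,
        ← Finset.sum_filter_add_sum_filter_not _ (fun t => t ∈ stab ρ b)]
      have h3 : ∑ t ∈ (reflections ρ).filter (fun t => t ∉ stab ρ b),
          (reflCoef c t * root ρ t (ρ w v)) • (stabSeries ρ c b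
            ((fixFun ρ b t * divRoot t (actFun w φ)) (basePt ρ b)) * F.1 (t * w)) = 0 := by
        refine Finset.sum_eq_zero fun t ht => ?_
        obtain ⟨ht1, ht2⟩ := Finset.mem_filter.1 ht
        rw [Pi.mul_apply, fixFun_basePt_notMem b (mem_reflections.1 ht1) ht2, zero_mul,
          stabSeries_zero, zero_mul, smul_zero]
      rw [h3, add_zero, ← sum_reflections_stab]
      refine Finset.sum_congr rfl fun t ht => ?_
      have ht' : IsReflection ρ (t : G) :=
        (isReflection_stabRep b).1 (mem_reflections.1 ht)
      rw [Pi.mul_apply, fixFun_basePt_mem b ht' t.2, one_mul, smul_mul_assoc, mul_assoc,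
        ← divRoot_basePt b ht', F.2 t w]
      rfl)

theorem thetaData_commute (v v' : V) :
    (thetaData c b).Y v * (thetaData c b).Y v' = (thetaData c b).Y v' * (thetaData c b).Y v :=
  LinearMap.ext fun F => Subtype.ext (funext fun w => by
    change HHat.y _ _ _ _ * (HHat.y _ _ _ _ * F.1 w) = HHat.y _ _ _ _ * (HHat.y _ _ _ _ * F.1 w)
    rw [← mul_assoc, HHat.y_y, mul_assoc])

variable (hρ : Function.Injective ρ)

/-- The homomorphism `θ`. -/
def thetaHom : HHat ρ c b →ₐ[ℂ] ZHat ρ c b :=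
  HHat.lift (thetaData c b).addPert ((thetaData c b).addPert_commute hρ (thetaData_commute c b))

theorem thetaHom_f (φ : FormalFun ρ b) : thetaHom c b hρ (HHat.f ρ c b φ) = thetaFun c b φ :=
  HHat.lift_f _ _ _

theorem thetaHom_g (u : G) : thetaHom c b hρ (HHat.g ρ c b u) = translation _ _ u :=
  HHat.lift_g _ _ _

theorem thetaHom_y (v : V) :
    thetaHom c b hρ (HHat.y ρ c b v) = thetaDeriv c b v + (thetaData c b).pert v :=
  HHat.lift_y _ _ _

open Classical in
theorem thetaHom_y_apply (a : V) (F : FunK _ _) (w : G) :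
    (thetaHom c b hρ (HHat.y ρ c b a) F).1 w =
      HHat.y (stabRep ρ b) (stabParam ρ c b) 0 (ρ w a) * F.1 w +
      ∑ s ∈ (reflections ρ).filter (fun s => s ∉ stab ρ b),
        (2 * c.val s / (1 - reflEigenvalue ρ s)) •
          (stabSeries ρ c b (root ρ s (ρ w a) • (linSeries (root ρ s) b)⁻¹) *
            (F.1 (s * w) - F.1 w)) := by
  rw [thetaHom_y, LinearMap.add_apply, FunK.coe_add_apply, thetaDeriv_apply, DunklData.pert,
    LinearMap.sum_apply, FunK.coe_sum_apply]
  congr 1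
  have h1 : ∀ s ∈ reflections ρ, ((reflCoef c s • ((thetaData c b).ι (root ρ s a • rootInv ρ b s) *
      ((thetaData c b).γ s - 1)) : ZHat ρ c b) F).1 w =
      (fun t => reflCoef c t • (stabSeries ρ c b (root ρ t (ρ w a) • (linSeries (root ρ t) b)⁻¹) *
        (F.1 (t * w) - F.1 w))) (w * s * w⁻¹) := by
    intro s hs
    have hs' := mem_reflections.1 hs
    change reflCoef c s • (stabSeries ρ c b (actFun w (root ρ s a • rootInv ρ b s) (basePt ρ b)) *
      (F.1 (w * s) - F.1 w)) = _
    beta_reduce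
    rw [actFun_rootInv hs', reflCoef_conj c hs', inv_mul_cancel_right]
    rfl
  rw [Finset.sum_congr rfl h1, sum_reflections_conj (fun t => reflCoef c t •
    (stabSeries ρ c b (root ρ t (ρ w a) • (linSeries (root ρ t) b)⁻¹) *
        (F.1 (t * w) - F.1 w))) w, ← Finset.sum_filter_add_sum_filter_not _ (fun t => t ∈ stab ρ b)]
  rw [Finset.sum_eq_zero, zero_add]
  · rfl
  · intro t ht
    obtain ⟨ht1, ht2⟩ := Finset.mem_filter.1 ht
    have : (linSeries (root ρ t) b)⁻¹ = 0 := by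
      rw [MvPowerSeries.inv_eq_zero, constantCoeff_linSeries,
        (mem_stab_iff_root b (mem_reflections.1 ht1)).1 ht2]
    rw [this, smul_zero, stabSeries_zero, zero_mul, smul_zero]

end Theta

section ThetaBijective

variable {G V : Type u} [Group G] [Finite G] [AddCommGroup V] [Module ℂ V] [FiniteDimensional ℂ V]
variable {ρ : Representation ℂ G V} (c : Param ρ) (b : V)

theorem DunklData.Y_locConst {R : Type*} [Ring R] [Algebra ℂ R] {c : Param ρ} {b : V}
    (D : DunklData c b (fixFun ρ b) R) (v : V) (u : orbit ρ b → ℂ) :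
    D.Y v * D.ι (locConst ρ b u) = D.ι (locConst ρ b u) * D.Y v := by
  rw [D.y_f, derivFun_locConst, map_zero, zero_add, Finset.sum_eq_zero, add_zero]
  intro s hs
  have h := fixFun_mul_divRoot (mem_reflections.1 hs) u (1 : FormalFun ρ b)
  rw [divRoot_one (mem_reflections.1 hs), mul_one, mul_zero, mul_zero] at h
  rw [h, map_zero, zero_mul, smul_zero]

theorem fixFun_mul_divRoot_extendZero {s : G} (hs : IsReflection ρ s) (f : FormalSeries V) :
    fixFun ρ b s * divRoot s (extendZero ρ b f) =
      extendZero ρ b (fixFun ρ b s (basePt ρ b) * divRoot s (extendZero ρ b f) (basePt ρ b)) := by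
  obtain ⟨u, hu⟩ := extendZero_one_eq (ρ := ρ) b
  have h1 : extendZero ρ b f = extendZero ρ b 1 * extendZero ρ b f := by
    rw [← extendZero_mul, one_mul]
  conv_lhs => rw [h1, hu, fixFun_mul_divRoot hs, ← hu, mul_comm, mul_extendZero_one]
  rfl

variable (ρ) in
/-- The indicator function of `b`, as an element of the completed algebra. -/
def baseIdem : HHat ρ c b := HHat.f ρ c b (extendZero ρ b 1)

theorem baseIdem_mul_self : baseIdem ρ c b * baseIdem ρ c b = baseIdem ρ c b := by
  rw [baseIdem, ← HHat.f_mul, ← extendZero_mul, one_mul]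

theorem f_extendZero_mul_baseIdem (f : FormalSeries V) :
    HHat.f ρ c b (extendZero ρ b f) * baseIdem ρ c b = HHat.f ρ c b (extendZero ρ b f) := by
  rw [baseIdem, ← HHat.f_mul, ← extendZero_mul, mul_one]

theorem baseIdem_mul_f_extendZero (f : FormalSeries V) :
    baseIdem ρ c b * HHat.f ρ c b (extendZero ρ b f) = HHat.f ρ c b (extendZero ρ b f) := by
  rw [baseIdem, ← HHat.f_mul, ← extendZero_mul, one_mul]

theorem baseIdem_mul_f (φ : FormalFun ρ b) : baseIdem ρ c b * HHat.f ρ c b φ =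
    HHat.f ρ c b (extendZero ρ b (φ (basePt ρ b))) := by
  rw [baseIdem, ← HHat.f_mul, mul_comm, mul_extendZero_one]

theorem g_mul_baseIdem {h : G} (hh : h ∈ stab ρ b) :
    HHat.g ρ c b h * baseIdem ρ c b = baseIdem ρ c b * HHat.g ρ c b h := by
  rw [baseIdem, HHat.g_f, actFun_extendZero b hh, map_one]

variable (ρ) in
/-- The elements of `V` in the completed algebra, without the terms with poles. -/
def innerY : V →ₗ[ℂ] HHat ρ c b := (HHat.data ρ c b).subPert.Y

theorem y_eq_innerY_add (v : V) :
    HHat.y ρ c b v = innerY ρ c b v + (HHat.data ρ c b).pert v := (sub_add_cancel _ _).symm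

theorem innerY_mul_baseIdem (v : V) :
    innerY ρ c b v * baseIdem ρ c b = baseIdem ρ c b * innerY ρ c b v := by
  obtain ⟨u, hu⟩ := extendZero_one_eq (ρ := ρ) b
  rw [baseIdem, hu]
  exact (HHat.data ρ c b).subPert.Y_locConst v u

theorem g_mul_innerY (w : G) (v : V) :
    HHat.g ρ c b w * innerY ρ c b v = innerY ρ c b (ρ w v) * HHat.g ρ c b w :=
  (HHat.data ρ c b).subPert.g_y w v

theorem innerY_mul_f_extendZero (v : V) (f : FormalSeries V) :
    innerY ρ c b v * HHat.f ρ c b (extendZero ρ b f) =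
      HHat.f ρ c b (extendZero ρ b f) * innerY ρ c b v +
      (HHat.f ρ c b (extendZero ρ b (derivSeries v f)) +
        ∑ s ∈ reflections (stabRep ρ b), (reflCoef c (s : G) * root ρ (s : G) v) •
          (HHat.f ρ c b (extendZero ρ b
            (divRoot s (fun _ => f : FormalFun (stabRep ρ b) 0) (basePt (stabRep ρ b) 0))) *
              HHat.g ρ c b (s : G))) := by
  classical
  refine ((HHat.data ρ c b).subPert.y_f v (extendZero ρ b f)).trans ?_
  rw [derivFun_extendZero]
  congr 2
  rw [← Finset.sum_filter_add_sum_filter_not _ (fun t => t ∈ stab ρ b)]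
  have h3 : ∑ t ∈ (reflections ρ).filter (fun t => t ∉ stab ρ b),
      (reflCoef c t * root ρ t v) • ((HHat.data ρ c b).subPert.ι
        (fixFun ρ b t * divRoot t (extendZero ρ b f)) * (HHat.data ρ c b).subPert.γ t) = 0 := by
    refine Finset.sum_eq_zero fun t ht => ?_
    obtain ⟨ht1, ht2⟩ := Finset.mem_filter.1 ht
    have ht1' := mem_reflections.1 ht1
    rw [fixFun_mul_divRoot_extendZero b ht1', fixFun_basePt_notMem b ht1' ht2, zero_mul, map_zero,
      map_zero, zero_mul, smul_zero]
  rw [h3, add_zero, ← sum_reflections_stab]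
  refine Finset.sum_congr rfl fun t ht => ?_
  have ht' : IsReflection ρ (t : G) := (isReflection_stabRep b).1 (mem_reflections.1 ht)
  rw [fixFun_mul_divRoot_extendZero b ht', fixFun_basePt_mem b ht' t.2, one_mul]
  have h4 := congrFun (divRoot_basePt b ht' (extendZero ρ b f)) (basePt (stabRep ρ b) 0)
  rw [extendZero_same] at h4
  rw [h4]
  rfl

variable (ρ) in
/-- The right ideal generated by the indicator function of `b`. -/
def baseCorner : Submodule ℂ (HHat ρ c b) :=
  LinearMap.eqLocus (LinearMap.mulLeft ℂ (baseIdem ρ c b)) LinearMap.id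

theorem mem_baseCorner {x : HHat ρ c b} : x ∈ baseCorner ρ c b ↔ baseIdem ρ c b * x = x := Iff.rfl

/-- Left multiplication on the right ideal generated by the indicator function of `b`. -/
def baseCornerMul (z : HHat ρ c b)
    (hz : ∀ x, baseIdem ρ c b * x = x → baseIdem ρ c b * (z * x) = z * x) :
    Module.End ℂ (baseCorner ρ c b) :=
  (LinearMap.mulLeft ℂ z).restrict hz

theorem baseCornerMul_apply (z : HHat ρ c b)
    (hz : ∀ x, baseIdem ρ c b * x = x → baseIdem ρ c b * (z * x) = z * x) (x : baseCorner ρ c b) :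
    (baseCornerMul c b z hz x : HHat ρ c b) = z * x := rfl

theorem commute_mul_mem {z : HHat ρ c b} (hz : z * baseIdem ρ c b = baseIdem ρ c b * z)
    (x : HHat ρ c b) (hx : baseIdem ρ c b * x = x) : baseIdem ρ c b * (z * x) = z * x := by
  rw [← mul_assoc, ← hz, mul_assoc, hx]

/-- The relations of `Ĥ_{c'}(G_b, V)_0` on the right ideal generated by the indicator function. -/
def baseData : DunklData (stabParam ρ c b) 0 1 (Module.End ℂ (baseCorner ρ c b)) where
  ι :=
    { toFun := fun φ => baseCornerMul c b (HHat.f ρ c b (extendZero ρ b (φ (basePt (stabRep ρ b) 0))))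
        (commute_mul_mem c b (by rw [f_extendZero_mul_baseIdem, baseIdem_mul_f_extendZero]))
      map_one' := LinearMap.ext fun x => Subtype.ext x.2
      map_mul' := fun φ ψ => LinearMap.ext fun x => Subtype.ext (by
        rw [baseCornerMul_apply, Pi.mul_apply, extendZero_mul, HHat.f_mul, mul_assoc]
        rfl)
      map_zero' := LinearMap.ext fun x => Subtype.ext (by
        rw [baseCornerMul_apply, Pi.zero_apply, map_zero, HHat.f_zero, zero_mul]
        rfl)
      map_add' := fun φ ψ => LinearMap.ext fun x => Subtype.ext (by
        rw [baseCornerMul_apply, Pi.add_apply, map_add, HHat.f_add, add_mul]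
        rfl)
      commutes' := fun r => LinearMap.ext fun x => Subtype.ext (by
        have h1 : algebraMap ℂ (FormalFun (stabRep ρ b) 0) r (basePt (stabRep ρ b) 0) =
          r • (1 : FormalSeries V) := by rw [Algebra.algebraMap_eq_smul_one]; rfl
        rw [baseCornerMul_apply, h1, map_smul, HHat.f_smul, smul_mul_assoc]
        exact congrArg (r • ·) x.2) }
  γ :=
    { toFun := fun h => baseCornerMul c b (HHat.g ρ c b (h : G))
        (commute_mul_mem c b (g_mul_baseIdem c b h.2))
      map_one' := LinearMap.ext fun x => Subtype.ext (by
        rw [baseCornerMul_apply]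
        exact (congrArg (· * x.1) (HHat.g_one _ _ _)).trans (one_mul _))
      map_mul' := fun h h' => LinearMap.ext fun x => Subtype.ext (by
        rw [baseCornerMul_apply]
        exact (congrArg (· * x.1) (HHat.g_mul _ _ _ _ _)).trans (mul_assoc _ _ _)) }
  Y :=
    { toFun := fun v => baseCornerMul c b (innerY ρ c b v)
        (commute_mul_mem c b (innerY_mul_baseIdem c b v))
      map_add' := fun v v' => LinearMap.ext fun x => Subtype.ext (by
        rw [baseCornerMul_apply, map_add, add_mul]
        rfl)
      map_smul' := fun r v => LinearMap.ext fun x => Subtype.ext (by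
        rw [baseCornerMul_apply, map_smul, smul_mul_assoc]
        rfl) }
  g_f h φ := LinearMap.ext fun x => Subtype.ext (by
    change HHat.g ρ c b (h : G) * (HHat.f ρ c b (extendZero ρ b _) * x.1) =
      HHat.f ρ c b (extendZero ρ b _) * (HHat.g ρ c b (h : G) * x.1)
    rw [← mul_assoc, HHat.g_f, actFun_extendZero b h.2, mul_assoc]
    exact congrArg (fun q => HHat.f ρ c b (extendZero ρ b q) * (HHat.g ρ c b (h : G) * x.1))
      (actFun_basePt (ρ := stabRep ρ b) 0 (map_zero ((stabRep ρ b) h)) φ).symm)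
  g_y h v := LinearMap.ext fun x => Subtype.ext (by
    change HHat.g ρ c b (h : G) * (innerY ρ c b v * x.1) =
      innerY ρ c b (ρ h v) * (HHat.g ρ c b (h : G) * x.1)
    rw [← mul_assoc, g_mul_innerY, mul_assoc])
  y_f v φ := LinearMap.ext fun x => Subtype.ext (by
    simp only [LinearMap.add_apply, LinearMap.sum_apply, LinearMap.smul_apply, Submodule.coe_add,
      Submodule.coe_sum, Submodule.coe_smul, Pi.one_apply, one_mul]
    change innerY ρ c b v * (HHat.f ρ c b (extendZero ρ b _) * x.1) =
      HHat.f ρ c b (extendZero ρ b _) * (innerY ρ c b v * x.1) +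
      (HHat.f ρ c b (extendZero ρ b _) * x.1 + ∑ s ∈ reflections (stabRep ρ b),
        (reflCoef c (s : G) * root ρ (s : G) v) • (HHat.f ρ c b (extendZero ρ b _) *
          (HHat.g ρ c b (s : G) * x.1)))
    rw [← mul_assoc, innerY_mul_f_extendZero, add_mul, add_mul, mul_assoc, Finset.sum_mul,
      formalFun_zero_eq, derivFun_apply]
    congr 2
    refine Finset.sum_congr rfl fun s _ => ?_
    rw [smul_mul_assoc, mul_assoc])

variable (hρ : Function.Injective ρ)

/-- The action of `Ĥ_{c'}(G_b, V)_0` on the right ideal generated by the indicator function. -/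
def baseLift : StabHat ρ c b →ₐ[ℂ] Module.End ℂ (baseCorner ρ c b) :=
  HHat.lift (baseData c b) fun v v' => LinearMap.ext fun x => Subtype.ext (by
    change innerY ρ c b v * (innerY ρ c b v' * x.1) = innerY ρ c b v' * (innerY ρ c b v * x.1)
    rw [← mul_assoc, ← mul_assoc]
    congr 1
    exact (HHat.data ρ c b).subPert_commute hρ (HHat.y_y ρ c b) v v')

theorem baseLift_mul (a : StabHat ρ c b) : ∀ (x : baseCorner ρ c b) (z : HHat ρ c b)
    (h : x.1 * z ∈ baseCorner ρ c b), (baseLift c b hρ a ⟨x.1 * z, h⟩ : HHat ρ c b) =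
      (baseLift c b hρ a x).1 * z := by
  induction a using HHat.induction with
  | hf φ =>
    intro x z h
    rw [baseLift, HHat.lift_f]
    exact (mul_assoc _ _ _).symm
  | hy v =>
    intro x z h
    rw [baseLift, HHat.lift_y]
    exact (mul_assoc _ _ _).symm
  | hg w =>
    intro x z h
    rw [baseLift, HHat.lift_g]
    exact (mul_assoc _ _ _).symm
  | hadd a a' ha ha' =>
    intro x z h
    rw [map_add, LinearMap.add_apply, LinearMap.add_apply, Submodule.coe_add, Submodule.coe_add,
      ha, ha', add_mul]
  | hmul a a' ha ha' =>
    intro x z h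
    rw [map_mul, Module.End.mul_apply, Module.End.mul_apply, ← ha]
    · congr 2
      exact Subtype.ext (ha' x z h)
    · rw [← ha' x z h]
      exact Subtype.prop _

/-- The embedding of `Ĥ_{c'}(G_b, V)_0`. -/
def baseEmb (a : StabHat ρ c b) : HHat ρ c b :=
  (baseLift c b hρ a ⟨baseIdem ρ c b, baseIdem_mul_self c b⟩).1

theorem baseLift_eq (a : StabHat ρ c b) (x : baseCorner ρ c b) :
    (baseLift c b hρ a x).1 = baseEmb c b hρ a * x.1 := by
  have h : baseIdem ρ c b * x.1 ∈ baseCorner ρ c b := by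
    rw [mem_baseCorner, ← mul_assoc, baseIdem_mul_self]
  rw [baseEmb, ← baseLift_mul c b hρ a ⟨baseIdem ρ c b, baseIdem_mul_self c b⟩ x.1 h]
  congr 2
  exact Subtype.ext x.2.symm

theorem baseEmb_mul (a a' : StabHat ρ c b) :
    baseEmb c b hρ (a * a') = baseEmb c b hρ a * baseEmb c b hρ a' := by
  rw [baseEmb, map_mul, Module.End.mul_apply, baseLift_eq]
  rfl

theorem baseEmb_add (a a' : StabHat ρ c b) :
    baseEmb c b hρ (a + a') = baseEmb c b hρ a + baseEmb c b hρ a' := by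
  rw [baseEmb, map_add, LinearMap.add_apply, Submodule.coe_add]
  rfl

theorem baseEmb_smul (r : ℂ) (a : StabHat ρ c b) :
    baseEmb c b hρ (r • a) = r • baseEmb c b hρ a := by
  rw [baseEmb, map_smul, LinearMap.smul_apply, Submodule.coe_smul]
  rfl

theorem baseEmb_f (φ : FormalFun (stabRep ρ b) 0) :
    baseEmb c b hρ (HHat.f (stabRep ρ b) (stabParam ρ c b) 0 φ) =
      HHat.f ρ c b (extendZero ρ b (φ (basePt (stabRep ρ b) 0))) := by
  rw [baseEmb, baseLift, HHat.lift_f]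
  exact f_extendZero_mul_baseIdem c b _

theorem baseEmb_g (h : stab ρ b) :
    baseEmb c b hρ (HHat.g (stabRep ρ b) (stabParam ρ c b) 0 h) =
      HHat.g ρ c b (h : G) * baseIdem ρ c b := by
  rw [baseEmb, baseLift, HHat.lift_g]
  rfl

theorem baseEmb_y (v : V) :
    baseEmb c b hρ (HHat.y (stabRep ρ b) (stabParam ρ c b) 0 v) =
      innerY ρ c b v * baseIdem ρ c b := by
  rw [baseEmb, baseLift, HHat.lift_y]
  rfl

theorem baseEmb_one : baseEmb c b hρ 1 = baseIdem ρ c b := by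
  rw [baseEmb, map_one]; rfl

open FunK

theorem thetaHom_innerY (v : V) : thetaHom c b hρ (innerY ρ c b v) = thetaDeriv c b v := by
  have h1 : thetaHom c b hρ ((HHat.data ρ c b).pert v) = (thetaData c b).pert v := by
    rw [DunklData.pert, map_sum, DunklData.pert]
    refine Finset.sum_congr rfl fun s _ => ?_
    rw [map_smul, map_mul, map_sub, map_one]
    have h2 : ∀ φ, thetaHom c b hρ ((HHat.data ρ c b).ι φ) = (thetaData c b).ι φ :=
      thetaHom_f c b hρ
    have h3 : ∀ w, thetaHom c b hρ ((HHat.data ρ c b).γ w) = (thetaData c b).γ w :=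
      thetaHom_g c b hρ
    rw [h2, h3]
  have h2 := thetaHom_y c b hρ v
  rw [y_eq_innerY_add, map_add, h1] at h2
  refine LinearMap.ext fun F => ?_
  have h3 := LinearMap.congr_fun h2 F
  rw [LinearMap.add_apply, LinearMap.add_apply] at h3
  exact add_right_cancel h3

theorem thetaFun_extendZero (f : FormalSeries V) :
    thetaFun c b (extendZero ρ b f) = corner (stab_g_mul c b) (stabSeries ρ c b f) := by
  refine LinearMap.ext fun F => Subtype.ext (funext fun w => ?_)
  rw [thetaFun_apply, corner_apply]
  by_cases hw : w ∈ stab ρ b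
  · rw [actFun_extendZero b hw, extendZero_same, basePoint_apply_mem _ hw, FunK.coe_mem F hw,
      ← mul_assoc, ← mul_assoc]
    congr 1
    exact (g_stabSeries c b ⟨w, hw⟩ f).symm
  · rw [actFun_extendZero_basePt b hw, basePoint_apply_notMem _ hw, stabSeries_zero, zero_mul,
      zero_mul]

theorem thetaHom_baseIdem : thetaHom c b hρ (baseIdem ρ c b) = corner (stab_g_mul c b) 1 := by
  rw [baseIdem, thetaHom_f, thetaFun_extendZero]
  congr 1
  exact HHat.f_one _ _ _

theorem thetaHom_baseEmb (a : StabHat ρ c b) :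
    thetaHom c b hρ (baseEmb c b hρ a) = corner (stab_g_mul c b) a := by
  induction a using HHat.induction with
  | hf φ =>
    rw [baseEmb_f, thetaHom_f, thetaFun_extendZero, stabSeries, formalFun_zero_eq]
  | hy v =>
    rw [baseEmb_y, map_mul, thetaHom_innerY, thetaHom_baseIdem]
    refine LinearMap.ext fun F => Subtype.ext (funext fun w => ?_)
    change (thetaDeriv c b v (corner (stab_g_mul c b) 1 F)).1 w = _
    rw [thetaDeriv_apply, corner_apply, corner_apply, one_mul]
    by_cases hw : w ∈ stab ρ b
    · rw [basePoint_apply_mem _ hw, ← mul_assoc, ← mul_assoc]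
      congr 1
      exact (HHat.g_y (stabRep ρ b) (stabParam ρ c b) 0 ⟨w, hw⟩ v).symm
    · rw [basePoint_apply_notMem _ hw, zero_mul, zero_mul, mul_zero]
  | hg h =>
    rw [baseEmb_g, map_mul, thetaHom_g, thetaHom_baseIdem]
    refine LinearMap.ext fun F => Subtype.ext (funext fun w => ?_)
    change (corner (stab_g_mul c b) 1 F).1 (w * h) = _
    rw [corner_apply, corner_apply, one_mul]
    by_cases hw : w ∈ stab ρ b
    · have hwh : w * h ∈ stab ρ b := mul_mem hw h.2
      rw [basePoint_apply_mem _ hw, basePoint_apply_mem _ hwh, ← mul_assoc]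
      congr 1
      exact HHat.g_mul (stabRep ρ b) (stabParam ρ c b) 0 ⟨w, hw⟩ h
    · have hwh : w * h ∉ stab ρ b := fun h' => hw (((stab ρ b).mul_mem_cancel_right h.2).1 h')
      rw [basePoint_apply_notMem _ hw, basePoint_apply_notMem _ hwh, zero_mul, zero_mul]
  | hadd a a' ha ha' => rw [baseEmb_add, map_add, ha, ha', corner_add]
  | hmul a a' ha ha' => rw [baseEmb_mul, map_mul, ha, ha', corner_mul (stab_g_one c b)]

theorem sum_actFun_extendZero [Fintype G] :
    ∑ r : G, actFun r⁻¹ (extendZero ρ b 1) = (Nat.card (stab ρ b) : FormalFun ρ b) := by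
  classical
  funext p
  obtain ⟨p, g, rfl⟩ := p
  rw [Finset.sum_apply]
  have h1 : ∀ r : G, actFun r⁻¹ (extendZero ρ b 1) ⟨ρ g b, g, rfl⟩ =
      if r * g ∈ stab ρ b then (1 : FormalSeries V) else 0 := by
    intro r
    unfold actFun
    split_ifs with h
    · have h2 : (⟨ρ r⁻¹⁻¹ (ρ g b), rep_mem_orbit ρ _ ⟨g, rfl⟩⟩ : orbit ρ b) = basePt ρ b :=
        Subtype.ext (by
          change ρ r⁻¹⁻¹ (ρ g b) = b
          rw [inv_inv, ← Module.End.mul_apply, ← map_mul]; exact h)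
      rw [h2, extendZero_same, map_one]
    · rw [extendZero_ne, map_zero]
      intro h2
      have h3 := congrArg Subtype.val h2
      simp only [inv_inv] at h3
      rw [← Module.End.mul_apply, ← map_mul] at h3
      exact h h3
  simp only [h1]
  rw [Finset.sum_ite, Finset.sum_const_zero, add_zero, Finset.sum_const]
  have h3 : (Finset.univ.filter fun r : G => r * g ∈ stab ρ b).card = Nat.card (stab ρ b) := by
    rw [Nat.card_eq_fintype_card, ← Finset.card_univ]
    refine Finset.card_bij' (fun r hr => ⟨r * g, (Finset.mem_filter.1 hr).2⟩)
      (fun h _ => (h : G) * g⁻¹) ?_ ?_ ?_ ?_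
    · simp
    · intro h _; simp
    · intro r _; simp
    · intro h _; simp
  rw [h3, nsmul_one]
  rfl

theorem sum_g_baseIdem [Fintype G] :
    (Nat.card (stab ρ b) : ℂ)⁻¹ • ∑ r : G, HHat.g ρ c b r⁻¹ * baseIdem ρ c b * HHat.g ρ c b r =
      1 := by
  have h1 : ∀ r : G, HHat.g ρ c b r⁻¹ * baseIdem ρ c b * HHat.g ρ c b r =
      HHat.fHom ρ c b (actFun r⁻¹ (extendZero ρ b 1)) := by
    intro r
    rw [baseIdem, HHat.g_f, mul_assoc, ← HHat.g_mul, inv_mul_cancel, HHat.g_one, mul_one]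
    rfl
  simp only [h1]
  rw [← map_sum, sum_actFun_extendZero, map_natCast, ← nsmul_one (A := HHat ρ c b),
    ← Nat.cast_smul_eq_nsmul ℂ, smul_smul, inv_mul_cancel₀, one_smul]
  exact_mod_cast Nat.card_pos.ne'

theorem baseIdem_f_g_baseIdem (φ : FormalFun ρ b) (w : G) : ∃ a, baseEmb c b hρ a =
    baseIdem ρ c b * (HHat.f ρ c b φ * HHat.g ρ c b w) * baseIdem ρ c b := by
  by_cases hw : w ∈ stab ρ b
  · refine ⟨HHat.f _ _ 0 (fun _ => φ (basePt ρ b)) * HHat.g _ _ 0 ⟨w, hw⟩, ?_⟩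
    rw [baseEmb_mul, baseEmb_f, baseEmb_g, ← mul_assoc (baseIdem ρ c b), baseIdem_mul_f, mul_assoc]
  · refine ⟨0, ?_⟩
    have h0 : baseEmb c b hρ 0 = 0 := by rw [baseEmb, map_zero]; rfl
    rw [h0, mul_assoc, mul_assoc, baseIdem, HHat.g_f, ← mul_assoc, ← HHat.f_mul, ← mul_assoc,
      ← HHat.f_mul]
    have : extendZero ρ b 1 * φ * actFun w (extendZero ρ b 1) = 0 := by
      rw [mul_assoc, mul_comm, mul_extendZero_one, Pi.mul_apply, actFun_extendZero_basePt b hw,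
        mul_zero, map_zero]
    rw [this, HHat.f_zero, zero_mul]

theorem exists_baseEmb_eq (z : HHat ρ c b) (r r' : G) : ∃ a, baseEmb c b hρ a =
    baseIdem ρ c b * (HHat.g ρ c b r * z * HHat.g ρ c b r') * baseIdem ρ c b := by
  induction z using HHat.induction generalizing r r' with
  | hf φ =>
    rw [HHat.g_f, mul_assoc (HHat.f ρ c b _), ← HHat.g_mul]
    exact baseIdem_f_g_baseIdem c b hρ _ _
  | hg w =>
    rw [← HHat.g_mul, ← HHat.g_mul, ← one_mul (HHat.g ρ c b _), ← HHat.f_one]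
    exact baseIdem_f_g_baseIdem c b hρ _ _
  | hadd z z' h h' =>
    obtain ⟨a, ha⟩ := h r r'
    obtain ⟨a', ha'⟩ := h' r r'
    exact ⟨a + a', by rw [baseEmb_add, ha, ha']; noncomm_ring⟩
  | hmul z z' h h' =>
    let _ := Fintype.ofFinite G
    choose a ha using fun p => h r p⁻¹
    choose a' ha' using fun p => h' p r'
    refine ⟨(Nat.card (stab ρ b) : ℂ)⁻¹ • ∑ p, a p * a' p, ?_⟩
    have hsum : ∀ (t : Finset G) (F : G → StabHat ρ c b),
        baseEmb c b hρ (∑ p ∈ t, F p) = ∑ p ∈ t, baseEmb c b hρ (F p) := fun t F =>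
      map_sum (AddMonoidHom.mk' (baseEmb c b hρ) (baseEmb_add c b hρ)) F t
    have h1 : z * z' = (Nat.card (stab ρ b) : ℂ)⁻¹ • ∑ p : G, z *
        (HHat.g ρ c b p⁻¹ * baseIdem ρ c b * HHat.g ρ c b p) * z' := by
      rw [← Finset.sum_mul, ← Finset.mul_sum, ← smul_mul_assoc, ← mul_smul_comm, sum_g_baseIdem,
        mul_one]
    rw [baseEmb_smul, hsum, h1, mul_smul_comm, smul_mul_assoc, mul_smul_comm, smul_mul_assoc,
      Finset.mul_sum, Finset.sum_mul, Finset.mul_sum, Finset.sum_mul]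
    congr 1
    refine Finset.sum_congr rfl fun p _ => ?_
    rw [baseEmb_mul, ha, ha']
    have h2 := baseIdem_mul_self (ρ := ρ) c b
    calc _ = baseIdem ρ c b * (HHat.g ρ c b r * z * HHat.g ρ c b p⁻¹) *
          (baseIdem ρ c b * baseIdem ρ c b) * (HHat.g ρ c b p * z' * HHat.g ρ c b r') *
          baseIdem ρ c b := by noncomm_ring
      _ = _ := by rw [h2]; noncomm_ring
  | hy v =>
    have hsum : ∀ (t : Finset G) (F : G → StabHat ρ c b),
        baseEmb c b hρ (∑ p ∈ t, F p) = ∑ p ∈ t, baseEmb c b hρ (F p) := fun t F =>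
      map_sum (AddMonoidHom.mk' (baseEmb c b hρ) (baseEmb_add c b hρ)) F t
    rw [HHat.g_y, mul_assoc (HHat.y ρ c b _), ← HHat.g_mul, y_eq_innerY_add, add_mul, mul_add, add_mul]
    have h1 : ∃ a, baseEmb c b hρ a = baseIdem ρ c b * (innerY ρ c b (ρ r v) *
        HHat.g ρ c b (r * r')) * baseIdem ρ c b := by
      obtain ⟨a, ha⟩ := baseIdem_f_g_baseIdem c b hρ 1 (r * r')
      refine ⟨HHat.y _ _ 0 (ρ r v) * a, ?_⟩
      rw [baseEmb_mul, baseEmb_y, ha, HHat.f_one, one_mul]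
      have h2 := baseIdem_mul_self (ρ := ρ) c b
      calc _ = innerY ρ c b (ρ r v) * (baseIdem ρ c b * baseIdem ρ c b) *
            (HHat.g ρ c b (r * r') * baseIdem ρ c b) := by noncomm_ring
        _ = _ := by
          rw [h2, innerY_mul_baseIdem]; noncomm_ring
    have h2 : ∀ s : G, ∃ a, baseEmb c b hρ a = baseIdem ρ c b *
        (reflCoef c s • ((HHat.data ρ c b).ι (root ρ s (ρ r v) • rootInv ρ b s) *
          ((HHat.data ρ c b).γ s - 1)) * HHat.g ρ c b (r * r')) * baseIdem ρ c b := by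
      intro s
      obtain ⟨a, ha⟩ := baseIdem_f_g_baseIdem c b hρ (root ρ s (ρ r v) • rootInv ρ b s) (s * (r * r'))
      obtain ⟨a', ha'⟩ := baseIdem_f_g_baseIdem c b hρ (root ρ s (ρ r v) • rootInv ρ b s) (r * r')
      refine ⟨reflCoef c s • (a + (-1 : ℂ) • a'), ?_⟩
      rw [baseEmb_smul, baseEmb_add, baseEmb_smul, ha, ha', HHat.g_mul _ _ _ s]
      change _ = baseIdem ρ c b * (reflCoef c s • (HHat.f ρ c b _ * (HHat.g ρ c b s - 1)) *
        HHat.g ρ c b (r * r')) * baseIdem ρ c b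
      rw [smul_mul_assoc, mul_smul_comm, smul_mul_assoc]
      congr 1
      rw [neg_one_smul]
      noncomm_ring
    obtain ⟨a, ha⟩ := h1
    choose a' ha' using h2
    refine ⟨a + ∑ s ∈ reflections ρ, a' s, ?_⟩
    rw [baseEmb_add, hsum, ha]
    congr 1
    rw [DunklData.pert, Finset.sum_mul, Finset.mul_sum, Finset.sum_mul]
    exact Finset.sum_congr rfl fun s _ => ha' s

theorem thetaHom_injective : Function.Injective (thetaHom c b hρ) := by
  let _ := Fintype.ofFinite G
  refine (injective_iff_map_eq_zero _).2 fun z hz => ?_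
  have h1 : ∀ r r' : G, baseIdem ρ c b * (HHat.g ρ c b r * z * HHat.g ρ c b r') *
      baseIdem ρ c b = 0 := by
    intro r r'
    obtain ⟨a, ha⟩ := exists_baseEmb_eq c b hρ z r r'
    have h2 := congrArg (thetaHom c b hρ) ha
    rw [thetaHom_baseEmb, map_mul, map_mul, map_mul, map_mul, hz, mul_zero, zero_mul, mul_zero,
      zero_mul, ← corner_zero (stab_g_mul c b)] at h2
    rw [← ha, corner_injective (stab_g_one c b) _ h2, baseEmb, map_zero]
    rfl
  have h2 := sum_g_baseIdem (ρ := ρ) c b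
  have h3 : z = ((Nat.card (stab ρ b) : ℂ)⁻¹ • ∑ r : G,
      HHat.g ρ c b r⁻¹ * baseIdem ρ c b * HHat.g ρ c b r) * z *
      ((Nat.card (stab ρ b) : ℂ)⁻¹ • ∑ r : G,
      HHat.g ρ c b r⁻¹ * baseIdem ρ c b * HHat.g ρ c b r) := by rw [h2, one_mul, mul_one]
  rw [h3, smul_mul_assoc, mul_smul_comm, smul_mul_assoc, Finset.sum_mul, Finset.sum_mul_sum,
    Finset.sum_eq_zero, smul_zero, smul_zero]
  intro r _
  refine Finset.sum_eq_zero fun r' _ => ?_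
  calc _ = HHat.g ρ c b r⁻¹ * (baseIdem ρ c b * (HHat.g ρ c b r * z * HHat.g ρ c b r'⁻¹) *
      baseIdem ρ c b) * HHat.g ρ c b r' := by noncomm_ring
    _ = 0 := by rw [h1, mul_zero, zero_mul]

theorem thetaHom_surjective : Function.Surjective (thetaHom c b hρ) := by
  let _ := Fintype.ofFinite G
  intro z
  have h2 := congrArg (thetaHom c b hρ) (sum_g_baseIdem (ρ := ρ) c b)
  rw [map_one] at h2
  have h3 : z = thetaHom c b hρ ((Nat.card (stab ρ b) : ℂ)⁻¹ • ∑ r : G,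
      HHat.g ρ c b r⁻¹ * baseIdem ρ c b * HHat.g ρ c b r) * z *
      thetaHom c b hρ ((Nat.card (stab ρ b) : ℂ)⁻¹ • ∑ r : G,
      HHat.g ρ c b r⁻¹ * baseIdem ρ c b * HHat.g ρ c b r) := by rw [h2, one_mul, mul_one]
  change z ∈ (thetaHom c b hρ).range
  rw [h3, map_smul, smul_mul_assoc, mul_smul_comm, smul_mul_assoc, map_sum, Finset.sum_mul,
    Finset.sum_mul_sum]
  refine Subalgebra.smul_mem _ (Subalgebra.smul_mem _ (sum_mem fun r _ => sum_mem fun r' _ => ?_) _) _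
  have h4 := corner_sandwich (stab_g_one c b) (stab_g_mul c b)
    (thetaHom c b hρ (HHat.g ρ c b r) * z * thetaHom c b hρ (HHat.g ρ c b r'⁻¹))
  rw [← thetaHom_baseIdem c b hρ, ← thetaHom_baseEmb c b hρ] at h4
  refine ⟨HHat.g ρ c b r⁻¹ * (baseEmb c b hρ (((thetaHom c b hρ (HHat.g ρ c b r) * z *
    thetaHom c b hρ (HHat.g ρ c b r'⁻¹)) (basePoint (stab_g_mul c b))).1 1)) * HHat.g ρ c b r', ?_⟩
  change thetaHom c b hρ _ = _
  rw [map_mul, map_mul, ← h4]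
  simp only [map_mul]
  noncomm_ring

/-- The isomorphism `θ`. -/
def thetaEquiv : HHat ρ c b ≃+* ZHat ρ c b :=
  RingEquiv.ofBijective (thetaHom c b hρ) ⟨thetaHom_injective c b hρ, thetaHom_surjective c b hρ⟩

theorem thetaEquiv_apply (z : HHat ρ c b) : thetaEquiv c b hρ z = thetaHom c b hρ z := rfl

theorem isTheta_thetaEquiv : IsTheta ρ c b (thetaEquiv c b hρ) where
  apply_g u F w := by rw [thetaEquiv_apply, thetaHom_g]; rfl
  apply_f φ F w := by rw [thetaEquiv_apply, thetaHom_f]; rfl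
  apply_y a F w := by
    rw [thetaEquiv_apply, thetaHom_y_apply]

end ThetaBijective


section Shift

open Polynomial

/-- The translate `p(X - k)` of a polynomial. -/
def shift (p : ℂ[X]) (k : ℂ) : ℂ[X] := p.comp (X - C k)

theorem shift_shift (p : ℂ[X]) (k l : ℂ) : shift (shift p k) l = shift p (k + l) := by
  unfold shift
  rw [comp_assoc, sub_comp, X_comp, C_comp, map_add]
  congr 1
  ring

theorem shift_zero (p : ℂ[X]) : shift p 0 = p := by simp [shift]

theorem shift_mul (p q : ℂ[X]) (k : ℂ) : shift (p * q) k = shift p k * shift q k := mul_comp _ _ _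

theorem shift_one (k : ℂ) : shift 1 k = 1 := one_comp

theorem eval_shift (p : ℂ[X]) (k z : ℂ) : (shift p k).eval z = p.eval (z - k) := by
  simp [shift]

theorem shift_ne_zero {p : ℂ[X]} (hp : p ≠ 0) (k : ℂ) : shift p k ≠ 0 := by
  intro h
  apply hp
  have := congrArg (fun q => shift q (-k)) h
  simp only [shift_shift, add_neg_cancel, shift_zero] at this
  rw [this, shift, zero_comp]

theorem aeval_shift {A : Type*} [Ring A] [Algebra ℂ A] (e : A) (p : ℂ[X]) (k : ℂ) :
    aeval e (shift p k) = aeval (e - algebraMap ℂ A k) p := by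
  simp [shift, aeval_comp]

theorem aeval_mul_of_mul_eq {A : Type*} [Ring A] [Algebra ℂ A] {e e' z : A} (h : e' * z = z * e)
    (p : ℂ[X]) : aeval e' p * z = z * aeval e p := by
  induction p using Polynomial.induction_on' with
  | add p q hp hq => rw [map_add, map_add, add_mul, mul_add, hp, hq]
  | monomial n a =>
    rw [aeval_monomial, aeval_monomial, mul_assoc, pow_shift h, ← mul_assoc, ← mul_assoc,
      Algebra.commutes]

theorem isCoprime_of_forall_eval {p q : ℂ[X]} (h : ∀ z, p.eval z = 0 → q.eval z ≠ 0) :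
    IsCoprime p q := by
  rw [Polynomial.isCoprime_iff_aeval_ne_zero_of_isAlgClosed ℂ ℂ]
  intro z
  by_cases hz : p.eval z = 0
  · right; simpa [Polynomial.aeval_def] using h z hz
  · left; simpa [Polynomial.aeval_def] using hz

theorem exists_isCoprime_shift {p q : ℂ[X]} (hp : p ≠ 0) (hq : q ≠ 0) :
    ∃ k₀ : ℕ, ∀ k : ℕ, k₀ ≤ k → IsCoprime (shift p k) q := by
  obtain ⟨B, hB⟩ := ((p.roots.toFinset ×ˢ q.roots.toFinset).image
    fun t => ‖t.2 - t.1‖).bddAbove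
  refine ⟨⌊B⌋₊ + 1, fun k hk => isCoprime_of_forall_eval fun z hz hz' => ?_⟩
  rw [eval_shift] at hz
  have h1 : ‖z - (z - k)‖ ≤ B := hB (by
    rw [Finset.mem_coe, Finset.mem_image]
    exact ⟨(z - k, z), by simp [hp, hq, hz, hz'], rfl⟩)
  rw [sub_sub_cancel, Complex.norm_natCast] at h1
  have h2 : B < ⌊B⌋₊ + 1 := Nat.lt_floor_add_one B
  have h3 : ((⌊B⌋₊ + 1 : ℕ) : ℝ) ≤ k := by exact_mod_cast hk
  push_cast at h3
  linarith

/-- The part of `q` that is coprime to `p`. -/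
theorem exists_coprime_dvd_mul_pow {p q : ℂ[X]} (hq : q ≠ 0) :
    ∃ (w : ℂ[X]) (n : ℕ), w ≠ 0 ∧ IsCoprime w p ∧ q ∣ w * p ^ n := by
  induction h : q.natDegree using Nat.strong_induction_on generalizing q with
  | _ d ih =>
    by_cases hc : IsCoprime q p
    · exact ⟨q, 0, hq, hc, by simp⟩
    · obtain ⟨z, hz, hz'⟩ : ∃ z, q.eval z = 0 ∧ p.eval z = 0 := by
        by_contra hcon
        push Not at hcon
        exact hc (isCoprime_of_forall_eval hcon)
      obtain ⟨q', rfl⟩ := dvd_iff_isRoot.2 hz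
      obtain ⟨p', hp'⟩ := dvd_iff_isRoot.2 hz'
      have hq' : q' ≠ 0 := right_ne_zero_of_mul hq
      rw [natDegree_mul (X_sub_C_ne_zero z) hq', natDegree_X_sub_C] at h
      obtain ⟨w, n, hw, hwp, hd⟩ := ih q'.natDegree (by omega) hq' rfl
      refine ⟨w, n + 1, hw, hwp, ?_⟩
      rw [pow_succ', ← mul_assoc, mul_comm w, mul_assoc]
      refine mul_dvd_mul ?_ hd
      rw [hp']
      exact dvd_mul_right _ _

end Shift

section EulerPoly

open Polynomial

variable {G V : Type u} [Group G] [Finite G] [AddCommGroup V] [Module ℂ V]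
  [FiniteDimensional ℂ V] (ρ : Representation ℂ G V) (c : Param ρ)

/-- A polynomial in the Euler element. -/
def eulerPoly (p : ℂ[X]) : H ρ c := aeval (euler ρ c) p

theorem eulerPoly_mul (p q : ℂ[X]) : eulerPoly ρ c (p * q) = eulerPoly ρ c p * eulerPoly ρ c q :=
  map_mul _ _ _

theorem eulerPoly_add (p q : ℂ[X]) : eulerPoly ρ c (p + q) = eulerPoly ρ c p + eulerPoly ρ c q :=
  map_add _ _ _

theorem eulerPoly_one : eulerPoly ρ c 1 = 1 := map_one _

theorem eulerPoly_commute (p q : ℂ[X]) :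
    eulerPoly ρ c p * eulerPoly ρ c q = eulerPoly ρ c q * eulerPoly ρ c p := by
  rw [← eulerPoly_mul, mul_comm, eulerPoly_mul]

theorem eulerPoly_shift_x (p : ℂ[X]) (a : Module.Dual ℂ V) :
    eulerPoly ρ c (shift p 1) * H.x ρ c a = H.x ρ c a * eulerPoly ρ c p := by
  rw [eulerPoly, aeval_shift]
  apply aeval_mul_of_mul_eq
  rw [sub_mul, euler_x, map_one, one_mul, add_sub_cancel_right]

theorem eulerPoly_y (p : ℂ[X]) (v : V) :
    eulerPoly ρ c p * H.y ρ c v = H.y ρ c v * eulerPoly ρ c (shift p 1) := by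
  rw [eulerPoly, eulerPoly, aeval_shift]
  apply aeval_mul_of_mul_eq
  rw [euler_y, map_one, mul_sub, mul_one]

/-- The part of the Euler element in the group algebra. -/
def eulerConst : H ρ c :=
  algebraMap ℂ _ (Module.finrank ℂ V / 2) -
    ∑ s ∈ reflections ρ, (2 * c.val s / (1 - reflEigenvalue ρ s)) • H.g ρ c s

theorem euler_eq : euler ρ c =
    ∑ i, H.x ρ c ((Module.finBasis ℂ V).coord i) * H.y ρ c (Module.finBasis ℂ V i) +
      eulerConst ρ c := by
  rw [euler, eulerConst, add_sub_assoc]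

/-- The group algebra in `H_c(G, V)`. -/
def groupAlgHom : MonoidAlgebra ℂ G →ₐ[ℂ] H ρ c :=
  MonoidAlgebra.lift ℂ _ _
    { toFun := H.g ρ c
      map_one' := H.g_one ρ c
      map_mul' := H.g_mul ρ c }

theorem groupAlgHom_single (w : G) (r : ℂ) :
    groupAlgHom ρ c (MonoidAlgebra.single w r) = r • H.g ρ c w := by
  simp [groupAlgHom]

theorem exists_eulerConst_root : ∃ r : ℂ[X], r.Monic ∧ aeval (eulerConst ρ c) r = 0 := by
  have hfin : Module.Finite ℂ (MonoidAlgebra ℂ G) :=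
    Module.Finite.equiv (MonoidAlgebra.coeffLinearEquiv (S := ℂ) (M := G) ℂ).symm
  obtain ⟨z, hz⟩ : ∃ z, groupAlgHom ρ c z = eulerConst ρ c :=
    ⟨algebraMap ℂ _ (Module.finrank ℂ V / 2) -
      ∑ s ∈ reflections ρ,
        (MonoidAlgebra.single s (2 * c.val s / (1 - reflEigenvalue ρ s)) : MonoidAlgebra ℂ G), by
      rw [map_sub, map_sum, AlgHom.commutes, eulerConst]
      simp only [groupAlgHom_single]⟩
  obtain ⟨r, hr, h⟩ := Algebra.IsIntegral.isIntegral (R := ℂ) z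
  refine ⟨r, hr, ?_⟩
  rw [← hz, Polynomial.aeval_algHom_apply, Polynomial.aeval_def, h, map_zero]

/-- A monic polynomial that annihilates the group algebra part of the Euler element. -/
def constPoly : ℂ[X] := (exists_eulerConst_root ρ c).choose

theorem constPoly_monic : (constPoly ρ c).Monic := (exists_eulerConst_root ρ c).choose_spec.1

theorem constPoly_ne_zero : constPoly ρ c ≠ 0 := (constPoly_monic ρ c).ne_zero

theorem aeval_constPoly : aeval (eulerConst ρ c) (constPoly ρ c) = 0 :=
  (exists_eulerConst_root ρ c).choose_spec.2

/-- The product of the first `n` translates of a polynomial. -/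
def shiftProd (p : ℂ[X]) (n : ℕ) : ℂ[X] := ∏ j ∈ Finset.range n, shift p j

theorem shiftProd_ne_zero {p : ℂ[X]} (hp : p ≠ 0) (n : ℕ) : shiftProd p n ≠ 0 :=
  Finset.prod_ne_zero_iff.2 fun _ _ => shift_ne_zero hp _

variable {M : Type*} [AddCommGroup M] [Module ℂ M] [Module (H ρ c) M] [IsScalarTower ℂ (H ρ c) M]

theorem H_smul_comm (z : H ρ c) (r : ℂ) (m : M) : z • r • m = r • z • m := by
  rw [← algebraMap_smul (H ρ c) r m, ← algebraMap_smul (H ρ c) r (z • m), ← mul_smul, ← mul_smul,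
    Algebra.commutes]

/-- The action of an element of `H_c(G, V)`, as a linear map. -/
def opH (M : Type*) [AddCommGroup M] [Module ℂ M] [Module (H ρ c) M] [IsScalarTower ℂ (H ρ c) M]
    (z : H ρ c) : M →ₗ[ℂ] M where
  toFun m := z • m
  map_add' := smul_add z
  map_smul' r m := H_smul_comm ρ c z r m

variable {ρ c} in
theorem eulerPoly_smul_mem {X : Submodule ℂ M} (hX : ∀ m ∈ X, euler ρ c • m ∈ X) (p : ℂ[X])
    {m : M} (hm : m ∈ X) : eulerPoly ρ c p • m ∈ X := by
  induction p using Polynomial.induction_on' with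
  | add p q hp hq => rw [eulerPoly_add, add_smul]; exact X.add_mem hp hq
  | monomial n a =>
    rw [eulerPoly, aeval_monomial, mul_smul, algebraMap_smul]
    refine X.smul_mem _ ?_
    induction n with
    | zero => simpa using hm
    | succ n ih => rw [pow_succ', mul_smul]; exact hX _ ih

variable {ρ c} in
theorem constPoly_smul_mem {X U : Submodule ℂ M} (hX : ∀ m ∈ X, euler ρ c • m ∈ X)
    (hU : ∀ w, ∀ m ∈ U, H.g ρ c w • m ∈ U)
    (hUX : ∀ m ∈ U, ∀ v : V, ∀ a, H.x ρ c a • H.y ρ c v • m ∈ X) {m : M} (hm : m ∈ U) :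
    eulerPoly ρ c (constPoly ρ c) • m ∈ X := by
  have hc : ∀ m ∈ U, eulerConst ρ c • m ∈ U := by
    intro m hm
    rw [eulerConst, sub_smul, Finset.sum_smul, algebraMap_smul]
    refine U.sub_mem (U.smul_mem _ hm) (U.sum_mem fun s _ => ?_)
    rw [smul_assoc]
    exact U.smul_mem _ (hU s m hm)
  have h1 : ∀ m ∈ U, euler ρ c • m - eulerConst ρ c • m ∈ X := by
    intro m hm
    rw [euler_eq, add_smul, add_sub_cancel_right, Finset.sum_smul]
    refine X.sum_mem fun i _ => ?_
    rw [mul_smul]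
    exact hUX m hm _ _
  have h2 : ∀ (n : ℕ), ∀ m ∈ U, euler ρ c ^ n • m - eulerConst ρ c ^ n • m ∈ X := by
    intro n
    induction n with
    | zero => intro m _; simp
    | succ n ih =>
      intro m hm
      have h3 : euler ρ c ^ n • (euler ρ c • m - eulerConst ρ c • m) ∈ X := by
        have := eulerPoly_smul_mem hX (Polynomial.X ^ n) (h1 m hm)
        rwa [eulerPoly, map_pow, aeval_X] at this
      have h4 := X.add_mem h3 (ih _ (hc m hm))
      rwa [smul_sub, sub_add_sub_cancel, ← mul_smul, ← mul_smul, ← pow_succ, ← pow_succ] at h4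
  have h3 : ∀ p : ℂ[X], eulerPoly ρ c p • m - aeval (eulerConst ρ c) p • m ∈ X := by
    intro p
    induction p using Polynomial.induction_on' with
    | add p q hp hq =>
      rw [eulerPoly_add, map_add, add_smul, add_smul, add_sub_add_comm]
      exact X.add_mem hp hq
    | monomial n a =>
      rw [eulerPoly, aeval_monomial, aeval_monomial, mul_smul, mul_smul, algebraMap_smul,
        algebraMap_smul, ← smul_sub]
      exact X.smul_mem _ (h2 n m hm)
  have h4 := h3 (constPoly ρ c)
  rwa [aeval_constPoly, zero_smul, sub_zero] at h4

variable (M) in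
/-- The vectors killed by all products of `n` elements of `V`. -/
def nilOrder (n : ℕ) : Submodule ℂ M where
  carrier := {m | NilpotentOfOrder ρ c n m}
  zero_mem' := nilpotentOfOrder_zero n
  add_mem' := NilpotentOfOrder.add
  smul_mem' r m h := by
    rw [← algebraMap_smul (H ρ c) r m]
    exact NilpotentOfOrder.algebraMap_smul r h

variable {ρ c}

theorem mem_nilOrder {n : ℕ} {m : M} : m ∈ nilOrder ρ c M n ↔ NilpotentOfOrder ρ c n m := Iff.rfl

theorem mem_nilOrder_succ {n : ℕ} {m : M} :
    m ∈ nilOrder ρ c M (n + 1) ↔ ∀ v, H.y ρ c v • m ∈ nilOrder ρ c M n := Iff.rfl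

theorem mem_nilOrder_one {m : M} : m ∈ nilOrder ρ c M 1 ↔ ∀ v, H.y ρ c v • m = 0 := Iff.rfl

theorem nilOrder_mono {n k : ℕ} (h : n ≤ k) : nilOrder ρ c M n ≤ nilOrder ρ c M k :=
  fun _ hm => NilpotentOfOrder.mono h hm

theorem euler_smul_mem_nilOrder {n : ℕ} {m : M} (hm : m ∈ nilOrder ρ c M n) :
    euler ρ c • m ∈ nilOrder ρ c M n := by
  induction n generalizing m with
  | zero => rw [show m = 0 from hm, smul_zero]; exact Submodule.zero_mem _
  | succ n ih =>
    rw [mem_nilOrder_succ] at hm ⊢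
    intro v
    have h1 : H.y ρ c v * euler ρ c = euler ρ c * H.y ρ c v + H.y ρ c v := by
      rw [euler_y, sub_add_cancel]
    rw [← mul_smul, h1, add_smul, mul_smul]
    exact Submodule.add_mem _ (ih (hm v)) (hm v)

theorem eulerPoly_smul_mem_nilOrder {n : ℕ} {m : M} (hm : m ∈ nilOrder ρ c M n) (p : ℂ[X]) :
    eulerPoly ρ c p • m ∈ nilOrder ρ c M n :=
  eulerPoly_smul_mem (fun _ => euler_smul_mem_nilOrder) p hm

theorem constPoly_smul_singular {m : M} (hm : m ∈ nilOrder ρ c M 1) :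
    eulerPoly ρ c (constPoly ρ c) • m = 0 := by
  have := constPoly_smul_mem (ρ := ρ) (c := c) (X := (⊥ : Submodule ℂ M))
    (U := nilOrder ρ c M 1) (by simp) (fun w m h => NilpotentOfOrder.g_smul w h)
    (fun m h v a => by rw [mem_nilOrder_one.1 h v, smul_zero]; exact Submodule.zero_mem _) hm
  simpa using this

theorem shift_constPoly_smul_mem {n : ℕ} {m : M} (hm : m ∈ nilOrder ρ c M (n + 1)) :
    eulerPoly ρ c (shift (constPoly ρ c) n) • m ∈ nilOrder ρ c M n := by
  induction n generalizing m with
  | zero =>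
    rw [Nat.cast_zero, shift_zero, constPoly_smul_singular hm]
    exact Submodule.zero_mem _
  | succ n ih =>
    rw [mem_nilOrder_succ]
    intro v
    rw [Nat.cast_succ, ← shift_shift, ← mul_smul, ← eulerPoly_y, mul_smul]
    exact ih (mem_nilOrder_succ.1 hm v)

theorem shiftProd_smul_eq_zero {n : ℕ} {m : M} (hm : m ∈ nilOrder ρ c M n) :
    eulerPoly ρ c (shiftProd (constPoly ρ c) n) • m = 0 := by
  induction n generalizing m with
  | zero => rw [show m = 0 from hm, smul_zero]
  | succ n ih =>
    rw [shiftProd, Finset.prod_range_succ, eulerPoly_mul, mul_smul]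
    exact ih (shift_constPoly_smul_mem hm)

theorem eulerPoly_smul_eq_zero_of_isCoprime {p q : ℂ[X]} (h : IsCoprime p q) {X : Submodule ℂ M}
    (hX : ∀ m ∈ X, euler ρ c • m ∈ X) {m : M} (hp : eulerPoly ρ c p • m ∈ X)
    (hq : eulerPoly ρ c q • m ∈ X) : m ∈ X := by
  obtain ⟨a, b, hab⟩ := h
  have h1 := X.add_mem (eulerPoly_smul_mem hX a hp) (eulerPoly_smul_mem hX b hq)
  rwa [← mul_smul, ← mul_smul, ← eulerPoly_mul, ← eulerPoly_mul, ← add_smul, ← eulerPoly_add,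
    hab, eulerPoly_one, one_smul] at h1

theorem eq_zero_of_isCoprime {p q : ℂ[X]} (h : IsCoprime p q) {m : M}
    (hp : eulerPoly ρ c p • m = 0) (hq : eulerPoly ρ c q • m = 0) : m = 0 := by
  have := eulerPoly_smul_eq_zero_of_isCoprime (ρ := ρ) (c := c) (X := (⊥ : Submodule ℂ M)) h
    (by simp) (m := m) (by simpa using hp) (by simpa using hq)
  simpa using this

omit [Module ℂ M] [IsScalarTower ℂ (H ρ c) M] in
theorem mem_eulerFinite_of_eulerPoly {p : ℂ[X]} (hp : p ≠ 0) {m : M}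
    (hm : eulerPoly ρ c p • m = 0) : m ∈ eulerFinite ρ c M := by
  induction h : p.natDegree using Nat.strong_induction_on generalizing p m with
  | _ d ih =>
    by_cases hd : p.natDegree = 0
    · obtain ⟨a, rfl⟩ := natDegree_eq_zero.1 hd
      have ha : a ≠ 0 := by simpa using hp
      have h2 : m = 0 := by
        have h3 : eulerPoly ρ c (C a⁻¹) • eulerPoly ρ c (C a) • m = 0 := by rw [hm, smul_zero]
        rwa [← mul_smul, ← eulerPoly_mul, ← C_mul, inv_mul_cancel₀ ha, C_1, eulerPoly_one,
          one_smul] at h3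
      rw [h2]
      exact Submodule.zero_mem _
    · obtain ⟨z, hz⟩ := IsAlgClosed.exists_root p (by
        rw [degree_eq_natDegree hp]
        exact_mod_cast hd)
      obtain ⟨q, hq, hqz⟩ := exists_eq_pow_rootMultiplicity_mul_and_not_dvd p hp z
      have hn : 0 < p.rootMultiplicity z := (rootMultiplicity_pos hp).2 hz
      set n := p.rootMultiplicity z with hn'
      have hq0 : q ≠ 0 := by rintro rfl; simp at hqz
      have hcop : IsCoprime ((X - C z) ^ n) q :=
        ((irreducible_X_sub_C z).coprime_iff_not_dvd.2 hqz).pow_left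
      have hdeg : p.natDegree = n + q.natDegree := by
        conv_lhs => rw [hq]
        rw [natDegree_mul (pow_ne_zero _ (X_sub_C_ne_zero z)) hq0, natDegree_pow,
          natDegree_X_sub_C, mul_one]
      obtain ⟨a, b, hab⟩ := hcop
      have h1 : eulerPoly ρ c (a * (X - C z) ^ n) • m + eulerPoly ρ c (b * q) • m = m := by
        rw [← add_smul, ← eulerPoly_add, hab, eulerPoly_one, one_smul]
      rw [← h1]
      refine Submodule.add_mem _ (ih q.natDegree (by omega) hq0 ?_ rfl) ?_
      · rw [← mul_smul, ← eulerPoly_mul, mul_left_comm, mul_comm q, ← hq, eulerPoly_mul, mul_smul,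
          hm, smul_zero]
      · refine AddSubgroup.subset_closure ⟨z, n, ?_⟩
        have h2 : (euler ρ c - algebraMap ℂ _ z) ^ n = eulerPoly ρ c ((X - C z) ^ n) := by
          simp [eulerPoly]
        rw [h2, ← mul_smul, ← eulerPoly_mul, mul_left_comm, ← hq, eulerPoly_mul, mul_smul, hm,
          smul_zero]

theorem nilOrder_le_eulerFinite {n : ℕ} {m : M} (hm : m ∈ nilOrder ρ c M n) :
    m ∈ eulerFinite ρ c M :=
  mem_eulerFinite_of_eulerPoly (shiftProd_ne_zero (constPoly_ne_zero ρ c) n)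
    (shiftProd_smul_eq_zero hm)

end EulerPoly


section FiniteCodimension

variable {R N : Type*} [CommRing R] [Algebra ℂ R] [AddCommGroup N] [Module R N] [Module ℂ N]
  [IsScalarTower ℂ R N]

theorem exists_fg_sup_pow_smul (I : Ideal R) (hI : I.FG) (hN : Module.Finite R N)
    {D : Submodule ℂ R} (hD : D.FG) (hDI : D ⊔ I.restrictScalars ℂ = ⊤) (k : ℕ) :
    ∃ F : Submodule ℂ N, F.FG ∧ F ⊔ (I ^ k • ⊤ : Submodule R N).restrictScalars ℂ = ⊤ := by
  have hone : ∃ F : Submodule ℂ N, F.FG ∧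
      F ⊔ (I • ⊤ : Submodule R N).restrictScalars ℂ = ⊤ := by
    obtain ⟨s, hs⟩ := hN.fg_top
    refine ⟨Submodule.map₂ (Algebra.lsmul ℂ ℂ N).toLinearMap D (Submodule.span ℂ s),
      hD.map₂ _ (Submodule.fg_span s.finite_toSet), ?_⟩
    have key : ∀ n ∈ Submodule.span R (s : Set N), ∀ r : R, r • n ∈
        Submodule.map₂ (Algebra.lsmul ℂ ℂ N).toLinearMap D (Submodule.span ℂ s) ⊔
          (I • ⊤ : Submodule R N).restrictScalars ℂ := by
      intro n hn
      induction hn using Submodule.span_induction with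
      | zero => intro r; rw [smul_zero]; exact Submodule.zero_mem _
      | add a b _ _ ha hb => intro r; rw [smul_add]; exact Submodule.add_mem _ (ha r) (hb r)
      | smul r' x _ hx => intro r; rw [smul_smul]; exact hx _
      | mem x hx =>
        intro r
        obtain ⟨d, hd, i, hi, h⟩ := Submodule.mem_sup.1 (hDI ▸ Submodule.mem_top : r ∈ _)
        rw [← h, add_smul]
        have h1 : d • x ∈ Submodule.map₂ (Algebra.lsmul ℂ ℂ N).toLinearMap D (Submodule.span ℂ s) :=
          Submodule.apply_mem_map₂ _ hd (Submodule.subset_span hx)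
        have h2 : i • x ∈ (I • ⊤ : Submodule R N) := Submodule.smul_mem_smul hi Submodule.mem_top
        exact Submodule.add_mem_sup h1 h2
    rw [eq_top_iff]
    rintro n -
    rw [← one_smul R n]
    exact key n (by rw [hs]; trivial) 1
  obtain ⟨F₁, hF₁, h₁⟩ := hone
  induction k with
  | zero => exact ⟨⊥, Submodule.fg_bot, by simp⟩
  | succ k ih =>
    obtain ⟨F, hF, h⟩ := ih
    obtain ⟨t, ht⟩ := hI.pow (n := k)
    let F' := Submodule.map₂ (Algebra.lsmul ℂ ℂ N).toLinearMap (Submodule.span ℂ (t : Set R)) F₁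
    refine ⟨F ⊔ F', hF.sup ((Submodule.fg_span t.finite_toSet).map₂ _ hF₁), ?_⟩
    have key : ∀ r ∈ I ^ k, ∀ n : N,
        r • n ∈ F' ⊔ (I ^ (k + 1) • ⊤ : Submodule R N).restrictScalars ℂ := by
      intro r hr
      rw [← ht] at hr
      induction hr using Submodule.span_induction with
      | zero => intro n; rw [zero_smul]; exact Submodule.zero_mem _
      | add a b _ _ ha hb => intro n; rw [add_smul]; exact Submodule.add_mem _ (ha n) (hb n)
      | smul a r _ ih => intro n; rw [smul_eq_mul, mul_comm, mul_smul]; exact ih _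
      | mem r hr =>
        intro n
        obtain ⟨d, hd, i, hi, h⟩ := Submodule.mem_sup.1 (h₁ ▸ Submodule.mem_top : n ∈ _)
        rw [← h, smul_add]
        have h1 : r • d ∈ F' := Submodule.apply_mem_map₂ _ (Submodule.subset_span hr) hd
        refine Submodule.add_mem_sup h1 ?_
        change r • i ∈ I ^ (k + 1) • (⊤ : Submodule R N)
        rw [pow_succ, Submodule.mul_smul]
        exact Submodule.smul_mem_smul (ht ▸ Ideal.subset_span hr) hi
    rw [eq_top_iff, ← h, sup_assoc]
    refine sup_le le_sup_left (le_trans ?_ le_sup_right)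
    intro n hn
    refine Submodule.smul_induction_on (show n ∈ I ^ k • (⊤ : Submodule R N) from hn)
      (fun r hr n _ => key r hr n) fun a b ha hb => Submodule.add_mem _ ha hb

theorem finiteDimensional_of_disjoint {F S T : Submodule ℂ N} (hF : F.FG) (hFT : F ⊔ T = ⊤)
    (hST : S ⊓ T = ⊥) : FiniteDimensional ℂ S := by
  have : FiniteDimensional ℂ F := Module.Finite.of_fg hF
  have h1 : FiniteDimensional ℂ (N ⧸ T) := by
    refine Module.Finite.of_surjective (T.mkQ ∘ₗ F.subtype) fun q => ?_
    obtain ⟨n, rfl⟩ := T.mkQ_surjective q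
    obtain ⟨d, hd, t, ht, h⟩ := Submodule.mem_sup.1 (hFT ▸ Submodule.mem_top : n ∈ F ⊔ T)
    refine ⟨⟨d, hd⟩, ?_⟩
    rw [← h, map_add, (Submodule.mkQ_apply T t), (Submodule.Quotient.mk_eq_zero T).2 ht, add_zero]
    rfl
  refine Module.Finite.of_injective (T.mkQ ∘ₗ S.subtype) ?_
  rw [← LinearMap.ker_eq_bot, eq_bot_iff]
  rintro ⟨s, hs⟩ h
  have h2 : s ∈ S ⊓ T := ⟨hs, (Submodule.Quotient.mk_eq_zero T).1 h⟩
  rw [hST] at h2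
  exact Subtype.ext h2

end FiniteCodimension

section CommAeval

open scoped IsMulCommutative

variable {R ι : Type*} [Ring R] [Algebra ℂ R] (z : ι → R) (h : ∀ i j, z i * z j = z j * z i)

/-- Evaluation of polynomials at a commuting family. -/
def commAeval : MvPolynomial ι ℂ →ₐ[ℂ] R :=
  have := Algebra.isMulCommutative_adjoin ℂ (s := Set.range z)
    (by rintro _ ⟨i, rfl⟩ _ ⟨j, rfl⟩; exact h i j)
  (Algebra.adjoin ℂ (Set.range z)).val.comp
    (MvPolynomial.aeval fun i => (⟨z i, Algebra.subset_adjoin ⟨i, rfl⟩⟩ :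
      Algebra.adjoin ℂ (Set.range z)))

@[simp] theorem commAeval_X (i : ι) : commAeval z h (MvPolynomial.X i) = z i := by
  have := Algebra.isMulCommutative_adjoin ℂ (s := Set.range z)
    (by rintro _ ⟨i, rfl⟩ _ ⟨j, rfl⟩; exact h i j)
  change (Algebra.adjoin ℂ (Set.range z)).val (MvPolynomial.aeval _ (MvPolynomial.X i)) = z i
  rw [MvPolynomial.aeval_X]
  rfl

end CommAeval

section PolyAction

variable {G V : Type u} [Group G] [Finite G] [AddCommGroup V] [Module ℂ V]
  [FiniteDimensional ℂ V] (ρ : Representation ℂ G V) (c : Param ρ)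

/-- The homomorphism `ℂ[V] → H_c(G, V)`. -/
def polyH : Poly V →ₐ[ℂ] H ρ c :=
  commAeval (fun i => H.x ρ c ((Module.finBasis ℂ V).coord i)) fun _ _ => H.x_x ρ c _ _

@[simp] theorem polyH_X (i : Fin (Module.finrank ℂ V)) :
    polyH ρ c (MvPolynomial.X i) = H.x ρ c ((Module.finBasis ℂ V).coord i) := commAeval_X _ _ i

/-- The polynomial of degree one given by a linear form. -/
def linPoly (a : Module.Dual ℂ V) : Poly V :=
  ∑ i, a (Module.finBasis ℂ V i) • MvPolynomial.X i

theorem polyH_linPoly (a : Module.Dual ℂ V) : polyH ρ c (linPoly a) = H.x ρ c a := by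
  rw [linPoly, map_sum, ← sum_coord_x]
  simp only [map_smul, polyH_X]

theorem range_polyH : (polyH ρ c).range = polySubalgebra ρ c := by
  apply le_antisymm
  · rintro _ ⟨P, rfl⟩
    change polyH ρ c P ∈ _
    induction P using MvPolynomial.induction_on with
    | C r =>
      rw [← MvPolynomial.algebraMap_eq, AlgHom.commutes]
      exact Subalgebra.algebraMap_mem _ r
    | add p q hp hq => rw [map_add]; exact Subalgebra.add_mem _ hp hq
    | mul_X p i hp =>
      rw [map_mul, polyH_X]
      exact Subalgebra.mul_mem _ hp (Algebra.subset_adjoin ⟨_, rfl⟩)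
  · refine Algebra.adjoin_le ?_
    rintro _ ⟨a, rfl⟩
    exact ⟨linPoly a, polyH_linPoly ρ c a⟩

/-- Left multiplication by polynomials. -/
instance polyModuleH : Module (Poly V) (H ρ c) := Module.compHom _ (polyH ρ c).toRingHom

theorem poly_smul_H (P : Poly V) (z : H ρ c) : P • z = polyH ρ c P * z := rfl

variable {M : Type*} [AddCommGroup M] [Module (H ρ c) M] [Module (Poly V) M]
  [IsScalarTower (Poly V) (H ρ c) M]

theorem poly_smul (P : Poly V) (m : M) : P • m = polyH ρ c P • m := by
  rw [← one_smul (H ρ c) m, ← smul_assoc, poly_smul_H, mul_one, one_smul]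

theorem X_smul (i : Fin (Module.finrank ℂ V)) (m : M) :
    (MvPolynomial.X i : Poly V) • m = H.x ρ c ((Module.finBasis ℂ V).coord i) • m := by
  rw [poly_smul ρ c, polyH_X]

theorem linPoly_smul (a : Module.Dual ℂ V) (m : M) : linPoly a • m = H.x ρ c a • m := by
  rw [poly_smul ρ c, polyH_linPoly]

theorem finite_polySubalgebra_iff :
    Module.Finite (polySubalgebra ρ c) M ↔ Module.Finite (Poly V) M := by
  have hmem : ∀ P : Poly V, polyH ρ c P ∈ polySubalgebra ρ c := fun P => by
    rw [← range_polyH]; exact ⟨P, rfl⟩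
  constructor
  · rintro ⟨s, hs⟩
    refine ⟨s, ?_⟩
    rw [eq_top_iff] at hs ⊢
    rintro m -
    have hm := hs (show m ∈ ⊤ from trivial)
    induction hm using Submodule.span_induction with
    | zero => exact Submodule.zero_mem _
    | mem x hx => exact Submodule.subset_span hx
    | add a b _ _ ha hb => exact Submodule.add_mem _ ha hb
    | smul r x _ hx =>
      obtain ⟨r, hr⟩ := r
      have hr' := hr
      rw [← range_polyH] at hr'
      obtain ⟨P, rfl⟩ := hr'
      have h2 : (⟨polyH ρ c P, hr⟩ : polySubalgebra ρ c) • x = P • x := (poly_smul ρ c P x).symm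
      change (⟨polyH ρ c P, hr⟩ : polySubalgebra ρ c) • x ∈ _
      rw [h2]
      exact Submodule.smul_mem _ _ hx
  · rintro ⟨s, hs⟩
    refine ⟨s, ?_⟩
    rw [eq_top_iff] at hs ⊢
    rintro m -
    have hm := hs (show m ∈ ⊤ from trivial)
    induction hm using Submodule.span_induction with
    | zero => exact Submodule.zero_mem _
    | mem x hx => exact Submodule.subset_span hx
    | add a b _ _ ha hb => exact Submodule.add_mem _ ha hb
    | smul P x _ hx =>
      have h2 : (⟨polyH ρ c P, hmem P⟩ : polySubalgebra ρ c) • x = P • x := (poly_smul ρ c P x).symm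
      rw [← h2]
      exact Submodule.smul_mem _ _ hx

end PolyAction

section CategoryOCriterion

open Polynomial

variable {G V : Type u} [Group G] [Finite G] [AddCommGroup V] [Module ℂ V]
  [FiniteDimensional ℂ V] {ρ : Representation ℂ G V} {c : Param ρ}
variable {M : Type*} [AddCommGroup M] [Module ℂ M] [Module (H ρ c) M] [IsScalarTower ℂ (H ρ c) M]
  [Module (Poly V) M] [IsScalarTower (Poly V) (H ρ c) M]

variable (V) in
/-- The ideal of polynomials without constant term. -/
def augIdeal : Ideal (Poly V) := Ideal.span (Set.range MvPolynomial.X)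

theorem augIdeal_fg : (augIdeal V).FG := Submodule.fg_span (Set.finite_range _)

theorem augIdeal_compl :
    ∃ D : Submodule ℂ (Poly V), D.FG ∧ D ⊔ (augIdeal V).restrictScalars ℂ = ⊤ := by
  refine ⟨Submodule.span ℂ {1}, Submodule.fg_span (Set.finite_singleton _), ?_⟩
  rw [eq_top_iff]
  rintro P -
  induction P using MvPolynomial.induction_on with
  | C r =>
    refine Submodule.mem_sup_left (Submodule.mem_span_singleton.2 ⟨r, ?_⟩)
    rw [← MvPolynomial.algebraMap_eq, Algebra.algebraMap_eq_smul_one]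
  | add p q hp hq => exact Submodule.add_mem _ hp hq
  | mul_X p i _ =>
    exact Submodule.mem_sup_right (Ideal.mul_mem_left _ _ (Ideal.subset_span ⟨i, rfl⟩))

omit [IsScalarTower ℂ (H ρ c) M] [IsScalarTower (Poly V) (H ρ c) M] [Module ℂ M] [Module (Poly V) M] in
theorem NilpotentOfOrder.of_forall_finBasis {n : ℕ} {m : M}
    (h : ∀ i, NilpotentOfOrder ρ c n (H.y ρ c (Module.finBasis ℂ V i) • m)) :
    NilpotentOfOrder ρ c (n + 1) m := by
  intro v
  rw [← sum_coord_y, Finset.sum_smul]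
  refine NilpotentOfOrder.sum _ _ fun i _ => ?_
  rw [Algebra.smul_def, mul_smul]
  exact (h i).algebraMap_smul _

theorem finiteDimensional_nilOrder (h : FiniteDimensional ℂ (nilOrder ρ c M 1)) (n : ℕ) :
    FiniteDimensional ℂ (nilOrder ρ c M n) := by
  induction n with
  | zero =>
    have : nilOrder ρ c M 0 = ⊥ := by
      ext m; exact Iff.rfl
    rw [this]
    infer_instance
  | succ n ih =>
    let φ : nilOrder ρ c M (n + 1) →ₗ[ℂ] (Fin (Module.finrank ℂ V) → nilOrder ρ c M n) :=
      LinearMap.pi fun i => (opH ρ c M (H.y ρ c (Module.finBasis ℂ V i))).restrict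
        fun m hm => mem_nilOrder_succ.1 hm _
    have hker : FiniteDimensional ℂ (LinearMap.ker φ) := by
      have hle : (LinearMap.ker φ).map (Submodule.subtype _) ≤ nilOrder ρ c M 1 := by
        rintro _ ⟨m, hm, rfl⟩
        refine NilpotentOfOrder.of_forall_finBasis fun i => ?_
        exact congrArg Subtype.val (congrFun (LinearMap.mem_ker.1 hm) i)
      have := Submodule.finiteDimensional_of_le hle
      exact Module.Finite.equiv (Submodule.equivMapOfInjective _ (Submodule.subtype_injective _)
        (LinearMap.ker φ)).symm
    have := Module.Finite.equiv φ.quotKerEquivRange.symm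
    exact Module.Finite.of_submodule_quotient (LinearMap.ker φ)

theorem mem_nilOrder_of_isCoprime {A : ℂ[X]} {n₀ : ℕ}
    (hA : ∀ n : ℕ, n₀ ≤ n → IsCoprime (shift (constPoly ρ c) n) A) {N : ℕ} {m : M}
    (hm : m ∈ nilOrder ρ c M N) (h : eulerPoly ρ c A • m = 0) : m ∈ nilOrder ρ c M n₀ := by
  induction N with
  | zero => rw [show m = 0 from hm]; exact Submodule.zero_mem _
  | succ N ih =>
    by_cases hN : N + 1 ≤ n₀
    · exact nilOrder_mono hN hm
    · refine ih (eulerPoly_smul_eq_zero_of_isCoprime (hA N (by omega))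
        (fun _ => euler_smul_mem_nilOrder) (shift_constPoly_smul_mem hm) ?_)
      rw [h]
      exact Submodule.zero_mem _

/-- A locally nilpotent module with finite dimensional space of singular vectors is finitely
generated over `ℂ[V]`. -/
theorem finite_poly_of_singular (hM : ∀ m : M, IsNilpotentVec ρ c m)
    (hs : FiniteDimensional ℂ (nilOrder ρ c M 1)) : Module.Finite (Poly V) M := by
  have hr := constPoly_ne_zero ρ c
  obtain ⟨n₁, hn₁⟩ := exists_isCoprime_shift hr hr
  obtain ⟨n₀, hn₀⟩ := exists_isCoprime_shift hr (shiftProd_ne_zero hr n₁)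
  have htower : IsScalarTower ℂ (Poly V) M := ⟨fun r P m => by
    rw [poly_smul ρ c, poly_smul ρ c, map_smul, smul_assoc]⟩
  have key : ∀ N : ℕ, ∀ m ∈ nilOrder ρ c M N,
      m ∈ Submodule.span (Poly V) (nilOrder ρ c M n₀ : Set M) := by
    intro N
    induction N with
    | zero => intro m hm; rw [show m = 0 from hm]; exact Submodule.zero_mem _
    | succ N ih =>
      intro m hm
      let X : Submodule ℂ M := Submodule.span ℂ
        {t | ∃ (a : Module.Dual ℂ V) (u : M), u ∈ nilOrder ρ c M N ∧ t = H.x ρ c a • u}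
      have hXle : ∀ t ∈ X, t ∈ Submodule.span (Poly V) (nilOrder ρ c M n₀ : Set M) := by
        intro t ht
        induction ht using Submodule.span_induction with
        | zero => exact Submodule.zero_mem _
        | add a b _ _ ha hb => exact Submodule.add_mem _ ha hb
        | smul r x _ hx => exact Submodule.smul_of_tower_mem _ r hx
        | mem x hx =>
          obtain ⟨a, u, hu, rfl⟩ := hx
          rw [← linPoly_smul ρ c]
          exact Submodule.smul_mem _ _ (ih u hu)
      have hXe : ∀ t ∈ X, euler ρ c • t ∈ X := by
        intro t ht
        induction ht using Submodule.span_induction with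
        | zero => rw [smul_zero]; exact Submodule.zero_mem _
        | add a b _ _ ha hb => rw [smul_add]; exact Submodule.add_mem _ ha hb
        | smul r x _ hx => rw [H_smul_comm]; exact Submodule.smul_mem _ r hx
        | mem x hx =>
          obtain ⟨a, u, hu, rfl⟩ := hx
          rw [← mul_smul, euler_x, add_smul, mul_smul]
          exact X.add_mem (Submodule.subset_span ⟨a, _, euler_smul_mem_nilOrder hu, rfl⟩)
            (Submodule.subset_span ⟨a, u, hu, rfl⟩)
      have h1 : eulerPoly ρ c (constPoly ρ c) • m ∈ X :=
        constPoly_smul_mem (U := nilOrder ρ c M (N + 1)) hXe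
          (fun w m h => NilpotentOfOrder.g_smul w h)
          (fun m h v a => Submodule.subset_span ⟨a, _, mem_nilOrder_succ.1 h v, rfl⟩) hm
      let B : ℂ[X] := ∏ j ∈ Finset.Ico n₁ (max n₁ (N + 1)), shift (constPoly ρ c) j
      have hB : IsCoprime B (constPoly ρ c) :=
        IsCoprime.prod_left fun j hj => hn₁ j (Finset.mem_Ico.1 hj).1
      have hAB : shiftProd (constPoly ρ c) n₁ * B =
          shiftProd (constPoly ρ c) (max n₁ (N + 1)) :=
        Finset.prod_range_mul_prod_Ico _ (le_max_left _ _)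
      obtain ⟨a, b, hab⟩ := hB
      have h2 : eulerPoly ρ c (a * B) • m + eulerPoly ρ c (b * constPoly ρ c) • m = m := by
        rw [← add_smul, ← eulerPoly_add, hab, eulerPoly_one, one_smul]
      rw [← h2]
      refine Submodule.add_mem _ (Submodule.subset_span ?_) (hXle _ ?_)
      · refine mem_nilOrder_of_isCoprime hn₀ (eulerPoly_smul_mem_nilOrder hm _) ?_
        rw [← mul_smul, ← eulerPoly_mul, mul_left_comm, hAB, eulerPoly_mul, mul_smul,
          shiftProd_smul_eq_zero (nilOrder_mono (le_max_right _ _) hm), smul_zero]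
      · rw [eulerPoly_mul, mul_smul]
        exact eulerPoly_smul_mem hXe _ h1
  have hfd := finiteDimensional_nilOrder hs n₀
  obtain ⟨s, hs⟩ := (Module.Finite.iff_fg.1 hfd)
  refine ⟨s, ?_⟩
  rw [eq_top_iff]
  rintro m -
  obtain ⟨N, hN⟩ := hM m
  refine Submodule.span_le.2 ?_ (key N m hN)
  rw [← hs]
  exact Submodule.span_subset_span ℂ (Poly V) _

/-- Vectors killed by products of the translates of `P(𝐡)` by at least `k`. -/
def shiftKer (M : Type*) [AddCommGroup M] [Module ℂ M] [Module (H ρ c) M]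
    [IsScalarTower ℂ (H ρ c) M] [Module (Poly V) M] [IsScalarTower (Poly V) (H ρ c) M]
    (P : ℂ[X]) (k : ℕ) : Set M :=
  {m | ∃ W ∈ Submonoid.closure {p | ∃ d : ℕ, k ≤ d ∧ p = shift P d}, eulerPoly ρ c W • m = 0}

theorem x_smul_mem_shiftKer {P : ℂ[X]} {k : ℕ} {m : M} (hm : m ∈ shiftKer (ρ := ρ) (c := c) M P k)
    (a : Module.Dual ℂ V) : H.x ρ c a • m ∈ shiftKer (ρ := ρ) (c := c) M P (k + 1) := by
  obtain ⟨W, hW, h⟩ := hm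
  refine ⟨shift W 1, ?_, by rw [← mul_smul, eulerPoly_shift_x, mul_smul, h, smul_zero]⟩
  clear h
  induction hW using Submonoid.closure_induction with
  | mem p hp =>
    obtain ⟨d, hd, rfl⟩ := hp
    refine Submonoid.subset_closure ⟨d + 1, by omega, ?_⟩
    rw [shift_shift, Nat.cast_succ]
  | one => rw [shift_one]; exact Submonoid.one_mem _
  | mul p q _ _ hp hq => rw [shift_mul]; exact Submonoid.mul_mem _ hp hq

theorem shiftKer_anti {P : ℂ[X]} {k : ℕ} {m : M}
    (hm : m ∈ shiftKer (ρ := ρ) (c := c) M P (k + 1)) : m ∈ shiftKer (ρ := ρ) (c := c) M P k := by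
  obtain ⟨W, hW, h⟩ := hm
  refine ⟨W, Submonoid.closure_mono ?_ hW, h⟩
  rintro _ ⟨d, hd, rfl⟩
  exact ⟨d, by omega, rfl⟩

variable (ρ c M) in
/-- `shiftKer` as a submodule over `ℂ[V]`. -/
def shiftKerSub (P : ℂ[X]) (k : ℕ) : Submodule (Poly V) M where
  carrier := shiftKer (ρ := ρ) (c := c) M P k
  zero_mem' := ⟨1, Submonoid.one_mem _, smul_zero _⟩
  add_mem' := by
    rintro a b ⟨W, hW, h⟩ ⟨W', hW', h'⟩
    refine ⟨W * W', Submonoid.mul_mem _ hW hW', ?_⟩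
    rw [smul_add, eulerPoly_mul, mul_smul _ _ b, h', smul_zero, eulerPoly_commute, mul_smul, h,
      smul_zero, add_zero]
  smul_mem' := by
    intro Q m hm
    have hadd : ∀ a b : M, a ∈ shiftKer (ρ := ρ) (c := c) M P k →
        b ∈ shiftKer (ρ := ρ) (c := c) M P k → a + b ∈ shiftKer (ρ := ρ) (c := c) M P k := by
      rintro a b ⟨W, hW, h⟩ ⟨W', hW', h'⟩
      refine ⟨W * W', Submonoid.mul_mem _ hW hW', ?_⟩
      rw [smul_add, eulerPoly_mul, mul_smul _ _ b, h', smul_zero, eulerPoly_commute, mul_smul, h,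
        smul_zero, add_zero]
    induction Q using MvPolynomial.induction_on generalizing m with
    | C r =>
      obtain ⟨W, hW, h⟩ := hm
      refine ⟨W, hW, ?_⟩
      rw [← MvPolynomial.algebraMap_eq, poly_smul ρ c, AlgHom.commutes, algebraMap_smul,
        H_smul_comm, h, smul_zero]
    | add p q hp hq => rw [add_smul]; exact hadd _ _ (hp hm) (hq hm)
    | mul_X p i hp =>
      rw [mul_smul]
      refine hp ?_
      rw [X_smul ρ c]
      exact shiftKer_anti (x_smul_mem_shiftKer hm _)

theorem augIdeal_pow_smul_le_shiftKerSub {P : ℂ[X]} (h0 : shiftKerSub ρ c M P 0 = ⊤) (k : ℕ) :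
    augIdeal V ^ k • (⊤ : Submodule (Poly V) M) ≤ shiftKerSub ρ c M P k := by
  induction k with
  | zero => rw [h0]; exact le_top
  | succ k ih =>
    rw [pow_succ', Submodule.mul_smul]
    refine (Submodule.smul_mono le_rfl ih).trans (Submodule.smul_le.2 fun Q hQ m hm => ?_)
    induction hQ using Submodule.span_induction with
    | zero => rw [zero_smul]; exact Submodule.zero_mem _
    | add a b _ _ ha hb => rw [add_smul]; exact Submodule.add_mem _ ha hb
    | smul r x _ hx => rw [smul_assoc]; exact Submodule.smul_mem _ r hx
    | mem x hx =>
      obtain ⟨i, rfl⟩ := hx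
      rw [X_smul ρ c]
      exact x_smul_mem_shiftKer hm _

/-- In an object of category `𝒪`, the vectors killed by `q(𝐡)` meet deep terms of the `ℂ[V]`-adic
filtration trivially. -/
theorem exists_eq_zero_of_mem_augIdeal_pow (hM : ∀ m : M, IsNilpotentVec ρ c m)
    (hfin : Module.Finite (Poly V) M) {q : ℂ[X]} (hq : q ≠ 0) :
    ∃ k : ℕ, ∀ m ∈ augIdeal V ^ k • (⊤ : Submodule (Poly V) M), eulerPoly ρ c q • m = 0 → m = 0 := by
  obtain ⟨s, hs⟩ := hfin.fg_top
  choose n hn using hM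
  let N := s.sup n
  let P := shiftProd (constPoly ρ c) N
  have hP : P ≠ 0 := shiftProd_ne_zero (constPoly_ne_zero ρ c) N
  obtain ⟨k, hk⟩ := exists_isCoprime_shift hP hq
  have h0 : shiftKerSub ρ c M P 0 = ⊤ := by
    rw [eq_top_iff, ← hs, Submodule.span_le]
    intro m hm
    refine ⟨shift P (0 : ℕ), Submonoid.subset_closure ⟨0, le_rfl, rfl⟩, ?_⟩
    rw [Nat.cast_zero, shift_zero]
    exact shiftProd_smul_eq_zero (nilOrder_mono (Finset.le_sup hm) (mem_nilOrder.2 (hn m)))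
  refine ⟨k, fun m hm hqm => ?_⟩
  obtain ⟨W, hW, h⟩ := augIdeal_pow_smul_le_shiftKerSub h0 k hm
  refine eq_zero_of_isCoprime (ρ := ρ) (c := c) (p := W) (q := q) ?_ h hqm
  clear h
  induction hW using Submonoid.closure_induction with
  | mem p hp =>
    obtain ⟨d, hd, rfl⟩ := hp
    exact hk d hd
  | one => exact isCoprime_one_left
  | mul p q _ _ hp hq => exact hp.mul_left hq

theorem finiteDimensional_singular (hM : ∀ m : M, IsNilpotentVec ρ c m)
    (hfin : Module.Finite (Poly V) M) : FiniteDimensional ℂ (nilOrder ρ c M 1) := by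
  have htower : IsScalarTower ℂ (Poly V) M := ⟨fun r P m => by
    rw [poly_smul ρ c, poly_smul ρ c, map_smul, smul_assoc]⟩
  obtain ⟨k, hk⟩ := exists_eq_zero_of_mem_augIdeal_pow hM hfin (constPoly_ne_zero ρ c)
  obtain ⟨D, hD, hDI⟩ := augIdeal_compl (V := V)
  obtain ⟨F, hF, h⟩ := exists_fg_sup_pow_smul (N := M) (augIdeal V) augIdeal_fg hfin hD hDI k
  refine finiteDimensional_of_disjoint hF h (eq_bot_iff.2 ?_)
  rintro m ⟨h1, h2⟩
  exact hk m h2 (constPoly_smul_singular h1)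

theorem eq_bot_of_augIdeal_smul_eq_top (hM : ∀ m : M, IsNilpotentVec ρ c m)
    (hfin : Module.Finite (Poly V) M) (h : augIdeal V • (⊤ : Submodule (Poly V) M) = ⊤) (m : M) :
    m = 0 := by
  have hpow : ∀ k, augIdeal V ^ k • (⊤ : Submodule (Poly V) M) = ⊤ := by
    intro k
    induction k with
    | zero => simp
    | succ k ih => rw [pow_succ, Submodule.mul_smul, h, ih]
  obtain ⟨N, hN⟩ := hM m
  obtain ⟨k, hk⟩ := exists_eq_zero_of_mem_augIdeal_pow hM hfin
    (shiftProd_ne_zero (constPoly_ne_zero ρ c) N)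
  exact hk m (by rw [hpow]; trivial) (shiftProd_smul_eq_zero (mem_nilOrder.2 hN))

end CategoryOCriterion


section AdicLimit

variable {R N : Type*} [CommRing R] (I : Ideal R) [IsAdicComplete I R] [AddCommGroup N] [Module R N]
  [Module.Finite R N]

/-- Finitely generated modules over an adically complete ring contain the limits of Cauchy
sequences. -/
theorem exists_adic_limit (n : ℕ → N)
    (hn : ∀ k, n (k + 1) - n k ∈ I ^ k • (⊤ : Submodule R N)) :
    ∃ l : N, ∀ k, l - n k ∈ I ^ k • (⊤ : Submodule R N) := by
  obtain ⟨d, π, hπ⟩ := Module.Finite.exists_fin' R N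
  have hlift : ∀ k, ∀ m ∈ I ^ k • (⊤ : Submodule R N),
      ∃ u : Fin d → R, (∀ i, u i ∈ I ^ k) ∧ π u = m := by
    intro k m hm
    induction hm using Submodule.smul_induction_on' with
    | smul r hr m _ =>
      obtain ⟨u, rfl⟩ := hπ m
      exact ⟨r • u, fun i => Ideal.mul_mem_right _ _ hr, map_smul _ _ _⟩
    | add a _ b _ ha hb =>
      obtain ⟨u, hu, rfl⟩ := ha
      obtain ⟨u', hu', rfl⟩ := hb
      exact ⟨u + u', fun i => Ideal.add_mem _ (hu i) (hu' i), map_add _ _ _⟩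
  have hmap : ∀ k, ∀ u : Fin d → R, (∀ i, u i ∈ I ^ k) → π u ∈ I ^ k • (⊤ : Submodule R N) := by
    intro k u hu
    rw [LinearMap.pi_apply_eq_sum_univ π u]
    exact Submodule.sum_mem _ fun i _ => Submodule.smul_mem_smul (hu i) trivial
  choose u hu hπu using fun k => hlift k _ (hn k)
  obtain ⟨u₀, hu₀⟩ := hπ (n 0)
  let s : ℕ → Fin d → R := fun k => u₀ + ∑ j ∈ Finset.range k, u j
  have hs : ∀ k, π (s k) = n k := by
    intro k
    simp only [s, map_add, map_sum, hπu, hu₀, Finset.sum_range_sub, add_sub_cancel]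
  have hlim : ∀ i, ∃ l : R, ∀ k, s k i ≡ l [SMOD (I ^ k • ⊤ : Submodule R R)] := by
    intro i
    refine IsPrecomplete.prec inferInstance fun {m k} hmk => ?_
    rw [SModEq.sub_mem]
    have h1 : s m i - s k i = -∑ j ∈ Finset.Ico m k, u j i := by
      simp only [s, Pi.add_apply, Finset.sum_apply]
      rw [← Finset.sum_range_add_sum_Ico _ hmk]
      abel
    rw [h1, smul_eq_mul, Ideal.mul_top]
    refine Submodule.neg_mem _ (Submodule.sum_mem _ fun j hj => ?_)
    exact Ideal.pow_le_pow_right (Finset.mem_Ico.1 hj).1 (hu j i)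
  choose l hl using hlim
  refine ⟨π l, fun k => ?_⟩
  rw [← hs k, ← map_sub]
  refine hmap k _ fun i => ?_
  have := SModEq.sub_mem.1 (hl i k).symm
  rwa [smul_eq_mul, Ideal.mul_top] at this

end AdicLimit

section HatModules

variable {G V : Type u} [Group G] [Finite G] [AddCommGroup V] [Module ℂ V]
  [FiniteDimensional ℂ V] (ρ : Representation ℂ G V) (c : Param ρ) (b : V)

/-- Left multiplication by functions. -/
instance funModuleHHat : Module (FormalFun ρ b) (HHat ρ c b) :=
  Module.compHom _ (HHat.fHom ρ c b).toRingHom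

/-- Left multiplication by elements of `H_c(G, V)`. -/
instance hModuleHHat : Module (H ρ c) (HHat ρ c b) := Module.compHom _ (HHat.ofH ρ c b).toRingHom

theorem fun_smul_HHat (φ : FormalFun ρ b) (z : HHat ρ c b) : φ • z = HHat.f ρ c b φ * z := rfl

theorem H_smul_HHat (h : H ρ c) (z : HHat ρ c b) : h • z = HHat.ofH ρ c b h * z := rfl

section

variable {N : Type*} [AddCommGroup N] [Module (HHat ρ c b) N]

theorem f_smul_eq [Module (FormalFun ρ b) N] [IsScalarTower (FormalFun ρ b) (HHat ρ c b) N]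
    (φ : FormalFun ρ b) (n : N) : HHat.f ρ c b φ • n = φ • n := by
  rw [← one_smul (HHat ρ c b) n, ← smul_assoc φ, fun_smul_HHat, ← smul_assoc, smul_eq_mul]

theorem ofH_smul_eq [Module (H ρ c) N] [IsScalarTower (H ρ c) (HHat ρ c b) N]
    (h : H ρ c) (n : N) : HHat.ofH ρ c b h • n = h • n := by
  rw [← one_smul (HHat ρ c b) n, ← smul_assoc h, H_smul_HHat, ← smul_assoc, smul_eq_mul]

end

variable {ρ c b}
variable {N : Type*} [AddCommGroup N] [Module (HHat ρ c b) N] [Module ℂ N]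
  [Module (FormalFun ρ b) N] [Module (H ρ c) N] [IsScalarTower ℂ (HHat ρ c b) N]
  [IsScalarTower (FormalFun ρ b) (HHat ρ c b) N] [IsScalarTower (H ρ c) (HHat ρ c b) N]
  [IsScalarTower ℂ (FormalFun ρ b) N] [IsScalarTower ℂ (H ρ c) N]

theorem hat_y_smul (v : V) (n : N) : HHat.y ρ c b v • n = H.y ρ c v • n := by
  rw [← HHat.ofH_y, ofH_smul_eq]

theorem hat_g_smul (w : G) (n : N) : HHat.g ρ c b w • n = H.g ρ c w • n := by
  rw [← HHat.ofH_g, ofH_smul_eq]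

theorem hat_x_smul (a : Module.Dual ℂ V) (n : N) :
    H.x ρ c a • n = (linFun b a : FormalFun ρ b) • n := by
  rw [← ofH_smul_eq ρ c b, HHat.ofH_x, f_smul_eq]

theorem g_fun_smul (w : G) (φ : FormalFun ρ b) (n : N) :
    H.g ρ c w • φ • n = actFun w φ • H.g ρ c w • n := by
  rw [← hat_g_smul (b := b), ← hat_g_smul (b := b), ← f_smul_eq ρ c b, ← f_smul_eq ρ c b,
    ← mul_smul, ← mul_smul, HHat.g_f]

theorem y_fun_smul (v : V) (φ : FormalFun ρ b) (n : N) :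
    H.y ρ c v • φ • n = φ • H.y ρ c v • n + (derivFun v φ • n +
      ∑ s ∈ reflections ρ, (reflCoef c s * root ρ s v) • divRoot s φ • H.g ρ c s • n) := by
  have h := congrArg (fun z : HHat ρ c b => z • n) (HHat.y_f ρ c b v φ)
  simp only [add_smul, Finset.sum_smul, mul_smul, smul_assoc, f_smul_eq, hat_y_smul,
    hat_g_smul] at h
  simpa only [mul_smul] using h

theorem g_smul_mem_pow (w : G) {k : ℕ} {n : N}
    (hn : n ∈ orbIdeal ρ b ^ k • (⊤ : Submodule (FormalFun ρ b) N)) :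
    H.g ρ c w • n ∈ orbIdeal ρ b ^ k • (⊤ : Submodule (FormalFun ρ b) N) := by
  induction hn using Submodule.smul_induction_on' with
  | smul φ hφ n _ =>
    rw [g_fun_smul]
    exact Submodule.smul_mem_smul (actFun_mem w hφ) trivial
  | add a _ b _ ha hb => rw [smul_add]; exact Submodule.add_mem _ ha hb

theorem y_smul_mem_pow (v : V) {k : ℕ} {n : N}
    (hn : n ∈ orbIdeal ρ b ^ (k + 1) • (⊤ : Submodule (FormalFun ρ b) N)) :
    H.y ρ c v • n ∈ orbIdeal ρ b ^ k • (⊤ : Submodule (FormalFun ρ b) N) := by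
  induction hn using Submodule.smul_induction_on' with
  | smul φ hφ n _ =>
    rw [y_fun_smul]
    refine Submodule.add_mem _ (Submodule.smul_mem_smul
      (Ideal.pow_le_pow_right (Nat.le_succ k) hφ) trivial) (Submodule.add_mem _
      (Submodule.smul_mem_smul (derivFun_mem v hφ) trivial) (Submodule.sum_mem _ fun s hs => ?_))
    exact Submodule.smul_of_tower_mem _ _
      (Submodule.smul_mem_smul (divRoot_mem (mem_reflections.1 hs) hφ) trivial)
  | add a _ b _ ha hb => rw [smul_add]; exact Submodule.add_mem _ ha hb

theorem eq_zero_of_forall_mem_pow_smul [Module.Finite (FormalFun ρ b) N] {n : N}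
    (h : ∀ k, n ∈ orbIdeal ρ b ^ k • (⊤ : Submodule (FormalFun ρ b) N)) : n = 0 := by
  have h1 := Ideal.iInf_pow_smul_eq_bot_of_le_jacobson (M := N) (orbIdeal ρ b)
    orbIdeal_le_jacobson
  have h2 : n ∈ (⨅ i : ℕ, orbIdeal ρ b ^ i • (⊤ : Submodule (FormalFun ρ b) N)) :=
    Submodule.mem_iInf _ |>.2 h
  rw [h1] at h2
  exact h2

theorem orbIdeal_compl : ∃ D : Submodule ℂ (FormalFun ρ b), D.FG ∧
    D ⊔ (orbIdeal ρ b).restrictScalars ℂ = ⊤ := by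
  refine ⟨LinearMap.range (locConst ρ b).toLinearMap, ?_, ?_⟩
  · rw [LinearMap.range_eq_map]
    exact Submodule.FG.map _ Module.Finite.fg_top
  · rw [eq_top_iff]
    rintro φ -
    refine Submodule.mem_sup.2 ⟨locConst ρ b fun p => MvPowerSeries.constantCoeff (φ p),
      ⟨_, rfl⟩, φ - locConst ρ b fun p => MvPowerSeries.constantCoeff (φ p), ?_, by abel⟩
    change _ ∈ orbIdeal ρ b
    rw [← pow_one (orbIdeal ρ b), mem_orbIdeal_pow]
    intro p
    rw [mem_varIdeal_pow]
    have h : MvPowerSeries.constantCoeff (φ p - MvPowerSeries.C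
        (MvPowerSeries.constantCoeff (φ p))) = 0 := by simp
    exact_mod_cast MvPowerSeries.one_le_order_iff_constCoeff_eq_zero.2 h

theorem orbIdeal_fg : (orbIdeal ρ b).FG := IsNoetherian.noetherian _

theorem exists_fg_sup_orbIdeal_pow (hN : Module.Finite (FormalFun ρ b) N) (k : ℕ) :
    ∃ F : Submodule ℂ N, F.FG ∧
      F ⊔ (orbIdeal ρ b ^ k • ⊤ : Submodule (FormalFun ρ b) N).restrictScalars ℂ = ⊤ := by
  obtain ⟨D, hD, h⟩ := orbIdeal_compl (ρ := ρ) (b := b)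
  exact exists_fg_sup_pow_smul (orbIdeal ρ b) orbIdeal_fg hN hD h k

end HatModules

section HatZero

open Polynomial

variable {G V : Type u} [Group G] [Finite G] [AddCommGroup V] [Module ℂ V]
  [FiniteDimensional ℂ V] {ρ : Representation ℂ G V} {c : Param ρ}
variable {N : Type*} [AddCommGroup N] [Module (HHat ρ c 0) N] [Module ℂ N]
  [Module (FormalFun ρ 0) N] [Module (H ρ c) N] [IsScalarTower ℂ (HHat ρ c 0) N]
  [IsScalarTower (FormalFun ρ 0) (HHat ρ c 0) N] [IsScalarTower (H ρ c) (HHat ρ c 0) N]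
  [IsScalarTower ℂ (FormalFun ρ 0) N] [IsScalarTower ℂ (H ρ c) N]

theorem linFun_zero_mem (a : Module.Dual ℂ V) : (linFun 0 a : FormalFun ρ 0) ∈ orbIdeal ρ 0 := by
  rw [← pow_one (orbIdeal ρ 0), mem_orbIdeal_pow]
  rintro ⟨p, hp⟩
  have hp0 : p = 0 := by
    obtain ⟨g, rfl⟩ := hp
    exact map_zero _
  subst hp0
  rw [pow_one]
  change linSeries a 0 ∈ _
  rw [linSeries_zero_eq]
  exact Submodule.sum_mem _ fun i _ => smul_mem_ideal _ _ (X_mem_varIdeal i)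

theorem orbIdeal_zero_eq : orbIdeal ρ 0 = Ideal.span (Set.range fun i =>
    (linFun 0 ((Module.finBasis ℂ V).coord i) : FormalFun ρ 0)) := by
  apply le_antisymm
  · rw [orbIdeal, Ideal.map_le_iff_le_comap, varIdeal, Ideal.span_le]
    rintro _ ⟨i, rfl⟩
    refine Ideal.subset_span ⟨i, ?_⟩
    funext p
    obtain ⟨p, hp⟩ := p
    have hp0 : p = 0 := by
      obtain ⟨g, rfl⟩ := hp
      exact map_zero _
    subst hp0
    exact linSeries_coord_zero i
  · rw [Ideal.span_le]
    rintro _ ⟨i, rfl⟩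
    exact linFun_zero_mem _

theorem x_smul_mem_pow (a : Module.Dual ℂ V) {k : ℕ} {n : N}
    (hn : n ∈ orbIdeal ρ 0 ^ k • (⊤ : Submodule (FormalFun ρ 0) N)) :
    H.x ρ c a • n ∈ orbIdeal ρ 0 ^ (k + 1) • (⊤ : Submodule (FormalFun ρ 0) N) := by
  rw [hat_x_smul (b := 0), pow_succ', Submodule.mul_smul]
  exact Submodule.smul_mem_smul (linFun_zero_mem a) hn

theorem euler_smul_mem_pow {k : ℕ} {n : N}
    (hn : n ∈ orbIdeal ρ 0 ^ k • (⊤ : Submodule (FormalFun ρ 0) N)) :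
    euler ρ c • n ∈ orbIdeal ρ 0 ^ k • (⊤ : Submodule (FormalFun ρ 0) N) := by
  cases k with
  | zero => simp
  | succ k =>
    rw [euler, sub_smul, add_smul, Finset.sum_smul, Finset.sum_smul, algebraMap_smul]
    refine Submodule.sub_mem _ (Submodule.add_mem _ (Submodule.sum_mem _ fun i _ => ?_)
      (Submodule.smul_of_tower_mem _ _ hn)) (Submodule.sum_mem _ fun s _ => ?_)
    · rw [mul_smul]
      exact x_smul_mem_pow _ (y_smul_mem_pow _ hn)
    · rw [smul_assoc]
      exact Submodule.smul_of_tower_mem _ _ (g_smul_mem_pow s hn)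

theorem eulerPoly_smul_mem_pow (p : ℂ[X]) {k : ℕ} {n : N}
    (hn : n ∈ orbIdeal ρ 0 ^ k • (⊤ : Submodule (FormalFun ρ 0) N)) :
    eulerPoly ρ c p • n ∈ orbIdeal ρ 0 ^ k • (⊤ : Submodule (FormalFun ρ 0) N) :=
  eulerPoly_smul_mem (X := (orbIdeal ρ 0 ^ k • (⊤ : Submodule (FormalFun ρ 0) N)).restrictScalars ℂ)
    (fun _ => euler_smul_mem_pow) p hn

theorem shift_smul_mem_pow {p : ℂ[X]}
    (hp : ∀ n : N, eulerPoly ρ c p • n ∈ orbIdeal ρ 0 • (⊤ : Submodule (FormalFun ρ 0) N))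
    {k : ℕ} {n : N} (hn : n ∈ orbIdeal ρ 0 ^ k • (⊤ : Submodule (FormalFun ρ 0) N)) :
    eulerPoly ρ c (shift p k) • n ∈
      orbIdeal ρ 0 ^ (k + 1) • (⊤ : Submodule (FormalFun ρ 0) N) := by
  induction k generalizing n with
  | zero => simpa [shift_zero] using hp n
  | succ k ih =>
    rw [pow_succ', Submodule.mul_smul] at hn
    induction hn using Submodule.smul_induction_on' with
    | add a _ b _ ha hb => rw [smul_add]; exact Submodule.add_mem _ ha hb
    | smul φ hφ n hn =>
      rw [orbIdeal_zero_eq] at hφ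
      induction hφ using Submodule.span_induction generalizing n with
      | zero => rw [zero_smul, smul_zero]; exact Submodule.zero_mem _
      | add a b _ _ ha hb =>
        rw [add_smul, smul_add]; exact Submodule.add_mem _ (ha n hn) (hb n hn)
      | smul r x _ hx =>
        rw [smul_eq_mul, mul_comm, mul_smul]
        exact hx _ (Submodule.smul_mem _ r hn)
      | mem x hx =>
        obtain ⟨i, rfl⟩ := hx
        rw [← hat_x_smul (c := c), Nat.cast_succ, ← shift_shift, ← mul_smul, eulerPoly_shift_x,
          mul_smul]
        exact x_smul_mem_pow _ (ih hn)

theorem shiftProd_smul_mem_pow {p : ℂ[X]}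
    (hp : ∀ n : N, eulerPoly ρ c p • n ∈ orbIdeal ρ 0 • (⊤ : Submodule (FormalFun ρ 0) N))
    (k : ℕ) (n : N) : eulerPoly ρ c (shiftProd p k) • n ∈
      orbIdeal ρ 0 ^ k • (⊤ : Submodule (FormalFun ρ 0) N) := by
  induction k with
  | zero => simp
  | succ k ih =>
    rw [shiftProd, Finset.prod_range_succ, mul_comm, eulerPoly_mul, mul_smul]
    exact shift_smul_mem_pow hp ih

variable (ρ c) in
theorem exists_eulerPoly_smul_mem (hN : Module.Finite (FormalFun ρ 0) N) : ∃ p : ℂ[X], p ≠ 0 ∧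
    ∀ n : N, eulerPoly ρ c p • n ∈ orbIdeal ρ 0 • (⊤ : Submodule (FormalFun ρ 0) N) := by
  obtain ⟨F, hF, h⟩ := exists_fg_sup_orbIdeal_pow (N := N) hN 1
  rw [pow_one] at h
  let T := (orbIdeal ρ 0 • ⊤ : Submodule (FormalFun ρ 0) N).restrictScalars ℂ
  have hfd : FiniteDimensional ℂ (N ⧸ T) := by
    have : FiniteDimensional ℂ F := Module.Finite.of_fg hF
    refine Module.Finite.of_surjective (T.mkQ ∘ₗ F.subtype) fun q => ?_
    obtain ⟨n, rfl⟩ := T.mkQ_surjective q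
    obtain ⟨d, hd, t, ht, h⟩ := Submodule.mem_sup.1 (h ▸ Submodule.mem_top : n ∈ F ⊔ T)
    refine ⟨⟨d, hd⟩, ?_⟩
    rw [← h, map_add, Submodule.mkQ_apply T t, (Submodule.Quotient.mk_eq_zero T).2 ht, add_zero]
    rfl
  have hle : T ≤ T.comap (opH ρ c N (euler ρ c)) := by
    intro n hn
    have h1 : n ∈ orbIdeal ρ 0 ^ 1 • (⊤ : Submodule (FormalFun ρ 0) N) := by
      rw [pow_one]; exact hn
    have h2 := euler_smul_mem_pow (c := c) h1
    rw [pow_one] at h2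
    exact h2
  let e : Module.End ℂ (N ⧸ T) := T.mapQ T (opH ρ c N (euler ρ c)) hle
  obtain ⟨p, hp, hpe⟩ := Algebra.IsIntegral.isIntegral (R := ℂ) e
  have hmk : ∀ (q : ℂ[X]) (n : N), aeval e q (T.mkQ n) = T.mkQ (eulerPoly ρ c q • n) := by
    intro q n
    induction q using Polynomial.induction_on' with
    | add q r hq hr =>
      rw [map_add, LinearMap.add_apply, hq, hr, eulerPoly_add, add_smul, map_add]
    | monomial k a =>
      have h3 : ∀ k, (e ^ k) (T.mkQ n) = T.mkQ (euler ρ c ^ k • n) := by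
        intro k
        induction k with
        | zero => simp
        | succ k ih => rw [pow_succ', Module.End.mul_apply, ih, pow_succ', mul_smul]; rfl
      rw [aeval_monomial, Module.End.mul_apply, h3, Module.algebraMap_end_apply, ← map_smul,
        eulerPoly, aeval_monomial, mul_smul, algebraMap_smul]
  refine ⟨p, hp.ne_zero, fun n => ?_⟩
  have h4 := hmk p n
  rw [aeval_def, hpe, LinearMap.zero_apply] at h4
  exact (Submodule.Quotient.mk_eq_zero T).1 h4.symm

theorem mem_pow_succ_of_isCoprime {p q : ℂ[X]}
    (hp : ∀ n : N, eulerPoly ρ c p • n ∈ orbIdeal ρ 0 • (⊤ : Submodule (FormalFun ρ 0) N))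
    {k : ℕ} (hq : IsCoprime (shift p k) q) {n : N}
    (hn : n ∈ orbIdeal ρ 0 ^ k • (⊤ : Submodule (FormalFun ρ 0) N))
    (hqn : eulerPoly ρ c q • n ∈ orbIdeal ρ 0 ^ (k + 1) • (⊤ : Submodule (FormalFun ρ 0) N)) :
    n ∈ orbIdeal ρ 0 ^ (k + 1) • (⊤ : Submodule (FormalFun ρ 0) N) :=
  eulerPoly_smul_eq_zero_of_isCoprime (ρ := ρ) (c := c)
    (X := (orbIdeal ρ 0 ^ (k + 1) • (⊤ : Submodule (FormalFun ρ 0) N)).restrictScalars ℂ) hq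
    (fun _ => euler_smul_mem_pow) (shift_smul_mem_pow hp hn) hqn

theorem eq_zero_of_forall_isCoprime (hN : Module.Finite (FormalFun ρ 0) N) {p q : ℂ[X]}
    (hp : ∀ n : N, eulerPoly ρ c p • n ∈ orbIdeal ρ 0 • (⊤ : Submodule (FormalFun ρ 0) N))
    {k₀ : ℕ} (hq : ∀ k : ℕ, k₀ ≤ k → IsCoprime (shift p k) q) {n : N}
    (hn : n ∈ orbIdeal ρ 0 ^ k₀ • (⊤ : Submodule (FormalFun ρ 0) N))
    (hqn : eulerPoly ρ c q • n = 0) : n = 0 := by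
  have key : ∀ k, k₀ ≤ k → n ∈ orbIdeal ρ 0 ^ k • (⊤ : Submodule (FormalFun ρ 0) N) := by
    intro k hk
    induction k, hk using Nat.le_induction with
    | base => exact hn
    | succ k hk ih =>
      refine mem_pow_succ_of_isCoprime hp (hq k hk) ih ?_
      rw [hqn]
      exact Submodule.zero_mem _
  refine eq_zero_of_forall_mem_pow_smul (ρ := ρ) (b := 0) fun k => ?_
  have h1 := key (max k₀ k) (le_max_left _ _)
  exact Submodule.smul_mono (Ideal.pow_le_pow_right (le_max_right _ _)) le_rfl h1

variable (ρ c) in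
/-- For large `k`, a vector of `𝔪ᵏN` that is taken to `𝔪ᵏN` by `V` lies in `𝔪ᵏ⁺¹N`. -/
theorem exists_mem_pow_succ_zero (hN : Module.Finite (FormalFun ρ 0) N) :
    ∃ k₀ : ℕ, ∀ k, k₀ ≤ k → ∀ n ∈ orbIdeal ρ 0 ^ k • (⊤ : Submodule (FormalFun ρ 0) N),
      (∀ v, H.y ρ c v • n ∈ orbIdeal ρ 0 ^ k • (⊤ : Submodule (FormalFun ρ 0) N)) →
      n ∈ orbIdeal ρ 0 ^ (k + 1) • (⊤ : Submodule (FormalFun ρ 0) N) := by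
  obtain ⟨p, hp0, hp⟩ := exists_eulerPoly_smul_mem ρ c (N := N) hN
  obtain ⟨k₀, hk₀⟩ := exists_isCoprime_shift hp0 (constPoly_ne_zero ρ c)
  refine ⟨k₀, fun k hk n hn hy => mem_pow_succ_of_isCoprime hp (hk₀ k hk) hn ?_⟩
  let U : Submodule ℂ N :=
    { carrier := {n | n ∈ orbIdeal ρ 0 ^ k • (⊤ : Submodule (FormalFun ρ 0) N) ∧
        ∀ v, H.y ρ c v • n ∈ orbIdeal ρ 0 ^ k • (⊤ : Submodule (FormalFun ρ 0) N)}
      zero_mem' := ⟨Submodule.zero_mem _, fun v => by rw [smul_zero]; exact Submodule.zero_mem _⟩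
      add_mem' := fun {a b} ha hb => ⟨Submodule.add_mem _ ha.1 hb.1, fun v => by
        rw [smul_add]; exact Submodule.add_mem _ (ha.2 v) (hb.2 v)⟩
      smul_mem' := fun r a ha => ⟨Submodule.smul_of_tower_mem _ r ha.1, fun v => by
        rw [H_smul_comm]; exact Submodule.smul_of_tower_mem _ r (ha.2 v)⟩ }
  refine constPoly_smul_mem (ρ := ρ) (c := c) (U := U)
    (X := (orbIdeal ρ 0 ^ (k + 1) • (⊤ : Submodule (FormalFun ρ 0) N)).restrictScalars ℂ)
    (fun _ => euler_smul_mem_pow) ?_ ?_ ⟨hn, hy⟩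
  · rintro w m ⟨h1, h2⟩
    refine ⟨g_smul_mem_pow w h1, fun v => ?_⟩
    have h3 := H.g_y ρ c w (ρ w⁻¹ v)
    rw [apply_inv_apply] at h3
    rw [← mul_smul, ← h3, mul_smul]
    exact g_smul_mem_pow w (h2 _)
  · rintro m ⟨-, h2⟩ v a
    exact x_smul_mem_pow a (h2 v)

/-- On finitely generated modules over the completion at zero, the vectors that are finite under
`𝐡` are the nilpotent ones. -/
theorem eulerFinite_eq_nilpotentVectors (hN : Module.Finite (FormalFun ρ 0) N) :
    eulerFinite ρ c N = nilpotentVectors ρ c N := by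
  obtain ⟨p, hp0, hp⟩ := exists_eulerPoly_smul_mem ρ c (N := N) hN
  apply le_antisymm
  · intro n hn
    change n ∈ AddSubgroup.closure _ at hn
    induction hn using AddSubgroup.closure_induction with
    | zero => exact Submodule.zero_mem _
    | add a b _ _ ha hb => exact Submodule.add_mem _ ha hb
    | neg a _ ha => exact Submodule.neg_mem _ ha
    | mem n hn =>
      obtain ⟨μ, l, h⟩ := hn
      have h2 : (euler ρ c - algebraMap ℂ _ μ) ^ l = eulerPoly ρ c ((X - C μ) ^ l) := by
        simp [eulerPoly]
      rw [h2] at h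
      obtain ⟨k₀, hk₀⟩ := exists_isCoprime_shift hp0
        (pow_ne_zero l (X_sub_C_ne_zero μ) : (X - C μ) ^ l ≠ 0)
      refine ⟨k₀, ?_⟩
      have key : ∀ (j k : ℕ), j + k = k₀ → ∀ n : N,
          eulerPoly ρ c (shift ((X - C μ) ^ l) (-k)) • n = 0 → NilpotentOfOrder ρ c j n := by
        intro j
        induction j with
        | zero =>
          intro k hk n hn
          refine eq_zero_of_forall_isCoprime hN hp (k₀ := 0) (fun i _ => ?_) (by simp) hn
          have h3 := hk₀ (i + k) (by omega)
          have h4 := h3.map (compRingHom (X - C (-(k : ℂ))))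
          change IsCoprime (shift _ _) (shift _ _) at h4
          rw [shift_shift] at h4
          simpa using h4
        | succ j ih =>
          intro k hk n hn v
          refine ih (k + 1) (by omega) _ ?_
          rw [← mul_smul, eulerPoly_y, shift_shift, mul_smul]
          have h5 : -((k + 1 : ℕ) : ℂ) + 1 = -k := by push_cast; ring
          rw [h5, hn, smul_zero]
      refine key k₀ 0 rfl n ?_
      simpa [shift_zero] using h
  · rintro n ⟨k, hk⟩
    exact nilOrder_le_eulerFinite (mem_nilOrder.2 hk)

/-- A finitely generated module over the completion at zero is generated by its `𝐡`-finite vectors,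
modulo the maximal ideal. -/
theorem exists_eulerFinite_sub_mem (hN : Module.Finite (FormalFun ρ 0) N) (n : N) :
    ∃ n' ∈ eulerFinite ρ c N, n - n' ∈ orbIdeal ρ 0 • (⊤ : Submodule (FormalFun ρ 0) N) := by
  obtain ⟨p, hp0, hp⟩ := exists_eulerPoly_smul_mem ρ c (N := N) hN
  obtain ⟨k₀, hk₀⟩ := exists_isCoprime_shift hp0 hp0
  obtain ⟨w, M, hw0, hw, hdvd⟩ := exists_coprime_dvd_mul_pow (p := p) (shiftProd_ne_zero hp0 k₀)
  let W : ℕ → ℂ[X] := fun k => w * ∏ j ∈ Finset.Ico k₀ (max k₀ k), shift p j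
  have hW : ∀ k, IsCoprime (W k) (p ^ (M + 1)) := fun k =>
    (hw.mul_left (IsCoprime.prod_left fun j hj => hk₀ j (Finset.mem_Ico.1 hj).1)).pow_right
  have hWdvd : ∀ k, W k ∣ W (k + 1) := fun k => by
    refine mul_dvd_mul_left _ (Finset.prod_dvd_prod_of_subset _ _ _ ?_)
    exact Finset.Ico_subset_Ico le_rfl (max_le_max le_rfl (Nat.le_succ k))
  have hkill : ∀ (k : ℕ) (q : ℂ[X]), W k * p ^ (M + 1) ∣ q → ∀ n : N,
      eulerPoly ρ c q • n ∈ orbIdeal ρ 0 ^ k • (⊤ : Submodule (FormalFun ρ 0) N) := by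
    rintro k q hq n
    have h1 : shiftProd p (max k₀ k) ∣ q := by
      refine dvd_trans ?_ hq
      have h2 : shiftProd p (max k₀ k) =
          shiftProd p k₀ * ∏ j ∈ Finset.Ico k₀ (max k₀ k), shift p j :=
        (Finset.prod_range_mul_prod_Ico _ (le_max_left _ _)).symm
      rw [h2, pow_succ, ← mul_assoc]
      refine Dvd.dvd.mul_right ?_ _
      rw [mul_right_comm]
      exact mul_dvd_mul_right hdvd _
    obtain ⟨q', rfl⟩ := h1
    rw [mul_comm, eulerPoly_mul, mul_smul]
    refine eulerPoly_smul_mem_pow _ ?_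
    exact Submodule.smul_mono (Ideal.pow_le_pow_right (le_max_right _ _)) le_rfl
      (shiftProd_smul_mem_pow hp _ n)
  choose a d had using id hW
  let s : ℕ → N := fun k => eulerPoly ρ c (a k * W k) • n
  obtain ⟨l, hl⟩ := exists_adic_limit (orbIdeal ρ 0) s fun k => by
    change eulerPoly ρ c _ • n - eulerPoly ρ c _ • n ∈ _
    rw [← sub_smul, eulerPoly, eulerPoly, ← map_sub]
    refine hkill k _ (IsCoprime.mul_dvd (hW k) ?_ ?_) n
    · exact dvd_sub ((hWdvd k).mul_left _) (dvd_mul_left _ _)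
    · refine ⟨d k - d (k + 1), ?_⟩
      linear_combination had (k + 1) - had k
  refine ⟨l, ?_, ?_⟩
  · refine mem_eulerFinite_of_eulerPoly (pow_ne_zero (M + 1) hp0) ?_
    refine eq_zero_of_forall_mem_pow_smul (ρ := ρ) (b := 0) fun k => ?_
    have h1 : eulerPoly ρ c (p ^ (M + 1)) • l = eulerPoly ρ c (p ^ (M + 1)) • (l - s k) +
        eulerPoly ρ c (p ^ (M + 1) * (a k * W k)) • n := by
      rw [smul_sub, eulerPoly_mul, mul_smul, sub_add_cancel]
    rw [h1]
    refine Submodule.add_mem _ (eulerPoly_smul_mem_pow _ (hl k)) (hkill k _ ⟨a k, ?_⟩ n)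
    ring
  · have h1 : n - l = eulerPoly ρ c (d 1 * p ^ (M + 1)) • n - (l - s 1) := by
      have h2 : eulerPoly ρ c (a 1 * W 1) • n + eulerPoly ρ c (d 1 * p ^ (M + 1)) • n = n := by
        rw [← add_smul, ← eulerPoly_add, had 1, eulerPoly_one, one_smul]
      change n - l = _ - (l - eulerPoly ρ c (a 1 * W 1) • n)
      nth_rewrite 1 [← h2]
      abel
    have h3 := hl 1
    rw [pow_one] at h3
    rw [h1]
    refine Submodule.sub_mem _ ?_ h3
    rw [pow_succ', mul_left_comm, eulerPoly_mul, mul_smul]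
    exact hp _

end HatZero


section HatObjects

variable {G V : Type u} [Group G] [Finite G] [AddCommGroup V] [Module ℂ V]
  [FiniteDimensional ℂ V] (ρ : Representation ℂ G V) (c : Param ρ) (b : V)
  (N : Type*) [AddCommGroup N] [Module (HHat ρ c b) N]

/-- The complex vector space underlying a module over the completed algebra. -/
@[reducible] def hatModuleC : Module ℂ N := Module.compHom N (algebraMap ℂ (HHat ρ c b))

/-- The action of functions on a module over the completed algebra. -/
@[reducible] def hatModuleFun : Module (FormalFun ρ b) N :=
  Module.compHom N (HHat.fHom ρ c b).toRingHom

/-- The action of `H_c(G, V)` on a module over the completed algebra. -/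
@[reducible] def hatModuleH : Module (H ρ c) N := Module.compHom N (HHat.ofH ρ c b).toRingHom

theorem hatModule_towers :
    letI := hatModuleC ρ c b N
    letI := hatModuleFun ρ c b N
    letI := hatModuleH ρ c b N
    IsScalarTower ℂ (HHat ρ c b) N ∧ IsScalarTower (FormalFun ρ b) (HHat ρ c b) N ∧
      IsScalarTower (H ρ c) (HHat ρ c b) N ∧ IsScalarTower ℂ (FormalFun ρ b) N ∧
      IsScalarTower ℂ (H ρ c) N := by
  let _ := hatModuleC ρ c b N
  let _ := hatModuleFun ρ c b N
  let _ := hatModuleH ρ c b N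
  refine ⟨⟨fun r z n => ?_⟩, ⟨fun φ z n => ?_⟩, ⟨fun h z n => ?_⟩, ⟨fun r φ n => ?_⟩,
    ⟨fun r h n => ?_⟩⟩
  · rw [Algebra.smul_def, mul_smul]; rfl
  · rw [fun_smul_HHat, mul_smul]; rfl
  · rw [H_smul_HHat, mul_smul]; rfl
  · change HHat.fHom ρ c b (r • φ) • n = algebraMap ℂ (HHat ρ c b) r • HHat.fHom ρ c b φ • n
    rw [map_smul, Algebra.smul_def, mul_smul]
  · change HHat.ofH ρ c b (r • h) • n = algebraMap ℂ (HHat ρ c b) r • HHat.ofH ρ c b h • n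
    rw [map_smul, Algebra.smul_def, mul_smul]

end HatObjects

section Corner

variable {G V : Type u} [Group G] [Finite G] [AddCommGroup V] [Module ℂ V]
  [FiniteDimensional ℂ V] {ρ : Representation ℂ G V} (c : Param ρ) (b : V)
  (hρ : Function.Injective ρ)

/-- `ε` identifies `N'` with the subspace of the module `N` over the completion at `b` cut out by
the indicator function of `b`. -/
structure IsCorner {N' N : Type*} [AddCommGroup N'] [Module (StabHat ρ c b) N'] [AddCommGroup N]
    [Module (HHat ρ c b) N] (ε : N' →+ N) : Prop where
  map_smul : ∀ a n, ε (a • n) = baseEmb c b hρ a • ε n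
  injective : Function.Injective ε
  exists_eq : ∀ n, ∃ n', ε n' = baseIdem ρ c b • n

/-- The canonical map from `N` to the corner of the induced module. -/
def cornerMap (N : ModuleCat.{u} (StabHat ρ c b)) : N →+
    (ModuleCat.restrictScalars (thetaEquiv c b hρ).toRingHom).obj ((functorI ρ c b).obj N) where
  toFun n := inductionMk N (FunK.basePoint (stab_g_mul c b)) n
  map_zero' := tensorMk_zero (S := ZHat ρ c b) _ N _
  map_add' := inductionMk_add N _

theorem isCorner_cornerMap (N : ModuleCat.{u} (StabHat ρ c b)) :
    IsCorner c b hρ (cornerMap c b hρ N) := by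
  have hsmul : ∀ (z : HHat ρ c b) (t : (functorI ρ c b).obj N),
      (z • (show (ModuleCat.restrictScalars (thetaEquiv c b hρ).toRingHom).obj
        ((functorI ρ c b).obj N) from t) : (functorI ρ c b).obj N) =
        (thetaHom c b hρ z : ZHat ρ c b) • t := fun _ _ => rfl
  refine ⟨fun a n => ?_, ?_, fun t => ?_⟩
  · refine Eq.trans ?_ (hsmul _ _).symm
    rw [thetaHom_baseEmb]
    change _ = FunK.corner (stab_g_mul c b) a • inductionMk N (FunK.basePoint (stab_g_mul c b)) n
    rw [corner_smul_eq, inductionEval_mk, FunK.basePoint_one (stab_g_one c b), one_smul]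
    rfl
  · intro n n' h
    have h1 := congrArg (inductionEval N) h
    change inductionEval N (inductionMk N (FunK.basePoint (stab_g_mul c b)) n) =
      inductionEval N (inductionMk N (FunK.basePoint (stab_g_mul c b)) n') at h1
    rwa [inductionEval_mk, inductionEval_mk, FunK.basePoint_one (stab_g_one c b), one_smul,
      one_smul] at h1
  · refine ⟨inductionEval N t, Eq.trans ?_ (hsmul _ _).symm⟩
    rw [thetaHom_baseIdem]
    have h := corner_smul_eq (stab_g_mul c b) N 1 t
    rw [one_smul] at h
    exact h.symm

theorem exists_isCorner (N : Type u) [AddCommGroup N] [Module (HHat ρ c b) N] :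
    ∃ (N' : ModuleCat.{u} (StabHat ρ c b)) (ε : N' →+ N), IsCorner c b hρ ε := by
  have hI : (functorI ρ c b).IsEquivalence :=
    inductionFunctor_isEquivalence (stab_g_one c b) (stab_g_mul c b)
  let Q : ModuleCat.{u} (HHat ρ c b) := ModuleCat.of _ N
  let Z := (ModuleCat.restrictScalars (R := ZHat ρ c b) (thetaEquiv c b hρ).symm.toRingHom).obj Q
  let e : (functorI ρ c b).obj ((functorI ρ c b).objPreimage Z) ≅ Z :=
    (functorI ρ c b).objObjPreimageIso Z
  have hc := isCorner_cornerMap c b hρ ((functorI ρ c b).objPreimage Z)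
  have he : ∀ (z : HHat ρ c b) (t : (functorI ρ c b).obj ((functorI ρ c b).objPreimage Z)),
      (e.hom.hom ((thetaHom c b hρ z : ZHat ρ c b) • t) : N) = z • (e.hom.hom t : N) := by
    intro z t
    rw [_root_.map_smul]
    change (thetaEquiv c b hρ).symm (thetaEquiv c b hρ z) • (e.hom.hom t : N) = _
    rw [RingEquiv.symm_apply_apply]
  refine ⟨(functorI ρ c b).objPreimage Z,
    (e.hom.hom.toAddMonoidHom : _ →+ N).comp (cornerMap c b hρ _), ⟨fun a n => ?_, ?_, fun n => ?_⟩⟩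
  · refine Eq.trans ?_ (he _ _)
    exact congrArg e.hom.hom (hc.map_smul a n)
  · exact (e.toLinearEquiv.injective).comp hc.injective
  · obtain ⟨t, ht⟩ := e.toLinearEquiv.surjective n
    obtain ⟨n', hn'⟩ := hc.exists_eq t
    refine ⟨n', ?_⟩
    refine (congrArg e.hom.hom hn').trans ((he _ _).trans ?_)
    exact congrArg (fun m : N => baseIdem ρ c b • m) ht

variable {c b hρ}
variable {N : Type*} [AddCommGroup N] [Module (HHat ρ c b) N] [Module ℂ N]
  [Module (FormalFun ρ b) N] [Module (H ρ c) N] [IsScalarTower ℂ (HHat ρ c b) N]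
  [IsScalarTower (FormalFun ρ b) (HHat ρ c b) N] [IsScalarTower (H ρ c) (HHat ρ c b) N]
  [IsScalarTower ℂ (FormalFun ρ b) N] [IsScalarTower ℂ (H ρ c) N]
variable {N' : Type*} [AddCommGroup N'] [Module (StabHat ρ c b) N'] [Module ℂ N']
  [Module (FormalFun (stabRep ρ b) 0) N'] [Module (H (stabRep ρ b) (stabParam ρ c b)) N']
  [IsScalarTower ℂ (StabHat ρ c b) N']
  [IsScalarTower (FormalFun (stabRep ρ b) 0) (StabHat ρ c b) N']
  [IsScalarTower (H (stabRep ρ b) (stabParam ρ c b)) (StabHat ρ c b) N']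
  [IsScalarTower ℂ (FormalFun (stabRep ρ b) 0) N']
  [IsScalarTower ℂ (H (stabRep ρ b) (stabParam ρ c b)) N']

namespace IsCorner

variable {ε : N' →+ N} (hε : IsCorner c b hρ ε)

omit [Module ℂ N] [Module (FormalFun ρ b) N] [Module (H ρ c) N] [IsScalarTower ℂ (HHat ρ c b) N]
  [IsScalarTower (FormalFun ρ b) (HHat ρ c b) N] [IsScalarTower (H ρ c) (HHat ρ c b) N]
  [IsScalarTower ℂ (FormalFun ρ b) N] [IsScalarTower ℂ (H ρ c) N] [Module ℂ N']
  [Module (FormalFun (stabRep ρ b) 0) N'] [Module (H (stabRep ρ b) (stabParam ρ c b)) N']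
  [IsScalarTower ℂ (StabHat ρ c b) N']
  [IsScalarTower (FormalFun (stabRep ρ b) 0) (StabHat ρ c b) N']
  [IsScalarTower (H (stabRep ρ b) (stabParam ρ c b)) (StabHat ρ c b) N']
  [IsScalarTower ℂ (FormalFun (stabRep ρ b) 0) N']
  [IsScalarTower ℂ (H (stabRep ρ b) (stabParam ρ c b)) N'] in
include hε in
theorem baseIdem_smul (n : N') : baseIdem ρ c b • ε n = ε n := by
  rw [← baseEmb_one c b hρ, ← hε.map_smul, one_smul]

include hε in
theorem map_fun_smul (φ : FormalFun (stabRep ρ b) 0) (n : N') :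
    ε (φ • n) = extendZero ρ b (φ (basePt (stabRep ρ b) 0)) • ε n := by
  rw [← f_smul_eq (stabRep ρ b) (stabParam ρ c b) 0, hε.map_smul, baseEmb_f, f_smul_eq]

include hε in
theorem fun_smul (ψ : FormalFun ρ b) (n : N') :
    ψ • ε n = ε ((fun _ => ψ (basePt ρ b) : FormalFun (stabRep ρ b) 0) • n) := by
  rw [hε.map_fun_smul, ← mul_extendZero_one, mul_smul]
  congr 1
  have h := hε.baseIdem_smul n
  rw [baseIdem, f_smul_eq] at h
  exact h.symm

include hε in
theorem map_mem_pow {k : ℕ} {n : N'}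
    (hn : n ∈ orbIdeal (stabRep ρ b) 0 ^ k • (⊤ : Submodule (FormalFun (stabRep ρ b) 0) N')) :
    ε n ∈ orbIdeal ρ b ^ k • (⊤ : Submodule (FormalFun ρ b) N) := by
  induction hn using Submodule.smul_induction_on' with
  | smul φ hφ n _ =>
    rw [hε.map_fun_smul]
    refine Submodule.smul_mem_smul (mem_orbIdeal_pow.2 fun p => ?_) trivial
    by_cases hp : p = basePt ρ b
    · subst hp
      rw [extendZero_same]
      exact mem_orbIdeal_pow.1 hφ _
    · rw [extendZero_ne b _ hp]
      exact Ideal.zero_mem _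
  | add a _ b _ ha hb => rw [map_add]; exact Submodule.add_mem _ ha hb

include hε in
theorem mem_pow_of_map {k : ℕ} {n : N'}
    (hn : ε n ∈ orbIdeal ρ b ^ k • (⊤ : Submodule (FormalFun ρ b) N)) :
    n ∈ orbIdeal (stabRep ρ b) 0 ^ k • (⊤ : Submodule (FormalFun (stabRep ρ b) 0) N') := by
  have key : ∀ m ∈ orbIdeal ρ b ^ k • (⊤ : Submodule (FormalFun ρ b) N), ∃ n',
      n' ∈ orbIdeal (stabRep ρ b) 0 ^ k • (⊤ : Submodule (FormalFun (stabRep ρ b) 0) N') ∧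
        ε n' = baseIdem ρ c b • m := by
    intro m hm
    induction hm using Submodule.smul_induction_on' with
    | smul φ hφ m _ =>
      obtain ⟨m', hm'⟩ := hε.exists_eq m
      refine ⟨(fun _ => φ (basePt ρ b) : FormalFun (stabRep ρ b) 0) • m',
        Submodule.smul_mem_smul (mem_orbIdeal_pow.2 fun _ => mem_orbIdeal_pow.1 hφ _) trivial, ?_⟩
      rw [← hε.fun_smul, hm', baseIdem, f_smul_eq, f_smul_eq, smul_smul, smul_smul, mul_comm]
    | add a _ b _ ha hb =>
      obtain ⟨a', ha', ha''⟩ := ha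
      obtain ⟨b', hb', hb''⟩ := hb
      exact ⟨a' + b', Submodule.add_mem _ ha' hb', by rw [map_add, ha'', hb'', smul_add]⟩
  obtain ⟨n', hn', h⟩ := key _ hn
  rw [hε.baseIdem_smul] at h
  rwa [← hε.injective h]

variable (N) in
theorem sum_baseIdem_smul [Fintype G] (n : N) : (Nat.card (stab ρ b) : ℂ)⁻¹ •
    ∑ r : G, H.g ρ c r⁻¹ • baseIdem ρ c b • H.g ρ c r • n = n := by
  have h := congrArg (fun z : HHat ρ c b => z • n) (sum_g_baseIdem (ρ := ρ) c b)
  simp only [smul_assoc, Finset.sum_smul, mul_smul, one_smul, hat_g_smul] at h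
  exact h

include hε in
theorem finite_of_finite (hN : Module.Finite (FormalFun (stabRep ρ b) 0) N') :
    Module.Finite (FormalFun ρ b) N := by
  classical
  let _ := Fintype.ofFinite G
  obtain ⟨s, hs⟩ := hN.fg_top
  refine ⟨(Finset.univ : Finset G).biUnion fun r => s.image fun n => H.g ρ c r • ε n, ?_⟩
  rw [eq_top_iff]
  rintro n -
  set L := Submodule.span (FormalFun ρ b)
    (((Finset.univ : Finset G).biUnion fun r => s.image fun n => H.g ρ c r • ε n : Finset N) :
      Set N) with hL
  have key : ∀ (r : G) (n' : N'), H.g ρ c r • ε n' ∈ L := by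
    intro r n'
    have hn' : n' ∈ Submodule.span (FormalFun (stabRep ρ b) 0) (s : Set N') := by rw [hs]; trivial
    induction hn' using Submodule.span_induction with
    | zero => rw [map_zero, smul_zero]; exact Submodule.zero_mem _
    | add a b _ _ ha hb => rw [map_add, smul_add]; exact Submodule.add_mem _ ha hb
    | smul φ n' _ ih => rw [hε.map_fun_smul, g_fun_smul]; exact Submodule.smul_mem _ _ ih
    | mem n' hn' =>
      refine Submodule.subset_span ?_
      rw [Finset.mem_coe, Finset.mem_biUnion]
      exact ⟨r, Finset.mem_univ _, Finset.mem_image_of_mem _ hn'⟩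
  rw [← sum_baseIdem_smul (ρ := ρ) (c := c) (b := b) N n]
  refine Submodule.smul_of_tower_mem _ _ (Submodule.sum_mem _ fun r _ => ?_)
  obtain ⟨n', hn'⟩ := hε.exists_eq (H.g ρ c r • n)
  rw [← hn']
  exact key _ _

include hε in
theorem finite (hN : Module.Finite (FormalFun ρ b) N) :
    Module.Finite (FormalFun (stabRep ρ b) 0) N' := by
  classical
  obtain ⟨s, hs⟩ := hN.fg_top
  choose q hq using hε.exists_eq
  refine ⟨s.image q, ?_⟩
  rw [eq_top_iff]
  have key : ∀ m : N, q m ∈ Submodule.span (FormalFun (stabRep ρ b) 0) ((s.image q : Finset N') :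
      Set N') := by
    intro m
    have hm : m ∈ Submodule.span (FormalFun ρ b) (s : Set N) := by rw [hs]; trivial
    induction hm using Submodule.span_induction with
    | zero =>
      have h0 : q 0 = 0 := hε.injective (by rw [hq, smul_zero, map_zero])
      rw [h0]
      exact Submodule.zero_mem _
    | add a b _ _ ha hb =>
      have h0 : q (a + b) = q a + q b := hε.injective (by rw [hq, map_add, hq, hq, smul_add])
      rw [h0]
      exact Submodule.add_mem _ ha hb
    | smul φ m _ ih =>
      have h0 : q (φ • m) = (fun _ => φ (basePt ρ b) : FormalFun (stabRep ρ b) 0) • q m :=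
        hε.injective (by
          rw [← hε.fun_smul, hq, hq, baseIdem, f_smul_eq, f_smul_eq, smul_smul, smul_smul,
            mul_comm])
      rw [h0]
      exact Submodule.smul_mem _ _ ih
    | mem m hm => exact Submodule.subset_span (Finset.mem_coe.2 (Finset.mem_image_of_mem q hm))
  rintro n -
  have h0 : q (ε n) = n := hε.injective (by rw [hq, hε.baseIdem_smul])
  rw [← h0]
  exact key _

include hε in
theorem map_y_smul (v : V) (n : N') :
    ε (H.y (stabRep ρ b) (stabParam ρ c b) v • n) = innerY ρ c b v • ε n := by
  rw [← hat_y_smul (b := 0), hε.map_smul, baseEmb_y, mul_smul, hε.baseIdem_smul]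

end IsCorner

theorem pert_smul_mem_pow (v : V) {k : ℕ} {n : N}
    (hn : n ∈ orbIdeal ρ b ^ k • (⊤ : Submodule (FormalFun ρ b) N)) :
    (HHat.data ρ c b).pert v • n ∈ orbIdeal ρ b ^ k • (⊤ : Submodule (FormalFun ρ b) N) := by
  rw [DunklData.pert, Finset.sum_smul]
  refine Submodule.sum_mem _ fun s _ => ?_
  rw [smul_assoc, mul_smul]
  refine Submodule.smul_of_tower_mem _ _ ?_
  change HHat.f ρ c b _ • (HHat.g ρ c b s - 1) • n ∈ _
  rw [f_smul_eq, sub_smul, one_smul, hat_g_smul]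
  exact Submodule.smul_mem _ _ (Submodule.sub_mem _ (g_smul_mem_pow s hn) hn)

end Corner

section KeyLemma

variable {G V : Type u} [Group G] [Finite G] [AddCommGroup V] [Module ℂ V]
  [FiniteDimensional ℂ V] {ρ : Representation ℂ G V} (c : Param ρ) (b : V)
variable {N : Type u} [AddCommGroup N] [Module (HHat ρ c b) N] [Module ℂ N]
  [Module (FormalFun ρ b) N] [Module (H ρ c) N] [IsScalarTower ℂ (HHat ρ c b) N]
  [IsScalarTower (FormalFun ρ b) (HHat ρ c b) N] [IsScalarTower (H ρ c) (HHat ρ c b) N]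
  [IsScalarTower ℂ (FormalFun ρ b) N] [IsScalarTower ℂ (H ρ c) N]

/-- For large `k`, a vector of `𝔪ᵏN` that is taken to `𝔪ᵏN` by `V` lies in `𝔪ᵏ⁺¹N`. -/
theorem exists_mem_pow_succ (hρ : Function.Injective ρ) (hN : Module.Finite (FormalFun ρ b) N) :
    ∃ k₀ : ℕ, ∀ k, k₀ ≤ k → ∀ n ∈ orbIdeal ρ b ^ k • (⊤ : Submodule (FormalFun ρ b) N),
      (∀ v, H.y ρ c v • n ∈ orbIdeal ρ b ^ k • (⊤ : Submodule (FormalFun ρ b) N)) →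
      n ∈ orbIdeal ρ b ^ (k + 1) • (⊤ : Submodule (FormalFun ρ b) N) := by
  obtain ⟨N', ε, hε⟩ := exists_isCorner c b hρ N
  let _ := hatModuleC (stabRep ρ b) (stabParam ρ c b) 0 N'
  let _ := hatModuleFun (stabRep ρ b) (stabParam ρ c b) 0 N'
  let _ := hatModuleH (stabRep ρ b) (stabParam ρ c b) 0 N'
  obtain ⟨_, _, _, _, _⟩ := hatModule_towers (stabRep ρ b) (stabParam ρ c b) 0 N'
  obtain ⟨k₀, hk₀⟩ := exists_mem_pow_succ_zero (stabRep ρ b) (stabParam ρ c b) (hε.finite hN)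
  refine ⟨k₀, fun k hk n hn hy => ?_⟩
  let _ := Fintype.ofFinite G
  rw [← IsCorner.sum_baseIdem_smul (ρ := ρ) (c := c) (b := b) N n]
  refine Submodule.smul_of_tower_mem _ _ (Submodule.sum_mem _ fun r _ => g_smul_mem_pow _ ?_)
  obtain ⟨n', hn'⟩ := hε.exists_eq (H.g ρ c r • n)
  have hbase : ∀ m ∈ orbIdeal ρ b ^ k • (⊤ : Submodule (FormalFun ρ b) N),
      baseIdem ρ c b • m ∈ orbIdeal ρ b ^ k • (⊤ : Submodule (FormalFun ρ b) N) := by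
    intro m hm
    rw [baseIdem, f_smul_eq]
    exact Submodule.smul_mem _ _ hm
  rw [← hn']
  refine hε.map_mem_pow (hk₀ k hk n' (hε.mem_pow_of_map ?_) fun v => hε.mem_pow_of_map ?_)
  · rw [hn']
    exact hbase _ (g_smul_mem_pow r hn)
  · rw [hε.map_y_smul, hn', ← mul_smul, innerY_mul_baseIdem, mul_smul]
    refine hbase _ ?_
    have h1 : innerY ρ c b v = HHat.y ρ c b v - (HHat.data ρ c b).pert v :=
      eq_sub_of_add_eq (y_eq_innerY_add c b v).symm
    rw [h1, sub_smul, hat_y_smul]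
    refine Submodule.sub_mem _ ?_ (pert_smul_mem_pow v (g_smul_mem_pow r hn))
    have h3 := H.g_y ρ c r (ρ r⁻¹ v)
    rw [apply_inv_apply] at h3
    rw [← mul_smul, ← h3, mul_smul]
    exact g_smul_mem_pow r (hy _)

end KeyLemma


section NilFiltration

variable {ι N : Type*} [Finite ι] [AddCommGroup N] [Module ℂ N]

/-- A complete separated filtration of finite codimension with a family of commuting operators of
degree `-1`, such that deep terms of the filtration are determined by the operators. -/
structure NilFiltration (y : ι → Module.End ℂ N) (F : ℕ → Submodule ℂ N) : Prop where
  comm : ∀ i j, y i * y j = y j * y i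
  anti : ∀ k, F (k + 1) ≤ F k
  map_mem : ∀ i k, ∀ n ∈ F (k + 1), y i n ∈ F k
  finite : ∀ k, FiniteDimensional ℂ (N ⧸ F k)
  eq_zero : ∀ n, (∀ k, n ∈ F k) → n = 0
  exists_limit : ∀ s : ℕ → N, (∀ k, s (k + 1) - s k ∈ F k) → ∃ l, ∀ k, l - s k ∈ F k
  exists_mem_succ : ∃ k₀, ∀ k, k₀ ≤ k → ∀ n ∈ F k, (∀ i, y i n ∈ F k) → n ∈ F (k + 1)

namespace NilFiltration

/-- Every product of `k` operators kills `n`. -/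
def OpNil (y : ι → Module.End ℂ N) : ℕ → N → Prop
  | 0, n => n = 0
  | k + 1, n => ∀ i, OpNil y k (y i n)

variable {y : ι → Module.End ℂ N} {F : ℕ → Submodule ℂ N} (h : NilFiltration y F)

include h in
theorem anti_le {k l : ℕ} (hkl : k ≤ l) : F l ≤ F k := antitone_nat_of_succ_le h.anti hkl

/-- The action of polynomials in the transposed operators on the dual space. -/
def dualAction : MvPolynomial ι ℂ →ₐ[ℂ] Module.End ℂ (Module.Dual ℂ N) :=
  commAeval (fun i => (y i).dualMap) fun i j => by
    ext t n
    change t (y j (y i n)) = t (y i (y j n))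
    rw [← Module.End.mul_apply, h.comm j i]
    rfl

theorem dualAction_X (i : ι) (t : Module.Dual ℂ N) (n : N) :
    h.dualAction (MvPolynomial.X i) t n = t (y i n) := by
  rw [dualAction, commAeval_X]
  rfl

/-- The dual space as a module over polynomials. -/
@[reducible] def dualModule : Module (MvPolynomial ι ℂ) (Module.Dual ℂ N) :=
  Module.compHom _ h.dualAction.toRingHom

/-- The continuous dual. -/
def contDual : @Submodule (MvPolynomial ι ℂ) (Module.Dual ℂ N) _ _ h.dualModule :=
  letI := h.dualModule
  { carrier := {t | ∃ k, t ∈ (F k).dualAnnihilator}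
    zero_mem' := ⟨0, Submodule.zero_mem _⟩
    add_mem' := by
      rintro t t' ⟨k, hk⟩ ⟨k', hk'⟩
      exact ⟨max k k', Submodule.add_mem _
        (Submodule.dualAnnihilator_anti (h.anti_le (le_max_left _ _)) hk)
        (Submodule.dualAnnihilator_anti (h.anti_le (le_max_right _ _)) hk')⟩
    smul_mem' := by
      intro P t ht
      change ∃ k, h.dualAction P t ∈ _
      induction P using MvPolynomial.induction_on generalizing t with
      | C r =>
        obtain ⟨k, hk⟩ := ht
        refine ⟨k, ?_⟩
        rw [← MvPolynomial.algebraMap_eq, AlgHom.commutes, Module.algebraMap_end_apply]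
        exact Submodule.smul_mem _ r hk
      | add p q hp hq =>
        obtain ⟨k, hk⟩ := hp ht
        obtain ⟨k', hk'⟩ := hq ht
        rw [map_add]
        exact ⟨max k k', Submodule.add_mem _
          (Submodule.dualAnnihilator_anti (h.anti_le (le_max_left _ _)) hk)
          (Submodule.dualAnnihilator_anti (h.anti_le (le_max_right _ _)) hk')⟩
      | mul_X p i hp =>
        rw [map_mul, Module.End.mul_apply]
        refine hp ?_
        obtain ⟨k, hk⟩ := ht
        refine ⟨k + 1, (Submodule.mem_dualAnnihilator _).2 fun n hn => ?_⟩
        rw [dualAction_X]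
        exact (Submodule.mem_dualAnnihilator _).1 hk _ (h.map_mem i k n hn) }

include h in
theorem finiteDimensional_dualAnnihilator (k : ℕ) :
    FiniteDimensional ℂ (F k).dualAnnihilator := by
  have := h.finite k
  exact Module.Finite.equiv (F k).dualQuotEquivDualAnnihilator

theorem contDual_finite :
    letI := h.dualModule
    Module.Finite (MvPolynomial ι ℂ) h.contDual := by
  classical
  let _ := Fintype.ofFinite ι
  let _ := h.dualModule
  obtain ⟨k₀, hk₀⟩ := h.exists_mem_succ
  have hstep : ∀ k, k₀ ≤ k → (F (k + 1)).dualAnnihilator ≤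
      (F k).dualAnnihilator ⊔ ⨆ i, (F k).dualAnnihilator.map (y i).dualMap := by
    intro k hk
    have hfd := h.finiteDimensional_dualAnnihilator k
    set D := (F k).dualAnnihilator ⊔ ⨆ i, (F k).dualAnnihilator.map (y i).dualMap with hD
    have hDfd : FiniteDimensional ℂ D := inferInstance
    rw [← Subspace.dualCoannihilator_dualAnnihilator_eq (W := D)]
    refine Submodule.dualAnnihilator_anti fun n hn => ?_
    rw [Submodule.mem_dualCoannihilator] at hn
    have hmem : ∀ n : N, (∀ t ∈ (F k).dualAnnihilator, t n = 0) → n ∈ F k := by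
      intro n hn
      rw [← Subspace.dualAnnihilator_dualCoannihilator_eq (W := F k),
        Submodule.mem_dualCoannihilator]
      exact hn
    refine hk₀ k hk n (hmem n fun t ht => hn t (Submodule.mem_sup_left ht)) fun i =>
      hmem _ fun t ht => hn ((y i).dualMap t) (Submodule.mem_sup_right ?_)
    exact Submodule.mem_iSup_of_mem i (Submodule.mem_map_of_mem ht)
  have hspan : ∀ k, ∀ t ∈ (F k).dualAnnihilator,
      t ∈ Submodule.span (MvPolynomial ι ℂ) ((F k₀).dualAnnihilator : Set (Module.Dual ℂ N)) := by
    intro k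
    induction k with
    | zero =>
      intro t ht
      exact Submodule.subset_span (Submodule.dualAnnihilator_anti (h.anti_le (Nat.zero_le k₀)) ht)
    | succ k ih =>
      intro t ht
      by_cases hk : k + 1 ≤ k₀
      · exact Submodule.subset_span (Submodule.dualAnnihilator_anti (h.anti_le hk) ht)
      · obtain ⟨a, ha, z, hz, rfl⟩ := Submodule.mem_sup.1 (hstep k (by omega) ht)
        refine Submodule.add_mem _ (ih a ha) ?_
        refine Submodule.iSup_induction _ (motive := fun z => z ∈ Submodule.span (MvPolynomial ι ℂ)
          ((F k₀).dualAnnihilator : Set (Module.Dual ℂ N))) hz ?_ (Submodule.zero_mem _)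
          fun u v hu hv => Submodule.add_mem _ hu hv
        · rintro i _ ⟨t', ht', rfl⟩
          have h1 : (y i).dualMap t' = (MvPolynomial.X i : MvPolynomial ι ℂ) • t' := by
            refine LinearMap.ext fun n => ?_
            exact (h.dualAction_X i t' n).symm
          rw [h1]
          exact Submodule.smul_mem _ _ (ih t' ht')
  have hfd := h.finiteDimensional_dualAnnihilator k₀
  obtain ⟨s, hs⟩ := Module.Finite.iff_fg.1 hfd
  refine Module.Finite.iff_fg.2 ⟨s, le_antisymm (Submodule.span_le.2 fun t ht => ?_) ?_⟩
  · refine ⟨k₀, ?_⟩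
    rw [← hs]
    exact Submodule.subset_span ht
  · rintro t ⟨k, hk⟩
    refine Submodule.span_le.2 ?_ (hspan k t hk)
    intro u hu
    have hu' : u ∈ Submodule.span ℂ (s : Set (Module.Dual ℂ N)) := by rw [hs]; exact hu
    clear hu
    induction hu' using Submodule.span_induction with
    | zero => exact Submodule.zero_mem _
    | mem u hu => exact Submodule.subset_span hu
    | add u v _ _ hu hv => exact Submodule.add_mem _ hu hv
    | smul r u _ hu =>
      have h1 : r • u = (MvPolynomial.C r : MvPolynomial ι ℂ) • u := by
        change r • u = h.dualAction _ u
        rw [← MvPolynomial.algebraMap_eq, AlgHom.commutes, Module.algebraMap_end_apply]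
      rw [h1]
      exact Submodule.smul_mem _ _ hu

include h in
theorem eq_zero_of_contDual {n : N} (hn : ∀ t, (∃ k, t ∈ (F k).dualAnnihilator) → t n = 0) :
    n = 0 := by
  refine h.eq_zero n fun k => ?_
  rw [← Subspace.dualAnnihilator_dualCoannihilator_eq (W := F k), Submodule.mem_dualCoannihilator]
  exact fun t ht => hn t ⟨k, ht⟩

include h in
/-- Every functional on the continuous dual is the evaluation at a vector. -/
theorem exists_eval_eq (Λ : Module.Dual ℂ N → ℂ)
    (hadd : ∀ k, ∀ t ∈ (F k).dualAnnihilator, ∀ t' ∈ (F k).dualAnnihilator,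
      Λ (t + t') = Λ t + Λ t')
    (hsmul : ∀ k, ∀ t ∈ (F k).dualAnnihilator, ∀ r : ℂ, Λ (r • t) = r * Λ t) :
    ∃ n : N, ∀ k, ∀ t ∈ (F k).dualAnnihilator, t n = Λ t := by
  have hk : ∀ k, ∃ n : N, ∀ t ∈ (F k).dualAnnihilator, t n = Λ t := by
    intro k
    have hfd := h.finiteDimensional_dualAnnihilator k
    let ev : N →ₗ[ℂ] Module.Dual ℂ (F k).dualAnnihilator :=
      (F k).dualAnnihilator.subtype.flip
    have hev : Function.Surjective ev := by
      rw [← LinearMap.dualMap_injective_iff]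
      intro φ φ' hφ
      obtain ⟨t, rfl⟩ := (Module.evalEquiv ℂ (F k).dualAnnihilator).surjective φ
      obtain ⟨t', rfl⟩ := (Module.evalEquiv ℂ (F k).dualAnnihilator).surjective φ'
      congr 1
      refine Subtype.ext (LinearMap.ext fun n => ?_)
      exact congrArg (fun ψ : Module.Dual ℂ N => ψ n) hφ
    obtain ⟨n, hn⟩ := hev
      { toFun := fun t => Λ t.1
        map_add' := fun t t' => hadd k t.1 t.2 t'.1 t'.2
        map_smul' := fun r t => hsmul k t.1 t.2 r }
    exact ⟨n, fun t ht => congrArg (fun ψ : Module.Dual ℂ _ => ψ ⟨t, ht⟩) hn⟩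
  choose s hs using hk
  obtain ⟨l, hl⟩ := h.exists_limit s fun k => by
    rw [← Subspace.dualAnnihilator_dualCoannihilator_eq (W := F k),
      Submodule.mem_dualCoannihilator]
    intro t ht
    rw [map_sub, hs k t ht, hs (k + 1) t (Submodule.dualAnnihilator_anti (h.anti k) ht), sub_self]
  refine ⟨l, fun k t ht => ?_⟩
  have h1 := (Submodule.mem_dualAnnihilator _).1 ht _ (hl k)
  rw [map_sub, sub_eq_zero] at h1
  rw [h1, hs k t ht]

theorem opNil_of_forall {k : ℕ} {n : N}
    (hn : ∀ P ∈ Ideal.span (Set.range MvPolynomial.X) ^ k, ∀ t ∈ h.contDual,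
      h.dualAction P t n = 0) : OpNil y k n := by
  induction k generalizing n with
  | zero =>
    refine h.eq_zero_of_contDual fun t ht => ?_
    have := hn 1 (by simp) t ht
    rwa [map_one] at this
  | succ k ih =>
    intro i
    refine ih fun P hP t ht => ?_
    rw [← dualAction_X, ← Module.End.mul_apply, ← map_mul]
    refine hn _ ?_ t ht
    rw [pow_succ']
    exact Ideal.mul_mem_mul (Ideal.subset_span ⟨i, rfl⟩) hP

theorem dualAction_eq_zero_of_opNil {k : ℕ} {n : N} (hn : OpNil y k n) {P : MvPolynomial ι ℂ}
    (hP : P ∈ Ideal.span (Set.range MvPolynomial.X) ^ k) (t : Module.Dual ℂ N) :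
    h.dualAction P t n = 0 := by
  induction k generalizing n P with
  | zero => rw [show n = 0 from hn, map_zero]
  | succ k ih =>
    rw [pow_succ'] at hP
    induction hP using Submodule.smul_induction_on' with
    | add a _ b _ ha hb => rw [map_add, LinearMap.add_apply, LinearMap.add_apply, ha, hb, add_zero]
    | smul A hA Q hQ =>
      induction hA using Submodule.span_induction generalizing Q with
      | zero => rw [zero_smul, map_zero]; rfl
      | add a b _ _ ha hb =>
        rw [add_smul, map_add, LinearMap.add_apply, LinearMap.add_apply, ha Q hQ, hb Q hQ, add_zero]
      | smul B A _ ih' =>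
        have h1 : (B • A) • Q = A • (B * Q) := by simp only [smul_eq_mul]; ring
        rw [h1]
        exact ih' _ (Ideal.mul_mem_left _ _ hQ)
      | mem A hA =>
        obtain ⟨i, rfl⟩ := hA
        rw [smul_eq_mul, map_mul, Module.End.mul_apply, dualAction_X]
        exact ih (hn i) hQ

end NilFiltration

open NilFiltration

variable {N'' : Type*} [AddCommGroup N''] [Module ℂ N'']

/-- Nilpotent vectors lift along surjections. -/
theorem NilFiltration.exists_opNil_lift {y : ι → Module.End ℂ N} {F : ℕ → Submodule ℂ N}
    (h : NilFiltration y F) {y'' : ι → Module.End ℂ N''} {F'' : ℕ → Submodule ℂ N''}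
    (h'' : NilFiltration y'' F'') (g : N →ₗ[ℂ] N'') (hg : Function.Surjective g)
    (hgy : ∀ i n, g (y i n) = y'' i (g n)) (hgF : ∀ k, ∀ n ∈ F k, g n ∈ F'' k)
    {k : ℕ} {n'' : N''} (hn : OpNil y'' k n'') : ∃ n l, OpNil y l n ∧ g n = n'' := by
  let _ := h.dualModule
  let _ := h''.dualModule
  have hfin : Module.Finite (MvPolynomial ι ℂ) h.contDual := h.contDual_finite
  have hact : ∀ (P : MvPolynomial ι ℂ) (t : Module.Dual ℂ N''),
      g.dualMap (h''.dualAction P t) = h.dualAction P (g.dualMap t) := by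
    intro P
    induction P using MvPolynomial.induction_on with
    | C r =>
      intro t
      rw [← MvPolynomial.algebraMap_eq, AlgHom.commutes, AlgHom.commutes,
        Module.algebraMap_end_apply, Module.algebraMap_end_apply, map_smul]
    | add p q hp hq =>
      intro t
      rw [map_add, map_add, LinearMap.add_apply, LinearMap.add_apply, map_add, hp, hq]
    | mul_X p i hp =>
      intro t
      rw [map_mul, map_mul, Module.End.mul_apply, Module.End.mul_apply, hp]
      congr 1
      refine LinearMap.ext fun n => ?_
      rw [dualAction_X]
      change h''.dualAction (MvPolynomial.X i) t (g n) = t (g (y i n))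
      rw [dualAction_X, hgy]
  let τ : h''.contDual →ₗ[MvPolynomial ι ℂ] h.contDual :=
    { toFun := fun t => ⟨g.dualMap t.1, by
        obtain ⟨k, hk⟩ := t.2
        refine ⟨k, (Submodule.mem_dualAnnihilator _).2 fun n hn => ?_⟩
        exact (Submodule.mem_dualAnnihilator _).1 hk _ (hgF k n hn)⟩
      map_add' := fun t t' => Subtype.ext (map_add g.dualMap _ _)
      map_smul' := fun P t => Subtype.ext (hact P t.1) }
  have hτ : Function.Injective τ := fun t t' ht => Subtype.ext
    (LinearMap.dualMap_injective_of_surjective hg (congrArg Subtype.val ht))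
  set J : Ideal (MvPolynomial ι ℂ) := Ideal.span (Set.range MvPolynomial.X) with hJ
  obtain ⟨k₁, hk₁⟩ := Ideal.exists_pow_inf_eq_pow_smul J (LinearMap.range τ)
  let Q : Submodule (MvPolynomial ι ℂ) h.contDual := J ^ (k₁ + k) • ⊤
  have hker : ∀ t : h''.contDual, τ t ∈ Q → t.1 n'' = 0 := by
    intro t ht
    have h1 : τ t ∈ J ^ (k₁ + k) • ⊤ ⊓ LinearMap.range τ := ⟨ht, t, rfl⟩
    rw [hk₁ _ (Nat.le_add_right _ _), Nat.add_sub_cancel_left] at h1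
    have h2 : τ t ∈ (J ^ k • (⊤ : Submodule _ h''.contDual)).map τ := by
      rw [Submodule.map_smul'', Submodule.map_top]
      exact Submodule.smul_mono le_rfl inf_le_right h1
    obtain ⟨t', ht', h3⟩ := h2
    rw [hτ h3] at ht'
    clear h3 h1 ht
    induction ht' using Submodule.smul_induction_on' with
    | smul P hP t _ => exact h''.dualAction_eq_zero_of_opNil hn hP t.1
    | add a _ b _ ha hb =>
      change a.1 n'' + b.1 n'' = 0
      rw [ha, hb, add_zero]
  let T₁ : Submodule ℂ (Module.Dual ℂ N) :=
    { carrier := {t | ∃ ht : t ∈ h.contDual, (⟨t, ht⟩ : h.contDual) ∈ Q}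
      zero_mem' := ⟨h.contDual.zero_mem, Q.zero_mem⟩
      add_mem' := fun {a b} ha hb =>
        ⟨h.contDual.add_mem ha.1 hb.1, Q.add_mem ha.2 hb.2⟩
      smul_mem' := fun r a ha => by
        have h1 : r • a = (MvPolynomial.C r : MvPolynomial ι ℂ) • a := by
          change r • a = h.dualAction _ a
          rw [← MvPolynomial.algebraMap_eq, AlgHom.commutes, Module.algebraMap_end_apply]
        rw [h1]
        exact ⟨h.contDual.smul_mem _ ha.1, Q.smul_mem _ ha.2⟩ }
  let T'' : Submodule ℂ (Module.Dual ℂ N'') :=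
    { carrier := {t | t ∈ h''.contDual}
      zero_mem' := h''.contDual.zero_mem
      add_mem' := fun {a b} ha hb => h''.contDual.add_mem ha hb
      smul_mem' := fun r a ha => by
        obtain ⟨k, hk⟩ := ha
        exact ⟨k, Submodule.smul_mem _ r hk⟩ }
  let σ : T'' →ₗ[ℂ] Module.Dual ℂ N ⧸ T₁ := T₁.mkQ ∘ₗ g.dualMap ∘ₗ T''.subtype
  let lam : Module.Dual ℂ T'' := Module.Dual.eval ℂ N'' n'' ∘ₗ T''.subtype
  have hlam : lam ∈ LinearMap.range σ.dualMap := by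
    rw [LinearMap.range_dualMap_eq_dualAnnihilator_ker, Submodule.mem_dualAnnihilator]
    intro t ht
    obtain ⟨_, ht'⟩ := (Submodule.Quotient.mk_eq_zero T₁).1 (LinearMap.mem_ker.1 ht)
    exact hker ⟨t.1, t.2⟩ ht'
  obtain ⟨μ, hμ⟩ := hlam
  obtain ⟨n, hn'⟩ := h.exists_eval_eq (fun t => μ (T₁.mkQ t))
    (fun _ t _ t' _ => by rw [map_add, map_add])
    (fun _ t _ r => by rw [map_smul, map_smul, smul_eq_mul])
  refine ⟨n, k₁ + k, h.opNil_of_forall fun P hP t ht => ?_, ?_⟩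
  · have h1 : h.dualAction P t ∈ h.contDual := h.contDual.smul_mem P ht
    obtain ⟨l, hl⟩ := h1
    rw [hn' l _ hl]
    have h2 : h.dualAction P t ∈ T₁ :=
      ⟨h.contDual.smul_mem P ht, Submodule.smul_mem_smul hP (show (⟨t, ht⟩ : h.contDual) ∈ ⊤ from
        trivial)⟩
    rw [Submodule.mkQ_apply, (Submodule.Quotient.mk_eq_zero T₁).2 h2, map_zero]
  · rw [← sub_eq_zero]
    refine h''.eq_zero_of_contDual fun t ht => ?_
    rw [map_sub, sub_eq_zero]
    have h1 := congrArg (fun φ : Module.Dual ℂ T'' => φ ⟨t, ht⟩) hμ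
    have h2 : μ (T₁.mkQ (g.dualMap t)) = t n'' := h1
    rw [← h2]
    obtain ⟨l, hl⟩ := (τ ⟨t, ht⟩).2
    exact hn' l _ hl

end NilFiltration

section ExactEb

variable {G V : Type u} [Group G] [Finite G] [AddCommGroup V] [Module ℂ V]
  [FiniteDimensional ℂ V] {ρ : Representation ℂ G V} (c : Param ρ) (b : V)
variable (N : Type u) [AddCommGroup N] [Module (HHat ρ c b) N] [Module ℂ N]
  [Module (FormalFun ρ b) N] [Module (H ρ c) N] [IsScalarTower ℂ (HHat ρ c b) N]
  [IsScalarTower (FormalFun ρ b) (HHat ρ c b) N] [IsScalarTower (H ρ c) (HHat ρ c b) N]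
  [IsScalarTower ℂ (FormalFun ρ b) N] [IsScalarTower ℂ (H ρ c) N]

theorem finiteDimensional_quotient_pow (hN : Module.Finite (FormalFun ρ b) N) (k : ℕ) :
    FiniteDimensional ℂ
      (N ⧸ (orbIdeal ρ b ^ k • ⊤ : Submodule (FormalFun ρ b) N).restrictScalars ℂ) := by
  obtain ⟨F, hF, h⟩ := exists_fg_sup_orbIdeal_pow (N := N) hN k
  have : FiniteDimensional ℂ F := Module.Finite.of_fg hF
  set T := (orbIdeal ρ b ^ k • ⊤ : Submodule (FormalFun ρ b) N).restrictScalars ℂ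
  refine Module.Finite.of_surjective (T.mkQ ∘ₗ F.subtype) fun q => ?_
  obtain ⟨n, rfl⟩ := T.mkQ_surjective q
  obtain ⟨d, hd, t, ht, h⟩ := Submodule.mem_sup.1 (h ▸ Submodule.mem_top : n ∈ F ⊔ T)
  refine ⟨⟨d, hd⟩, ?_⟩
  rw [← h, map_add, Submodule.mkQ_apply T t, (Submodule.Quotient.mk_eq_zero T).2 ht, add_zero]
  rfl

theorem nilFiltration (hρ : Function.Injective ρ) (hN : Module.Finite (FormalFun ρ b) N) :
    NilFiltration (fun i => opH ρ c N (H.y ρ c (Module.finBasis ℂ V i)))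
      fun k => (orbIdeal ρ b ^ k • ⊤ : Submodule (FormalFun ρ b) N).restrictScalars ℂ := by
  refine ⟨fun i j => ?_, fun k => ?_, fun i k n hn => ?_, fun k => ?_, fun n hn => ?_,
    fun s hs => ?_, ?_⟩
  · refine LinearMap.ext fun n => ?_
    change H.y ρ c _ • H.y ρ c _ • n = H.y ρ c _ • H.y ρ c _ • n
    rw [← mul_smul, H.y_y, mul_smul]
  · have h1 : (orbIdeal ρ b ^ (k + 1) • ⊤ : Submodule (FormalFun ρ b) N) ≤ orbIdeal ρ b ^ k • ⊤ :=
      Submodule.smul_mono (Ideal.pow_le_pow_right (Nat.le_succ k)) le_rfl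
    exact fun n hn => h1 hn
  · exact y_smul_mem_pow _ hn
  · exact finiteDimensional_quotient_pow b N hN k
  · exact eq_zero_of_forall_mem_pow_smul (ρ := ρ) (b := b) hn
  · exact exists_adic_limit (orbIdeal ρ b) s hs
  · obtain ⟨k₀, hk₀⟩ := exists_mem_pow_succ c b (N := N) hρ hN
    refine ⟨k₀, fun k hk n hn hy => hk₀ k hk n hn fun v => ?_⟩
    rw [← sum_coord_y, Finset.sum_smul]
    refine Submodule.sum_mem _ fun i _ => ?_
    rw [smul_assoc]
    exact Submodule.smul_of_tower_mem _ _ (hy i)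

variable {c b N}

theorem opNil_iff {M : Type*} [AddCommGroup M] [Module ℂ M] [Module (H ρ c) M]
    [IsScalarTower ℂ (H ρ c) M] {k : ℕ} {n : M} :
    NilFiltration.OpNil (fun i => opH ρ c M (H.y ρ c (Module.finBasis ℂ V i))) k n ↔
      NilpotentOfOrder ρ c k n := by
  induction k generalizing n with
  | zero => exact Iff.rfl
  | succ k ih =>
    constructor
    · intro h
      exact NilpotentOfOrder.of_forall_finBasis fun i => ih.1 (h i)
    · intro h i
      exact ih.2 (h _)

theorem finiteDimensional_singular_hat (hρ : Function.Injective ρ)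
    (hN : Module.Finite (FormalFun ρ b) N) : FiniteDimensional ℂ (nilOrder ρ c N 1) := by
  obtain ⟨k₀, hk₀⟩ := exists_mem_pow_succ c b (N := N) hρ hN
  obtain ⟨F, hF, h⟩ := exists_fg_sup_orbIdeal_pow (N := N) hN k₀
  refine finiteDimensional_of_disjoint hF h (eq_bot_iff.2 ?_)
  rintro n ⟨h1, h2⟩
  have key : ∀ k, k₀ ≤ k → n ∈ orbIdeal ρ b ^ k • (⊤ : Submodule (FormalFun ρ b) N) := by
    intro k hk
    induction k, hk using Nat.le_induction with
    | base => exact h2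
    | succ k hk ih =>
      refine hk₀ k hk n ih fun v => ?_
      rw [mem_nilOrder_one.1 h1 v]
      exact Submodule.zero_mem _
  refine eq_zero_of_forall_mem_pow_smul (ρ := ρ) (b := b) fun k => ?_
  exact Submodule.smul_mono (Ideal.pow_le_pow_right (le_max_right k₀ k)) le_rfl
    (key (max k₀ k) (le_max_left _ _))

theorem exists_nilpotent_lift {N'' : Type u} [AddCommGroup N''] [Module (HHat ρ c b) N'']
    [Module ℂ N''] [Module (FormalFun ρ b) N''] [Module (H ρ c) N'']
    [IsScalarTower ℂ (HHat ρ c b) N''] [IsScalarTower (FormalFun ρ b) (HHat ρ c b) N'']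
    [IsScalarTower (H ρ c) (HHat ρ c b) N''] [IsScalarTower ℂ (FormalFun ρ b) N'']
    [IsScalarTower ℂ (H ρ c) N''] (hρ : Function.Injective ρ)
    (hN : Module.Finite (FormalFun ρ b) N) (hN'' : Module.Finite (FormalFun ρ b) N'')
    (g : N →ₗ[HHat ρ c b] N'') (hg : Function.Surjective g) {n'' : N''}
    (hn : IsNilpotentVec ρ c n'') : ∃ n : N, IsNilpotentVec ρ c n ∧ g n = n'' := by
  obtain ⟨k, hk⟩ := hn
  obtain ⟨n, l, h1, h2⟩ := (nilFiltration c b N hρ hN).exists_opNil_lift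
    (nilFiltration c b N'' hρ hN'') (g.restrictScalars ℂ) hg
    (fun i n => by
      change g (H.y ρ c _ • n) = H.y ρ c _ • g n
      rw [← hat_y_smul (b := b), map_smul, hat_y_smul])
    (fun k n hn => by
      change g n ∈ orbIdeal ρ b ^ k • (⊤ : Submodule (FormalFun ρ b) N'')
      have hn' : n ∈ orbIdeal ρ b ^ k • (⊤ : Submodule (FormalFun ρ b) N) := hn
      induction hn' using Submodule.smul_induction_on' with
      | smul φ hφ n _ =>
        rw [← f_smul_eq ρ c b, map_smul, f_smul_eq]
        exact Submodule.smul_mem_smul hφ trivial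
      | add x hx y hy hx' hy' => rw [map_add]; exact Submodule.add_mem _ (hx' hx) (hy' hy))
    (opNil_iff.2 hk)
  exact ⟨n, ⟨l, opNil_iff.1 h1⟩, h2⟩

end ExactEb


section HatFun

variable {G V : Type u} [Group G] [Finite G] [AddCommGroup V] [Module ℂ V]
  [FiniteDimensional ℂ V] (ρ : Representation ℂ G V) (b : V)

/-- Functions on the formal neighborhood of the orbit of `b`, as an algebra over polynomials. -/
def HatFun : Type u := FormalFun ρ b

instance : CommRing (HatFun ρ b) := inferInstanceAs (CommRing (FormalFun ρ b))

instance : Algebra ℂ (HatFun ρ b) := inferInstanceAs (Algebra ℂ (FormalFun ρ b))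

instance : Algebra (Poly V) (HatFun ρ b) :=
  RingHom.toAlgebra (S := HatFun ρ b) (polyFun ρ b).toRingHom

instance : IsScalarTower ℂ (Poly V) (HatFun ρ b) :=
  IsScalarTower.of_algebraMap_eq fun r => ((polyFun ρ b).commutes r).symm

theorem mk_eq_mk_iff {k : ℕ} {P Q : Poly V} :
    (Submodule.Quotient.mk P : Poly V ⧸ (orbPolyIdeal ρ b ^ k • ⊤ : Submodule (Poly V) (Poly V))) =
      Submodule.Quotient.mk Q ↔ polyFun ρ b P - polyFun ρ b Q ∈ orbIdeal ρ b ^ k := by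
  rw [Submodule.Quotient.eq, smul_eq_mul, Ideal.mul_top, mem_orbPolyIdeal_pow, map_sub]

instance flat_hatFun : Module.Flat (Poly V) (HatFun ρ b) := by
  choose P hP using fun (f : FormalFun ρ b) (k : ℕ) => exists_poly_sub_mem (ρ := ρ) (b := b) f k
  let F : ∀ k, HatFun ρ b →ₗ[Poly V] Poly V ⧸ (orbPolyIdeal ρ b ^ k • ⊤ : Submodule (Poly V) _) :=
    fun k =>
    { toFun := fun f => Submodule.Quotient.mk (P f k)
      map_add' := fun (f f' : FormalFun ρ b) => by
        rw [← Submodule.Quotient.mk_add, mk_eq_mk_iff, map_add]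
        have := sub_mem (add_mem (hP f k) (hP f' k)) (hP (f + f') k)
        convert this using 1
        change polyFun ρ b (P (f + f') k) - _ = _
        ring
      map_smul' := fun Q (f : FormalFun ρ b) => by
        rw [RingHom.id_apply, ← Submodule.Quotient.mk_smul, mk_eq_mk_iff, smul_eq_mul, map_mul]
        have := sub_mem (Ideal.mul_mem_left _ (polyFun ρ b Q) (hP f k))
          (hP (polyFun ρ b Q * f) k)
        convert this using 1
        change polyFun ρ b (P (polyFun ρ b Q * f) k) - _ = _
        ring }
  have hF : ∀ {m k : ℕ} (hle : m ≤ k),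
      AdicCompletion.transitionMap (orbPolyIdeal ρ b) (Poly V) hle ∘ₗ F k = F m := by
    intro m k hle
    refine LinearMap.ext fun (f : FormalFun ρ b) => ?_
    change (Submodule.Quotient.mk (P f k) : Poly V ⧸ _) = Submodule.Quotient.mk (P f m)
    rw [mk_eq_mk_iff]
    have := sub_mem (hP f m) (Ideal.pow_le_pow_right hle (hP f k))
    convert this using 1
    ring
  let e := AdicCompletion.lift (orbPolyIdeal ρ b) F hF
  have he : Function.Bijective e := by
    constructor
    · rw [← LinearMap.ker_eq_bot, LinearMap.ker_eq_bot']
      intro (f : FormalFun ρ b) hf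
      refine eq_zero_of_forall_mem_orbIdeal_pow fun k => ?_
      have h1 : (Submodule.Quotient.mk (P f k) :
          Poly V ⧸ (orbPolyIdeal ρ b ^ k • ⊤ : Submodule (Poly V) _)) = Submodule.Quotient.mk 0 :=
        congrFun (congrArg Subtype.val hf) k
      rw [mk_eq_mk_iff, map_zero, sub_zero] at h1
      have := add_mem (hP f k) h1
      rwa [sub_add_cancel] at this
    · intro x
      induction x using AdicCompletion.induction_on with
      | h s =>
        obtain ⟨l, hl⟩ := exists_adic_limit (orbIdeal ρ b) (fun k => polyFun ρ b (s.1 k)) (by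
          intro k
          rw [smul_eq_mul, Ideal.mul_top, ← mk_eq_mk_iff]
          exact (s.2 (Nat.le_succ k)).symm)
        refine ⟨l, AdicCompletion.ext fun k => ?_⟩
        change (Submodule.Quotient.mk (P l k) : Poly V ⧸ _) = Submodule.Quotient.mk (s.1 k)
        rw [mk_eq_mk_iff]
        have h2 := hl k
        rw [smul_eq_mul, Ideal.mul_top] at h2
        have := sub_mem h2 (hP l k)
        convert this using 1
        ring
  exact Module.Flat.of_linearEquiv (LinearEquiv.ofBijective e he)

end HatFun

section HatTensor

variable {G V : Type u} [Group G] [Finite G] [AddCommGroup V] [Module ℂ V]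
  [FiniteDimensional ℂ V] (ρ : Representation ℂ G V) (b : V)
  (M : Type u) [AddCommGroup M] [Module (Poly V) M]

/-- The tensor product of the functions on the formal neighborhood with `M` over polynomials. -/
def HatTensor : Type u := HatFun ρ b ⊗[Poly V] M

instance : AddCommGroup (HatTensor ρ b M) := inferInstanceAs (AddCommGroup (HatFun ρ b ⊗[Poly V] M))

instance : Module ℂ (HatTensor ρ b M) := inferInstanceAs (Module ℂ (HatFun ρ b ⊗[Poly V] M))

instance : Module (FormalFun ρ b) (HatTensor ρ b M) :=
  inferInstanceAs (Module (HatFun ρ b) (HatFun ρ b ⊗[Poly V] M))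

instance : IsScalarTower ℂ (FormalFun ρ b) (HatTensor ρ b M) :=
  inferInstanceAs (IsScalarTower ℂ (HatFun ρ b) (HatFun ρ b ⊗[Poly V] M))

instance [Module.Finite (Poly V) M] : Module.Finite (FormalFun ρ b) (HatTensor ρ b M) :=
  inferInstanceAs (Module.Finite (HatFun ρ b) (HatFun ρ b ⊗[Poly V] M))

variable {M} in
/-- Pure tensors. -/
def hatTmul (f : FormalFun ρ b) (m : M) : HatTensor ρ b M :=
  TensorProduct.tmul (Poly V) (M := HatFun ρ b) f m

variable {ρ b M}

theorem hatTmul_add_left (f f' : FormalFun ρ b) (m : M) :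
    hatTmul ρ b (f + f') m = hatTmul ρ b f m + hatTmul ρ b f' m := TensorProduct.add_tmul _ _ _

theorem hatTmul_add (f : FormalFun ρ b) (m m' : M) :
    hatTmul ρ b f (m + m') = hatTmul ρ b f m + hatTmul ρ b f m' := TensorProduct.tmul_add _ _ _

theorem smul_hatTmul (r : ℂ) (f : FormalFun ρ b) (m : M) :
    r • hatTmul ρ b f m = hatTmul ρ b (r • f) m := rfl

theorem fun_smul_hatTmul (ψ f : FormalFun ρ b) (m : M) :
    ψ • hatTmul ρ b f m = hatTmul ρ b (ψ * f) m := rfl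

theorem hatTmul_poly (P : Poly V) (f : FormalFun ρ b) (m : M) :
    hatTmul ρ b f (P • m) = hatTmul ρ b (polyFun ρ b P * f) m :=
  (TensorProduct.smul_tmul P (show HatFun ρ b from f) m).symm

variable (ρ b) in
/-- The bilinear map `(f, m) ↦ f ⊗ m`. -/
def hatTmulHom : FormalFun ρ b →+ M →+ HatTensor ρ b M :=
  AddMonoidHom.mk' (fun f => AddMonoidHom.mk' (hatTmul ρ b f) (hatTmul_add f)) fun f f' =>
    AddMonoidHom.ext fun m => hatTmul_add_left f f' m

theorem hatTmul_sum {ι : Type*} (t : Finset ι) (f : FormalFun ρ b) (m : ι → M) :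
    hatTmul ρ b f (∑ i ∈ t, m i) = ∑ i ∈ t, hatTmul ρ b f (m i) :=
  map_sum (hatTmulHom ρ b f) m t

theorem hat_induction {p : HatTensor ρ b M → Prop} (add : ∀ t t', p t → p t' → p (t + t'))
    (tmul : ∀ f m, p (hatTmul ρ b f m)) (t : HatTensor ρ b M) : p t := by
  refine TensorProduct.induction_on (motive := p) (t : HatFun ρ b ⊗[Poly V] M) ?_ tmul add
  have := tmul 0 0
  rwa [← TensorProduct.zero_tmul (HatFun ρ b) (R := Poly V) (0 : M)]

/-- Additive maps out of the tensor product. -/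
def hatLift {N : Type*} [AddCommGroup N] (φ : FormalFun ρ b →+ M →+ N)
    (hφ : ∀ P f m, φ (polyFun ρ b P * f) m = φ f (P • m)) : HatTensor ρ b M →+ N :=
  TensorProduct.liftAddHom (M := HatFun ρ b) φ hφ

theorem hatLift_tmul {N : Type*} [AddCommGroup N] (φ : FormalFun ρ b →+ M →+ N)
    (hφ : ∀ P f m, φ (polyFun ρ b P * f) m = φ f (P • m)) (f : FormalFun ρ b) (m : M) :
    hatLift φ hφ (hatTmul ρ b f m) = φ f m := rfl

/-- Every element is, modulo a power of the ideal of the orbit, of the form `1 ⊗ m`. -/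
theorem exists_sub_tmul_mem (t : HatTensor ρ b M) (k : ℕ) : ∃ m : M,
    t - hatTmul ρ b 1 m ∈ orbIdeal ρ b ^ k • (⊤ : Submodule (FormalFun ρ b) (HatTensor ρ b M)) := by
  induction t using hat_induction with
  | add t t' ht ht' =>
    obtain ⟨m, hm⟩ := ht
    obtain ⟨m', hm'⟩ := ht'
    refine ⟨m + m', ?_⟩
    rw [hatTmul_add, add_sub_add_comm]
    exact Submodule.add_mem _ hm hm'
  | tmul f m =>
    obtain ⟨P, hP⟩ := exists_poly_sub_mem f k
    refine ⟨P • m, ?_⟩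
    have : hatTmul ρ b f m - hatTmul ρ b 1 (P • m) = (f - polyFun ρ b P) • hatTmul ρ b 1 m := by
      rw [hatTmul_poly, sub_smul, fun_smul_hatTmul, fun_smul_hatTmul, mul_one,
        mul_one]
    rw [this]
    exact Submodule.smul_mem_smul hP trivial

end HatTensor

section PolyRelations

variable {G V : Type u} [Group G] [Finite G] [AddCommGroup V] [Module ℂ V]
  [FiniteDimensional ℂ V] (ρ : Representation ℂ G V) (c : Param ρ) (b : V)

theorem polyFun_X (i : Fin (Module.finrank ℂ V)) :
    polyFun ρ b (MvPolynomial.X i) = linFun b ((Module.finBasis ℂ V).coord i) :=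
  MvPolynomial.aeval_X _ _

theorem polyFun_linPoly (a : Module.Dual ℂ V) : polyFun ρ b (linPoly a) = linFun b a := by
  let L : Module.Dual ℂ V →ₗ[ℂ] FormalFun ρ b :=
    { toFun := linFun b
      map_add' := linFun_add b
      map_smul' := fun r a => by rw [linFun_smul, Algebra.smul_def]; rfl }
  have : linFun b a = L a := rfl
  conv_rhs => rw [this, ← (Module.finBasis ℂ V).sum_dual_apply_smul_coord a, map_sum]
  rw [linPoly, map_sum]
  refine Finset.sum_congr rfl fun i _ => ?_
  rw [map_smul, map_smul, polyFun_X]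
  rfl

theorem ofH_polyH (P : Poly V) : HHat.ofH ρ c b (polyH ρ c P) = HHat.f ρ c b (polyFun ρ b P) := by
  have : (HHat.ofH ρ c b).comp (polyH ρ c) = (HHat.fHom ρ c b).comp (polyFun ρ b) := by
    ext1 i
    change HHat.ofH ρ c b (polyH ρ c _) = HHat.f ρ c b (polyFun ρ b _)
    rw [polyH_X, HHat.ofH_x, polyFun_X]
  exact DFunLike.congr_fun this P

theorem exists_g_polyH (w : G) (P : Poly V) : ∃ P' : Poly V,
    polyFun ρ b P' = actFun w (polyFun ρ b P) ∧
    H.g ρ c w * polyH ρ c P = polyH ρ c P' * H.g ρ c w := by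
  induction P using MvPolynomial.induction_on with
  | C r =>
    rw [← MvPolynomial.algebraMap_eq, AlgHom.commutes, AlgHom.commutes]
    refine ⟨algebraMap ℂ _ r, ?_, ?_⟩
    · rw [AlgHom.commutes, ← actHom_apply, AlgHom.commutes]
    · rw [AlgHom.commutes, Algebra.commutes]
  | add P Q hP hQ =>
    obtain ⟨P', h1, h2⟩ := hP
    obtain ⟨Q', h3, h4⟩ := hQ
    exact ⟨P' + Q', by rw [map_add, map_add, actFun_add, h1, h3],
      by rw [map_add, map_add, mul_add, add_mul, h2, h4]⟩
  | mul_X P i hP =>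
    obtain ⟨P', h1, h2⟩ := hP
    refine ⟨P' * linPoly (ρ.dual w ((Module.finBasis ℂ V).coord i)), ?_, ?_⟩
    · rw [map_mul, map_mul, actFun_mul, h1, polyFun_linPoly, polyFun_X, actFun_linFun]
    · rw [map_mul, map_mul, polyH_X, polyH_linPoly, ← mul_assoc, h2, mul_assoc, H.g_x, mul_assoc]

theorem exists_y_polyH (v : V) (P : Poly V) : ∃ (R : Poly V) (Q : G → Poly V),
    polyFun ρ b R = derivFun v (polyFun ρ b P) ∧
    (∀ s ∈ reflections ρ, polyFun ρ b (Q s) =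
      (reflCoef c s * root ρ s v) • divRoot s (polyFun ρ b P)) ∧
    H.y ρ c v * polyH ρ c P = polyH ρ c P * H.y ρ c v + (polyH ρ c R +
      ∑ s ∈ reflections ρ, polyH ρ c (Q s) * H.g ρ c s) := by
  induction P using MvPolynomial.induction_on with
  | C r =>
    rw [← MvPolynomial.algebraMap_eq, AlgHom.commutes, AlgHom.commutes]
    refine ⟨0, fun _ => 0, ?_, ?_, ?_⟩
    · have : algebraMap ℂ (FormalFun ρ b) r = locConst ρ b (fun _ => r) := rfl
      rw [map_zero, this, derivFun_locConst]
    · intro s hs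
      rw [map_zero, Algebra.algebraMap_eq_smul_one, divRoot_smul (mem_reflections.1 hs),
        divRoot_one (mem_reflections.1 hs), smul_zero, smul_zero]
    · simp [Algebra.commutes]
  | add P P' hP hP' =>
    obtain ⟨R, Q, h1, h2, h3⟩ := hP
    obtain ⟨R', Q', h1', h2', h3'⟩ := hP'
    refine ⟨R + R', Q + Q', ?_, ?_, ?_⟩
    · rw [map_add, map_add, derivFun_add, h1, h1']
    · intro s hs
      rw [Pi.add_apply, map_add, map_add, divRoot_add (mem_reflections.1 hs), smul_add, h2 s hs,
        h2' s hs]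
    · simp only [map_add, mul_add, add_mul, h3, h3', Pi.add_apply, Finset.sum_add_distrib]
      abel
  | mul_X P i hP =>
    obtain ⟨R, Q, h1, h2, h3⟩ := hP
    set a := (Module.finBasis ℂ V).coord i with ha
    refine ⟨R * linPoly a + a v • P, fun s => Q s * linPoly (ρ.dual s a) -
      (c.val s * root ρ s v * a (coroot ρ s)) • P, ?_, ?_, ?_⟩
    · rw [map_add, map_mul, map_mul, map_smul, derivFun_mul, h1, polyFun_linPoly, polyFun_X, ← ha,
        derivFun_linFun, Algebra.smul_def, mul_comm (algebraMap _ _ _)]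
    · intro s hs
      have hs' := mem_reflections.1 hs
      have hl : 1 - reflEigenvalue ρ s ≠ 0 := sub_ne_zero.2 (Ne.symm (root_facts hs').2.1)
      rw [map_sub, map_mul, map_mul, map_smul, polyFun_linPoly, polyFun_X, ← ha, divRoot_mul hs',
        divRoot_linFun hs', actFun_linFun, h2 s hs, smul_add, smul_mul_assoc, sub_eq_add_neg,
        ← neg_smul, mul_comm (polyFun ρ b P), ← Algebra.smul_def, smul_smul]
      congr 2
      rw [reflCoef]
      field_simp
    · rw [map_mul, polyH_X, ← ha, ← mul_assoc, h3, add_mul, add_mul, mul_assoc, H.y_x,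
        Finset.sum_mul]
      have h4 : ∀ s, polyH ρ c (Q s) * H.g ρ c s * H.x ρ c a =
          polyH ρ c (Q s) * H.x ρ c (ρ.dual s a) * H.g ρ c s := by
        intro s
        rw [mul_assoc, H.g_x, mul_assoc]
      simp only [h4, map_add, map_sub, map_mul, map_smul, polyH_linPoly, sub_mul,
        Finset.sum_sub_distrib, mul_add, mul_sub, Finset.mul_sum, mul_smul_comm, smul_mul_assoc,
        mul_assoc]
      rw [← Algebra.commutes, ← Algebra.smul_def]
      abel

end PolyRelations


section HatTensorAction

variable {G V : Type u} [Group G] [Finite G] [AddCommGroup V] [Module ℂ V]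
  [FiniteDimensional ℂ V] {ρ : Representation ℂ G V} (c : Param ρ) (b : V)
  (M : Type u) [AddCommGroup M] [Module (H ρ c) M] [Module (Poly V) M]
  [IsScalarTower (Poly V) (H ρ c) M]

/-- The action of the group on the tensor product. -/
def hatG (w : G) : Module.End ℂ (HatTensor ρ b M) :=
  letI F : HatTensor ρ b M →+ HatTensor ρ b M :=
    hatLift (AddMonoidHom.mk' (fun f => AddMonoidHom.mk'
      (fun m => hatTmul ρ b (actFun w f) (H.g ρ c w • m)) fun m m' => by
        rw [smul_add, hatTmul_add]) fun f f' => AddMonoidHom.ext fun m => by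
        change hatTmul ρ b (actFun w (f + f')) _ = hatTmul ρ b _ _ + hatTmul ρ b _ _
        rw [actFun_add, hatTmul_add_left]) (by
      intro P f m
      change hatTmul ρ b (actFun w (polyFun ρ b P * f)) (H.g ρ c w • m) =
        hatTmul ρ b (actFun w f) (H.g ρ c w • P • m)
      obtain ⟨P', h1, h2⟩ := exists_g_polyH ρ c b w P
      rw [poly_smul ρ c P, ← mul_smul, h2, mul_smul, ← poly_smul ρ c, hatTmul_poly, h1, actFun_mul])
  { toFun := F
    map_add' := map_add F
    map_smul' := fun r t => by
      induction t using hat_induction with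
      | add t t' ht ht' => rw [smul_add, map_add, map_add, smul_add, ht, ht']
      | tmul f m =>
        change hatTmul ρ b (actFun w (r • f)) _ = r • hatTmul ρ b (actFun w f) _
        rw [actFun_smul, smul_hatTmul] }

theorem hatG_tmul (w : G) (f : FormalFun ρ b) (m : M) :
    hatG c b M w (hatTmul ρ b f m) = hatTmul ρ b (actFun w f) (H.g ρ c w • m) := rfl

/-- The value of the Dunkl operator on a pure tensor. -/
def hatYVal (v : V) (f : FormalFun ρ b) (m : M) : HatTensor ρ b M :=
  hatTmul ρ b f (H.y ρ c v • m) + (hatTmul ρ b (derivFun v f) m +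
    ∑ s ∈ reflections ρ, hatTmul ρ b ((reflCoef c s * root ρ s v) • divRoot s f) (H.g ρ c s • m))

theorem hatYVal_mul (v : V) (φ f : FormalFun ρ b) (m : M) :
    hatYVal c b M v (φ * f) m = φ • hatYVal c b M v f m + (hatTmul ρ b (derivFun v φ * f) m +
      ∑ s ∈ reflections ρ, hatTmul ρ b (((reflCoef c s * root ρ s v) • divRoot s φ) * actFun s f)
        (H.g ρ c s • m)) := by
  simp only [hatYVal, smul_add, fun_smul_hatTmul, Finset.smul_sum, derivFun_mul, hatTmul_add_left]
  have : ∀ s ∈ reflections ρ, hatTmul ρ b ((reflCoef c s * root ρ s v) • divRoot s (φ * f))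
      (H.g ρ c s • m) = hatTmul ρ b (φ * (reflCoef c s * root ρ s v) • divRoot s f)
      (H.g ρ c s • m) + hatTmul ρ b (((reflCoef c s * root ρ s v) • divRoot s φ) * actFun s f)
      (H.g ρ c s • m) := by
    intro s hs
    rw [← hatTmul_add_left, divRoot_mul (mem_reflections.1 hs), smul_add, smul_mul_assoc,
      mul_smul_comm, add_comm]
  rw [Finset.sum_congr rfl this, Finset.sum_add_distrib]
  abel

theorem hatYVal_poly (v : V) (P : Poly V) (f : FormalFun ρ b) (m : M) :
    hatYVal c b M v (polyFun ρ b P * f) m = hatYVal c b M v f (P • m) := by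
  obtain ⟨R, Q, h1, h2, h3⟩ := exists_y_polyH ρ c b v P
  have h4 : H.y ρ c v • P • m = P • H.y ρ c v • m + (R • m +
      ∑ s ∈ reflections ρ, Q s • H.g ρ c s • m) := by
    simp only [poly_smul ρ c]
    rw [← mul_smul, h3]
    simp only [add_smul, Finset.sum_smul, mul_smul]
  have h5 : ∀ s, hatTmul ρ b ((reflCoef c s * root ρ s v) • divRoot s f) (H.g ρ c s • P • m) =
      hatTmul ρ b (actFun s (polyFun ρ b P) * (reflCoef c s * root ρ s v) • divRoot s f)
        (H.g ρ c s • m) := by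
    intro s
    obtain ⟨P', h6, h7⟩ := exists_g_polyH ρ c b s P
    rw [poly_smul ρ c P, ← mul_smul (H.g ρ c s), h7, mul_smul (polyH ρ c P'), ← poly_smul ρ c,
      hatTmul_poly, h6]
  have h8 : ∀ s ∈ reflections ρ,
      hatTmul ρ b ((reflCoef c s * root ρ s v) • divRoot s (polyFun ρ b P * f)) (H.g ρ c s • m) =
      hatTmul ρ b (polyFun ρ b (Q s) * f) (H.g ρ c s • m) +
      hatTmul ρ b (actFun s (polyFun ρ b P) * (reflCoef c s * root ρ s v) • divRoot s f)
        (H.g ρ c s • m) := by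
    intro s hs
    rw [mul_comm (polyFun ρ b P), divRoot_mul (mem_reflections.1 hs), h2 s hs, smul_add,
      hatTmul_add_left, add_comm, smul_mul_assoc, mul_smul_comm, mul_comm f, mul_comm (divRoot s f)]
  simp only [hatYVal, h4, h5, hatTmul_add, hatTmul_sum, hatTmul_poly, h1, derivFun_mul,
    hatTmul_add_left]
  rw [Finset.sum_congr rfl h8, Finset.sum_add_distrib]
  abel

/-- The Dunkl operators on the tensor product. -/
def hatY (v : V) : Module.End ℂ (HatTensor ρ b M) :=
  letI F : HatTensor ρ b M →+ HatTensor ρ b M :=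
    hatLift (AddMonoidHom.mk' (fun f => AddMonoidHom.mk' (hatYVal c b M v f) fun m m' => by
        simp only [hatYVal, smul_add, hatTmul_add, Finset.sum_add_distrib]
        abel) fun f f' => AddMonoidHom.ext fun m => by
        change hatYVal c b M v (f + f') m = hatYVal c b M v f m + hatYVal c b M v f' m
        have : ∀ s ∈ reflections ρ, hatTmul ρ b ((reflCoef c s * root ρ s v) • divRoot s (f + f'))
            (H.g ρ c s • m) = hatTmul ρ b ((reflCoef c s * root ρ s v) • divRoot s f)
            (H.g ρ c s • m) + hatTmul ρ b ((reflCoef c s * root ρ s v) • divRoot s f')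
            (H.g ρ c s • m) := by
          intro s hs
          rw [divRoot_add (mem_reflections.1 hs), smul_add, hatTmul_add_left]
        simp only [hatYVal, derivFun_add, hatTmul_add_left]
        rw [Finset.sum_congr rfl this, Finset.sum_add_distrib]
        abel) (hatYVal_poly c b M v)
  { toFun := F
    map_add' := map_add F
    map_smul' := fun r t => by
      induction t using hat_induction with
      | add t t' ht ht' => rw [smul_add, map_add, map_add, smul_add, ht, ht']
      | tmul f m =>
        change hatYVal c b M v (r • f) m = r • hatYVal c b M v f m
        simp only [hatYVal, smul_add, Finset.smul_sum, smul_hatTmul, derivFun_smul]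
        refine congrArg₂ _ rfl (congrArg₂ _ rfl (Finset.sum_congr rfl fun s hs => ?_))
        rw [divRoot_smul (mem_reflections.1 hs), smul_comm] }

theorem hatY_tmul (v : V) (f : FormalFun ρ b) (m : M) :
    hatY c b M v (hatTmul ρ b f m) = hatYVal c b M v f m := rfl

variable {c b M} in
theorem hatEnd_ext {F F' : Module.End ℂ (HatTensor ρ b M)}
    (h : ∀ f m, F (hatTmul ρ b f m) = F' (hatTmul ρ b f m)) : F = F' := by
  refine LinearMap.ext fun t => ?_
  induction t using hat_induction with
  | add t t' ht ht' => rw [map_add, map_add, ht, ht']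
  | tmul f m => exact h f m

/-- The operators on the tensor product. -/
def hatTensorData : DunklData c b 1 (Module.End ℂ (HatTensor ρ b M)) where
  ι := Algebra.lsmul ℂ ℂ (HatTensor ρ b M)
  γ :=
    { toFun := hatG c b M
      map_one' := hatEnd_ext fun f m => by
        rw [hatG_tmul, actFun_one, H.g_one, one_smul]; rfl
      map_mul' := fun w w' => hatEnd_ext fun f m => by
        rw [Module.End.mul_apply, hatG_tmul, hatG_tmul, hatG_tmul, actFun_actFun, H.g_mul,
          mul_smul] }
  Y :=
    { toFun := hatY c b M
      map_add' := fun v v' => hatEnd_ext fun f m => by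
        rw [LinearMap.add_apply, hatY_tmul, hatY_tmul, hatY_tmul]
        simp only [hatYVal, H.y_add, add_smul, hatTmul_add, derivFun_add_left, hatTmul_add_left,
          map_add, mul_add, Finset.sum_add_distrib]
        abel
      map_smul' := fun r v => hatEnd_ext fun f m => by
        rw [RingHom.id_apply, LinearMap.smul_apply, hatY_tmul, hatY_tmul]
        have h1 : hatTmul ρ b f ((r • H.y ρ c v) • m) = hatTmul ρ b (r • f) (H.y ρ c v • m) := by
          rw [Algebra.smul_def, mul_smul, ← AlgHom.commutes (polyH ρ c), ← poly_smul ρ c,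
            hatTmul_poly, AlgHom.commutes, ← Algebra.smul_def]
        simp only [hatYVal, H.y_smul, h1, smul_add, smul_hatTmul, derivFun_smul_left, map_smul,
          Finset.smul_sum, smul_smul, smul_eq_mul]
        refine congrArg₂ _ rfl (congrArg₂ _ rfl (Finset.sum_congr rfl fun s hs => ?_))
        rw [mul_left_comm] }
  g_f w φ := hatEnd_ext fun f m => by
    change hatTmul ρ b (actFun w (φ * f)) _ = hatTmul ρ b (actFun w φ * actFun w f) _
    rw [actFun_mul]
  g_y w v := hatEnd_ext fun f m => by
    change hatG c b M w (hatYVal c b M v f m) = hatYVal c b M (ρ w v) (actFun w f) (H.g ρ c w • m)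
    rw [hatYVal, hatYVal, ← sum_reflections_conj (fun s => hatTmul ρ b
      ((reflCoef c s * root ρ s (ρ w v)) • divRoot s (actFun w f)) (H.g ρ c s • H.g ρ c w • m)) w]
    simp only [map_add, map_sum, hatG_tmul, ← mul_smul, H.g_y, ← derivFun_actFun]
    refine congrArg₂ _ rfl (congrArg₂ _ rfl (Finset.sum_congr rfl fun s hs => ?_))
    have hs' := mem_reflections.1 hs
    rw [mul_smul (reflCoef c s), actFun_smul, actFun_divRoot hs', reflCoef_conj c hs', ← H.g_mul,
      ← H.g_mul, inv_mul_cancel_right, mul_smul (reflCoef c s)]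
  y_f v φ := hatEnd_ext fun f m => by
    have h := hatYVal_mul c b M v φ f m
    simp only [LinearMap.add_apply, LinearMap.sum_apply, LinearMap.smul_apply,
      Module.End.mul_apply, Pi.one_apply, one_mul]
    refine h.trans (congrArg₂ _ rfl (congrArg₂ _ rfl (Finset.sum_congr rfl fun s hs => ?_)))
    change _ = (reflCoef c s * root ρ s v) • hatTmul ρ b (divRoot s φ * actFun s f) (H.g ρ c s • m)
    rw [smul_hatTmul, smul_mul_assoc]

theorem hatY_mem_pow (v : V) {k : ℕ} {t : HatTensor ρ b M}
    (ht : t ∈ orbIdeal ρ b ^ (k + 1) • (⊤ : Submodule (FormalFun ρ b) (HatTensor ρ b M))) :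
    hatY c b M v t ∈ orbIdeal ρ b ^ k • (⊤ : Submodule (FormalFun ρ b) (HatTensor ρ b M)) := by
  induction ht using Submodule.smul_induction_on' with
  | smul φ hφ t _ =>
    have h : hatY c b M v (φ • t) = φ • hatY c b M v t + (derivFun v φ • t +
        ∑ s ∈ reflections ρ, (reflCoef c s * root ρ s v) • (divRoot s φ • hatG c b M s t)) := by
      have := DFunLike.congr_fun ((hatTensorData c b M).y_f v φ) t
      simp only [LinearMap.add_apply, LinearMap.sum_apply, LinearMap.smul_apply,
        Module.End.mul_apply, Pi.one_apply, one_mul] at this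
      exact this
    rw [h]
    refine Submodule.add_mem _ (Submodule.smul_mem_smul
      (Ideal.pow_le_pow_right (Nat.le_succ k) hφ) trivial) (Submodule.add_mem _
      (Submodule.smul_mem_smul (derivFun_mem v hφ) trivial) (Submodule.sum_mem _ fun s hs => ?_))
    rw [← smul_assoc]
    exact Submodule.smul_mem_smul
      (smul_mem_ideal _ _ (divRoot_mem (mem_reflections.1 hs) hφ)) trivial
  | add x _ y _ hx hy => rw [map_add]; exact Submodule.add_mem _ hx hy

theorem hatYVal_one (v : V) (m : M) :
    hatYVal c b M v 1 m = hatTmul ρ b 1 (H.y ρ c v • m) := by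
  have h1 : derivFun v (1 : FormalFun ρ b) = 0 := by
    rw [← map_one (locConst ρ b), derivFun_locConst]
  have h0 : ∀ m : M, hatTmul ρ b 0 m = 0 := fun m => TensorProduct.zero_tmul _ _
  rw [hatYVal, Finset.sum_eq_zero, h1, h0, add_zero, add_zero]
  intro s hs
  rw [divRoot_one (mem_reflections.1 hs), smul_zero, h0]

theorem hatY_commute [Module.Finite (Poly V) M] (v v' : V) :
    hatY c b M v * hatY c b M v' = hatY c b M v' * hatY c b M v := by
  refine LinearMap.ext fun t => sub_eq_zero.1 ?_
  refine eq_zero_of_forall_mem_pow_smul (ρ := ρ) (b := b) fun k => ?_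
  obtain ⟨m, hm⟩ := exists_sub_tmul_mem t (k + 1 + 1)
  have h : ∀ v v', hatY c b M v (hatY c b M v' (hatTmul ρ b 1 m)) =
      hatTmul ρ b 1 (H.y ρ c v • H.y ρ c v' • m) := by
    intro v v'
    rw [hatY_tmul, hatYVal_one, hatY_tmul, hatYVal_one]
  have h1 := hatY_mem_pow c b M v (hatY_mem_pow c b M v' hm)
  have h2 := hatY_mem_pow c b M v' (hatY_mem_pow c b M v hm)
  rw [map_sub, map_sub, h] at h1 h2
  have := Submodule.sub_mem _ h1 h2
  rw [← mul_smul, ← mul_smul, H.y_y, sub_sub_sub_cancel_right] at this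
  exact this

/-- The module structure over the completed algebra. -/
instance hatTensorModule [Module.Finite (Poly V) M] : Module (HHat ρ c b) (HatTensor ρ b M) :=
  Module.compHom _ (HHat.lift (hatTensorData c b M) (hatY_commute c b M)).toRingHom

section

variable [Module.Finite (Poly V) M]

theorem f_smul_hatTensor (φ : FormalFun ρ b) (t : HatTensor ρ b M) :
    HHat.f ρ c b φ • t = φ • t :=
  DFunLike.congr_fun (HHat.lift_f (hatTensorData c b M) (hatY_commute c b M) φ) t

theorem y_smul_hatTensor (v : V) (t : HatTensor ρ b M) :
    HHat.y ρ c b v • t = hatY c b M v t :=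
  DFunLike.congr_fun (HHat.lift_y (hatTensorData c b M) (hatY_commute c b M) v) t

theorem g_smul_hatTensor (w : G) (t : HatTensor ρ b M) :
    HHat.g ρ c b w • t = hatG c b M w t :=
  DFunLike.congr_fun (HHat.lift_g (hatTensorData c b M) (hatY_commute c b M) w) t

theorem ofH_smul_one_tmul (h : H ρ c) (m : M) :
    HHat.ofH ρ c b h • hatTmul ρ b 1 m = hatTmul ρ b 1 (h • m) := by
  let K : AddSubgroup (M × HatTensor ρ b M) :=
    AddMonoidHom.ker ((hatTmulHom ρ b 1).comp (AddMonoidHom.fst _ _) - AddMonoidHom.snd _ _)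
  let _ : Module (H ρ c) (HatTensor ρ b M) := Module.compHom _ (HHat.ofH ρ c b).toRingHom
  have hK : ∀ p : M × HatTensor ρ b M, p ∈ K ↔ hatTmul ρ b 1 p.1 = p.2 := fun p => sub_eq_zero
  have hx : ∀ P : Poly V, ∀ p ∈ K, polyH ρ c P • p ∈ K := by
    intro P p hp
    rw [hK] at hp ⊢
    change hatTmul ρ b 1 (polyH ρ c P • p.1) = HHat.ofH ρ c b (polyH ρ c P) • p.2
    rw [ofH_polyH, ← hp, f_smul_hatTensor, fun_smul_hatTmul, ← poly_smul ρ c, hatTmul_poly]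
  have := H.smul_mem_of_generators K (fun r p hp => by
      rw [← AlgHom.commutes (polyH ρ c)]; exact hx _ p hp) (fun a p hp => by
      rw [← polyH_linPoly]; exact hx _ p hp) (fun v p hp => by
      rw [hK] at hp ⊢
      change hatTmul ρ b 1 (H.y ρ c v • p.1) = HHat.ofH ρ c b (H.y ρ c v) • p.2
      rw [HHat.ofH_y, ← hp, y_smul_hatTensor, hatY_tmul, hatYVal_one]) (fun w p hp => by
      rw [hK] at hp ⊢
      change hatTmul ρ b 1 (H.g ρ c w • p.1) = HHat.ofH ρ c b (H.g ρ c w) • p.2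
      rw [HHat.ofH_g, ← hp, g_smul_hatTensor, hatG_tmul, ← actHom_apply, map_one])
    h (m := (m, hatTmul ρ b 1 m)) ((hK _).2 rfl)
  exact ((hK _).1 this).symm

end

end HatTensorAction


section Objects

variable {G V : Type u} [Group G] [Finite G] [AddCommGroup V] [Module ℂ V]
  [FiniteDimensional ℂ V] {ρ : Representation ℂ G V} {c : Param ρ} {b : V}

section

variable (M : ModuleCat.{u} (H ρ c))

instance moduleCatC : Module ℂ M := Module.compHom M (algebraMap ℂ (H ρ c))

instance moduleCatPoly : Module (Poly V) M := Module.compHom M (polyH ρ c).toRingHom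

instance : IsScalarTower ℂ (H ρ c) M :=
  ⟨fun r h m => by rw [Algebra.smul_def, mul_smul]; rfl⟩

instance : IsScalarTower (Poly V) (H ρ c) M :=
  ⟨fun P h m => by rw [poly_smul_H, mul_smul]; rfl⟩

variable {M}

theorem isCatO_iff : IsCatO ρ c M ↔ Module.Finite (Poly V) M ∧ ∀ m : M, IsNilpotentVec ρ c m := by
  rw [← finite_polySubalgebra_iff ρ c]
  exact Iff.rfl

theorem IsCatO.of_injective {M' : ModuleCat.{u} (H ρ c)} (f : M' ⟶ M)
    (hf : Function.Injective f.hom) (hM : IsCatO ρ c M) : IsCatO ρ c M' := by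
  rw [isCatO_iff] at hM ⊢
  have := hM.1
  refine ⟨Module.Finite.of_injective (f.hom.restrictScalars (Poly V)) hf, fun m => ?_⟩
  obtain ⟨n, hn⟩ := hM.2 (f.hom m)
  refine ⟨n, ?_⟩
  clear hM this
  induction n generalizing m with
  | zero => exact hf (hn.trans (map_zero _).symm)
  | succ n ih => exact fun v => ih _ (by rw [map_smul]; exact hn v)

theorem IsCatO.of_surjective {M' : ModuleCat.{u} (H ρ c)} (f : M ⟶ M')
    (hf : Function.Surjective f.hom) (hM : IsCatO ρ c M) : IsCatO ρ c M' := by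
  rw [isCatO_iff] at hM ⊢
  have := hM.1
  refine ⟨Module.Finite.of_surjective (f.hom.restrictScalars (Poly V)) hf, fun m => ?_⟩
  obtain ⟨m, rfl⟩ := hf m
  obtain ⟨n, hn⟩ := hM.2 m
  exact ⟨n, hn.map f.hom⟩

end

section

variable (N : ModuleCat.{u} (HHat ρ c b))

instance hatCatC : Module ℂ N := hatModuleC ρ c b N

instance hatCatFun : Module (FormalFun ρ b) N := hatModuleFun ρ c b N

instance hatCatH : Module (H ρ c) N := hatModuleH ρ c b N

instance : IsScalarTower ℂ (HHat ρ c b) N := (hatModule_towers ρ c b N).1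

instance : IsScalarTower (FormalFun ρ b) (HHat ρ c b) N := (hatModule_towers ρ c b N).2.1

instance : IsScalarTower (H ρ c) (HHat ρ c b) N := (hatModule_towers ρ c b N).2.2.1

instance : IsScalarTower ℂ (FormalFun ρ b) N := (hatModule_towers ρ c b N).2.2.2.1

instance : IsScalarTower ℂ (H ρ c) N := (hatModule_towers ρ c b N).2.2.2.2

variable (ρ c b) in
/-- The modules over the completed algebra that are finitely generated over functions. -/
def IsHatO : ObjectProperty (ModuleCat.{u} (HHat ρ c b)) := fun N =>
  Module.Finite (FormalFun ρ b) N

variable {N}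

theorem IsHatO.of_injective {N' : ModuleCat.{u} (HHat ρ c b)} (f : N' ⟶ N)
    (hf : Function.Injective f.hom) (hN : IsHatO ρ c b N) : IsHatO ρ c b N' := by
  have : Module.Finite (FormalFun ρ b) N := hN
  exact Module.Finite.of_injective (f.hom.restrictScalars (FormalFun ρ b)) hf

theorem IsHatO.of_surjective {N' : ModuleCat.{u} (HHat ρ c b)} (f : N ⟶ N')
    (hf : Function.Surjective f.hom) (hN : IsHatO ρ c b N) : IsHatO ρ c b N' := by
  have : Module.Finite (FormalFun ρ b) N := hN
  exact Module.Finite.of_surjective (f.hom.restrictScalars (FormalFun ρ b)) hf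

end

end Objects

section Completion

variable {G V : Type u} [Group G] [Finite G] [AddCommGroup V] [Module ℂ V]
  [FiniteDimensional ℂ V] {ρ : Representation ℂ G V} {c : Param ρ} (b : V)
  (M : ModuleCat.{u} (H ρ c))

/-- The class of `z ⊗ m` in the completion. -/
def completionMk (z : HHat ρ c b) (m : M) : (completion ρ c b).obj M :=
  tensorMk (fun r => LinearMap.toSpanSingleton _ _ ((HHat.ofH ρ c b).toRingHom r)) M z m

theorem completionMk_ofH (z : HHat ρ c b) (h : H ρ c) (m : M) :
    completionMk b M (z * HHat.ofH ρ c b h) m = completionMk b M z (h • m) :=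
  tensorMk_act (fun r => LinearMap.toSpanSingleton _ _ ((HHat.ofH ρ c b).toRingHom r)) M z h m

theorem smul_completionMk (z z' : HHat ρ c b) (m : M) :
    z • completionMk b M z' m = completionMk b M (z * z') m := rfl

theorem completion_map_mk {M' : ModuleCat.{u} (H ρ c)} (f : M ⟶ M') (z : HHat ρ c b) (m : M) :
    ((completion ρ c b).map f).hom (completionMk b M z m) = completionMk b M' z (f.hom m) := rfl

/-- The map from a module to its completion. -/
def completionUnit : M →ₗ[H ρ c] (completion ρ c b).obj M where
  toFun m := completionMk b M 1 m
  map_add' m m' := tensorMk_add _ M _ m m'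
  map_smul' h m := by
    change completionMk b M 1 (h • m) = HHat.ofH ρ c b h • completionMk b M 1 m
    rw [← completionMk_ofH, smul_completionMk, one_mul, mul_one]

variable {b M}

theorem completionUnit_apply (m : M) : completionUnit b M m = completionMk b M 1 m := rfl

theorem smul_completionUnit (z : HHat ρ c b) (m : M) :
    z • completionUnit b M m = completionMk b M z m := by
  rw [completionUnit_apply, smul_completionMk, mul_one]

theorem completion_map_unit {M' : ModuleCat.{u} (H ρ c)} (f : M ⟶ M') (m : M) :
    ((completion ρ c b).map f).hom (completionUnit b M m) = completionUnit b M' (f.hom m) := rfl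

section Lift

variable {N : Type*} [AddCommGroup N] [Module (HHat ρ c b) N] (u : M →+ N)
  (hu : ∀ h m, u (h • m) = HHat.ofH ρ c b h • u m)

/-- Homomorphisms out of a completion. -/
def completionLift : (completion ρ c b).obj M →ₗ[HHat ρ c b] N :=
  tensorLift (fun r => LinearMap.toSpanSingleton _ _ ((HHat.ofH ρ c b).toRingHom r)) M
    (AddMonoidHom.mk' (fun z => AddMonoidHom.mk' (fun m => z • u m) fun m m' => by
      rw [map_add, smul_add]) fun z z' => AddMonoidHom.ext fun m => add_smul z z' (u m))
    (fun z z' m => mul_smul z z' (u m)) (fun z h m => by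
      change (z * HHat.ofH ρ c b h) • u m = z • u (h • m)
      rw [hu, mul_smul])

theorem completionLift_unit (m : M) : completionLift u hu (completionUnit b M m) = u m :=
  one_smul _ _

end Lift

theorem completion_hom_ext {N : Type*} [AddCommGroup N] [Module (HHat ρ c b) N]
    {F F' : (completion ρ c b).obj M →ₗ[HHat ρ c b] N}
    (h : ∀ m, F (completionUnit b M m) = F' (completionUnit b M m)) : F = F' := by
  refine LinearMap.ext fun t => ?_
  induction t using tensor_induction with
  | add t t' ht ht' => exact ((map_add F t t').trans (congrArg₂ _ ht ht')).trans (map_add F' _ _).symm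
  | mk z m =>
    change F (completionMk b M z m) = F' (completionMk b M z m)
    rw [← smul_completionUnit, map_smul, map_smul, h]

section

variable [Module.Finite (Poly V) M]

variable (b M) in
/-- The completion as a tensor product over polynomials. -/
def completionEquiv : HatTensor ρ b M ≃ₗ[HHat ρ c b] (completion ρ c b).obj M :=
  letI F : HatTensor ρ b M →+ (completion ρ c b).obj M :=
    hatLift (AddMonoidHom.mk' (fun f => AddMonoidHom.mk'
      (fun m => HHat.f ρ c b f • completionUnit b M m) fun m m' => by rw [map_add, smul_add])
      fun f f' => AddMonoidHom.ext fun m => by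
        change HHat.fHom ρ c b (f + f') • completionUnit b M m = _
        rw [map_add, add_smul]
        rfl) (by
      intro P f m
      change HHat.fHom ρ c b (polyFun ρ b P * f) • completionUnit b M m =
        HHat.f ρ c b f • completionUnit b M (P • m)
      rw [mul_comm, map_mul, poly_smul ρ c, map_smul, ← ofH_smul_eq ρ c b, ofH_polyH, mul_smul]
      rfl)
  letI T : (completion ρ c b).obj M →ₗ[HHat ρ c b] HatTensor ρ b M :=
    completionLift (hatTmulHom ρ b 1) fun h m => (ofH_smul_one_tmul c b M h m).symm
  haveI hF : ∀ f m, F (hatTmul ρ b f m) = HHat.f ρ c b f • completionUnit b M m := fun f m => rfl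
  haveI hT : ∀ m, T (completionUnit b M m) = hatTmul ρ b 1 m := completionLift_unit _ _
  haveI hlin : ∀ (z : HHat ρ c b) t, F (z • t) = z • F t := fun z t => by
      induction z using HHat.induction generalizing t with
      | hf φ =>
        induction t using hat_induction with
        | add t t' ht ht' => rw [smul_add, map_add, map_add, smul_add, ht, ht']
        | tmul f m =>
          rw [f_smul_hatTensor, fun_smul_hatTmul, hF, hF, ← mul_smul]
          exact congrArg (· • completionUnit b M m) (map_mul (HHat.fHom ρ c b) φ f)
      | hg w =>
        induction t using hat_induction with
        | add t t' ht ht' => rw [smul_add, map_add, map_add, smul_add, ht, ht']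
        | tmul f m =>
          rw [g_smul_hatTensor, hatG_tmul, hF, hF, ← mul_smul, HHat.g_f, mul_smul, map_smul,
            hat_g_smul]
      | hy v =>
        induction t using hat_induction with
        | add t t' ht ht' => rw [smul_add, map_add, map_add, smul_add, ht, ht']
        | tmul f m =>
          rw [y_smul_hatTensor, hatY_tmul, hatYVal, map_add, map_add, map_sum, hF, hF, hF,
            ← mul_smul, HHat.y_f, add_smul, add_smul, mul_smul, hat_y_smul, map_smul,
            Finset.sum_smul]
          refine congrArg₂ _ rfl (congrArg₂ _ rfl (Finset.sum_congr rfl fun s hs => ?_))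
          rw [hF, map_smul, smul_assoc, mul_smul (HHat.f ρ c b _), hat_g_smul, f_smul_eq, f_smul_eq,
            smul_assoc]
      | hadd z z' hz hz' => rw [add_smul, map_add, hz, hz', add_smul]
      | hmul z z' hz hz' => rw [mul_smul, hz, hz', mul_smul]
  { toFun := F
    map_add' := map_add F
    map_smul' := hlin
    invFun := T
    left_inv := fun t => by
      induction t using hat_induction with
      | add t t' ht ht' => rw [map_add, map_add, ht, ht']
      | tmul f m =>
        rw [hF, map_smul, hT, f_smul_hatTensor, fun_smul_hatTmul, mul_one]
    right_inv := fun t => by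
      let F' : HatTensor ρ b M →ₗ[HHat ρ c b] (completion ρ c b).obj M :=
        { toFun := F, map_add' := map_add F, map_smul' := hlin }
      have : F'.comp T = LinearMap.id := completion_hom_ext fun m => by
        change F (T (completionUnit b M m)) = _
        rw [hT, hF]
        exact (congrArg (· • completionUnit b M m) (map_one (HHat.fHom ρ c b))).trans (one_smul _ _)
      exact DFunLike.congr_fun this t }

theorem completionEquiv_tmul (f : FormalFun ρ b) (m : M) :
    completionEquiv b M (hatTmul ρ b f m) = f • completionUnit b M m :=
  f_smul_eq ρ c b f (completionUnit b M m)

theorem completionEquiv_fun_smul (f : FormalFun ρ b) (t : HatTensor ρ b M) :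
    completionEquiv b M (f • t) = f • completionEquiv b M t := by
  rw [← f_smul_hatTensor c b M, map_smul, f_smul_eq]

variable (b M) in
theorem isHatO_completion : IsHatO ρ c b ((completion ρ c b).obj M) :=
  Module.Finite.of_surjective
    { toFun := completionEquiv b M
      map_add' := map_add _
      map_smul' := completionEquiv_fun_smul : HatTensor ρ b M →ₗ[FormalFun ρ b] _ }
    (completionEquiv b M).surjective

theorem exists_sub_completionUnit_mem (t : (completion ρ c b).obj M) (k : ℕ) : ∃ m : M,
    t - completionUnit b M m ∈
      orbIdeal ρ b ^ k • (⊤ : Submodule (FormalFun ρ b) ((completion ρ c b).obj M)) := by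
  obtain ⟨t, rfl⟩ := (completionEquiv b M).surjective t
  obtain ⟨m, hm⟩ := exists_sub_tmul_mem t k
  refine ⟨m, ?_⟩
  have h1 : completionUnit b M m = completionEquiv b M (hatTmul ρ b 1 m) := by
    rw [completionEquiv_tmul, one_smul]
  rw [h1, ← map_sub]
  generalize t - hatTmul ρ b 1 m = t' at hm
  induction hm using Submodule.smul_induction_on' with
  | smul φ hφ t _ =>
    rw [completionEquiv_fun_smul]
    exact Submodule.smul_mem_smul hφ trivial
  | add x _ y _ hx hy => rw [map_add]; exact Submodule.add_mem _ hx hy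

section

variable {M' M'' : ModuleCat.{u} (H ρ c)} [Module.Finite (Poly V) M'] [Module.Finite (Poly V) M'']

variable (b) in
/-- The map induced on tensor products over polynomials. -/
def hatTensorMap (f : M ⟶ M') : HatTensor ρ b M →+ HatTensor ρ b M' :=
  (LinearMap.lTensor (HatFun ρ b) (f.hom.restrictScalars (Poly V))).toAddMonoidHom

theorem hatTensorMap_tmul (f : M ⟶ M') (φ : FormalFun ρ b) (m : M) :
    hatTensorMap b f (hatTmul ρ b φ m) = hatTmul ρ b φ (f.hom m) := rfl

theorem completion_map_equiv (f : M ⟶ M') (t : HatTensor ρ b M) :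
    ((completion ρ c b).map f).hom (completionEquiv b M t) =
      completionEquiv b M' (hatTensorMap b f t) := by
  induction t using hat_induction with
  | add t t' ht ht' => rw [map_add, map_add, map_add, map_add, ht, ht']
  | tmul φ m =>
    rw [hatTensorMap_tmul, completionEquiv_tmul, completionEquiv_tmul, ← f_smul_eq ρ c b,
      ← f_smul_eq ρ c b, map_smul, completion_map_unit]

theorem completion_map_injective {f : M ⟶ M'} (hf : Function.Injective f.hom) :
    Function.Injective ((completion ρ c b).map f).hom := by
  have h1 : Function.Injective (hatTensorMap b f) :=
    Module.Flat.lTensor_preserves_injective_linearMap (M := HatFun ρ b)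
      (f.hom.restrictScalars (Poly V)) hf
  intro t t' h
  obtain ⟨t, rfl⟩ := (completionEquiv b M).surjective t
  obtain ⟨t', rfl⟩ := (completionEquiv b M).surjective t'
  rw [completion_map_equiv, completion_map_equiv] at h
  rw [h1 ((completionEquiv b M').injective h)]

theorem completion_map_exact {f : M ⟶ M'} {g : M' ⟶ M''} (h : Function.Exact f.hom g.hom) :
    Function.Exact ((completion ρ c b).map f).hom ((completion ρ c b).map g).hom := by
  have h1 : Function.Exact (hatTensorMap b f) (hatTensorMap b g) :=
    Module.Flat.lTensor_exact (HatFun ρ b) (f := f.hom.restrictScalars (Poly V))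
      (g := g.hom.restrictScalars (Poly V)) h
  intro t
  obtain ⟨t, rfl⟩ := (completionEquiv b M').surjective t
  rw [completion_map_equiv, map_eq_zero_iff _ (completionEquiv b M'').injective, h1 t]
  constructor
  · rintro ⟨t', rfl⟩
    exact ⟨completionEquiv b M t', completion_map_equiv f t'⟩
  · rintro ⟨t', ht'⟩
    obtain ⟨t', rfl⟩ := (completionEquiv b M).surjective t'
    rw [completion_map_equiv] at ht'
    exact ⟨t', (completionEquiv b M').injective ht'⟩

omit [Module.Finite (Poly V) M] [Module.Finite (Poly V) M'] in
theorem completion_map_surjective {f : M ⟶ M'} (hf : Function.Surjective f.hom) :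
    Function.Surjective ((completion ρ c b).map f).hom := by
  intro t
  induction t using tensor_induction with
  | add t t' ht ht' =>
    obtain ⟨u, rfl⟩ := ht
    obtain ⟨u', rfl⟩ := ht'
    exact ⟨u + u', map_add _ _ _⟩
  | mk z m =>
    obtain ⟨m, rfl⟩ := hf m
    exact ⟨completionMk b M z m, completion_map_mk b M f z m⟩

end

end

end Completion

section CompletionAtZero

open Polynomial

variable {G V : Type u} [Group G] [Finite G] [AddCommGroup V] [Module ℂ V]
  [FiniteDimensional ℂ V] {ρ : Representation ℂ G V} {c : Param ρ}
  {M : ModuleCat.{u} (H ρ c)}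

omit [FiniteDimensional ℂ V] in
theorem sub_C_constantCoeff_mem (P : Poly V) :
    P - MvPolynomial.C (MvPolynomial.constantCoeff P) ∈ augIdeal V := by
  induction P using MvPolynomial.induction_on with
  | C r => rw [MvPolynomial.constantCoeff_C, sub_self]; exact Ideal.zero_mem _
  | add P Q hP hQ =>
    rw [map_add, map_add, add_sub_add_comm]
    exact Ideal.add_mem _ hP hQ
  | mul_X P i hP =>
    rw [map_mul, MvPolynomial.constantCoeff_X, mul_zero, map_zero, sub_zero]
    exact Ideal.mul_mem_left _ _ (Ideal.subset_span ⟨i, rfl⟩)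

/-- The value at the origin. -/
def valZero (ρ : Representation ℂ G V) : FormalFun ρ 0 →+* ℂ :=
  MvPowerSeries.constantCoeff.comp
    (Pi.evalRingHom (fun _ : orbit ρ (0 : V) => FormalSeries V) ⟨0, self_mem_orbit ρ 0⟩)

theorem valZero_polyFun (P : Poly V) :
    valZero ρ (polyFun ρ 0 P) = MvPolynomial.constantCoeff P := by
  induction P using MvPolynomial.induction_on with
  | C r =>
    rw [← MvPolynomial.algebraMap_eq, AlgHom.commutes, MvPolynomial.algebraMap_eq,
      MvPolynomial.constantCoeff_C]
    exact MvPowerSeries.constantCoeff_C (σ := Fin (Module.finrank ℂ V)) r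
  | add P Q hP hQ => rw [map_add, map_add, map_add, hP, hQ]
  | mul_X P i hP =>
    have : valZero ρ (linFun 0 ((Module.finBasis ℂ V).coord i)) = 0 := by
      simp [valZero, linFun, linSeries]
    rw [map_mul, map_mul, map_mul, polyFun_X, this, MvPolynomial.constantCoeff_X, mul_zero,
      mul_zero]

theorem eq_zero_of_completionUnit_eq_zero (hM : IsCatO ρ c M)
    (h : ∀ m, completionUnit 0 M m = 0) (m : M) : m = 0 := by
  rw [isCatO_iff] at hM
  have := hM.1
  refine eq_bot_of_augIdeal_smul_eq_top hM.2 hM.1 (eq_top_iff.2 fun m _ => ?_) m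
  let Q := M ⧸ (augIdeal V • (⊤ : Submodule (Poly V) M))
  let φ : FormalFun ρ 0 →+ M →+ Q := AddMonoidHom.mk' (fun f => AddMonoidHom.mk'
    (fun m => (MvPolynomial.C (valZero ρ f) : Poly V) • (Submodule.Quotient.mk m : Q))
      fun m m' => by rw [Submodule.Quotient.mk_add, smul_add]) fun f f' =>
    AddMonoidHom.ext fun m => by
      change (MvPolynomial.C (valZero ρ (f + f')) : Poly V) • (Submodule.Quotient.mk m : Q) = _
      rw [map_add, map_add, add_smul]
      rfl
  have hφ : ∀ P f m, φ (polyFun ρ 0 P * f) m = φ f (P • m) := by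
    intro P f m
    change (MvPolynomial.C (valZero ρ (polyFun ρ 0 P * f)) : Poly V) •
      (Submodule.Quotient.mk m : Q) = (MvPolynomial.C (valZero ρ f) : Poly V) •
      (Submodule.Quotient.mk (P • m) : Q)
    rw [map_mul, mul_comm, map_mul, mul_smul, valZero_polyFun, ← Submodule.Quotient.mk_smul]
    congr 1
    rw [eq_comm, Submodule.Quotient.eq, ← sub_smul]
    exact Submodule.smul_mem_smul (sub_C_constantCoeff_mem P) trivial
  have h1 : hatTmul ρ 0 1 m = 0 := by
    refine (completionEquiv 0 M).injective ?_
    rw [completionEquiv_tmul, h, smul_zero, map_zero]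
  have h2 : hatLift φ hφ (hatTmul ρ 0 1 m) = Submodule.Quotient.mk m := by
    rw [hatLift_tmul]
    change (MvPolynomial.C (valZero ρ 1) : Poly V) • (Submodule.Quotient.mk m : Q) = _
    rw [map_one, map_one, one_smul]
  rw [h1, map_zero] at h2
  exact (Submodule.Quotient.mk_eq_zero _).1 h2.symm

theorem completionUnit_injective (hM : IsCatO ρ c M) : Function.Injective (completionUnit 0 M) := by
  let K := LinearMap.ker (completionUnit 0 M)
  let i : ModuleCat.of (H ρ c) K ⟶ M := ModuleCat.ofHom K.subtype
  have hK : IsCatO ρ c (ModuleCat.of (H ρ c) K) := hM.of_injective i K.injective_subtype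
  have := (isCatO_iff.1 hM).1
  have := (isCatO_iff.1 hK).1
  rw [← LinearMap.ker_eq_bot, Submodule.eq_bot_iff]
  intro m hm
  have h := eq_zero_of_completionUnit_eq_zero hK (fun k => ?_) ⟨m, hm⟩
  · exact congrArg Subtype.val h
  · refine completion_map_injective (b := 0) (f := i) K.injective_subtype ?_
    rw [completion_map_unit, map_zero]
    exact k.2

theorem exists_completionUnit_eq (hM : IsCatO ρ c M) {n : (completion ρ c 0).obj M}
    (hn : IsNilpotentVec ρ c n) : ∃ m, completionUnit 0 M m = n := by
  have hfin := (isCatO_iff.1 hM).1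
  have hN := isHatO_completion 0 M
  obtain ⟨l, hl⟩ := hn
  have hQ := shiftProd_smul_eq_zero (mem_nilOrder.2 hl)
  have hQ0 := shiftProd_ne_zero (constPoly_ne_zero ρ c) l
  set Q := shiftProd (constPoly ρ c) l
  obtain ⟨p, hp0, hp⟩ := exists_eulerPoly_smul_mem ρ c hN
  obtain ⟨k₀, hk₀⟩ := exists_isCoprime_shift hp0 hQ0
  obtain ⟨m, hm⟩ := exists_sub_completionUnit_mem n k₀
  obtain ⟨l', hl'⟩ := (isCatO_iff.1 hM).2 m
  have hq := shiftProd_smul_eq_zero (mem_nilOrder.2 hl')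
  obtain ⟨w, L, -, hw, hdvd⟩ := exists_coprime_dvd_mul_pow (p := Q)
    (shiftProd_ne_zero (constPoly_ne_zero ρ c) l')
  obtain ⟨a, d, had⟩ := hw
  refine ⟨eulerPoly ρ c (a * w) • m, (sub_eq_zero.1 ?_).symm⟩
  have h1 : n = eulerPoly ρ c (a * w) • n := by
    conv_lhs => rw [← one_smul (H ρ c) n, ← eulerPoly_one ρ c, ← had, eulerPoly_add, add_smul,
      eulerPoly_mul ρ c d, mul_smul, hQ, smul_zero, add_zero]
  have h2 : n - completionUnit 0 M (eulerPoly ρ c (a * w) • m) =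
      eulerPoly ρ c (a * w) • (n - completionUnit 0 M m) := by
    rw [smul_sub, ← h1, map_smul]
  refine eq_zero_of_forall_isCoprime hN (q := Q ^ (L + 1)) hp (k₀ := k₀)
    (fun j hj => (hk₀ j hj).pow_right) (by rw [h2]; exact eulerPoly_smul_mem_pow _ hm) ?_
  rw [smul_sub, ← map_smul, pow_succ, eulerPoly_mul, mul_smul, hQ, smul_zero, zero_sub, ← mul_smul,
    ← eulerPoly_mul, neg_eq_zero, ← eulerPoly_mul]
  obtain ⟨e, he⟩ := hdvd
  have h3 : Q ^ L * Q * (a * w) = (Q * a * e) * shiftProd (constPoly ρ c) l' := by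
    rw [mul_assoc _ e, mul_comm e, ← he]
    ring
  rw [h3, eulerPoly_mul, mul_smul, hq, smul_zero, map_zero]

end CompletionAtZero


section NilpotentPart

variable {G V : Type u} [Group G] [Finite G] [AddCommGroup V] [Module ℂ V]
  [FiniteDimensional ℂ V] {ρ : Representation ℂ G V} {c : Param ρ} {b : V}

/-- The inclusion of the nilpotent vectors. -/
def nilpotentIncl (N : ModuleCat.{u} (HHat ρ c b)) : (functorEb ρ c b).obj N →ₗ[H ρ c] N where
  toFun n := n.1
  map_add' _ _ := rfl
  map_smul' _ _ := rfl

variable {N N' : ModuleCat.{u} (HHat ρ c b)}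

theorem nilpotentIncl_injective : Function.Injective (nilpotentIncl N) := Subtype.val_injective

theorem exists_nilpotentIncl_eq {n : N} (hn : IsNilpotentVec ρ c n) :
    ∃ m, nilpotentIncl N m = n := ⟨⟨n, hn⟩, rfl⟩

theorem isNilpotentVec_of_incl {m : (functorEb ρ c b).obj N} : IsNilpotentVec ρ c m := by
  obtain ⟨n, hn⟩ := m.2
  refine ⟨n, ?_⟩
  replace hn : NilpotentOfOrder ρ c n (nilpotentIncl N m) := hn
  induction n generalizing m with
  | zero => exact nilpotentIncl_injective (hn.trans (map_zero _).symm)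
  | succ n ih => exact fun v => ih (by rw [map_smul]; exact hn v)

theorem nilpotentIncl_map (f : N ⟶ N') (m : (functorEb ρ c b).obj N) :
    nilpotentIncl N' (((functorEb ρ c b).map f).hom m) = f.hom (nilpotentIncl N m) := rfl

theorem hat_map_ofH_smul (f : N ⟶ N') (h : H ρ c) (n : N) : f.hom (h • n) = h • f.hom n := by
  rw [← ofH_smul_eq ρ c b, map_smul, ofH_smul_eq]

theorem IsNilpotentVec.hat_map (f : N ⟶ N') {n : N} (hn : IsNilpotentVec ρ c n) :
    IsNilpotentVec ρ c (f.hom n) := by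
  obtain ⟨k, hk⟩ := hn
  let F : N →ₗ[H ρ c] N' :=
    { toFun := f.hom, map_add' := map_add f.hom, map_smul' := hat_map_ofH_smul f }
  exact ⟨k, hk.map F⟩

theorem isCatO_functorEb (hρ : Function.Injective ρ) (hN : IsHatO ρ c b N) :
    IsCatO ρ c ((functorEb ρ c b).obj N) := by
  refine isCatO_iff.2 ⟨?_, fun m => isNilpotentVec_of_incl⟩
  refine finite_poly_of_singular (ρ := ρ) (c := c) (fun m => isNilpotentVec_of_incl) ?_
  have := finiteDimensional_singular_hat (ρ := ρ) (c := c) (b := b) (N := N) hρ hN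
  let φ : nilOrder ρ c ((functorEb ρ c b).obj N) 1 →ₗ[ℂ] nilOrder ρ c N 1 :=
    { toFun := fun m => ⟨nilpotentIncl N m.1, (mem_nilOrder.1 m.2).map (nilpotentIncl N)⟩
      map_add' := fun _ _ => rfl
      map_smul' := fun r m => Subtype.ext <| by
        change nilpotentIncl N (algebraMap ℂ (H ρ c) r • m.1) = r • nilpotentIncl N m.1
        rw [map_smul, algebraMap_smul] }
  exact Module.Finite.of_injective φ fun m m' h =>
    Subtype.ext (nilpotentIncl_injective (congrArg (fun t => t.1) h))

theorem functorEb_map_injective {f : N ⟶ N'} (hf : Function.Injective f.hom) :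
    Function.Injective ((functorEb ρ c b).map f).hom := by
  intro m m' h
  refine nilpotentIncl_injective (hf ?_)
  rw [← nilpotentIncl_map, h, nilpotentIncl_map]

theorem functorEb_map_exact {N'' : ModuleCat.{u} (HHat ρ c b)} {f : N ⟶ N'} {g : N' ⟶ N''}
    (hf : Function.Injective f.hom) (h : Function.Exact f.hom g.hom) :
    Function.Exact ((functorEb ρ c b).map f).hom ((functorEb ρ c b).map g).hom := by
  intro m
  rw [← map_eq_zero_iff _ nilpotentIncl_injective, nilpotentIncl_map, h]
  constructor
  · rintro ⟨n, hn⟩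
    have h1 : IsNilpotentVec ρ c n := by
      obtain ⟨k, hk⟩ := m.2
      replace hk : NilpotentOfOrder ρ c k (nilpotentIncl N' m) := hk
      rw [← hn] at hk
      clear hn
      refine ⟨k, ?_⟩
      induction k generalizing n with
      | zero => exact hf (hk.trans (map_zero _).symm)
      | succ k ih => exact fun v => ih _ (by rw [hat_map_ofH_smul]; exact hk v)
    obtain ⟨n, rfl⟩ := exists_nilpotentIncl_eq h1
    exact ⟨n, nilpotentIncl_injective hn⟩
  · rintro ⟨n, rfl⟩
    exact ⟨nilpotentIncl N n, rfl⟩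

theorem functorEb_map_surjective (hρ : Function.Injective ρ) (hN : IsHatO ρ c b N)
    (hN' : IsHatO ρ c b N') {f : N ⟶ N'} (hf : Function.Surjective f.hom) :
    Function.Surjective ((functorEb ρ c b).map f).hom := by
  intro m
  have hm : IsNilpotentVec ρ c (nilpotentIncl N' m) := m.2
  obtain ⟨n, hn, h⟩ := exists_nilpotent_lift hρ hN hN' f.hom hf hm
  obtain ⟨n, rfl⟩ := exists_nilpotentIncl_eq hn
  exact ⟨n, nilpotentIncl_injective h⟩

end NilpotentPart

section CompletionAdjunction

variable {G V : Type u} [Group G] [Finite G] [AddCommGroup V] [Module ℂ V]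
  [FiniteDimensional ℂ V] {ρ : Representation ℂ G V} (c : Param ρ) (b : V)

theorem isHatO_completion_obj (M : CatO ρ c) : IsHatO ρ c b ((completion ρ c b).obj M.obj) :=
  letI := (isCatO_iff.1 M.property).1
  isHatO_completion b M.obj

/-- Completion of modules in category `𝒪`. -/
def completionO : CatO ρ c ⥤ (IsHatO ρ c b).FullSubcategory :=
  (IsHatO ρ c b).lift ((IsCatO ρ c).ι ⋙ completion ρ c b) (isHatO_completion_obj c b)

variable (hρ : Function.Injective ρ)

/-- Nilpotent vectors of finitely generated modules. -/
def nilpotentO : (IsHatO ρ c b).FullSubcategory ⥤ CatO ρ c :=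
  (IsCatO ρ c).lift ((IsHatO ρ c b).ι ⋙ functorEb ρ c b) fun N => isCatO_functorEb hρ N.property

variable {c b} in
/-- The homomorphism out of the completion given by a homomorphism to the nilpotent vectors. -/
def nilpotentLift {M : ModuleCat.{u} (H ρ c)} {N : ModuleCat.{u} (HHat ρ c b)}
    (u : M →ₗ[H ρ c] (functorEb ρ c b).obj N) : (completion ρ c b).obj M →ₗ[HHat ρ c b] N :=
  completionLift ((nilpotentIncl N).comp u).toAddMonoidHom fun h m => by
    change nilpotentIncl N (u (h • m)) = HHat.ofH ρ c b h • nilpotentIncl N (u m)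
    rw [map_smul, map_smul, ofH_smul_eq]

variable {c b} in
theorem nilpotentLift_unit {M : ModuleCat.{u} (H ρ c)} {N : ModuleCat.{u} (HHat ρ c b)}
    (u : M →ₗ[H ρ c] (functorEb ρ c b).obj N) (m : M) :
    nilpotentLift u (completionUnit b M m) = nilpotentIncl N (u m) := completionLift_unit _ _ m

variable {c b} in
/-- The bijection between homomorphisms out of the completion and homomorphisms into the nilpotent
vectors. -/
def completionHomEquiv {M : ModuleCat.{u} (H ρ c)} (hM : IsCatO ρ c M)
    (N : ModuleCat.{u} (HHat ρ c b)) :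
    ((completion ρ c b).obj M ⟶ N) ≃ (M ⟶ (functorEb ρ c b).obj N) where
  toFun F := ModuleCat.ofHom
    { toFun := fun m => ⟨F.hom (completionUnit b M m), by
        obtain ⟨k, hk⟩ := (isCatO_iff.1 hM).2 m
        exact IsNilpotentVec.hat_map F ⟨k, hk.map (completionUnit b M)⟩⟩
      map_add' := fun m m' => Subtype.ext <| by
        change F.hom (completionUnit b M (m + m')) = _
        rw [map_add, map_add]
        rfl
      map_smul' := fun h m => Subtype.ext <| by
        change F.hom (completionUnit b M (h • m)) = _
        rw [map_smul, hat_map_ofH_smul]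
        rfl }
  invFun u := ModuleCat.ofHom (nilpotentLift u.hom)
  left_inv F := ModuleCat.hom_ext <| completion_hom_ext fun m => nilpotentLift_unit _ m
  right_inv u := ModuleCat.hom_ext <| LinearMap.ext fun m => Subtype.ext <| nilpotentLift_unit _ m

/-- Completion is left adjoint to taking nilpotent vectors. -/
def completionAdjunction : completionO c b ⊣ nilpotentO c b hρ :=
  Adjunction.mkOfHomEquiv
    { homEquiv := fun M N =>
        { toFun := fun F => ObjectProperty.homMk (completionHomEquiv M.property N.obj F.hom)
          invFun := fun u => ObjectProperty.homMk ((completionHomEquiv M.property N.obj).symm u.hom)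
          left_inv := fun F => ObjectProperty.hom_ext _ (Equiv.symm_apply_apply _ F.hom)
          right_inv := fun u => ObjectProperty.hom_ext _ (Equiv.apply_symm_apply _ u.hom) }
      homEquiv_naturality_left_symm := fun {M' M N} f g => by
        refine ObjectProperty.hom_ext _ (ModuleCat.hom_ext (completion_hom_ext fun m => ?_))
        exact (nilpotentLift_unit (f.hom ≫ g.hom).hom m).trans
          (nilpotentLift_unit g.hom.hom (f.hom.hom m)).symm
      homEquiv_naturality_right := fun {M N N'} f g => rfl }

theorem isExactFunctor_completionO : IsExactFunctor (completionO c b) := by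
  refine ⟨⟨fun {M M' f g} => ?_⟩, fun A B C f g hf h hg => ?_⟩
  · refine ObjectProperty.hom_ext _ (ModuleCat.hom_ext (completion_hom_ext fun m => ?_))
    change completionUnit b M'.obj ((f + g).hom.hom m) = completionUnit b M'.obj (f.hom.hom m) +
      completionUnit b M'.obj (g.hom.hom m)
    rw [← map_add]
    rfl
  · have := (isCatO_iff.1 A.property).1
    have := (isCatO_iff.1 B.property).1
    have := (isCatO_iff.1 C.property).1
    exact ⟨completion_map_injective (M := A.obj) (M' := B.obj) hf,
      completion_map_exact (M := A.obj) (M' := B.obj) (M'' := C.obj) h,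
      completion_map_surjective hg⟩

theorem isExactFunctor_nilpotentO : IsExactFunctor (nilpotentO c b hρ) :=
  ⟨⟨rfl⟩, fun _ B C _ _ hf h hg =>
    ⟨functorEb_map_injective hf, functorEb_map_exact hf h,
      functorEb_map_surjective hρ B.property C.property hg⟩⟩

end CompletionAdjunction

section ZeroEquivalence

variable {G V : Type u} [Group G] [Finite G] [AddCommGroup V] [Module ℂ V]
  [FiniteDimensional ℂ V] {ρ : Representation ℂ G V} {c : Param ρ}
  {N : ModuleCat.{u} (HHat ρ c 0)}

theorem eq_top_of_nilpotent_mem (hN : IsHatO ρ c 0 N) (R : Submodule (FormalFun ρ 0) N)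
    (hR : ∀ n : N, IsNilpotentVec ρ c n → n ∈ R) : R = ⊤ := by
  have hN' : Module.Finite (FormalFun ρ 0) N := hN
  refine eq_top_iff.2 (Submodule.le_of_le_smul_of_le_jacobson_bot hN'.fg_top
    orbIdeal_le_jacobson fun n _ => ?_)
  obtain ⟨n', h1, h2⟩ := exists_eulerFinite_sub_mem (c := c) hN' n
  rw [eulerFinite_eq_nilpotentVectors hN'] at h1
  exact Submodule.mem_sup.2 ⟨n', hR n' h1, n - n', h2, by abel⟩

theorem eq_zero_of_nilpotent_eq_zero (hN : IsHatO ρ c 0 N)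
    (h : ∀ n : N, IsNilpotentVec ρ c n → n = 0) (n : N) : n = 0 := by
  have : (⊥ : Submodule (FormalFun ρ 0) N) = ⊤ := eq_top_of_nilpotent_mem hN ⊥ h
  exact (Submodule.mem_bot (FormalFun ρ 0)).1 (this ▸ trivial)

/-- The canonical map from the completion of the nilpotent vectors. -/
def completionCounit (N : ModuleCat.{u} (HHat ρ c 0)) :
    (completion ρ c 0).obj ((functorEb ρ c 0).obj N) →ₗ[HHat ρ c 0] N :=
  nilpotentLift LinearMap.id

theorem completionCounit_unit (m : (functorEb ρ c 0).obj N) :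
    completionCounit N (completionUnit 0 _ m) = nilpotentIncl N m := nilpotentLift_unit _ m

theorem completionCounit_bijective (hρ : Function.Injective ρ) (hN : IsHatO ρ c 0 N) :
    Function.Bijective (completionCounit N) := by
  have hM := isCatO_functorEb hρ hN
  constructor
  · let K := LinearMap.ker (completionCounit N)
    let i : ModuleCat.of (HHat ρ c 0) K ⟶ (completion ρ c 0).obj ((functorEb ρ c 0).obj N) :=
      ModuleCat.ofHom K.subtype
    have hK : IsHatO ρ c 0 (ModuleCat.of (HHat ρ c 0) K) :=
      IsHatO.of_injective i K.injective_subtype (isHatO_completion_obj c 0 ⟨_, hM⟩)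
    rw [← LinearMap.ker_eq_bot, Submodule.eq_bot_iff]
    intro t ht
    refine congrArg Subtype.val (eq_zero_of_nilpotent_eq_zero hK (fun k hk => ?_) ⟨t, ht⟩)
    obtain ⟨m, hm⟩ := exists_completionUnit_eq hM (hk.hat_map i)
    have h1 : completionCounit N (i.hom k) = 0 := k.2
    rw [← hm, completionCounit_unit, map_eq_zero_iff _ nilpotentIncl_injective] at h1
    rw [h1, map_zero] at hm
    exact Subtype.ext hm.symm
  · let R := LinearMap.range ((completionCounit N).restrictScalars (FormalFun ρ 0))
    have hR : R = ⊤ := eq_top_of_nilpotent_mem hN R fun n hn => by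
      obtain ⟨m, rfl⟩ := exists_nilpotentIncl_eq hn
      exact ⟨_, completionCounit_unit m⟩
    exact fun n => LinearMap.range_eq_top.1 hR n

variable (c) in
/-- Completion at zero is an equivalence. -/
def completionZeroEquivalence (hρ : Function.Injective ρ) :
    CatO ρ c ≌ (IsHatO ρ c 0).FullSubcategory :=
  haveI : ∀ M, IsIso ((completionAdjunction c 0 hρ).unit.app M) := fun M => by
    rw [← ObjectProperty.isIso_hom_iff, ConcreteCategory.isIso_iff_bijective]
    constructor
    · intro m m' h
      exact completionUnit_injective M.property (congrArg Subtype.val h)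
    · intro n
      obtain ⟨m, hm⟩ := exists_completionUnit_eq M.property (n := n.1) n.2
      exact ⟨m, Subtype.ext hm⟩
  haveI : ∀ N, IsIso ((completionAdjunction c 0 hρ).counit.app N) := fun N => by
    rw [← ObjectProperty.isIso_hom_iff, ConcreteCategory.isIso_iff_bijective]
    exact completionCounit_bijective hρ N.property
  (completionAdjunction c 0 hρ).toEquivalence

end ZeroEquivalence


section ExactEquivalence

variable {R S : Type u} [Ring R] [Ring S] {P : ObjectProperty (ModuleCat.{u} R)}
  {Q : ObjectProperty (ModuleCat.{u} S)}

/-- An additive equivalence with a full subcategory that is closed under submodules and quotients is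
exact. -/
theorem isExactFunctor_of_isEquivalence (F : P.FullSubcategory ⥤ Q.FullSubcategory)
    [F.IsEquivalence] [F.Additive]
    (hsub : ∀ {X Y : ModuleCat.{u} S} (f : X ⟶ Y), Function.Injective f.hom → Q Y → Q X)
    (hquot : ∀ {X Y : ModuleCat.{u} S} (f : X ⟶ Y), Function.Surjective f.hom → Q X → Q Y) :
    IsExactFunctor F := by
  have hker : ∀ (A B : P.FullSubcategory) (f : A ⟶ B) (x : (F.obj A).obj),
      (F.map f).hom.hom x = 0 → ∃ (K : P.FullSubcategory) (i : K ⟶ A) (k : (F.obj K).obj),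
        i ≫ f = 0 ∧ (F.map i).hom.hom k = x := by
    intro A B f x hx
    let K := LinearMap.ker (F.map f).hom.hom
    let j : ModuleCat.of S K ⟶ (F.obj A).obj := ModuleCat.ofHom K.subtype
    let K' : Q.FullSubcategory := ⟨ModuleCat.of S K, hsub j K.injective_subtype (F.obj A).property⟩
    let j' : K' ⟶ F.obj A := ObjectProperty.homMk j
    let e := F.objObjPreimageIso K'
    refine ⟨F.objPreimage K', F.preimage (e.hom ≫ j'), e.inv.hom.hom ⟨x, hx⟩, ?_, ?_⟩
    · refine F.map_injective ?_
      have h0 : j' ≫ F.map f = 0 := ObjectProperty.hom_ext _ (ModuleCat.hom_ext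
        (LinearMap.ext fun k => k.2))
      rw [F.map_comp, F.map_preimage, Category.assoc, h0, Limits.comp_zero, F.map_zero]
    · rw [F.map_preimage]
      have h1 : e.inv ≫ e.hom ≫ j' = j' := by rw [Iso.inv_hom_id_assoc]
      exact congrArg (fun u : K' ⟶ F.obj A => u.hom.hom ⟨x, hx⟩) h1
  refine ⟨inferInstance, fun A B C f g hf h hg => ⟨?_, ?_, ?_⟩⟩
  · refine (injective_iff_map_eq_zero (F.map f).hom.hom).2 fun x hx => ?_
    obtain ⟨K, i, k, h1, rfl⟩ := hker A B f x hx
    have : i = 0 := by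
      refine ObjectProperty.hom_ext _ (ModuleCat.hom_ext (LinearMap.ext fun y => hf ?_))
      exact (congrArg (fun u : K ⟶ B => u.hom.hom y) h1).trans (map_zero f.hom.hom).symm
    rw [this, F.map_zero]
    rfl
  · intro x
    constructor
    · intro hx
      obtain ⟨K, i, k, h1, rfl⟩ := hker B C g x hx
      have h2 : ∀ y, ∃ z, f.hom.hom z = i.hom.hom y := fun y =>
        (h _).1 (congrArg (fun u : K ⟶ C => u.hom.hom y) h1)
      choose l hl using h2
      let L : K ⟶ A := ObjectProperty.homMk (ModuleCat.ofHom
        { toFun := l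
          map_add' := fun y y' => hf (by
            change f.hom.hom _ = f.hom.hom _
            rw [map_add, hl, hl, hl, map_add])
          map_smul' := fun r y => hf (by
            change f.hom.hom _ = f.hom.hom (r • l y)
            rw [map_smul, hl, hl, map_smul]) })
      have hL : L ≫ f = i := ObjectProperty.hom_ext _ (ModuleCat.hom_ext (LinearMap.ext hl))
      rw [← hL, F.map_comp]
      exact ⟨_, rfl⟩
    · rintro ⟨y, rfl⟩
      have h1 : f ≫ g = 0 := ObjectProperty.hom_ext _ (ModuleCat.hom_ext
        (LinearMap.ext fun y => (h _).2 ⟨y, rfl⟩))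
      have h2 : F.map f ≫ F.map g = 0 := by rw [← F.map_comp, h1, F.map_zero]
      exact congrArg (fun u : F.obj A ⟶ F.obj C => u.hom.hom y) h2
  · let U := LinearMap.range (F.map g).hom.hom
    let q : (F.obj C).obj ⟶ ModuleCat.of S ((F.obj C).obj ⧸ U) := ModuleCat.ofHom U.mkQ
    let Q' : Q.FullSubcategory := ⟨_, hquot q U.mkQ_surjective (F.obj C).property⟩
    let q' : F.obj C ⟶ Q' := ObjectProperty.homMk q
    let e := F.objObjPreimageIso Q'
    have h1 : F.map g ≫ q' ≫ e.inv = 0 := by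
      have : F.map g ≫ q' = 0 := ObjectProperty.hom_ext _ (ModuleCat.hom_ext
        (LinearMap.ext fun y => (Submodule.Quotient.mk_eq_zero U).2 ⟨y, rfl⟩))
      rw [← Category.assoc, this, Limits.zero_comp]
    have h2 : F.preimage (q' ≫ e.inv) = 0 := by
      have h3 : g ≫ F.preimage (q' ≫ e.inv) = 0 :=
        F.map_injective (by rw [F.map_comp, F.map_preimage, h1, F.map_zero])
      refine ObjectProperty.hom_ext _ (ModuleCat.hom_ext (LinearMap.ext fun y => ?_))
      obtain ⟨y, rfl⟩ := hg y
      exact congrArg (fun u : B ⟶ F.objPreimage Q' => u.hom.hom y) h3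
    have h4 : q' = 0 := by
      have h5 : q' ≫ e.inv = 0 := by rw [← F.map_preimage (q' ≫ e.inv), h2, F.map_zero]
      rw [← Category.comp_id q', ← e.inv_hom_id, ← Category.assoc, h5, Limits.zero_comp]
    intro y
    have h6 : U.mkQ y = 0 := congrArg (fun u : F.obj C ⟶ Q' => u.hom.hom y) h4
    exact (Submodule.Quotient.mk_eq_zero U).1 h6

theorem IsExactFunctor.comp {T : Type u} [Ring T] {P' : ObjectProperty (ModuleCat.{u} T)}
    {F : P.FullSubcategory ⥤ Q.FullSubcategory} {F' : Q.FullSubcategory ⥤ P'.FullSubcategory}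
    (hF : IsExactFunctor F) (hF' : IsExactFunctor F') : IsExactFunctor (F ⋙ F') := by
  have := hF.1
  have := hF'.1
  refine ⟨inferInstance, fun A B C f g hf h hg => ?_⟩
  obtain ⟨h1, h2, h3⟩ := hF.2 A B C f g hf h hg
  exact hF'.2 _ _ _ _ _ h1 h2 h3

end ExactEquivalence

section LocalEquivalence

variable {G V : Type u} [Group G] [Finite G] [AddCommGroup V] [Module ℂ V]
  [FiniteDimensional ℂ V] {ρ : Representation ℂ G V} (c : Param ρ) (b : V)

instance : (IsHatO ρ c b).IsClosedUnderIsomorphisms :=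
  ⟨fun e h => IsHatO.of_injective e.inv
    ((ConcreteCategory.bijective_of_isIso e.inv).1) h⟩

/-- `𝐡`-finite vectors and nilpotent vectors agree. -/
def eulerIsoNilpotent {N : ModuleCat.{u} (HHat ρ c 0)} (hN : IsHatO ρ c 0 N) :
    (functorE ρ c).obj N ≅ (functorEb ρ c 0).obj N :=
  (LinearEquiv.ofEq _ _ (eulerFinite_eq_nilpotentVectors (ρ := ρ) (c := c) (N := N) hN)).toModuleIso

theorem isCatO_functorE (hρ : Function.Injective ρ) {N : ModuleCat.{u} (HHat ρ c 0)}
    (hN : IsHatO ρ c 0 N) : IsCatO ρ c ((functorE ρ c).obj N) :=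
  IsCatO.of_injective (eulerIsoNilpotent c hN).hom
    ((ConcreteCategory.bijective_of_isIso (eulerIsoNilpotent c hN).hom).1)
    (isCatO_functorEb hρ hN)

/-- `𝐡`-finite vectors of finitely generated modules. -/
def eulerO (hρ : Function.Injective ρ) : (IsHatO ρ c 0).FullSubcategory ⥤ CatO ρ c :=
  (IsCatO ρ c).lift ((IsHatO ρ c 0).ι ⋙ functorE ρ c) fun N => isCatO_functorE c hρ N.property

/-- Taking `𝐡`-finite vectors is an equivalence, with completion as its inverse. -/
def eulerEquivalence (hρ : Function.Injective ρ) : (IsHatO ρ c 0).FullSubcategory ≌ CatO ρ c :=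
  (completionZeroEquivalence c hρ).symm.changeFunctor (G := eulerO c hρ)
    (NatIso.ofComponents (fun N => ObjectProperty.isoMk _ (eulerIsoNilpotent c N.property).symm)
      fun _ => rfl)

instance (hρ : Function.Injective ρ) : (eulerO c hρ).Additive := ⟨rfl⟩

variable [(functorI ρ c b).IsEquivalence]

/-- The equivalence between the modules over the completions at `b` and at zero. -/
def localEquivalence (θ : HHat ρ c b ≃+* ZHat ρ c b) :
    ModuleCat.{u} (HHat ρ c b) ≌ ModuleCat.{u} (StabHat ρ c b) :=
  (ModuleCat.restrictScalarsEquivalenceOfRingEquiv (S := HHat ρ c b) (R := ZHat ρ c b)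
    θ.symm).trans (functorI ρ c b).asEquivalence.symm

instance : (functorI ρ c b).Additive := by
  refine ⟨fun {M N f g} => ModuleCat.hom_ext (LinearMap.ext fun t => ?_)⟩
  induction t using inductionFunctor_induction with
  | add t t' ht ht' => rw [map_add, map_add, ht, ht']
  | mk p m => exact inductionMk_add N p (f.hom m) (g.hom m)

instance (θ : HHat ρ c b ≃+* ZHat ρ c b) : (localEquivalence c b θ).functor.Additive := by
  have : (functorI ρ c b).asEquivalence.functor.Additive :=
    inferInstanceAs (functorI ρ c b).Additive
  have h1 : (functorI ρ c b).asEquivalence.symm.functor.Additive :=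
    Equivalence.inverse_additive (functorI ρ c b).asEquivalence
  have h2 : (ModuleCat.restrictScalarsEquivalenceOfRingEquiv (S := HHat ρ c b) (R := ZHat ρ c b)
    θ.symm).functor.Additive := inferInstance
  exact inferInstanceAs (_ ⋙ _).Additive

theorem isHatO_induced_iff (hρ : Function.Injective ρ) (N : ModuleCat.{u} (StabHat ρ c b)) :
    IsHatO ρ c b ((localEquivalence c b (thetaEquiv c b hρ)).inverse.obj N) ↔
      IsHatO (stabRep ρ b) (stabParam ρ c b) 0 N := by
  let N₁ : ModuleCat.{u} (HHat ρ c b) :=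
    (ModuleCat.restrictScalars (thetaEquiv c b hρ).toRingHom).obj ((functorI ρ c b).obj N)
  have h : IsCorner c b hρ (N' := N) (N := N₁) (cornerMap c b hρ N) := isCorner_cornerMap c b hρ N
  change Module.Finite (FormalFun ρ b) N₁ ↔ _
  exact ⟨fun hN => IsCorner.finite h hN, fun hN => IsCorner.finite_of_finite h hN⟩

theorem inverseImage_isHatO (hρ : Function.Injective ρ) :
    (IsHatO (stabRep ρ b) (stabParam ρ c b) 0).inverseImage
      (localEquivalence c b (thetaEquiv c b hρ)).functor = IsHatO ρ c b := by
  ext N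
  refine (isHatO_induced_iff c b hρ _).symm.trans ?_
  exact (IsHatO ρ c b).prop_iff_of_iso
    ((localEquivalence c b (thetaEquiv c b hρ)).unitIso.app N).symm

/-- The equivalence between the finitely generated modules over the completions at `b` and at
zero. -/
def localEquivalenceO (hρ : Function.Injective ρ) : (IsHatO ρ c b).FullSubcategory ≌
    (IsHatO (stabRep ρ b) (stabParam ρ c b) 0).FullSubcategory :=
  (localEquivalence c b (thetaEquiv c b hρ)).congrFullSubcategory (inverseImage_isHatO c b hρ)

instance (hρ : Function.Injective ρ) : (localEquivalenceO c b hρ).functor.Additive :=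
  ⟨fun {_ _ f g} => ObjectProperty.hom_ext _
    ((localEquivalence c b (thetaEquiv c b hρ)).functor.map_add (f := f.hom) (g := g.hom))⟩

end LocalEquivalence


section InvariantPart

open Polynomial

variable {G V : Type u} [Group G] [Finite G] [AddCommGroup V] [Module ℂ V]
  [FiniteDimensional ℂ V] {ρ : Representation ℂ G V} {c : Param ρ}

theorem average_mem (v : V) : average ρ v ∈ ρ.invariants := fun g => rep_apply_average g v

theorem average_redSection (q : V ⧸ ρ.invariants) : average ρ (redSection ρ q) = 0 := by
  obtain ⟨v, rfl⟩ := Submodule.Quotient.mk_surjective _ q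
  rw [redSection_mk, map_sub, average_of_invariant (average_mem v), sub_self]

theorem average_coroot {s : G} (hs : IsReflection ρ s) : average ρ (coroot ρ s) = 0 := by
  obtain ⟨h0, h1, h2, hy, -⟩ := root_facts hs
  have h := congrArg (average ρ) (hy (coroot ρ s))
  rw [average_apply_rep, map_sub, map_smul, h2] at h
  have h3 : ((1 - (reflEigenvalue ρ s)⁻¹) / 2 * 2) • average ρ (coroot ρ s) = 0 :=
    sub_eq_self.1 h.symm
  refine (smul_eq_zero.1 h3).resolve_left fun h4 => h1 ?_
  rw [div_mul_cancel₀ _ two_ne_zero, sub_eq_zero, eq_comm, inv_eq_one] at h4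
  exact h4

variable (ρ) in
/-- The `G`-invariant linear forms dual to a basis of `V^G`. -/
def invForm (i : Fin (Module.finrank ℂ ρ.invariants)) : Module.Dual ℂ V :=
  (Module.finBasis ℂ ρ.invariants).coord i ∘ₗ (average ρ).codRestrict _ average_mem

theorem invForm_eq_zero {v : V} (h : average ρ v = 0) (i) : invForm ρ i v = 0 := by
  have : (average ρ).codRestrict _ average_mem v = 0 := Subtype.ext h
  rw [invForm, LinearMap.comp_apply, this, map_zero]

theorem invForm_coe (u : ρ.invariants) (i) :
    invForm ρ i u = (Module.finBasis ℂ ρ.invariants).coord i u := by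
  have : (average ρ).codRestrict _ average_mem (u : V) = u :=
    Subtype.ext (average_of_invariant u.2)
  rw [invForm, LinearMap.comp_apply, this]

theorem dual_invForm (g : G) (i) : ρ.dual g (invForm ρ i) = invForm ρ i := by
  ext v
  have : (average ρ).codRestrict _ average_mem (ρ g⁻¹ v) =
      (average ρ).codRestrict _ average_mem v := Subtype.ext (average_apply_rep g⁻¹ v)
  rw [dual_apply', invForm, LinearMap.comp_apply, LinearMap.comp_apply, this]

theorem sum_invForm_smul (v : V) :
    ∑ i, invForm ρ i v • ((Module.finBasis ℂ ρ.invariants i : ρ.invariants) : V) = average ρ v :=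
  (map_sum ρ.invariants.subtype _ _).symm.trans (congrArg Subtype.val
    ((Module.finBasis ℂ ρ.invariants).sum_repr ((average ρ).codRestrict _ average_mem v)))

variable (ρ c)

/-- The element of `H_c(G, V)` given by an invariant form. -/
def invX (i : Fin (Module.finrank ℂ ρ.invariants)) : H ρ c := H.x ρ c (invForm ρ i)

/-- The element of `H_c(G, V)` given by a basis vector of `V^G`. -/
def invY (i : Fin (Module.finrank ℂ ρ.invariants)) : H ρ c :=
  H.y ρ c (Module.finBasis ℂ ρ.invariants i : ρ.invariants)

/-- The Euler element of the invariant part. -/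
def invEuler : H ρ c := ∑ i, invX ρ c i * invY ρ c i

variable {ρ}

theorem y_invX (v : V) (i) :
    H.y ρ c v * invX ρ c i = invX ρ c i * H.y ρ c v + algebraMap ℂ _ (invForm ρ i v) := by
  rw [invX, H.y_x, Finset.sum_eq_zero, sub_zero]
  intro s hs
  rw [invForm_eq_zero (average_coroot (mem_reflections.1 hs)), mul_zero, zero_smul]

theorem commute_redHom {z : H ρ c}
    (hx : ∀ a : Module.Dual ℂ (V ⧸ ρ.invariants), Commute z (H.x ρ c (a ∘ₗ ρ.invariants.mkQ)))
    (hy : ∀ q, Commute z (H.y ρ c (redSection ρ q))) (hg : ∀ w, Commute z (H.g ρ c w))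
    (h : H (redRep ρ) c.reduce) : Commute z (redHom ρ c h) := by
  obtain ⟨h, rfl⟩ := RingQuot.mkAlgHom_surjective ℂ (Rel (redRep ρ) c.reduce) h
  change Commute z (redHom ρ c (H.mk _ _ h))
  induction h using FreeAlgebra.induction with
  | grade0 r => rw [AlgHom.commutes, AlgHom.commutes]; exact (Algebra.commute_algebraMap_right r z)
  | grade1 i =>
    cases i with
    | x a => exact (redHom_x c a).symm ▸ hx a
    | y q => exact (redHom_y c q).symm ▸ hy q
    | g w => exact (redHom_g c w).symm ▸ hg w
  | mul a b ha hb => rw [map_mul, map_mul]; exact ha.mul_right hb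
  | add a b ha hb => rw [map_add, map_add]; exact ha.add_right hb

theorem commute_invX (i) (h : H (redRep ρ) c.reduce) : Commute (invX ρ c i) (redHom ρ c h) := by
  refine commute_redHom c (fun a => H.x_x ρ c _ _) (fun q => ?_) (fun w => ?_) h
  · have := y_invX c (redSection ρ q) i
    rw [invForm_eq_zero (average_redSection q), map_zero, add_zero] at this
    exact this.symm
  · have := H.g_x ρ c w (invForm ρ i)
    rw [dual_invForm] at this
    exact this.symm

theorem invEuler_invX (i) : (invEuler ρ c - algebraMap ℂ _ 1) * invX ρ c i =
    invX ρ c i * invEuler ρ c := by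
  have h1 : ∀ j, invX ρ c j * invY ρ c j * invX ρ c i = invX ρ c i * (invX ρ c j * invY ρ c j) +
      if j = i then invX ρ c j else 0 := by
    intro j
    have h2 : invX ρ c j * invX ρ c i = invX ρ c i * invX ρ c j := H.x_x ρ c _ _
    have h3 : invForm ρ i (Module.finBasis ℂ ρ.invariants j : ρ.invariants) =
        if j = i then 1 else 0 := by
      rw [invForm_coe, Module.Basis.coord_apply, Module.Basis.repr_self, Finsupp.single_apply]
    rw [mul_assoc, invY, y_invX, h3, mul_add, ← mul_assoc, h2, mul_assoc]
    split_ifs <;> simp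
  rw [sub_mul, map_one, one_mul, invEuler, Finset.sum_mul, Finset.mul_sum]
  simp only [h1, Finset.sum_add_distrib, Finset.sum_ite_eq', Finset.mem_univ, if_true]
  rw [add_sub_cancel_right]

theorem y_invEuler {u : V} (hu : u ∈ ρ.invariants) : H.y ρ c u * invEuler ρ c =
    invEuler ρ c * H.y ρ c u + H.y ρ c u := by
  have h1 : ∀ i, H.y ρ c u * (invX ρ c i * invY ρ c i) = invX ρ c i * invY ρ c i * H.y ρ c u +
      invForm ρ i u • invY ρ c i := by
    intro i
    have h2 : H.y ρ c u * invY ρ c i = invY ρ c i * H.y ρ c u := H.y_y ρ c _ _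
    rw [← mul_assoc, y_invX, add_mul, mul_assoc, h2, mul_assoc, Algebra.smul_def]
  rw [invEuler, Finset.mul_sum, Finset.sum_mul]
  simp only [h1, Finset.sum_add_distrib]
  congr 1
  have h3 : ∀ i, invForm ρ i u • invY ρ c i = H.yLin ρ c (invForm ρ i u •
      ((Module.finBasis ℂ ρ.invariants i : ρ.invariants) : V)) := fun i =>
    ((H.yLin ρ c).map_smul _ _).symm
  simp only [h3]
  rw [← map_sum, sum_invForm_smul, average_of_invariant hu]
  rfl

theorem x_eq_sum_invX (a : Module.Dual ℂ V) : H.x ρ c a =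
    ∑ i, a (Module.finBasis ℂ ρ.invariants i : ρ.invariants) • invX ρ c i +
      redHom ρ c (H.x _ _ (a ∘ₗ redSection ρ)) := by
  have h1 : a = ∑ i, a (Module.finBasis ℂ ρ.invariants i : ρ.invariants) • invForm ρ i +
      (a ∘ₗ redSection ρ) ∘ₗ ρ.invariants.mkQ := by
    ext v
    have h2 := congrArg a (sum_invForm_smul (ρ := ρ) v)
    rw [map_sum] at h2
    simp only [map_smul, smul_eq_mul] at h2
    simp only [LinearMap.add_apply, LinearMap.sum_apply, LinearMap.smul_apply, smul_eq_mul,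
      LinearMap.comp_apply, Submodule.mkQ_apply, redSection_mk, map_sub]
    rw [Finset.sum_congr rfl fun i _ => mul_comm _ _, h2, add_sub_cancel]
  rw [redHom_x]
  conv_lhs => rw [h1]
  change H.xLin ρ c _ = _
  rw [map_add, map_sum]
  simp only [map_smul]
  rfl

theorem y_eq_average_add (v : V) : H.y ρ c v =
    H.y ρ c (average ρ v) + redHom ρ c (H.y _ _ (Submodule.Quotient.mk v)) := by
  rw [redHom_y, redSection_mk, ← H.y_add, add_sub_cancel]

section Span

variable {c} {M : Type*} [AddCommGroup M] [Module (H ρ c) M]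

variable (ρ c) in
/-- The span of the products of invariant forms with elements of `N₀`. -/
inductive XSpan (N₀ : Set M) : M → Prop
  | of {n : M} : n ∈ N₀ → XSpan N₀ n
  | zero : XSpan N₀ 0
  | add {m m' : M} : XSpan N₀ m → XSpan N₀ m' → XSpan N₀ (m + m')
  | x (i) {m : M} : XSpan N₀ m → XSpan N₀ (invX ρ c i • m)

/-- A subgroup annihilated by `V^G` and stable under `H_c(G, V / V^G)`. -/
structure IsRedSubgroup (N₀ : AddSubgroup M) : Prop where
  red : ∀ h, ∀ n ∈ N₀, redHom ρ c h • n ∈ N₀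
  inv : ∀ u ∈ ρ.invariants, ∀ n ∈ N₀, H.y ρ c u • n = 0

variable {N₀ : AddSubgroup M} (hN₀ : IsRedSubgroup (ρ := ρ) (c := c) N₀)

include hN₀ in
theorem XSpan.red_smul (h : H (redRep ρ) c.reduce) {m : M} (hm : XSpan ρ c (N₀ : Set M) m) :
    XSpan ρ c (N₀ : Set M) (redHom ρ c h • m) := by
  induction hm with
  | of hn => exact .of (hN₀.red h _ hn)
  | zero => rw [smul_zero]; exact .zero
  | add _ _ ih ih' => rw [smul_add]; exact .add ih ih'
  | x i _ ih => rw [← mul_smul, ← (commute_invX c i h).eq, mul_smul]; exact .x i ih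

/-- The submodule spanned by products of invariant forms with elements of `N₀`. -/
def xSpan : Submodule (H ρ c) M :=
  letI S : AddSubgroup M :=
    { carrier := {m | XSpan ρ c (N₀ : Set M) m}
      zero_mem' := .zero
      add_mem' := .add
      neg_mem' := fun {m} hm => by
        have := hm.red_smul hN₀ (-1)
        rwa [map_neg, map_one, neg_smul, one_smul] at this }
  { S with
    smul_mem' := fun h m hm => by
      refine H.smul_mem_of_generators S (fun r m hm => ?_) (fun a m hm => ?_) (fun v m hm => ?_)
        (fun w m hm => ?_) h (show m ∈ S from hm)
      · rw [← AlgHom.commutes (redHom ρ c)]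
        exact XSpan.red_smul hN₀ _ hm
      · rw [x_eq_sum_invX, add_smul, Finset.sum_smul]
        refine S.add_mem (S.sum_mem fun i _ => ?_) (XSpan.red_smul hN₀ _ hm)
        rw [Algebra.smul_def, mul_smul, ← AlgHom.commutes (redHom ρ c)]
        exact XSpan.red_smul hN₀ _ (.x i hm)
      · rw [y_eq_average_add, add_smul]
        refine S.add_mem ?_ (XSpan.red_smul hN₀ _ hm)
        have hm' : XSpan ρ c (N₀ : Set M) m := hm
        induction hm' with
        | of hn => rw [hN₀.inv _ (average_mem v) _ hn]; exact S.zero_mem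
        | zero => rw [smul_zero]; exact S.zero_mem
        | add h h' ih ih' => rw [smul_add]; exact S.add_mem (ih h) (ih' h')
        | x i h ih =>
          rw [← mul_smul, y_invX, add_smul, mul_smul, ← AlgHom.commutes (redHom ρ c)]
          exact S.add_mem (.x i (ih h)) (XSpan.red_smul hN₀ _ h)
      · rw [← redHom_g]
        exact XSpan.red_smul hN₀ _ hm }

include hN₀ in
theorem XSpan.exists_aeval {m : M} (hm : XSpan ρ c (N₀ : Set M) m) :
    ∃ P : ℂ[X], (∀ k : ℕ, P.eval (-k : ℂ) ≠ 0) ∧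
      ∃ n ∈ N₀, aeval (invEuler ρ c) P • (m - n) = 0 := by
  induction hm with
  | @of n hn => exact ⟨1, by simp, n, hn, by rw [sub_self, smul_zero]⟩
  | zero => exact ⟨1, by simp, 0, N₀.zero_mem, by rw [sub_self, smul_zero]⟩
  | add _ _ ih ih' =>
    obtain ⟨P, hP, n, hn, h⟩ := ih
    obtain ⟨P', hP', n', hn', h'⟩ := ih'
    refine ⟨P * P', fun k => ?_, n + n', N₀.add_mem hn hn', ?_⟩
    · rw [eval_mul]; exact mul_ne_zero (hP k) (hP' k)
    · rw [add_sub_add_comm, smul_add, map_mul, mul_smul _ _ (_ - n'), h', smul_zero, add_zero,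
        ← map_mul, mul_comm, map_mul, mul_smul, h, smul_zero]
  | @x i m _ ih =>
    obtain ⟨P, hP, n, hn, h⟩ := ih
    refine ⟨shift (P * X) 1, fun k => ?_, 0, N₀.zero_mem, ?_⟩
    · have h1 : (shift (P * X) 1).eval (-k : ℂ) = P.eval (-(k + 1 : ℕ) : ℂ) * -(k + 1 : ℕ) := by
        simp only [shift, eval_comp, eval_sub, eval_X, eval_C, eval_mul]
        push_cast
        ring_nf
      rw [h1]
      refine mul_ne_zero (hP _) (neg_ne_zero.2 (Nat.cast_ne_zero.2 (Nat.succ_ne_zero k)))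
    · have h2 : invEuler ρ c • n = 0 := by
        rw [invEuler, Finset.sum_smul]
        refine Finset.sum_eq_zero fun j _ => ?_
        rw [mul_smul, invY, hN₀.inv _ (Subtype.property _) n hn, smul_zero]
      have h3 : aeval (invEuler ρ c) (P * X) • m = 0 := by
        have h5 : aeval (invEuler ρ c) (P * X) • (m - n) = 0 := by
          rw [mul_comm, map_mul, mul_smul, h, smul_zero]
        rwa [map_mul, aeval_X, mul_smul, smul_sub, h2, sub_zero, ← mul_smul,
          show aeval (invEuler ρ c) P * invEuler ρ c = aeval (invEuler ρ c) (P * X) by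
            rw [map_mul, aeval_X]] at h5
      rw [sub_zero, ← mul_smul, aeval_shift, aeval_mul_of_mul_eq (invEuler_invX c i), mul_smul, h3,
        smul_zero]

theorem mem_of_mem_xSpan {m : M} (hm : m ∈ xSpan hN₀)
    (h : ∀ u ∈ ρ.invariants, H.y ρ c u • m = 0) : m ∈ N₀ := by
  obtain ⟨P, hP, n, hn, h1⟩ := XSpan.exists_aeval hN₀ hm
  have h2 : invEuler ρ c • (m - n) = 0 := by
    rw [invEuler, Finset.sum_smul]
    refine Finset.sum_eq_zero fun j _ => ?_
    rw [mul_smul, invY, smul_sub, hN₀.inv _ (Subtype.property _) n hn, h _ (Subtype.property _),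
      sub_zero, smul_zero]
  have h3 : aeval (invEuler ρ c) P • (m - n) = algebraMap ℂ (H ρ c) (P.eval 0) • (m - n) := by
    have h4 := divX_mul_X_add P
    conv_lhs => rw [← h4, map_add, map_mul, aeval_X, aeval_C, add_smul, mul_smul, h2, smul_zero,
      zero_add, coeff_zero_eq_eval_zero]
  rw [h3] at h1
  have h5 := congrArg (algebraMap ℂ (H ρ c) (P.eval 0)⁻¹ • ·) h1
  have h6 : P.eval 0 ≠ 0 := by simpa using hP 0
  simp only [smul_zero, ← mul_smul, ← map_mul, inv_mul_cancel₀ h6, map_one, one_smul] at h5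
  rw [sub_eq_zero.1 h5]
  exact hn

variable (ρ c) in
/-- Products of `n` elements of `V^G` annihilate `m`. -/
def InvNil : ℕ → M → Prop
  | 0, m => m = 0
  | n + 1, m => ∀ u ∈ ρ.invariants, InvNil n (H.y ρ c u • m)

theorem NilpotentOfOrder.invNil {n : ℕ} {m : M} (h : NilpotentOfOrder ρ c n m) :
    InvNil ρ c n m := by
  induction n generalizing m with
  | zero => exact h
  | succ n ih => exact fun u _ => ih (h u)

theorem InvNil.euler_sub {n : ℕ} {m : M} (h : InvNil ρ c (n + 1) m) :
    InvNil ρ c n ((invEuler ρ c - algebraMap ℂ _ (n : ℂ)) • m) := by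
  induction n generalizing m with
  | zero =>
    change _ • m = 0
    rw [Nat.cast_zero, map_zero, sub_zero, invEuler, Finset.sum_smul]
    refine Finset.sum_eq_zero fun i _ => ?_
    rw [mul_smul, invY, show H.y ρ c _ • m = 0 from h _ (Subtype.property _), smul_zero]
  | succ n ih =>
    intro u hu
    have h1 : H.y ρ c u * (invEuler ρ c - algebraMap ℂ _ ((n + 1 : ℕ) : ℂ)) =
        (invEuler ρ c - algebraMap ℂ _ (n : ℂ)) * H.y ρ c u := by
      rw [mul_sub, y_invEuler c hu, sub_mul, ← Algebra.commutes, Nat.cast_succ, map_add, map_one,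
        add_mul, one_mul]
      abel
    rw [← mul_smul, h1, mul_smul]
    exact ih (h u hu)

theorem InvNil.mem_xSpan (h0 : ∀ m : M, (∀ u ∈ ρ.invariants, H.y ρ c u • m = 0) → m ∈ N₀)
    {n : ℕ} {m : M} (h : InvNil ρ c n m) : m ∈ xSpan hN₀ := by
  induction n generalizing m with
  | zero => rw [show m = 0 from h]; exact Submodule.zero_mem _
  | succ n ih =>
    rcases Nat.eq_zero_or_pos n with rfl | hn
    · exact .of (h0 m h)
    · have h1 : (algebraMap ℂ (H ρ c) (n : ℂ)⁻¹ * algebraMap ℂ (H ρ c) (n : ℂ)) • m = m := by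
        rw [← map_mul, inv_mul_cancel₀ (Nat.cast_ne_zero.2 hn.ne'), map_one, one_smul]
      have h2 : algebraMap ℂ (H ρ c) (n : ℂ) • m =
          invEuler ρ c • m - (invEuler ρ c - algebraMap ℂ _ (n : ℂ)) • m := by
        rw [sub_smul, sub_sub_cancel]
      rw [← h1, mul_smul, h2]
      refine Submodule.smul_mem _ _ (Submodule.sub_mem _ ?_ (ih h.euler_sub))
      rw [invEuler, Finset.sum_smul]
      refine Submodule.sum_mem _ fun i _ => ?_
      rw [mul_smul]
      exact Submodule.smul_mem _ _ (ih (h _ (Subtype.property _)))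

end Span

end InvariantPart


section ReducedEmbedding

variable {G V : Type u} [Group G] [Finite G] [AddCommGroup V] [Module ℂ V]
  [FiniteDimensional ℂ V] {ρ : Representation ℂ G V} {c : Param ρ}
  {M M' : ModuleCat.{u} (H ρ c)} {N : ModuleCat.{u} (H (redRep ρ) c.reduce)}

/-- An additive map from an `H_c(G, V / V^G)`-module that is compatible with the actions and takes
values in the vectors annihilated by `V^G`. -/
structure IsRedMap (j : N →+ M) : Prop where
  smul : ∀ h n, j (h • n) = redHom ρ c h • j n
  inv : ∀ u ∈ ρ.invariants, ∀ n, H.y ρ c u • j n = 0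

variable {j : N →+ M}

theorem IsRedMap.y_smul (hj : IsRedMap j) (v : V) (n : N) :
    H.y ρ c v • j n = j (H.y (redRep ρ) c.reduce (Submodule.Quotient.mk v) • n) := by
  rw [y_eq_average_add, add_smul, hj.inv _ (average_mem v), zero_add, hj.smul]

theorem IsRedMap.nilpotentOfOrder_iff (hj : IsRedMap j) (hi : Function.Injective j) {k : ℕ}
    {n : N} : NilpotentOfOrder (redRep ρ) c.reduce k n ↔ NilpotentOfOrder ρ c k (j n) := by
  induction k generalizing n with
  | zero => exact (map_eq_zero_iff j hi).symm
  | succ k ih =>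
    refine ⟨fun h v => ?_, fun h q => ?_⟩
    · rw [hj.y_smul]
      exact ih.1 (h _)
    · obtain ⟨v, rfl⟩ := Submodule.Quotient.mk_surjective _ q
      rw [ih, ← hj.y_smul]
      exact h v

/-- The map between spaces of singular vectors. -/
def singularMap (hj : IsRedMap j) (hi : Function.Injective j) :
    nilOrder (redRep ρ) c.reduce N 1 →ₗ[ℂ] nilOrder ρ c M 1 where
  toFun n := ⟨j n.1, (hj.nilpotentOfOrder_iff hi).1 n.2⟩
  map_add' n n' := Subtype.ext (map_add j _ _)
  map_smul' r n := Subtype.ext <| by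
    change j (algebraMap ℂ (H (redRep ρ) c.reduce) r • n.1) = algebraMap ℂ (H ρ c) r • j n.1
    rw [hj.smul, AlgHom.commutes]

theorem IsRedMap.isCatO (hj : IsRedMap j) (hi : Function.Injective j) (hM : IsCatO ρ c M) :
    IsCatO (redRep ρ) c.reduce N := by
  rw [isCatO_iff] at hM ⊢
  have hN : ∀ n : N, IsNilpotentVec (redRep ρ) c.reduce n := fun n =>
    (hM.2 (j n)).imp fun k => (hj.nilpotentOfOrder_iff hi).2
  have := finiteDimensional_singular hM.2 hM.1
  exact ⟨finite_poly_of_singular hN (Module.Finite.of_injective (singularMap hj hi) fun n n' h =>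
    Subtype.ext (hi (congrArg Subtype.val h))), hN⟩

theorem IsRedMap.isRedSubgroup (hj : IsRedMap j) : IsRedSubgroup (ρ := ρ) (c := c) j.range where
  red := by
    rintro h _ ⟨n, rfl⟩
    exact ⟨h • n, hj.smul h n⟩
  inv := by
    rintro u hu _ ⟨n, rfl⟩
    exact hj.inv u hu n

theorem IsRedMap.exists_eq (hj : IsRedMap j) (hs : ∀ m, XSpan ρ c (j.range : Set M) m) {m : M}
    (h : ∀ u ∈ ρ.invariants, H.y ρ c u • m = 0) : ∃ n, j n = m :=
  mem_of_mem_xSpan hj.isRedSubgroup (hs m) h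

theorem IsRedMap.isCatO_of_span (hj : IsRedMap j) (hi : Function.Injective j)
    (hs : ∀ m, XSpan ρ c (j.range : Set M) m) (hN : IsCatO (redRep ρ) c.reduce N) :
    IsCatO ρ c M := by
  rw [isCatO_iff] at hN ⊢
  have hM : ∀ m : M, IsNilpotentVec ρ c m := fun m => by
    induction hs m with
    | of hn =>
      obtain ⟨n, rfl⟩ := hn
      exact (hN.2 n).imp fun k => (hj.nilpotentOfOrder_iff hi).1
    | zero => exact (nilpotentVectors ρ c M).zero_mem
    | add _ _ h h' => exact (nilpotentVectors ρ c M).add_mem h h'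
    | x i _ h => exact (nilpotentVectors ρ c M).smul_mem _ h
  have := finiteDimensional_singular hN.2 hN.1
  refine ⟨finite_poly_of_singular hM (Module.Finite.of_surjective (singularMap hj hi) ?_), hM⟩
  rintro ⟨m, hm⟩
  obtain ⟨n, rfl⟩ := hj.exists_eq hs fun u _ => hm u
  exact ⟨⟨n, (hj.nilpotentOfOrder_iff hi).2 hm⟩, rfl⟩

theorem hom_ext_of_span (hs : ∀ m, XSpan ρ c (j.range : Set M) m) {f f' : M →ₗ[H ρ c] M'}
    (h : ∀ n, f (j n) = f' (j n)) : f = f' := by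
  ext m
  induction hs m with
  | of hn =>
    obtain ⟨n, rfl⟩ := hn
    exact h n
  | zero => rw [map_zero, map_zero]
  | add _ _ h h' => rw [map_add, map_add, h, h']
  | x i _ h => rw [map_smul, map_smul, h]

theorem IsRedMap.exists_extension (hj : IsRedMap j) (hi : Function.Injective j)
    (hs : ∀ m, XSpan ρ c (j.range : Set M) m) {k : N →+ M'} (hk : IsRedMap k)
    (hM' : IsCatO ρ c M') : ∃ f : M →ₗ[H ρ c] M', ∀ n, f (j n) = k n := by
  let N₀ : AddSubgroup (M × M') := (j.prod k).range
  have hN₀ : IsRedSubgroup (ρ := ρ) (c := c) N₀ :=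
    { red := by
        rintro h _ ⟨n, rfl⟩
        exact ⟨h • n, Prod.ext (hj.smul h n) (hk.smul h n)⟩
      inv := by
        rintro u hu _ ⟨n, rfl⟩
        exact Prod.ext (hj.inv u hu n) (hk.inv u hu n) }
  have h0 : ∀ (d : ℕ) (m' : M'), InvNil ρ c d m' → ((0, m') : M × M') ∈ xSpan hN₀ → m' = 0 := by
    intro d
    induction d with
    | zero => exact fun m' h _ => h
    | succ d ih =>
      intro m' h hm
      obtain ⟨n, hn⟩ := mem_of_mem_xSpan hN₀ hm fun u hu => Prod.ext (smul_zero _)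
        (ih _ (h u hu) (by simpa using (xSpan hN₀).smul_mem (H.y ρ c u) hm))
      have h1 : n = 0 := hi ((congrArg Prod.fst hn).trans (map_zero j).symm)
      rw [h1, map_zero] at hn
      exact (congrArg Prod.snd hn).symm
  let p : xSpan hN₀ →ₗ[H ρ c] M := (LinearMap.fst _ _ _).comp (xSpan hN₀).subtype
  have hp : Function.Bijective p := by
    refine ⟨(injective_iff_map_eq_zero p).2 ?_, fun m => ?_⟩
    · rintro ⟨⟨m, m'⟩, hm⟩ (rfl : m = 0)
      obtain ⟨d, hd⟩ := hM'.2 m'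
      exact Subtype.ext (Prod.ext rfl (h0 d m' hd.invNil hm))
    · induction hs m with
      | of hn =>
        obtain ⟨n, rfl⟩ := hn
        exact ⟨⟨(j n, k n), .of ⟨n, rfl⟩⟩, rfl⟩
      | zero => exact ⟨0, rfl⟩
      | add _ _ h h' =>
        obtain ⟨t, rfl⟩ := h
        obtain ⟨t', rfl⟩ := h'
        exact ⟨t + t', map_add p t t'⟩
      | x i _ h =>
        obtain ⟨t, rfl⟩ := h
        exact ⟨invX ρ c i • t, map_smul p _ t⟩
  let e := LinearEquiv.ofBijective p hp
  refine ⟨((LinearMap.snd _ _ _).comp (xSpan hN₀).subtype).comp e.symm.toLinearMap, fun n => ?_⟩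
  have h1 : e.symm (j n) = ⟨(j n, k n), .of ⟨n, rfl⟩⟩ := (e.symm_apply_eq).2 rfl
  change (e.symm (j n)).1.2 = k n
  rw [h1]

/-- The inclusion of `ζ(M)` in `M`. -/
def zetaIncl (M : ModuleCat.{u} (H ρ c)) : (zeta ρ c).obj M →+ M where
  toFun m := m.1
  map_zero' := rfl
  map_add' _ _ := rfl

theorem zetaIncl_injective : Function.Injective (zetaIncl M) := Subtype.val_injective

theorem isRedMap_zetaIncl (M : ModuleCat.{u} (H ρ c)) : IsRedMap (zetaIncl M) :=
  ⟨fun _ _ => rfl, fun u hu n => n.2 u hu⟩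

theorem xSpan_zeta (hM : IsCatO ρ c M) (m : M) : XSpan ρ c ((zetaIncl M).range : Set M) m := by
  obtain ⟨d, hd⟩ := hM.2 m
  exact hd.invNil.mem_xSpan (isRedMap_zetaIncl M).isRedSubgroup fun m h => ⟨⟨m, h⟩, rfl⟩

theorem isCatO_zeta (M : CatO ρ c) : IsCatO (redRep ρ) c.reduce ((zeta ρ c).obj M.obj) :=
  (isRedMap_zetaIncl M.obj).isCatO zetaIncl_injective M.property

instance : (zetaO (isCatO_zeta (ρ := ρ) (c := c))).Faithful where
  map_injective {M M'} f f' h := by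
    refine ObjectProperty.hom_ext _ (ModuleCat.hom_ext (hom_ext_of_span (xSpan_zeta M.property)
      fun n => ?_))
    exact congrArg (fun t => zetaIncl M'.obj (t.hom.hom n)) h

instance : (zetaO (isCatO_zeta (ρ := ρ) (c := c))).Full where
  map_surjective {M M'} ψ := by
    obtain ⟨f, hf⟩ := (isRedMap_zetaIncl M.obj).exists_extension zetaIncl_injective
      (xSpan_zeta M.property) (k := (zetaIncl M'.obj).comp ψ.hom.hom.toAddMonoidHom)
      ⟨fun h n => congrArg (zetaIncl M'.obj) (map_smul ψ.hom.hom h n),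
        fun u hu n => (isRedMap_zetaIncl M'.obj).inv u hu _⟩ M'.property
    refine ⟨ObjectProperty.homMk (ModuleCat.ofHom f), ObjectProperty.hom_ext _ (ModuleCat.hom_ext
      (LinearMap.ext fun n => Subtype.ext (hf n)))⟩

theorem IsRedMap.exists_zeta_iso (hj : IsRedMap j) (hi : Function.Injective j)
    (hs : ∀ m, XSpan ρ c (j.range : Set M) m) : Nonempty ((zeta ρ c).obj M ≅ N) := by
  let e : N →ₗ[H (redRep ρ) c.reduce] (zeta ρ c).obj M :=
    { toFun := fun n => ⟨j n, fun u hu => hj.inv u hu n⟩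
      map_add' := fun n n' => Subtype.ext (map_add j n n')
      map_smul' := fun h n => Subtype.ext (hj.smul h n) }
  refine ⟨(LinearEquiv.ofBijective e ⟨fun n n' h => hi (congrArg Subtype.val h), fun m => ?_⟩
    ).toModuleIso.symm⟩
  obtain ⟨n, hn⟩ := hj.exists_eq hs m.2
  exact ⟨n, Subtype.ext hn⟩

end ReducedEmbedding

section Extension

variable {G V : Type u} [Group G] [Finite G] [AddCommGroup V] [Module ℂ V]
  [FiniteDimensional ℂ V] {ρ : Representation ℂ G V} {c : Param ρ}

/-- Weyl algebra generators that commute with an image of `H_c(G, V / V^G)`. -/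
structure RedExtension (ρ : Representation ℂ G V) (c : Param ρ) (B : Type*) [Ring B]
    [Algebra ℂ B] where
  /-- the homomorphism on `H_c(G, V / V^G)` -/
  α : H (redRep ρ) c.reduce →ₐ[ℂ] B
  /-- the coordinates on `V^G` -/
  X : Fin (Module.finrank ℂ ρ.invariants) → B
  /-- the derivatives along `V^G` -/
  Y : Fin (Module.finrank ℂ ρ.invariants) → B
  X_X : ∀ i k, Commute (X i) (X k)
  Y_Y : ∀ i k, Commute (Y i) (Y k)
  Y_X : ∀ i k, Y i * X k = X k * Y i + if i = k then 1 else 0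
  X_α : ∀ i h, Commute (X i) (α h)
  Y_α : ∀ i h, Commute (Y i) (α h)

namespace RedExtension

variable {B : Type*} [Ring B] [Algebra ℂ B] (D : RedExtension ρ c B)

/-- The image of a form, restricted to `V^G`. -/
def xInv (a : Module.Dual ℂ V) : B :=
  ∑ i, a (Module.finBasis ℂ ρ.invariants i : ρ.invariants) • D.X i

/-- The image of the invariant part of a vector. -/
def yInv (v : V) : B := ∑ i, invForm ρ i v • D.Y i

theorem xInv_α (a : Module.Dual ℂ V) (h) : Commute (D.xInv a) (D.α h) :=
  Commute.sum_left _ _ _ fun i _ => (D.X_α i h).smul_left _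

theorem yInv_α (v : V) (h) : Commute (D.yInv v) (D.α h) :=
  Commute.sum_left _ _ _ fun i _ => (D.Y_α i h).smul_left _

theorem xInv_xInv (a a' : Module.Dual ℂ V) : Commute (D.xInv a) (D.xInv a') :=
  Commute.sum_left _ _ _ fun i _ => Commute.sum_right _ _ _ fun k _ =>
    ((D.X_X i k).smul_left _).smul_right _

theorem yInv_yInv (v v' : V) : Commute (D.yInv v) (D.yInv v') :=
  Commute.sum_left _ _ _ fun i _ => Commute.sum_right _ _ _ fun k _ =>
    ((D.Y_Y i k).smul_left _).smul_right _

theorem yInv_xInv (v : V) (a : Module.Dual ℂ V) :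
    D.yInv v * D.xInv a = D.xInv a * D.yInv v + algebraMap ℂ B (a (average ρ v)) := by
  simp only [xInv, yInv, Finset.sum_mul_sum, smul_mul_smul_comm, Y_X, smul_add,
    Finset.sum_add_distrib, smul_ite, smul_zero, Finset.sum_ite_eq, Finset.mem_univ, if_true]
  congr 1
  · rw [Finset.sum_comm]
    exact Finset.sum_congr rfl fun i _ => Finset.sum_congr rfl fun k _ => by rw [mul_comm]
  · rw [← sum_invForm_smul, map_sum, map_sum]
    refine Finset.sum_congr rfl fun i _ => ?_
    rw [map_smul, smul_eq_mul, Algebra.algebraMap_eq_smul_one]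

/-- Images of the generators. -/
def gen : Gen G V → B
  | .x a => D.xInv a + D.α (H.x _ _ (a ∘ₗ redSection ρ))
  | .y v => D.yInv v + D.α (H.y _ _ (Submodule.Quotient.mk v))
  | .g w => D.α (H.g _ _ w)

/-- The homomorphism on `H_c(G, V)`. -/
def lift : H ρ c →ₐ[ℂ] B :=
  RingQuot.liftAlgHom ℂ ⟨FreeAlgebra.lift ℂ D.gen, by
    intro z z' h
    cases h with
    | x_add a a' =>
      simp only [map_add, FreeAlgebra.lift_ι_apply, gen, LinearMap.add_comp, H.x_add, xInv,
        LinearMap.add_apply, add_smul, Finset.sum_add_distrib]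
      abel
    | x_smul r a =>
      simp only [map_smul, FreeAlgebra.lift_ι_apply, gen, LinearMap.smul_comp, H.x_smul, xInv,
        LinearMap.smul_apply, smul_assoc, smul_add, Finset.smul_sum]
    | y_add v v' =>
      simp only [map_add, FreeAlgebra.lift_ι_apply, gen, Submodule.Quotient.mk_add, H.y_add, yInv,
        add_smul, Finset.sum_add_distrib]
      abel
    | y_smul r v =>
      simp only [map_smul, FreeAlgebra.lift_ι_apply, gen, Submodule.Quotient.mk_smul, H.y_smul,
        yInv, smul_assoc, smul_add, Finset.smul_sum]
    | g_one => simp only [map_one, FreeAlgebra.lift_ι_apply, gen, H.g_one]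
    | g_mul w w' => simp only [map_mul, FreeAlgebra.lift_ι_apply, gen, H.g_mul]
    | g_x w a =>
      have h1 : ρ.dual w a ∘ₗ redSection ρ = (redRep ρ).dual w (a ∘ₗ redSection ρ) := by
        refine LinearMap.ext fun q => ?_
        rw [dual_apply', LinearMap.comp_apply, LinearMap.comp_apply, dual_apply', redSection_rep]
      have h2 : D.xInv (ρ.dual w a) = D.xInv a := Finset.sum_congr rfl fun i _ => by
        rw [dual_apply', show ρ w⁻¹ _ = _ from Subtype.property (p := (· ∈ ρ.invariants)) _ w⁻¹]
      simp only [map_mul, FreeAlgebra.lift_ι_apply, gen]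
      rw [h1, h2, mul_add, add_mul, (D.xInv_α a _).eq, ← map_mul, ← map_mul, H.g_x]
    | g_y w v =>
      have h2 : D.yInv (ρ w v) = D.yInv v := Finset.sum_congr rfl fun i _ => by
        rw [← dual_invForm w i, dual_apply', inv_apply_apply, dual_invForm]
      simp only [map_mul, FreeAlgebra.lift_ι_apply, gen]
      rw [h2, mul_add, add_mul, (D.yInv_α v _).eq, ← map_mul, ← map_mul, H.g_y, redRep_mk]
    | x_x a a' =>
      simp only [map_mul, FreeAlgebra.lift_ι_apply, gen]
      refine Commute.add_left (.add_right (D.xInv_xInv a a') (D.xInv_α _ _))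
        (.add_right (D.xInv_α _ _).symm ?_)
      exact (show Commute _ _ from H.x_x _ _ _ _).map D.α
    | y_y v v' =>
      simp only [map_mul, FreeAlgebra.lift_ι_apply, gen]
      refine Commute.add_left (.add_right (D.yInv_yInv v v') (D.yInv_α _ _))
        (.add_right (D.yInv_α _ _).symm ?_)
      exact (show Commute _ _ from H.y_y _ _ _ _).map D.α
    | y_x v a =>
      simp only [map_mul, map_add, map_sub, map_sum, map_smul, FreeAlgebra.lift_ι_apply, gen,
        AlgHom.commutes]
      have h1 := congrArg D.α (H.y_x (redRep ρ) c.reduce (Submodule.Quotient.mk v)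
        (a ∘ₗ redSection ρ))
      simp only [map_mul, map_add, map_sub, map_sum, map_smul, AlgHom.commutes,
        reflections_redRep] at h1
      have h2 : ∀ s ∈ reflections ρ, c.reduce.val s * root (redRep ρ) s (Submodule.Quotient.mk v) *
          (a ∘ₗ redSection ρ) (coroot (redRep ρ) s) =
          c.val s * root ρ s v * a (coroot ρ s) := by
        intro s hs
        rw [mem_reflections] at hs
        rw [mul_assoc, root_pairing_redRep hs, redSection_mk, map_sub,
          root_invariant hs (average_mem v), sub_zero, mul_assoc, LinearMap.comp_apply,
          LinearMap.comp_apply, Submodule.mkQ_apply, redSection_mk, average_coroot hs, sub_zero]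
        rfl
      rw [Finset.sum_congr rfl fun s hs => by rw [h2 s hs], LinearMap.comp_apply, redSection_mk,
        map_sub a, map_sub (algebraMap ℂ B)] at h1
      rw [add_mul, mul_add, mul_add, h1, yInv_xInv, (D.yInv_α v _).eq, ← (D.xInv_α a _).eq]
      noncomm_ring⟩

theorem lift_mk (z : FreeAlgebra ℂ (Gen G V)) :
    D.lift (H.mk ρ c z) = FreeAlgebra.lift ℂ D.gen z := by
  unfold lift H.mk
  exact RingQuot.liftAlgHom_mkAlgHom_apply _ _ _ _

theorem lift_invX (i) : D.lift (invX ρ c i) = D.X i := by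
  have h1 : invForm ρ i ∘ₗ redSection ρ = 0 :=
    LinearMap.ext fun q => invForm_eq_zero (average_redSection q) i
  rw [invX, H.x, lift_mk, FreeAlgebra.lift_ι_apply, gen, h1, ← zero_smul ℂ
    (0 : Module.Dual ℂ (V ⧸ ρ.invariants)), H.x_smul, zero_smul, map_zero, add_zero, xInv,
    Finset.sum_eq_single i]
  · rw [invForm_coe, Module.Basis.coord_apply, Module.Basis.repr_self, Finsupp.single_eq_same,
      one_smul]
  · intro k _ hk
    rw [invForm_coe, Module.Basis.coord_apply, Module.Basis.repr_self,
      Finsupp.single_eq_of_ne hk.symm, zero_smul]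
  · exact fun h => (h (Finset.mem_univ i)).elim

theorem lift_y {u : V} (hu : u ∈ ρ.invariants) : D.lift (H.y ρ c u) = D.yInv u := by
  rw [H.y, lift_mk, FreeAlgebra.lift_ι_apply, gen, (Submodule.Quotient.mk_eq_zero _).2 hu,
    ← zero_smul ℂ (0 : V ⧸ ρ.invariants), H.y_smul, zero_smul, map_zero, add_zero]

theorem lift_redHom (h : H (redRep ρ) c.reduce) : D.lift (redHom ρ c h) = D.α h := by
  suffices D.lift.comp (redHom ρ c) = D.α from DFunLike.congr_fun this h
  refine RingQuot.ringQuot_ext' _ _ _ (FreeAlgebra.hom_ext (funext fun t => ?_))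
  cases t with
  | x a =>
    change D.lift (redHom ρ c (H.x _ _ a)) = D.α (H.x _ _ a)
    have h1 : (a ∘ₗ ρ.invariants.mkQ) ∘ₗ redSection ρ = a :=
      LinearMap.ext fun q => congrArg a (mk_redSection q)
    rw [redHom_x, H.x, lift_mk, FreeAlgebra.lift_ι_apply, gen, h1, xInv, Finset.sum_eq_zero,
      zero_add]
    intro i _
    rw [LinearMap.comp_apply, Submodule.mkQ_apply,
      (Submodule.Quotient.mk_eq_zero _).2 (Subtype.property _), map_zero, zero_smul]
  | y q =>
    change D.lift (redHom ρ c (H.y _ _ q)) = D.α (H.y _ _ q)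
    rw [redHom_y, H.y, lift_mk, FreeAlgebra.lift_ι_apply, gen, mk_redSection, yInv,
      Finset.sum_eq_zero, zero_add]
    intro i _
    rw [invForm_eq_zero (average_redSection q), zero_smul]
  | g w =>
    change D.lift (redHom ρ c (H.g _ _ w)) = D.α (H.g _ _ w)
    rw [redHom_g, H.g, lift_mk, FreeAlgebra.lift_ι_apply, gen]

end RedExtension

variable (ρ) in
/-- Polynomial functions on `V^G`. -/
abbrev InvPoly : Type := MvPolynomial (Fin (Module.finrank ℂ ρ.invariants)) ℂ

theorem pderiv_comm {σ : Type*} (i k : σ) (p : MvPolynomial σ ℂ) :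
    MvPolynomial.pderiv i (MvPolynomial.pderiv k p) =
      MvPolynomial.pderiv k (MvPolynomial.pderiv i p) := by
  classical
  have h : ⁅MvPolynomial.pderiv (R := ℂ) i, MvPolynomial.pderiv k⁆ = 0 :=
    MvPolynomial.derivation_ext fun l => by
      rw [Derivation.commutator_apply, MvPolynomial.pderiv_X, MvPolynomial.pderiv_X,
        Pi.single_apply, Pi.single_apply]
      split_ifs <;> simp
  have h1 := DFunLike.congr_fun h p
  rw [Derivation.commutator_apply] at h1
  exact sub_eq_zero.1 h1

theorem pderiv_mulLeft {σ : Type*} [DecidableEq σ] (i k : σ) :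
    ((MvPolynomial.pderiv i).toLinearMap * LinearMap.mulLeft ℂ (MvPolynomial.X k) :
      Module.End ℂ (MvPolynomial σ ℂ)) =
    LinearMap.mulLeft ℂ (MvPolynomial.X k) * (MvPolynomial.pderiv i).toLinearMap +
      if i = k then 1 else 0 := by
  refine LinearMap.ext fun p => ?_
  rw [Module.End.mul_apply, LinearMap.add_apply, Module.End.mul_apply, LinearMap.mulLeft_apply,
    LinearMap.mulLeft_apply, Derivation.coeFn_coe,
    MvPolynomial.pderiv_mul, MvPolynomial.pderiv_X, add_comm]
  by_cases h : i = k
  · rw [if_pos h, h, Pi.single_eq_same, one_mul, Module.End.one_apply]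
  · rw [if_neg h, Pi.single_eq_of_ne (Ne.symm h), zero_mul, LinearMap.zero_apply]

theorem commute_rTensor_lTensor {A N : Type*} [AddCommGroup A] [Module ℂ A] [AddCommGroup N]
    [Module ℂ N] (f : Module.End ℂ A) (g : Module.End ℂ N) :
    Commute (f.rTensor N) (g.lTensor A) :=
  TensorProduct.ext' fun _ _ => rfl

variable (N : ModuleCat.{u} (H (redRep ρ) c.reduce))

/-- The action on polynomial functions on `V^G` with values in `N`. -/
def redTensorExtension : RedExtension ρ c (Module.End ℂ (InvPoly ρ ⊗[ℂ] N)) where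
  α := (Module.End.lTensorAlgHom ℂ N (InvPoly ρ)).comp (Algebra.lsmul ℂ ℂ N)
  X i := Module.End.rTensorAlgHom ℂ (InvPoly ρ) N (LinearMap.mulLeft ℂ (MvPolynomial.X i))
  Y i := Module.End.rTensorAlgHom ℂ (InvPoly ρ) N (MvPolynomial.pderiv i).toLinearMap
  X_X i k := Commute.map (LinearMap.ext fun p => mul_left_comm _ _ p) _
  Y_Y i k := Commute.map (LinearMap.ext fun p => pderiv_comm i k p) _
  Y_X i k := by
    rw [← map_mul, pderiv_mulLeft, map_add, map_mul, apply_ite (Module.End.rTensorAlgHom ℂ _ N),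
      map_one, map_zero]
  X_α i h := commute_rTensor_lTensor _ (Algebra.lsmul ℂ ℂ N h)
  Y_α i h := commute_rTensor_lTensor _ (Algebra.lsmul ℂ ℂ N h)

/-- Polynomial functions on `V^G` with values in `N`, as a module over `H_c(G, V)`. -/
def redTensor : ModuleCat.{u} (H ρ c) :=
  letI : Module (H ρ c) (InvPoly ρ ⊗[ℂ] N) :=
    Module.compHom _ (redTensorExtension N).lift.toRingHom
  ModuleCat.of (H ρ c) (InvPoly ρ ⊗[ℂ] N)

/-- An elementary tensor. -/
def redTmul (p : InvPoly ρ) : N →+ redTensor N := (TensorProduct.mk ℂ (InvPoly ρ) N p).toAddMonoidHom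

theorem isRedMap_redTmul : IsRedMap (redTmul N 1) where
  smul h n := by
    change (1 : InvPoly ρ) ⊗ₜ[ℂ] (h • n) =
      (redTensorExtension N).lift (redHom ρ c h) ((1 : InvPoly ρ) ⊗ₜ[ℂ] n)
    rw [RedExtension.lift_redHom]
    rfl
  inv u hu n := by
    change (redTensorExtension N).lift (H.y ρ c u) ((1 : InvPoly ρ) ⊗ₜ[ℂ] n) = 0
    rw [RedExtension.lift_y _ hu, RedExtension.yInv, LinearMap.sum_apply]
    refine Finset.sum_eq_zero fun i _ => ?_
    rw [LinearMap.smul_apply]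
    change _ • (MvPolynomial.pderiv i (1 : InvPoly ρ) ⊗ₜ[ℂ] n) = 0
    rw [MvPolynomial.pderiv_one, TensorProduct.zero_tmul, smul_zero]

theorem redTmul_injective : Function.Injective (redTmul N (1 : InvPoly ρ)) := by
  let f : InvPoly ρ ⊗[ℂ] N →ₗ[ℂ] N :=
    (TensorProduct.lid ℂ N).toLinearMap ∘ₗ (MvPolynomial.aeval 0).toLinearMap.rTensor N
  have h : ∀ n, f ((1 : InvPoly ρ) ⊗ₜ[ℂ] n) = n := fun n => by simp [f]
  intro n n' hn
  rw [← h n, ← h n']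
  exact congrArg f hn

theorem xSpan_redTensor (t : redTensor N) :
    XSpan ρ c ((redTmul N (1 : InvPoly ρ)).range : Set (redTensor N)) t := by
  induction t using TensorProduct.induction_on with
  | zero => exact .zero
  | add t t' h h' => exact .add h h'
  | tmul p n =>
    change XSpan ρ c _ (redTmul N p n)
    induction p using MvPolynomial.induction_on generalizing n with
    | C r =>
      refine .of ⟨r • n, ?_⟩
      change (1 : InvPoly ρ) ⊗ₜ[ℂ] (r • n) = MvPolynomial.C r ⊗ₜ[ℂ] n
      rw [← TensorProduct.smul_tmul, MvPolynomial.smul_eq_C_mul, mul_one]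
    | add p q hp hq =>
      have h : redTmul N (p + q) n = redTmul N p n + redTmul N q n := TensorProduct.add_tmul p q n
      rw [h]
      exact .add (hp n) (hq n)
    | mul_X p i hp =>
      have h : redTmul N (p * MvPolynomial.X i) n = invX ρ c i • redTmul N p n := by
        change _ = (redTensorExtension N).lift (invX ρ c i) (p ⊗ₜ[ℂ] n)
        rw [RedExtension.lift_invX, mul_comm]
        rfl
      rw [h]
      exact .x i (hp n)

instance : (zetaO (isCatO_zeta (ρ := ρ) (c := c))).EssSurj where
  mem_essImage N := by
    have hj := isRedMap_redTmul N.obj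
    have hi := redTmul_injective N.obj
    have hs := xSpan_redTensor N.obj
    obtain ⟨e⟩ := hj.exists_zeta_iso hi hs
    exact ⟨⟨_, hj.isCatO_of_span hi hs N.property⟩, ⟨ObjectProperty.isoMk _ e⟩⟩

theorem zetaO_isEquivalence : (zetaO (isCatO_zeta (ρ := ρ) (c := c))).IsEquivalence where

end Extension


section Main

variable {G V : Type u} [Group G] [Finite G] [AddCommGroup V] [Module ℂ V]
  [FiniteDimensional ℂ V] {ρ : Representation ℂ G V} (c : Param ρ) (b : V)

theorem stabRep_injective (hρ : Function.Injective ρ) : Function.Injective (stabRep ρ b) :=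
  hρ.comp Subtype.val_injective

instance : (zetaO (isCatO_zeta (ρ := ρ) (c := c))).Additive := ⟨rfl⟩

variable [(functorI ρ c b).IsEquivalence]
  [(zetaO (isCatO_zeta (ρ := stabRep ρ b) (c := stabParam ρ c b))).IsEquivalence]

/-- The equivalence between finitely generated modules over the completion at `b` and category `𝒪`
of the reduced stabilizer. -/
def reducedEquivalence (hρ : Function.Injective ρ) : (IsHatO ρ c b).FullSubcategory ≌
    CatO (redRep (stabRep ρ b)) (stabParam ρ c b).reduce :=
  (localEquivalenceO c b hρ).trans
    ((eulerEquivalence (stabParam ρ c b) (stabRep_injective b hρ)).trans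
      (zetaO (isCatO_zeta (ρ := stabRep ρ b) (c := stabParam ρ c b))).asEquivalence)

instance (hρ : Function.Injective ρ) : (reducedEquivalence c b hρ).functor.Additive :=
  inferInstanceAs ((localEquivalenceO c b hρ).functor ⋙
    eulerO (stabParam ρ c b) (stabRep_injective b hρ) ⋙
    zetaO (isCatO_zeta (ρ := stabRep ρ b) (c := stabParam ρ c b))).Additive

theorem isCatO_resAux (hρ : Function.Injective ρ) (M : CatO ρ c) :
    IsCatO (stabRep ρ b) (stabParam ρ c b) ((resAux (thetaEquiv c b hρ)).obj M.obj) :=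
  ((completionO c b ⋙ (localEquivalenceO c b hρ).functor ⋙
    eulerO (stabParam ρ c b) (stabRep_injective b hρ)).obj M).property

omit [(functorI ρ c b).IsEquivalence]
  [(zetaO (isCatO_zeta (ρ := stabRep ρ b) (c := stabParam ρ c b))).IsEquivalence] in
theorem isCatO_indAux (hρ : Function.Injective ρ)
    (N : CatO (stabRep ρ b) (stabParam ρ c b)) :
    IsCatO ρ c ((indAux (thetaEquiv c b hρ)).obj N.obj) :=
  have := inductionFunctor_isEquivalence (stab_g_one c b) (stab_g_mul c b)
  ((completionO (stabParam ρ c b) 0 ⋙ (localEquivalenceO c b hρ).inverse ⋙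
    nilpotentO c b hρ).obj N).property

theorem Res_eq (hρ : Function.Injective ρ) :
    Res (thetaEquiv c b hρ) isCatO_zeta (isCatO_resAux c b hρ) =
      completionO c b ⋙ (reducedEquivalence c b hρ).functor := rfl

theorem Ind_eq (hρ : Function.Injective ρ) :
    Ind (thetaEquiv c b hρ) isCatO_zeta (isCatO_indAux c b hρ) =
      (reducedEquivalence c b hρ).inverse ⋙ nilpotentO c b hρ := rfl

end Main

end Cherednik

end

theorem mainTheorem2 {G V : Type u} [Group G] [Finite G] [AddCommGroup V] [Module ℂ V]
    [FiniteDimensional ℂ V] (ρ : Representation ℂ G V) (hρ : Function.Injective ρ)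
    (c : Cherednik.Param ρ) (b : V) :
    ∃ θ : Cherednik.HHat ρ c b ≃+* Cherednik.ZHat ρ c b,
      Cherednik.IsTheta ρ c b θ ∧
      ∃ (_ : (Cherednik.functorI ρ c b).IsEquivalence)
        (hζ : ∀ M : Cherednik.CatO (Cherednik.stabRep ρ b) (Cherednik.stabParam ρ c b),
          Cherednik.IsCatO (Cherednik.redRep (Cherednik.stabRep ρ b))
            (Cherednik.stabParam ρ c b).reduce ((Cherednik.zeta _ _).obj M.obj))
        (_ : (Cherednik.zetaO hζ).IsEquivalence)
        (hR : ∀ M : Cherednik.CatO ρ c,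
          Cherednik.IsCatO (Cherednik.stabRep ρ b) (Cherednik.stabParam ρ c b)
            ((Cherednik.resAux θ).obj M.obj))
        (hI : ∀ N : Cherednik.CatO (Cherednik.stabRep ρ b) (Cherednik.stabParam ρ c b),
          Cherednik.IsCatO ρ c ((Cherednik.indAux θ).obj N.obj)),
        Cherednik.IsExactFunctor (Cherednik.Res θ hζ hR) ∧
        Cherednik.IsExactFunctor (Cherednik.Ind θ hζ hI) ∧
        Nonempty (Cherednik.Res θ hζ hR ⊣ Cherednik.Ind θ hζ hI) ∧
        Nonempty (Cherednik.Res θ hζ hR ⋙ Cherednik.Ind θ hζ hI ⋙ (Cherednik.IsCatO ρ c).ι ≅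
          (Cherednik.IsCatO ρ c).ι ⋙ Cherednik.completion ρ c b ⋙ Cherednik.functorEb ρ c b) := by
  have hI : (Cherednik.functorI ρ c b).IsEquivalence :=
    Cherednik.inductionFunctor_isEquivalence (Cherednik.stab_g_one c b) (Cherednik.stab_g_mul c b)
  have hζ : (Cherednik.zetaO (Cherednik.isCatO_zeta (ρ := Cherednik.stabRep ρ b)
    (c := Cherednik.stabParam ρ c b))).IsEquivalence := Cherednik.zetaO_isEquivalence
  let e := Cherednik.reducedEquivalence c b hρ
  have : e.functor.Additive := inferInstanceAs (Cherednik.reducedEquivalence c b hρ).functor.Additive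
  refine ⟨Cherednik.thetaEquiv c b hρ, Cherednik.isTheta_thetaEquiv c b hρ, hI,
    Cherednik.isCatO_zeta, hζ, Cherednik.isCatO_resAux c b hρ, Cherednik.isCatO_indAux c b hρ, ?_⟩
  rw [Cherednik.Res_eq, Cherednik.Ind_eq]
  refine ⟨?_, ?_, ⟨?_⟩, ⟨?_⟩⟩
  · exact (Cherednik.isExactFunctor_completionO c b).comp
      (Cherednik.isExactFunctor_of_isEquivalence e.functor
        (fun f hf h => Cherednik.IsCatO.of_injective f hf h)
        (fun f hf h => Cherednik.IsCatO.of_surjective f hf h))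
  · exact (Cherednik.isExactFunctor_of_isEquivalence e.inverse
      (fun f hf h => Cherednik.IsHatO.of_injective f hf h)
      (fun f hf h => Cherednik.IsHatO.of_surjective f hf h)).comp
      (Cherednik.isExactFunctor_nilpotentO c b hρ)
  · exact (Cherednik.completionAdjunction c b hρ).comp e.toAdjunction
  · exact CategoryTheory.Functor.isoWhiskerLeft (Cherednik.completionO c b)
      (CategoryTheory.Functor.isoWhiskerRight e.unitIso.symm
        (Cherednik.nilpotentO c b hρ ⋙ (Cherednik.IsCatO ρ c).ι))
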